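/- **Setting.** Let $(\tilde M,\tilde g)$ be a smooth oriented two-dimensional Lorentzian manifold (signature $(-,+)$) with volume form $\tilde\varepsilon_{ab}$ and Levi-Civita connection $\tilde\nabla$, let $r>0$ be a smooth function on $\tilde M$, and let $(S^2,\hat g)$ be the round unit sphere with volume form $\hat\varepsilon_{AB}$, connection $\hat\nabla$ and Laplacian $\hat\Delta=\hat g^{AB}\hat\nabla_A\hat\nabla_B$. Consider the spherically symmetric spacetime $M=\tilde M\times S^2$, $g=\tilde g_{ab}dx^adx^b+r^2\hat g_{AB}dx^Adx^B$, with Levi-Civita connection $\nabla$, and put $\tilde\Box=-\tilde\nabla^a\tilde\nabla_a$. All fields are smooth. A function on $M$, or a field $\alpha_a dx^a$ on $M$, is called *monopole-free* if it (each component) has zero mean over every sphere $\{p\}\times S^2$. For one-forms $A=\alpha_a dx^a+\beta_B dx^B$ and $J=J_a dx^a+J_B dx^B$ on $M$, Maxwell's equations are $-\nabla^\mu F_{\mu\nu}=J_\nu$ with $F_{\mu\nu}=\nabla_\mu A_\nu-\nabla_\nu A_\mu$. **Statement.** 1. For every $A$ there are unique smooth monopole-free functions $\mu,\nu$ on $M$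 with $\beta_B=\hat\nabla_B\mu+\hat\varepsilon_B{}^C\hat\nabla_C\nu$. Likewise write $J_B=\hat\nabla_B j+\hat\varepsilon_B{}^C\hat\nabla_C k$ with $j,k$ monopole-free. Put $\alpha_a^{(inv)}=\alpha_a-\tilde\nabla_a\mu$ and $\Phi=r^2\tilde\varepsilon^{ab}\tilde\nabla_a\alpha_b^{(inv)}$. 2. Under $A\mapsto A+d\xi$, $\nu$ and $\Phi$ are invariant, and so is $\alpha^{(inv)}_a$ if $\xi$ is monopole-free. 3. If $A$ satisfies Maxwell's equations with current $J$, then $\Phi$ is smooth and $$\tilde\Box\nu-\frac1{r^2}\hat\Delta\nu=k,\qquad \tilde\Box\Phi-\frac1{r^2}\hat\Delta\Phi=\tilde\varepsilon^{ab}\tilde\nabla_a(r^2J_b),\qquad \tilde\varepsilon_{ab}\tilde\nabla^a\Phi-\hat\Delta\alpha_b^{(inv)}=r^2J_b .$$ If moreover $\alpha_a$ is monopole-free, then $\alpha_a^{(inv)}$ and $\Phi$ are smooth and monopole-free, $\tilde\nabla^a\alpha_a^{(inv)}=j$, and $\alpha_b^{(inv)}$ is the unique smooth monopole-free solution $\alpha_b$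 of $\tilde\varepsilon_{ab}\tilde\nabla^a\Phi-\hat\Delta\alpha_b=r^2J_b$. 4. Conversely, let $J$ satisfy $\nabla^\mu J_\mu=0$ with $J_a$ monopole-free, and let $\Phi$ and $\nu$ be smooth monopole-free solutions of $\tilde\Box\Phi-r^{-2}\hat\Delta\Phi=\tilde\varepsilon^{ab}\tilde\nabla_a(r^2J_b)$ and $\tilde\Box\nu-r^{-2}\hat\Delta\nu=k$. Then there is a unique smooth monopole-free $\alpha_b$ with $\tilde\varepsilon_{ab}\tilde\nabla^a\Phi-\hat\Delta\alpha_b=r^2J_b$. It satisfies $r^2\tilde\varepsilon^{ab}\tilde\nabla_a\alpha_b=\Phi$ and $\tilde\nabla^a\alpha_a=j$. There are one-forms $A$ on $M$ with $\alpha^{(inv)}_a=\alpha_a$ and odd-parity invariant $\nu$; they all have the same Faraday tensor, and each of them satisfies Maxwell's equations with current $J$. -/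

import Mathlib

open scoped Manifold ContDiff

noncomputable section

namespace Electro

/-! ### Tensor calculus in coordinates, on a finite-dimensional vector space `E` with basis `b` -/

section Coordinates

variable {ι E : Type*} [Fintype ι] [DecidableEq ι] [NormedAddCommGroup E] [NormedSpace ℝ E]

/-- The partial derivative `∂_i f`. -/
def pderiv (b : Module.Basis ι ℝ E) (i : ι) (f : E → ℝ) (y : E) : ℝ :=
  fderiv ℝ f y (b i)

/-- The components `g^{ij}` of the inverse of a metric with components `G i j`. -/
def ginv (G : ι → ι → E → ℝ) (i j : ι) (y : E) : ℝ :=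
  (Matrix.of fun k l => G k l y)⁻¹ i j

/-- The Christoffel symbols `Γ^k_{ij}` of the Levi-Civita connection. -/
def christoffel (b : Module.Basis ι ℝ E) (G : ι → ι → E → ℝ) (k i j : ι) (y : E) : ℝ :=
  (1 / 2) * ∑ l, ginv G k l y *
    (pderiv b i (G j l) y + pderiv b j (G i l) y - pderiv b l (G i j) y)

/-- The covariant derivative `∇_i w_j` of a covector field. -/
def covDeriv₁ (b : Module.Basis ι ℝ E) (G : ι → ι → E → ℝ) (w : ι → E → ℝ)
    (i j : ι) (y : E) : ℝ :=
  pderiv b i (w j) y - ∑ k, christoffel b G k i j y * w k y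

/-- The covariant derivative `∇_k T_{ij}` of a covariant tensor field of rank two. -/
def covDeriv₂ (b : Module.Basis ι ℝ E) (G : ι → ι → E → ℝ) (T : ι → ι → E → ℝ)
    (k i j : ι) (y : E) : ℝ :=
  pderiv b k (T i j) y - ∑ l, christoffel b G l k i y * T l j y
    - ∑ l, christoffel b G l k j y * T i l y

end Coordinates

/-! ### Operators on a (boundaryless) semi-Riemannian manifold `N` -/

section Manifolds

variable {ι E H N : Type*} [Fintype ι] [DecidableEq ι] [NormedAddCommGroup E] [NormedSpace ℝ E]
  [TopologicalSpace H] (I : ModelWithCorners ℝ E H) [TopologicalSpace N] [ChartedSpace H N]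

/-- A field of covectors (a one-form) on `N`. -/
abbrev OneForm (N : Type*) [TopologicalSpace N] [ChartedSpace H N] : Type _ :=
  (q : N) → (TangentSpace I q →L[ℝ] ℝ)

/-- A field of bilinear forms (a covariant tensor field of rank two) on `N`. -/
abbrev TwoTensor (N : Type*) [TopologicalSpace N] [ChartedSpace H N] : Type _ :=
  (q : N) → (TangentSpace I q →ₗ[ℝ] TangentSpace I q →ₗ[ℝ] ℝ)

variable {I}

/-- The coordinate vector field `∂_i` of the preferred chart at `p`, at the point with
coordinates `y`. -/
def coordVec (I : ModelWithCorners ℝ E H) (b : Module.Basis ι ℝ E) (p : N) (i : ι) (y : E) :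
    TangentSpace I ((extChartAt I p).symm y) :=
  mfderiv 𝓘(ℝ, E) I (extChartAt I p).symm y (b i)

/-- The components `w_i` of a one-form in the preferred chart at `p`. -/
def comp₁ (b : Module.Basis ι ℝ E) (w : OneForm I N) (p : N) (i : ι) (y : E) : ℝ :=
  w ((extChartAt I p).symm y) (coordVec I b p i y)

/-- The components `T_{ij}` of a two-tensor in the preferred chart at `p`. -/
def comp₂ (b : Module.Basis ι ℝ E) (T : TwoTensor I N) (p : N) (i j : ι) (y : E) : ℝ :=
  T ((extChartAt I p).symm y) (coordVec I b p i y) (coordVec I b p j y)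

/-- A one-form is smooth if its components in the charts are. -/
def Smooth₁ (b : Module.Basis ι ℝ E) (w : OneForm I N) : Prop :=
  ∀ (p : N) (i : ι), ContDiffOn ℝ ∞ (comp₁ b w p i) (extChartAt I p).target

/-- A two-tensor is smooth if its components in the charts are. -/
def Smooth₂ (b : Module.Basis ι ℝ E) (T : TwoTensor I N) : Prop :=
  ∀ (p : N) (i j : ι), ContDiffOn ℝ ∞ (comp₂ b T p i j) (extChartAt I p).target

/-- The differential of a function. -/
def dfun (I : ModelWithCorners ℝ E H) (f : N → ℝ) : OneForm I N :=
  fun q => mfderiv I 𝓘(ℝ, ℝ) f q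

/-- The gradient `∇^i f`, as a tangent vector at `q`. -/
def gradient (b : Module.Basis ι ℝ E) (g : TwoTensor I N) (f : N → ℝ) (q : N) :
    TangentSpace I q :=
  ∑ i, ∑ j, ((Matrix.of fun k l => g q (b k) (b l))⁻¹ i j * dfun I f q (b j)) • b i

/-- The divergence `∇^i w_i` of a one-form, for the Levi-Civita connection of `g`. -/
def divergence (b : Module.Basis ι ℝ E) (g : TwoTensor I N) (w : OneForm I N) (p : N) : ℝ :=
  ∑ i, ∑ j, ginv (comp₂ b g p) i j (extChartAt I p p) *
    covDeriv₁ b (comp₂ b g p) (comp₁ b w p) i j (extChartAt I p p)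

/-- The operator `∇^i ∇_i` on functions. -/
def laplacian (b : Module.Basis ι ℝ E) (g : TwoTensor I N) (f : N → ℝ) (p : N) : ℝ :=
  divergence b g (dfun I f) p

/-- The covariant d'Alembertian `-∇^i ∇_i` on functions. -/
def dAlembertian (b : Module.Basis ι ℝ E) (g : TwoTensor I N) (f : N → ℝ) (p : N) : ℝ :=
  -laplacian b g f p

/-- The scalar curl `ε^{ij} ∇_i w_j`, where `ε^{ij} = g^{ik} g^{jl} ε_{kl}`. -/
def curl (b : Module.Basis ι ℝ E) (g ε : TwoTensor I N) (w : OneForm I N) (p : N) : ℝ :=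
  ∑ i, ∑ j, (∑ k, ∑ l, ginv (comp₂ b g p) i k (extChartAt I p p) *
      ginv (comp₂ b g p) j l (extChartAt I p p) * comp₂ b ε p k l (extChartAt I p p)) *
    covDeriv₁ b (comp₂ b g p) (comp₁ b w p) i j (extChartAt I p p)

/-- The components `F_{ij} = ∇_i A_j - ∇_j A_i` of the Faraday tensor of the potential `A` in the
preferred chart at `p`. -/
def faraday (b : Module.Basis ι ℝ E) (g : TwoTensor I N) (A : OneForm I N) (p : N)
    (i j : ι) (y : E) : ℝ :=
  covDeriv₁ b (comp₂ b g p) (comp₁ b A p) i j y - covDeriv₁ b (comp₂ b g p) (comp₁ b A p) j i y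

/-- Maxwell's equations `-∇^k F_{kj} = J_j` with `F = dA`. -/
def Maxwell (b : Module.Basis ι ℝ E) (g : TwoTensor I N) (A J : OneForm I N) : Prop :=
  ∀ (p : N) (j : ι),
    -(∑ k, ∑ i, ginv (comp₂ b g p) k i (extChartAt I p p) *
      covDeriv₂ b (comp₂ b g p) (faraday b g A p) k i j (extChartAt I p p))
      = comp₁ b J p j (extChartAt I p p)

end Manifolds

/-! ### The round two-sphere -/

/-- The unit sphere in `ℝ³`. -/
abbrev S2 : Type := Metric.sphere (0 : EuclideanSpace ℝ (Fin 3)) 1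

instance : Fact (Module.finrank ℝ (EuclideanSpace ℝ (Fin 3)) = 2 + 1) := ⟨by simp⟩

/-- The standard basis of the model space of two-dimensional manifolds. -/
abbrev b2 : Module.Basis (Fin 2) ℝ (EuclideanSpace ℝ (Fin 2)) :=
  (EuclideanSpace.basisFun (Fin 2) ℝ).toBasis

/-- The differential of the inclusion of the sphere into `ℝ³`. -/
def sphereIncl (s : S2) : TangentSpace (𝓡 2) s →L[ℝ] EuclideanSpace ℝ (Fin 3) :=
  mfderiv (𝓡 2) 𝓘(ℝ, EuclideanSpace ℝ (Fin 3)) (fun x : S2 => (x : EuclideanSpace ℝ (Fin 3))) s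

/-- The standard metric of the unit sphere, induced from `ℝ³`. -/
def sphereMetric : TwoTensor (𝓡 2) S2 := fun s =>
  LinearMap.mk₂ ℝ (fun u v => inner ℝ (sphereIncl s u) (sphereIncl s v))
    (by intros; simp [inner_add_left]) (by intros; simp [inner_smul_left])
    (by intros; simp [inner_add_right]) (by intros; simp [inner_smul_right])

/-- The volume form of the unit sphere, oriented by the outward normal: `ε(u, v) = det (s, u, v)`
for `u, v` tangent at `s`. -/
def sphereVol : TwoTensor (𝓡 2) S2 := fun s =>
  LinearMap.mk₂ ℝ
    (fun u v => Matrix.det !![s.1 0, s.1 1, s.1 2;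
      sphereIncl s u 0, sphereIncl s u 1, sphereIncl s u 2;
      sphereIncl s v 0, sphereIncl s v 1, sphereIncl s v 2])
    (by intros; simp [Matrix.det_fin_three]; ring) (by intros; simp [Matrix.det_fin_three]; ring)
    (by intros; simp [Matrix.det_fin_three]; ring) (by intros; simp [Matrix.det_fin_three]; ring)

/-- A function on the sphere is monopole-free if its mean value with respect to the surface
measure is zero. -/
def ZeroMean (f : S2 → ℝ) : Prop :=
  ∫ s, f s ∂((MeasureTheory.volume : MeasureTheory.Measure (EuclideanSpace ℝ (Fin 3))).toSphere) = 0

/-! ### Spherically symmetric spacetimes -/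

section Spacetime

variable (M : Type*) [TopologicalSpace M] [ChartedSpace (EuclideanSpace ℝ (Fin 2)) M]

/-- The data of a spherically symmetric spacetime `M × S²`: a Lorentzian metric `g` of signature
`(-,+)` on the two-dimensional manifold `M`, a volume form `vol` of `g` (equivalently, an
orientation of `M`), and the areal radius `r > 0`. -/
structure SphSymSpacetime where
  g : TwoTensor (𝓡 2) M
  g_smooth : Smooth₂ b2 g
  g_symm : ∀ p u v, g p u v = g p v u
  g_lorentzian : ∀ p, ∃ u v, g p u v = 0 ∧ g p u u < 0 ∧ 0 < g p v v
  vol : TwoTensor (𝓡 2) M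
  vol_smooth : Smooth₂ b2 vol
  vol_alt : ∀ p u, vol p u u = 0
  vol_sq : ∀ p u v, vol p u v ^ 2 = |g p u u * g p v v - g p u v * g p v u|
  r : M → ℝ
  r_smooth : ContMDiff (𝓡 2) 𝓘(ℝ, ℝ) ∞ r
  r_pos : ∀ p, 0 < r p

/-- The model with corners of `M × S²`. -/
abbrev I4 := (𝓡 2).prod (𝓡 2)

/-- The standard basis of the model space of `M × S²`. -/
abbrev b4 : Module.Basis (Fin 2 ⊕ Fin 2) ℝ
    (EuclideanSpace ℝ (Fin 2) × EuclideanSpace ℝ (Fin 2)) := b2.prod b2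

variable {M}

/-- The spacetime metric `g_{ab} dx^a dx^b + r² ĝ_{AB} dx^A dx^B` on `M × S²`. -/
def SphSymSpacetime.metric4 (B : SphSymSpacetime M) : TwoTensor I4 (M × S2) := fun x =>
  (B.g x.1).compl₁₂
      (LinearMap.fst ℝ (EuclideanSpace ℝ (Fin 2)) (EuclideanSpace ℝ (Fin 2)))
      (LinearMap.fst ℝ (EuclideanSpace ℝ (Fin 2)) (EuclideanSpace ℝ (Fin 2)))
    + (B.r x.1) ^ 2 • (sphereMetric x.2).compl₁₂
      (LinearMap.snd ℝ (EuclideanSpace ℝ (Fin 2)) (EuclideanSpace ℝ (Fin 2)))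
      (LinearMap.snd ℝ (EuclideanSpace ℝ (Fin 2)) (EuclideanSpace ℝ (Fin 2)))

/-- A one-form on `M` depending on a point of the sphere, such as `α_a dx^a`. -/
abbrev AngularOneForm (M : Type*) [TopologicalSpace M]
    [ChartedSpace (EuclideanSpace ℝ (Fin 2)) M] : Type _ :=
  S2 → OneForm (𝓡 2) M

/-- The part `α_a dx^a` of a one-form `α_a dx^a + β_B dx^B` on `M × S²`. -/
def orbitPart (A : OneForm I4 (M × S2)) : AngularOneForm M := fun s p =>
  (A (p, s)).comp
    (ContinuousLinearMap.inl ℝ (EuclideanSpace ℝ (Fin 2)) (EuclideanSpace ℝ (Fin 2)))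

/-- The part `β_B dx^B` of a one-form `α_a dx^a + β_B dx^B` on `M × S²`, at fixed `p : M`. -/
def spherePart (A : OneForm I4 (M × S2)) (p : M) : OneForm (𝓡 2) S2 := fun s =>
  (A (p, s)).comp
    (ContinuousLinearMap.inr ℝ (EuclideanSpace ℝ (Fin 2)) (EuclideanSpace ℝ (Fin 2)))

/-- Smoothness of `α_a dx^a`, as a one-form on `M × S²`. -/
def AngularOneForm.Smooth (α : AngularOneForm M) : Prop :=
  Smooth₁ (I := I4) (N := M × S2) b4 fun x => (α x.2 x.1).comp
    (ContinuousLinearMap.fst ℝ (EuclideanSpace ℝ (Fin 2)) (EuclideanSpace ℝ (Fin 2)))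

/-- All components of `α_a dx^a` have zero mean over the spheres. -/
def AngularOneForm.MonopoleFree (α : AngularOneForm M) : Prop :=
  ∀ (p : M) (u : TangentSpace (𝓡 2) p), ZeroMean fun s => α s p u

/-- A scalar field on `M × S²` is smooth. -/
def SmoothScalar (f : M × S2 → ℝ) : Prop := ContMDiff I4 𝓘(ℝ, ℝ) ∞ f

/-- A scalar field on `M × S²` has zero mean over the spheres. -/
def MonopoleFree (f : M × S2 → ℝ) : Prop := ∀ p : M, ZeroMean fun s => f (p, s)

/-- The smooth monopole-free fields `μ`, `ν` are the scalar potentials of the angular part of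
`A`: `β_B = ∇̂_B μ + ε̂_B^C ∇̂_C ν`. -/
structure IsAngularPotentials (A : OneForm I4 (M × S2)) (μ ν : M × S2 → ℝ) : Prop where
  smooth_even : SmoothScalar μ
  smooth_odd : SmoothScalar ν
  monopoleFree_even : MonopoleFree μ
  monopoleFree_odd : MonopoleFree ν
  decomp : ∀ (p : M) (s : S2) (v : TangentSpace (𝓡 2) s),
    spherePart A p s v = dfun (𝓡 2) (fun s' => μ (p, s')) s v
      + sphereVol s v (gradient b2 sphereMetric (fun s' => ν (p, s')) s)

/-- The even-parity gauge invariant `α_a^(inv) = α_a - ∇̃_a μ`. -/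
def alphaInv (A : OneForm I4 (M × S2)) (μ : M × S2 → ℝ) : AngularOneForm M := fun s p =>
  orbitPart A s p - dfun (𝓡 2) (fun p' => μ (p', s)) p

/-- `Δ̂ f`, the Laplacian of the unit sphere acting on a scalar field on `M × S²`. -/
def sphereLap (f : M × S2 → ℝ) (p : M) (s : S2) : ℝ :=
  laplacian b2 sphereMetric (fun s' => f (p, s')) s

namespace SphSymSpacetime

variable (B : SphSymSpacetime M)

/-- The scalar `r² ε̃^{ab} ∇̃_a α_b`. -/
def phi (α : AngularOneForm M) : M × S2 → ℝ := fun x =>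
  B.r x.1 ^ 2 * curl b2 B.g B.vol (α x.2) x.1

/-- The operator `□̃ f - r⁻² Δ̂ f` on scalar fields on `M × S²`. -/
def masterOp (f : M × S2 → ℝ) (p : M) (s : S2) : ℝ :=
  dAlembertian b2 B.g (fun p' => f (p', s)) p - (B.r p ^ 2)⁻¹ * sphereLap f p s

/-- The master equation `□̃ν - r⁻² Δ̂ν = k`. -/
def OddMaster (ν k : M × S2 → ℝ) : Prop :=
  ∀ p s, B.masterOp ν p s = k (p, s)

/-- The master equation `□̃Φ - r⁻² Δ̂Φ = ε̃^{ab} ∇̃_a (r² J_b)`. -/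
def EvenMaster (Φ : M × S2 → ℝ) (J : OneForm I4 (M × S2)) : Prop :=
  ∀ p s, B.masterOp Φ p s =
    curl b2 B.g B.vol (fun p' => B.r p' ^ 2 • orbitPart J s p') p

/-- The reconstruction equation `ε̃_{ab} ∇̃^a Φ - Δ̂ α_b = r² J_b`. -/
def Reconstruction (Φ : M × S2 → ℝ) (α : AngularOneForm M) (J : OneForm I4 (M × S2)) : Prop :=
  ∀ (p : M) (s : S2) (u : TangentSpace (𝓡 2) p),
    B.vol p (gradient b2 B.g (fun p' => Φ (p', s)) p) u
      - laplacian b2 sphereMetric (fun s' => α s' p u) s = B.r p ^ 2 * orbitPart J s p u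

/-- The equation `∇̃^a α_a = j`. -/
def EvenDivergence (α : AngularOneForm M) (j : M × S2 → ℝ) : Prop :=
  ∀ p s, divergence b2 B.g (α s) p = j (p, s)

/-- The continuity equation `∇^μ J_μ = 0` on `M × S²`. -/
def Conserved (J : OneForm I4 (M × S2)) : Prop :=
  ∀ x, divergence b4 B.metric4 J x = 0

end SphSymSpacetime

/-- The one-form `A` on `M × S²` is smooth and has the gauge invariants `α^(inv) = α` and
`ν^(inv) = ν`. -/
def HasInvariants (A : OneForm I4 (M × S2)) (α : AngularOneForm M) (ν : M × S2 → ℝ) : Prop :=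
  Smooth₁ b4 A ∧ ∃ μ, IsAngularPotentials A μ ν ∧ alphaInv A μ = α

end Spacetime

end Electro

end

/-!
The proof separates the angular dependence of all fields from their dependence on the orbit space,
so that Maxwell's equations become two equations for families of functions on the sphere.

**The sphere.** A function `f` on `S²` is handled through its extension to `ℝ³ \ {0}` by
homogeneity of degree zero, and a covector field through its three components along the rotation
fields `e_i × x`. In this global frame the Laplacian is `∑ D_i D_i` (`rotLap`), and divergence, curl
and the co-exact field `ε_B^C ∇_C ν` have explicit expressions (`rotDiv`, `rotCurl`, `rotStar`).
Integrals over the sphere are replaced by integrals over `ℝ³` against a radial weight (`avg`), which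
makes integration by parts and differentiation under the integral sign available. Since
`log (1 - cos θ)` is a Green function (`logConv_rotLap`), the Poisson equation with a source of mean
zero has a solution (`rotLap_invLap`), which depends smoothly on parameters (`SmoothFam.invLap`);
integration by parts makes it unique among the functions of mean zero (`eq_of_rotLap_eq`). On the
sphere there are no harmonic one-forms (`eq_zero_of_harmonic`). Solving for the potentials the
Poisson equations whose sources are the divergence and the curl of `β_B` therefore gives the
decomposition `β_B = ∇_B μ + ε_B^C ∇_C ν` (`hodge`, `exists_angularPotentials`).

**Maxwell's equations.** At the centre of a stereographic chart the metric of the sphere is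
Euclidean to first order, so over that point the spacetime metric has the one-jet of a warped
product with a flat fibre (`WarpedAt`), whose Christoffel symbols are short. The Faraday tensor
consists of the curl of `α^(inv)`, the mixed part `∇_a (ε_B^C ∇_C ν) - ∇_B α_a^(inv)` and the curl
of `ε_B^C ∇_C ν`; in particular it depends on the gauge invariants only
(`faraday_eq_of_hasInvariants`). Its divergence has an orbit part, which is the reconstruction
equation `ε_{ab} ∇^a Φ - Δ α_b = r² J_b` for `Φ` and `α = α^(inv)`, and a sphere part with the even
potential `∇^a α_a` and the odd potential `□ν - r⁻² Δν` (`maxwell_iff`). By uniqueness of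
potentials, Maxwell's equations hold if and only if the reconstruction equation does and these two
potentials are, up to constants on the spheres, `j` and `k`.

**The master equation.** The reconstruction equation is linear, and `Δ` commutes with the operators
of the orbit space. Its curl says that the master equation for `Φ` holds if and only if
`Δ (r² ε^{ab} ∇_a α_b) = Δ Φ` (`Reconstruction.curl_eq`, `evenMaster_iff`). Its divergence, in which
`Φ` drops out, says together with the continuity equation that `Δ (∇^a α_a) = Δ j`
(`Reconstruction.div_eq`, `conserved_iff`). For monopole-free fields `Δ` may be cancelled. This
shows that a solution of Maxwell's equations solves the master equations. Conversely, for given `Φ`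
the reconstruction equation is solved by inverting `Δ` (`exists_reconstruction`,
`reconstruction_unique`): its sources have mean zero over the spheres since `Φ` and `J_a` do.
-/


noncomputable section

namespace Electro

section

/-! ### Functions on the sphere and the rotation vector fields -/

/-- Euclidean three-space, the ambient space of the sphere. -/
abbrev E3 : Type := EuclideanSpace ℝ (Fin 3)

/-- The radial projection `x ↦ x / ‖x‖` of `ℝ³ \ {0}` onto the sphere; the value at the origin is
irrelevant. -/
def sphereProj (x : E3) : S2 :=
  if h : x = 0 then ⟨EuclideanSpace.single 0 1, by simp⟩
  else ⟨‖x‖⁻¹ • x, by simp [norm_smul, h]⟩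

theorem coe_sphereProj {x : E3} (h : x ≠ 0) : (sphereProj x : E3) = ‖x‖⁻¹ • x := by
  simp [sphereProj, h]

theorem S2.norm_coe (s : S2) : ‖(s : E3)‖ = 1 := norm_eq_of_mem_sphere s

theorem S2.coe_ne_zero (s : S2) : (s : E3) ≠ 0 := by
  intro h; simpa [h] using S2.norm_coe s

theorem S2.sum_sq (s : S2) : s.1 0 ^ 2 + s.1 1 ^ 2 + s.1 2 ^ 2 = 1 := by
  have := S2.norm_coe s
  rw [EuclideanSpace.norm_eq, Real.sqrt_eq_one] at this
  simpa [Fin.sum_univ_three] using this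

@[simp]
theorem sphereProj_coe (s : S2) : sphereProj (s : E3) = s := by
  apply Subtype.ext; rw [coe_sphereProj (S2.coe_ne_zero s), S2.norm_coe]; simp

theorem sphereProj_smul {c : ℝ} (hc : 0 < c) (x : E3) : sphereProj (c • x) = sphereProj x := by
  by_cases h : x = 0
  · simp [h]
  · apply Subtype.ext
    rw [coe_sphereProj h, coe_sphereProj (by simp [h, hc.ne']), norm_smul, smul_smul,
      Real.norm_of_nonneg hc.le, mul_inv, mul_right_comm, inv_mul_cancel₀ hc.ne', one_mul]

theorem contDiffOn_coe_sphereProj :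
    ContDiffOn ℝ ∞ (fun x : E3 => (sphereProj x : E3)) {0}ᶜ := by
  have : ContDiffOn ℝ ∞ (fun x : E3 => ‖x‖⁻¹ • x) {0}ᶜ := by
    intro x hx
    refine ContDiffAt.contDiffWithinAt ?_
    exact ((contDiffAt_norm ℝ hx).inv (by simpa using hx)).smul contDiffAt_id
  exact this.congr fun x hx => coe_sphereProj hx

/-- The infinitesimal rotation `x ↦ e_i × x` of `ℝ³`. -/
def rot (i : Fin 3) : E3 →L[ℝ] E3 :=
  (EuclideanSpace.proj (i + 1) : E3 →L[ℝ] ℝ).smulRight (EuclideanSpace.single (i + 2) 1) -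
    (EuclideanSpace.proj (i + 2) : E3 →L[ℝ] ℝ).smulRight (EuclideanSpace.single (i + 1) 1)

theorem rot_apply (i : Fin 3) (x : E3) : rot i x =
    x (i + 1) • EuclideanSpace.single (i + 2) 1 - x (i + 2) • EuclideanSpace.single (i + 1) 1 := by
  simp [rot]

theorem rot_zero (x : E3) : rot 0 x = !₂[0, -x 2, x 1] := by
  ext j; fin_cases j <;> simp [rot_apply]
theorem rot_one (x : E3) : rot 1 x = !₂[x 2, 0, -x 0] := by
  ext j; fin_cases j <;> simp [rot_apply]
theorem rot_two (x : E3) : rot 2 x = !₂[-x 1, x 0, 0] := by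
  ext j; fin_cases j <;> simp [rot_apply]

/-- The derivative of a function on the sphere along the rotation field `e_i × x`. -/
def rotD (i : Fin 3) (f : S2 → ℝ) (s : S2) : ℝ :=
  fderiv ℝ (fun x => f (sphereProj x)) (s : E3) (rot i s)

/-- The Laplacian of the unit sphere as the sum of squares of the rotation fields. -/
def rotLap (f : S2 → ℝ) (s : S2) : ℝ := ∑ i, rotD i (rotD i f) s

/-- Smoothness of a function on the sphere, tested on its homogeneous extension. -/
def SmoothS (f : S2 → ℝ) : Prop := ContDiffOn ℝ ∞ (fun x => f (sphereProj x)) {0}ᶜ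

theorem two_le_infty : (2 : WithTop ℕ∞) ≤ ∞ :=
  WithTop.coe_le_coe.2 (le_top : (2 : ℕ∞) ≤ ⊤)

variable {P : Type*} [NormedAddCommGroup P] [NormedSpace ℝ P]

/-- A family `f y` of functions on the sphere, smooth jointly in the parameter `y ∈ U` and the
point of the sphere. -/
def SmoothFam (U : Set P) (f : P → S2 → ℝ) : Prop :=
  ContDiffOn ℝ ∞ (fun z : P × E3 => f z.1 (sphereProj z.2)) (U ×ˢ {0}ᶜ)

theorem isOpen_compl_zero : IsOpen ({0}ᶜ : Set E3) := isOpen_compl_singleton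

theorem SmoothFam.slice {U : Set P} {f : P → S2 → ℝ} (hf : SmoothFam U f) {y : P} (hy : y ∈ U) :
    SmoothS (f y) :=
  ContDiffOn.comp (g := fun z : P × E3 => f z.1 (sphereProj z.2)) hf
    (f := fun x : E3 => (y, x)) (by fun_prop) fun x hx => ⟨hy, hx⟩

theorem SmoothFam.congr {U : Set P} {f g : P → S2 → ℝ} (hf : SmoothFam U f)
    (h : ∀ y ∈ U, g y = f y) : SmoothFam U g :=
  ContDiffOn.congr hf fun z hz => by rw [h z.1 hz.1]

theorem SmoothS.fam {f : S2 → ℝ} (hf : SmoothS f) (U : Set P) : SmoothFam U fun _ => f :=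
  ContDiffOn.comp hf (f := fun z : P × E3 => z.2) (by fun_prop) fun _ hz => hz.2

theorem SmoothFam.of_param {U : Set P} {f : P → ℝ} (hf : ContDiffOn ℝ ∞ f U) :
    SmoothFam U fun y _ => f y :=
  ContDiffOn.comp hf (f := fun z : P × E3 => z.1) (by fun_prop) fun _ hz => hz.1

theorem SmoothFam.sub {U : Set P} {f g : P → S2 → ℝ} (hf : SmoothFam U f) (hg : SmoothFam U g) :
    SmoothFam U fun y s => f y s - g y s := ContDiffOn.sub hf hg
theorem SmoothFam.neg {U : Set P} {f : P → S2 → ℝ} (hf : SmoothFam U f) :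
    SmoothFam U fun y s => -f y s := ContDiffOn.neg hf
theorem SmoothFam.mul {U : Set P} {f g : P → S2 → ℝ} (hf : SmoothFam U f) (hg : SmoothFam U g) :
    SmoothFam U fun y s => f y s * g y s := ContDiffOn.mul hf hg
theorem SmoothFam.sum {κ : Type*} [Fintype κ] {U : Set P} {f : κ → P → S2 → ℝ}
    (hf : ∀ k, SmoothFam U (f k)) : SmoothFam U fun y s => ∑ k, f k y s :=
  ContDiffOn.sum fun k _ => hf k

theorem SmoothS.add {f g : S2 → ℝ} (hf : SmoothS f) (hg : SmoothS g) :
    SmoothS fun s => f s + g s := ContDiffOn.add hf hg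
theorem SmoothS.sub {f g : S2 → ℝ} (hf : SmoothS f) (hg : SmoothS g) :
    SmoothS fun s => f s - g s := ContDiffOn.sub hf hg
theorem SmoothS.neg {f : S2 → ℝ} (hf : SmoothS f) :
    SmoothS fun s => -f s := ContDiffOn.neg hf
theorem SmoothS.mul {f g : S2 → ℝ} (hf : SmoothS f) (hg : SmoothS g) :
    SmoothS fun s => f s * g s := ContDiffOn.mul hf hg
theorem SmoothS.const (c : ℝ) : SmoothS fun _ => c := contDiffOn_const
theorem SmoothS.sum {κ : Type*} [Fintype κ] {f : κ → S2 → ℝ}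
    (hf : ∀ k, SmoothS (f k)) : SmoothS fun s => ∑ k, f k s :=
  ContDiffOn.sum fun k _ => hf k
theorem SmoothS.coord (j : Fin 3) : SmoothS fun s => s.1 j := by
  have h := contDiffOn_coe_sphereProj
  exact (contDiffOn_euclidean.1 h) j

theorem SmoothS.differentiableAt {f : S2 → ℝ} (hf : SmoothS f) {x : E3} (hx : x ≠ 0) :
    DifferentiableAt ℝ (fun x => f (sphereProj x)) x :=
  (hf.contDiffAt (isOpen_compl_zero.mem_nhds hx)).differentiableAt (by simp)

theorem SmoothS.continuousOn {f : S2 → ℝ} (hf : SmoothS f) :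
    ContinuousOn (fun x => f (sphereProj x)) {0}ᶜ := ContDiffOn.continuousOn hf

theorem SmoothS.continuous {f : S2 → ℝ} (hf : SmoothS f) : Continuous f := by
  have := hf.continuousOn.comp_continuous (f := fun s : S2 => (s : E3)) continuous_subtype_val
    S2.coe_ne_zero
  simpa [Function.comp_def] using this

theorem fderiv_ext_smul (f : S2 → ℝ) {c : ℝ} (hc : 0 < c) (x : E3) :
    c • fderiv ℝ (fun x => f (sphereProj x)) (c • x) = fderiv ℝ (fun x => f (sphereProj x)) x := by
  have := fderiv_comp_smul (𝕜 := ℝ) (f := fun x => f (sphereProj x)) (x := x) c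
  rw [← this]
  congr 1
  ext x
  simp [sphereProj_smul hc]

/-- The derivative of a homogeneous function along a rotation field is homogeneous. -/
theorem rotD_sphereProj (i : Fin 3) (f : S2 → ℝ) {x : E3} (hx : x ≠ 0) :
    rotD i f (sphereProj x) = fderiv ℝ (fun x => f (sphereProj x)) x (rot i x) := by
  have h : 0 < ‖x‖⁻¹ := by positivity
  rw [rotD, coe_sphereProj hx, map_smul, ← fderiv_ext_smul f h x]
  simp

theorem SmoothFam.contDiffAt {U : Set P} (hU : IsOpen U) {f : P → S2 → ℝ} (hf : SmoothFam U f)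
    {y : P} (hy : y ∈ U) {x : E3} (hx : x ≠ 0) :
    ContDiffAt ℝ ∞ (fun z : P × E3 => f z.1 (sphereProj z.2)) (y, x) :=
  ContDiffOn.contDiffAt hf ((hU.prod isOpen_compl_zero).mem_nhds ⟨hy, hx⟩)

/-- A rotation derivative as a derivative of the jointly smooth function of parameter and point. -/
theorem SmoothFam.rotD_eq {U : Set P} (hU : IsOpen U) {f : P → S2 → ℝ} (hf : SmoothFam U f)
    (i : Fin 3) {y : P} (hy : y ∈ U) {x : E3} (hx : x ≠ 0) :
    rotD i (f y) (sphereProj x) =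
      fderiv ℝ (fun z : P × E3 => f z.1 (sphereProj z.2)) (y, x) (0, rot i x) := by
  rw [rotD_sphereProj i _ hx]
  have h := ((hf.contDiffAt hU hy hx).differentiableAt (by simp)).hasFDerivAt
  have h2 := h.comp x (f := fun x : E3 => (y, x)) (hasFDerivAt_prodMk_right y x)
  have := h2.fderiv
  simp only [Function.comp_def] at this
  rw [this]
  simp

theorem SmoothFam.rotD {U : Set P} (hU : IsOpen U) {f : P → S2 → ℝ} (hf : SmoothFam U f)
    (i : Fin 3) : SmoothFam U fun y => rotD i (f y) := by
  have h1 : ContDiffOn ℝ ∞ (fderiv ℝ (fun z : P × E3 => f z.1 (sphereProj z.2)))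
      (U ×ˢ {0}ᶜ) :=
    ContDiffOn.fderiv_of_isOpen (n := ∞) hf (hU.prod isOpen_compl_zero) (by simp)
  refine ContDiffOn.congr (h1.clm_apply (g := fun z : P × E3 => ((0 : P), rot i z.2))
    (by fun_prop)) fun z hz => ?_
  exact hf.rotD_eq hU i hz.1 hz.2

theorem SmoothS.rotD {f : S2 → ℝ} (hf : SmoothS f) (i : Fin 3) : SmoothS (rotD i f) :=
  (SmoothFam.rotD (P := ℝ) isOpen_univ (hf.fam Set.univ) i).slice (Set.mem_univ 0)

theorem SmoothS.rotLap {f : S2 → ℝ} (hf : SmoothS f) : SmoothS (rotLap f) :=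
  SmoothS.sum fun i => (hf.rotD i).rotD i

theorem SmoothFam.rotLap {U : Set P} (hU : IsOpen U) {f : P → S2 → ℝ} (hf : SmoothFam U f) :
    SmoothFam U fun y => rotLap (f y) :=
  SmoothFam.sum fun i => (hf.rotD hU i).rotD hU i

/-- The derivative of a family of functions with respect to the parameter. -/
def parD (v : P) (f : P → S2 → ℝ) (y : P) (s : S2) : ℝ := fderiv ℝ (fun y => f y s) y v

theorem SmoothFam.hasFDerivAt_param {U : Set P} (hU : IsOpen U) {f : P → S2 → ℝ}
    (hf : SmoothFam U f) {y : P} (hy : y ∈ U) {x : E3} (hx : x ≠ 0) :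
    HasFDerivAt (fun y => f y (sphereProj x))
      ((fderiv ℝ (fun z : P × E3 => f z.1 (sphereProj z.2)) (y, x)).comp
        (ContinuousLinearMap.inl ℝ P E3)) y := by
  have h := ((hf.contDiffAt hU hy hx).differentiableAt (by simp)).hasFDerivAt
  exact h.comp y (f := fun y : P => (y, x)) (hasFDerivAt_prodMk_left y x)

theorem SmoothFam.parD_eq {U : Set P} (hU : IsOpen U) {f : P → S2 → ℝ} (hf : SmoothFam U f)
    (v : P) {y : P} (hy : y ∈ U) {x : E3} (hx : x ≠ 0) :
    parD v f y (sphereProj x) =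
      fderiv ℝ (fun z : P × E3 => f z.1 (sphereProj z.2)) (y, x) (v, 0) := by
  rw [parD, (hf.hasFDerivAt_param hU hy hx).fderiv]
  simp

theorem SmoothFam.contDiffOn_param {U : Set P} {f : P → S2 → ℝ}
    (hf : SmoothFam U f) (s : S2) : ContDiffOn ℝ ∞ (fun y => f y s) U := by
  have := ContDiffOn.comp (g := fun z : P × E3 => f z.1 (sphereProj z.2)) hf
    (f := fun y : P => (y, (s : E3))) (s := U) (by fun_prop) fun x hx => ⟨hx, S2.coe_ne_zero s⟩
  simpa [Function.comp_def] using this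

theorem SmoothFam.differentiableAt_param {U : Set P} (hU : IsOpen U) {f : P → S2 → ℝ}
    (hf : SmoothFam U f) {y : P} (hy : y ∈ U) (s : S2) : DifferentiableAt ℝ (fun y => f y s) y :=
  ((hf.contDiffOn_param s).contDiffAt (hU.mem_nhds hy)).differentiableAt (by simp)

theorem SmoothFam.parD {U : Set P} (hU : IsOpen U) {f : P → S2 → ℝ} (hf : SmoothFam U f)
    (v : P) : SmoothFam U (parD v f) := by
  have h1 : ContDiffOn ℝ ∞ (fderiv ℝ (fun z : P × E3 => f z.1 (sphereProj z.2)))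
      (U ×ˢ {0}ᶜ) :=
    ContDiffOn.fderiv_of_isOpen (n := ∞) hf (hU.prod isOpen_compl_zero) (by simp)
  refine ContDiffOn.congr (h1.clm_apply (g := fun z : P × E3 => (v, (0 : E3)))
    (by fun_prop)) fun z hz => ?_
  exact hf.parD_eq hU v hz.1 hz.2

/-- Rotation derivatives commute with derivatives in the parameter. -/
theorem SmoothFam.rotD_parD {U : Set P} (hU : IsOpen U) {f : P → S2 → ℝ} (hf : SmoothFam U f)
    (v : P) (i : Fin 3) {y : P} (hy : y ∈ U) (s : S2) :
    Electro.rotD i (Electro.parD v f y) s = Electro.parD v (fun y => Electro.rotD i (f y)) y s := by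
  have hs := S2.coe_ne_zero s
  have e1 := (hf.parD hU v).rotD_eq hU i hy hs
  have e2 := (hf.rotD hU i).parD_eq hU v hy hs
  rw [sphereProj_coe] at e1 e2
  rw [e1, e2]
  set F := fun z : P × E3 => f z.1 (sphereProj z.2) with hF
  have hcd : ContDiffAt ℝ ∞ F (y, (s : E3)) := hf.contDiffAt hU hy hs
  have hd : DifferentiableAt ℝ (fderiv ℝ F) (y, (s : E3)) :=
    (hcd.fderiv_right (m := ∞) (by simp)).differentiableAt (by simp)
  have hn : U ×ˢ {0}ᶜ ∈ nhds (y, (s : E3)) := (hU.prod isOpen_compl_zero).mem_nhds ⟨hy, hs⟩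
  have a1 : (fun z : P × E3 => Electro.parD v f z.1 (sphereProj z.2)) =ᶠ[nhds (y, (s : E3))]
      fun z => fderiv ℝ F z (v, 0) := by
    filter_upwards [hn] with z hz using hf.parD_eq hU v hz.1 hz.2
  have a2 : (fun z : P × E3 => Electro.rotD i (f z.1) (sphereProj z.2)) =ᶠ[nhds (y, (s : E3))]
      fun z => fderiv ℝ F z (0, rot i z.2) := by
    filter_upwards [hn] with z hz using hf.rotD_eq hU i hz.1 hz.2
  rw [a1.fderiv_eq, a2.fderiv_eq]
  have b1 := (hd.hasFDerivAt.clm_apply (hasFDerivAt_const ((v, 0) : P × E3) (y, (s : E3)))).fderiv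
  have b2 := (hd.hasFDerivAt.clm_apply
    (((ContinuousLinearMap.inr ℝ P E3).comp
      ((rot i).comp (ContinuousLinearMap.snd ℝ P E3))).hasFDerivAt (x := (y, (s : E3))))).fderiv
  simp only [ContinuousLinearMap.comp_apply, ContinuousLinearMap.inr_apply,
    ContinuousLinearMap.coe_snd'] at b2
  rw [b1, b2]
  have hz : fderiv ℝ F (y, (s : E3)) (0, 0) = 0 := map_zero _
  have hsym : IsSymmSndFDerivAt ℝ F (y, (s : E3)) :=
    hcd.isSymmSndFDerivAt (by simpa using two_le_infty)
  simpa [hz] using hsym.eq (0, rot i s) (v, 0)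

/-! ### The calculus of rotation derivatives -/

variable {f g : S2 → ℝ}

theorem rotD_add (hf : SmoothS f) (hg : SmoothS g) (i : Fin 3) (s : S2) :
    rotD i (fun s => f s + g s) s = rotD i f s + rotD i g s := by
  have h1 := hf.differentiableAt (S2.coe_ne_zero s)
  have h2 := hg.differentiableAt (S2.coe_ne_zero s)
  simp only [rotD]; rw [fderiv_fun_add h1 h2]; rfl

theorem rotD_sub (hf : SmoothS f) (hg : SmoothS g) (i : Fin 3) (s : S2) :
    rotD i (fun s => f s - g s) s = rotD i f s - rotD i g s := by
  have h1 := hf.differentiableAt (S2.coe_ne_zero s)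
  have h2 := hg.differentiableAt (S2.coe_ne_zero s)
  simp only [rotD]; rw [fderiv_fun_sub h1 h2]; rfl

theorem rotD_neg (i : Fin 3) (s : S2) (f : S2 → ℝ) :
    rotD i (fun s => -f s) s = -rotD i f s := by
  simp only [rotD]; rw [fderiv_fun_neg]; rfl

theorem rotD_const (i : Fin 3) (s : S2) (c : ℝ) : rotD i (fun _ => c) s = 0 := by
  simp [rotD]

theorem rotD_mul (hf : SmoothS f) (hg : SmoothS g) (i : Fin 3) (s : S2) :
    rotD i (fun s => f s * g s) s = rotD i f s * g s + f s * rotD i g s := by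
  have h1 := hf.differentiableAt (S2.coe_ne_zero s)
  have h2 := hg.differentiableAt (S2.coe_ne_zero s)
  simp only [rotD]; rw [fderiv_fun_mul h1 h2]; simp; ring

theorem rotD_const_mul (hf : SmoothS f) (c : ℝ) (i : Fin 3) (s : S2) :
    rotD i (fun s => c * f s) s = c * rotD i f s := by
  rw [rotD_mul (SmoothS.const c) hf, rotD_const]; ring

theorem rotD_sum {κ : Type*} [Fintype κ] {f : κ → S2 → ℝ} (hf : ∀ k, SmoothS (f k)) (i : Fin 3)
    (s : S2) : rotD i (fun s => ∑ k, f k s) s = ∑ k, rotD i (f k) s := by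
  simp only [rotD]
  rw [fderiv_fun_sum fun k _ => (hf k).differentiableAt (S2.coe_ne_zero s)]
  simp

/-- Chain rule. -/
theorem rotD_comp {φ : ℝ → ℝ} {φ' : ℝ} (hf : SmoothS f) (s : S2) (hφ : HasDerivAt φ φ' (f s))
    (i : Fin 3) : rotD i (fun s => φ (f s)) s = φ' * rotD i f s := by
  have h1 := (hf.differentiableAt (S2.coe_ne_zero s)).hasFDerivAt
  have h2 : HasDerivAt φ φ' (f (sphereProj (s : E3))) := by simpa using hφ
  have h3 := (h2.comp_hasFDerivAt (s : E3) h1).fderiv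
  simp only [Function.comp_def] at h3
  simp only [rotD]; rw [h3]; simp

/-- Euler's relation for the homogeneous extension. -/
theorem fderiv_ext_self (hf : SmoothS f) {x : E3} (hx : x ≠ 0) :
    fderiv ℝ (fun x => f (sphereProj x)) x x = 0 := by
  have h1 := (hf.differentiableAt hx).hasFDerivAt
  have h2 : HasDerivAt (fun t : ℝ => (1 + t) • x) x 0 := by
    simpa using ((hasDerivAt_id (0 : ℝ)).const_add 1).smul_const x
  have h4 : HasFDerivAt (fun x => f (sphereProj x)) (fderiv ℝ (fun x => f (sphereProj x)) x)
      ((fun t : ℝ => (1 + t) • x) 0) := by simpa using h1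
  have h3 := h4.comp_hasDerivAt (0 : ℝ) h2
  have h5 : (fun x => f (sphereProj x)) ∘ (fun t : ℝ => (1 + t) • x) =ᶠ[nhds 0]
      fun _ => f (sphereProj x) := by
    filter_upwards [Ioi_mem_nhds (show (-1 : ℝ) < 0 by norm_num)] with t ht
    simp only [Function.comp_apply]
    rw [sphereProj_smul (by simp at ht; linarith)]
  exact h3.unique ((hasDerivAt_const (0 : ℝ) (f (sphereProj x))).congr_of_eventuallyEq h5)

/-- The gradient of the homogeneous extension is recovered from the rotation derivatives. -/
theorem fderiv_ext_eq (hf : SmoothS f) (s : S2) (v : E3) :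
    fderiv ℝ (fun x => f (sphereProj x)) (s : E3) v =
      rotD 0 f s * (s.1 1 * v 2 - s.1 2 * v 1) + rotD 1 f s * (s.1 2 * v 0 - s.1 0 * v 2)
        + rotD 2 f s * (s.1 0 * v 1 - s.1 1 * v 0) := by
  have h0 := fderiv_ext_self hf (S2.coe_ne_zero s)
  simp only [rotD]
  set L := fderiv ℝ (fun x => f (sphereProj x)) (s : E3)
  have hL : ∀ w : E3, L w = w 0 * L (EuclideanSpace.single 0 1)
      + w 1 * L (EuclideanSpace.single 1 1) + w 2 * L (EuclideanSpace.single 2 1) := by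
    intro w
    have : w = w 0 • EuclideanSpace.single 0 1 + w 1 • EuclideanSpace.single 1 1
      + w 2 • EuclideanSpace.single 2 1 := by ext j; fin_cases j <;> simp
    conv_lhs => rw [this]
    simp
  rw [hL] at h0 ⊢
  rw [hL (rot 0 s), hL (rot 1 s), hL (rot 2 s), rot_zero, rot_one, rot_two]
  have := S2.sum_sq s
  simp
  set a := L (EuclideanSpace.single 0 1)
  set b := L (EuclideanSpace.single 1 1)
  set c := L (EuclideanSpace.single 2 1)
  linear_combination (-(v 0 * a + v 1 * b + v 2 * c)) * this
    + (s.1 0 * v 0 + s.1 1 * v 1 + s.1 2 * v 2) * h0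

theorem rotD_coord (i j : Fin 3) (s : S2) : rotD i (fun s => s.1 j) s = rot i s j := by
  have h0 : HasFDerivAt (fun x : E3 => (sphereProj x : E3) j) (((‖(s : E3)‖⁻¹ : ℝ) •
      (EuclideanSpace.proj j : E3 →L[ℝ] ℝ)) + (fderiv ℝ (fun x : E3 => ‖x‖⁻¹) s).smulRight (s.1 j))
      (s : E3) := by
    have h1 : HasFDerivAt (fun x : E3 => ‖x‖⁻¹) (fderiv ℝ (fun x : E3 => ‖x‖⁻¹) s) (s : E3) :=
      (((contDiffAt_norm ℝ (n := 1) (S2.coe_ne_zero s)).inv (by simp)).differentiableAt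
        (by simp)).hasFDerivAt
    have h2 := h1.mul (EuclideanSpace.proj j : E3 →L[ℝ] ℝ).hasFDerivAt
    refine (h2.congr_of_eventuallyEq ?_).congr_fderiv ?_
    · filter_upwards [isOpen_compl_zero.mem_nhds (S2.coe_ne_zero s)] with x hx
      simp [coe_sphereProj hx]
    · ext v; simp; ring
  have h2 : fderiv ℝ (fun x : E3 => ‖x‖⁻¹) (s : E3) (rot i s) = 0 := by
    have h3 : HasFDerivAt (fun x : E3 => (‖x‖ ^ 2)) (2 • (innerSL ℝ (s : E3))) (s : E3) :=
      (hasStrictFDerivAt_norm_sq (s : E3)).hasFDerivAt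
    have h5 := (hasDerivAt_inv (x := √(‖(s : E3)‖ ^ 2)) (by simp)).comp_hasFDerivAt (s : E3)
      (h3.sqrt (by simp))
    have h4 := h5.fderiv
    simp only [Function.comp_def, norm_nonneg, Real.sqrt_sq] at h4
    rw [h4]
    simp [rot_apply, inner_sub_right, inner_smul_right, EuclideanSpace.inner_single_right]
    ring
  rw [rotD, h0.fderiv]
  simp [h2]

/-- The commutator of two rotation derivatives is the derivative along the commutator of the
rotation fields; the second derivatives of the extension cancel by symmetry. -/
theorem rotD_comm_aux (hf : SmoothS f) (i j : Fin 3) (s : S2) :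
    rotD i (rotD j f) s - rotD j (rotD i f) s =
      fderiv ℝ (fun x => f (sphereProj x)) (s : E3) (rot j (rot i s) - rot i (rot j s)) := by
  have hs := S2.coe_ne_zero s
  set F := fun x => f (sphereProj x) with hF
  have hcd : ContDiffAt ℝ ∞ F (s : E3) := hf.contDiffAt (isOpen_compl_zero.mem_nhds hs)
  have hd : DifferentiableAt ℝ (fderiv ℝ F) (s : E3) :=
    (hcd.fderiv_right (m := ∞) (by simp)).differentiableAt (by simp)
  have key : ∀ k l, rotD k (rotD l f) s =
      fderiv ℝ (fderiv ℝ F) (s : E3) (rot k s) (rot l s) + fderiv ℝ F s (rot l (rot k s)) := by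
    intro k l
    rw [rotD]
    have a1 : (fun x => rotD l f (sphereProj x)) =ᶠ[nhds (s : E3)] fun x => fderiv ℝ F x (rot l x) := by
      filter_upwards [isOpen_compl_zero.mem_nhds hs] with x hx using rotD_sphereProj l f hx
    rw [a1.fderiv_eq, (hd.hasFDerivAt.clm_apply (rot l).hasFDerivAt).fderiv]
    simp [add_comm]
  have hsym : IsSymmSndFDerivAt ℝ F (s : E3) := hcd.isSymmSndFDerivAt (by simpa using two_le_infty)
  rw [key, key, map_sub, hsym.eq (rot i s) (rot j s)]
  ring

theorem rotD_comm01 (hf : SmoothS f) (s : S2) :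
    rotD 0 (rotD 1 f) s = rotD 1 (rotD 0 f) s - rotD 2 f s := by
  have h := rotD_comm_aux hf 0 1 s
  have e : rot 1 (rot 0 (s : E3)) - rot 0 (rot 1 s) = - rot 2 s := by
    ext j; fin_cases j <;> simp [rot_zero, rot_one, rot_two]
  rw [e, map_neg] at h; change _ = -rotD 2 f s at h; linarith

theorem rotD_comm12 (hf : SmoothS f) (s : S2) :
    rotD 1 (rotD 2 f) s = rotD 2 (rotD 1 f) s - rotD 0 f s := by
  have h := rotD_comm_aux hf 1 2 s
  have e : rot 2 (rot 1 (s : E3)) - rot 1 (rot 2 s) = - rot 0 s := by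
    ext j; fin_cases j <;> simp [rot_zero, rot_one, rot_two]
  rw [e, map_neg] at h; change _ = -rotD 0 f s at h; linarith

theorem rotD_comm20 (hf : SmoothS f) (s : S2) :
    rotD 2 (rotD 0 f) s = rotD 0 (rotD 2 f) s - rotD 1 f s := by
  have h := rotD_comm_aux hf 2 0 s
  have e : rot 0 (rot 2 (s : E3)) - rot 2 (rot 0 s) = - rot 1 s := by
    ext j; fin_cases j <;> simp [rot_zero, rot_one, rot_two]
  rw [e, map_neg] at h; change _ = -rotD 1 f s at h; linarith

/-- The rotation fields are orthogonal to the position: `n · Df = 0`. -/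
theorem coord_mul_rotD (f : S2 → ℝ) (s : S2) :
    s.1 0 * rotD 0 f s + s.1 1 * rotD 1 f s + s.1 2 * rotD 2 f s = 0 := by
  have h : s.1 0 • rot 0 (s : E3) + s.1 1 • rot 1 (s : E3) + s.1 2 • rot 2 (s : E3) = 0 := by
    ext j; fin_cases j <;> simp [rot_zero, rot_one, rot_two] <;> ring
  have h' := congrArg (fderiv ℝ (fun x => f (sphereProj x)) (s : E3)) h
  rwa [map_zero, map_add, map_add, ContinuousLinearMap.map_smul, ContinuousLinearMap.map_smul,
    ContinuousLinearMap.map_smul] at h'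

end

section

open MeasureTheory

/-! ### Spherical means as weighted integrals over `ℝ³` -/

/-- A smooth bump function around `1`, used as a function of the squared radius. -/
def radialBump : ContDiffBump (1 : ℝ) := ⟨1 / 4, 1 / 2, by norm_num, by norm_num⟩

/-- A smooth radial weight on `ℝ³` supported in a closed annulus around the unit sphere. -/
def wt (x : E3) : ℝ := radialBump (‖x‖ ^ 2)

/-- The closed annulus which contains the support of the weight. -/
def annulus : Set E3 := {x | 1 / 2 ≤ ‖x‖ ^ 2 ∧ ‖x‖ ^ 2 ≤ 3 / 2}

theorem contDiff_wt : ContDiff ℝ ∞ wt :=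
  radialBump.contDiff.comp (contDiff_norm_sq ℝ)

theorem wt_nonneg (x : E3) : 0 ≤ wt x := radialBump.nonneg

theorem wt_le_one (x : E3) : wt x ≤ 1 := radialBump.le_one

theorem wt_eq_zero {x : E3} (hx : x ∉ annulus) : wt x = 0 := by
  refine radialBump.zero_of_le_dist ?_
  by_contra h
  rw [not_le, Real.dist_eq, abs_lt] at h
  simp only [radialBump] at h
  exact hx ⟨by linarith [h.1], by linarith [h.2]⟩

theorem wt_coe (s : S2) : wt s = 1 := by
  rw [wt, S2.norm_coe]
  exact radialBump.one_of_mem_closedBall (by simp [radialBump])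

theorem wt_neg (x : E3) : wt (-x) = wt x := by simp [wt]

theorem isCompact_annulus : IsCompact annulus := by
  refine Metric.isCompact_of_isClosed_isBounded ?_ ?_
  · exact (isClosed_le (f := fun _ : E3 => (1 / 2 : ℝ)) (g := fun x : E3 => ‖x‖ ^ 2)
      (by fun_prop) (by fun_prop)).inter
      (isClosed_le (f := fun x : E3 => ‖x‖ ^ 2) (g := fun _ : E3 => (3 / 2 : ℝ))
        (by fun_prop) (by fun_prop))
  · refine (Metric.isBounded_closedBall (x := (0 : E3)) (r := 2)).subset fun x hx => ?_
    have h := hx.2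
    rw [mem_closedBall_zero_iff]
    nlinarith [norm_nonneg x]

theorem zero_notMem_annulus : (0 : E3) ∉ annulus := by
  intro h; have := h.1; norm_num at this

theorem ne_zero_of_mem_annulus {x : E3} (hx : x ∈ annulus) : x ≠ 0 := by
  rintro rfl; exact zero_notMem_annulus hx

theorem wt_eventually_zero : ∀ᶠ x in nhds (0 : E3), wt x = 0 := by
  filter_upwards [isCompact_annulus.isClosed.isOpen_compl.mem_nhds zero_notMem_annulus] with x hx
    using wt_eq_zero hx

theorem tsupport_wt : tsupport wt ⊆ annulus :=
  closure_minimal (fun x hx => by by_contra h; exact hx (wt_eq_zero h)) isCompact_annulus.isClosed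

theorem continuous_wt_mul {F : Type*} [NormedAddCommGroup F] [NormedSpace ℝ F] {h : E3 → F}
    (hh : ContinuousOn h {0}ᶜ) : Continuous fun x => wt x • h x := by
  rw [continuous_iff_continuousAt]
  intro x
  by_cases hx : x = 0
  · subst hx
    refine (continuousAt_const (y := (0 : F))).congr ?_
    filter_upwards [wt_eventually_zero] with x hx; simp [hx]
  · exact contDiff_wt.continuous.continuousAt.smul
      (hh.continuousAt (isOpen_compl_zero.mem_nhds hx))

theorem hasCompactSupport_wt_mul {F : Type*} [NormedAddCommGroup F] [NormedSpace ℝ F]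
    (h : E3 → F) : HasCompactSupport fun x => wt x • h x :=
  HasCompactSupport.intro isCompact_annulus fun x hx => by simp [wt_eq_zero hx]

theorem integrable_wt_mul {h : E3 → ℝ} (hh : ContinuousOn h {0}ᶜ) :
    Integrable fun x => wt x * h x :=
  (continuous_wt_mul hh).integrable_of_hasCompactSupport (hasCompactSupport_wt_mul h)

/-- The weighted integral of a function on the sphere; it is a positive multiple of its integral
over the sphere. -/
def avg (f : S2 → ℝ) : ℝ := ∫ x, wt x * f (sphereProj x)

theorem SmoothS.integrable {f : S2 → ℝ} (hf : SmoothS f) :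
    Integrable fun x => wt x * f (sphereProj x) := integrable_wt_mul hf.continuousOn

theorem avg_add {f g : S2 → ℝ} (hf : SmoothS f) (hg : SmoothS g) :
    avg (fun s => f s + g s) = avg f + avg g := by
  simp only [avg, mul_add]
  exact integral_add hf.integrable hg.integrable

theorem avg_sub {f g : S2 → ℝ} (hf : SmoothS f) (hg : SmoothS g) :
    avg (fun s => f s - g s) = avg f - avg g := by
  simp only [avg, mul_sub]
  exact integral_sub hf.integrable hg.integrable

theorem avg_neg (f : S2 → ℝ) : avg (fun s => -f s) = -avg f := by
  simp only [avg, mul_neg]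
  exact integral_neg _

theorem avg_const_mul (c : ℝ) (f : S2 → ℝ) : avg (fun s => c * f s) = c * avg f := by
  simp only [avg, mul_left_comm _ c]
  exact integral_const_mul _ _

theorem avg_sum {κ : Type*} [Fintype κ] {f : κ → S2 → ℝ} (hf : ∀ k, SmoothS (f k)) :
    avg (fun s => ∑ k, f k s) = ∑ k, avg (f k) := by
  simp only [avg, Finset.mul_sum]
  exact integral_finsetSum _ fun k _ => (hf k).integrable

theorem avg_const (c : ℝ) : avg (fun _ => c) = c * avg fun _ => 1 := by
  simpa using avg_const_mul c fun _ => 1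

/-- Positive definiteness of the `L²` product. -/
theorem avg_sq_eq_zero {f : S2 → ℝ} (hf : SmoothS f) (h : avg (fun s => f s * f s) = 0) :
    f = 0 := by
  have hc := continuous_wt_mul (hf.mul hf).continuousOn
  have h1 := (integral_eq_zero_iff_of_nonneg (fun x => mul_nonneg (wt_nonneg x) (mul_self_nonneg _))
    (hf.mul hf).integrable).1 h
  have h2 := Continuous.ae_eq_iff_eq volume hc continuous_zero |>.1 h1
  funext s
  have h3 := congrFun h2 (s : E3)
  simpa [wt_coe] using h3

theorem avg_one_pos : 0 < avg fun _ => 1 := by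
  refine lt_of_le_of_ne (integral_nonneg fun x => by simpa using wt_nonneg x) fun h => ?_
  have h2 := avg_sq_eq_zero (SmoothS.const 1) (by simpa using h.symm)
  have := congrFun h2 ⟨EuclideanSpace.single 0 1, by simp⟩
  simp at this

/-- In polar coordinates, the weighted integral is the integral over the sphere times a positive
radial factor. -/
theorem zeroMean_iff (f : S2 → ℝ) : ZeroMean f ↔ avg f = 0 := by
  have hmp := Measure.measurePreserving_homeomorphUnitSphereProd (volume : Measure E3)
  set ν := Measure.volumeIoiPow (Module.finrank ℝ E3 - 1) with hν
  have key : avg f = (∫ s, f s ∂((volume : Measure E3).toSphere)) *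
      ∫ r, radialBump ((r : ℝ) ^ 2) ∂ν := by
    rw [← integral_prod_mul, ← hmp.integral_comp (Homeomorph.measurableEmbedding _)]
    have h1 : avg f = ∫ x in ({0}ᶜ : Set E3), wt x * f (sphereProj x) := by
      rw [avg, setIntegral_eq_integral_of_forall_compl_eq_zero]
      intro x hx
      have : x = 0 := by simpa using hx
      rw [this, wt_eq_zero zero_notMem_annulus, zero_mul]
    rw [h1, ← integral_subtype_comap isOpen_compl_zero.measurableSet]
    refine integral_congr_ae (Filter.Eventually.of_forall fun x => ?_)
    have hx : (x : E3) ≠ 0 := x.2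
    have e1 : ((homeomorphUnitSphereProd E3) x).1 = sphereProj (x : E3) := by
      apply Subtype.ext
      rw [coe_sphereProj hx]
      simp
    have e2 : (((homeomorphUnitSphereProd E3) x).2 : ℝ) = ‖(x : E3)‖ := by simp
    simp only [e1, e2, wt, mul_comm]
  have hne : ∫ r, radialBump ((r : ℝ) ^ 2) ∂ν ≠ 0 := by
    intro h0
    have hpos := avg_one_pos
    have : avg (fun _ => 1) = 0 := by
      have hmp := Measure.measurePreserving_homeomorphUnitSphereProd (volume : Measure E3)
      have h1 : avg (fun _ => 1) = ∫ x in ({0}ᶜ : Set E3), wt x := by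
        rw [avg, setIntegral_eq_integral_of_forall_compl_eq_zero]
        · simp
        intro x hx
        have : x = 0 := by simpa using hx
        rw [this, wt_eq_zero zero_notMem_annulus]
      have h2 : avg (fun _ => 1) = (∫ s, (1 : ℝ) ∂((volume : Measure E3).toSphere)) *
          ∫ r, radialBump ((r : ℝ) ^ 2) ∂ν := by
        rw [← integral_prod_mul, ← hmp.integral_comp (Homeomorph.measurableEmbedding _), h1,
          ← integral_subtype_comap isOpen_compl_zero.measurableSet]
        refine integral_congr_ae (Filter.Eventually.of_forall fun x => ?_)
        have e2 : (((homeomorphUnitSphereProd E3) x).2 : ℝ) = ‖(x : E3)‖ := by simp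
        simp only [e2, wt, one_mul]
      rw [h2, h0, mul_zero]
    linarith
  rw [ZeroMean, key]
  simp [hne]

/-- Integration by parts: the rotation fields are divergence-free and annihilate the radial
weight. -/
theorem avg_rotD {f : S2 → ℝ} (hf : SmoothS f) (i : Fin 3) : avg (rotD i f) = 0 := by
  set F := fun x => f (sphereProj x) with hF
  have hF' : ContDiffOn ℝ ∞ (fderiv ℝ F) {0}ᶜ :=
    ContDiffOn.fderiv_of_isOpen (n := ∞) hf isOpen_compl_zero (by simp)
  have hw : Differentiable ℝ wt := contDiff_wt.differentiable (by simp)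
  have hwx : ∀ j : Fin 3, ContDiff ℝ ∞ fun x : E3 => wt x * x j := fun j =>
    contDiff_wt.mul (by fun_prop)
  have hd : ∀ (j : Fin 3) (x v : E3), fderiv ℝ (fun x : E3 => wt x * x j) x v
      = fderiv ℝ wt x v * x j + wt x * v j := by
    intro j x v
    have h := ((hw x).hasFDerivAt.mul (EuclideanSpace.proj j : E3 →L[ℝ] ℝ).hasFDerivAt).fderiv
    have e : (wt * ⇑(EuclideanSpace.proj j : E3 →L[ℝ] ℝ)) = fun x : E3 => wt x * x j := rfl
    rw [← e, h]
    simp; ring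
  have hz : ∀ x ∉ annulus, fderiv ℝ wt x = 0 := by
    intro x hx
    refine (hasFDerivAt_zero_of_eventually_const (0 : ℝ) ?_).fderiv
    filter_upwards [isCompact_annulus.isClosed.isOpen_compl.mem_nhds hx] with y hy
      using wt_eq_zero hy
  have hint : ∀ (G : E3 → ℝ) (H : E3 → ℝ), Continuous G → (∀ x ∉ annulus, G x = 0) →
      ContinuousOn H {0}ᶜ → Integrable fun x => G x * H x := by
    intro G H hG hG0 hH
    refine Continuous.integrable_of_hasCompactSupport ?_
      (HasCompactSupport.intro isCompact_annulus fun x hx => by simp [hG0 x hx])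
    rw [continuous_iff_continuousAt]
    intro x
    by_cases hx : x = 0
    · subst hx
      refine (continuousAt_const (y := (0 : ℝ))).congr ?_
      filter_upwards [isCompact_annulus.isClosed.isOpen_compl.mem_nhds zero_notMem_annulus]
        with x hx
      simp [hG0 x hx]
    · exact hG.continuousAt.mul (hH.continuousAt (isOpen_compl_zero.mem_nhds hx))
  have hFc : ∀ v : E3, ContinuousOn (fun x => fderiv ℝ F x v) {0}ᶜ := fun v =>
    hF'.continuousOn.clm_apply continuousOn_const
  have parts : ∀ (j : Fin 3) (v : E3), ∫ x, (wt x * x j) * fderiv ℝ F x v =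
      -∫ x, (fderiv ℝ wt x v * x j + wt x * v j) * F x := by
    intro j v
    have := integral_mul_fderiv_eq_neg_fderiv_mul_of_integrable (μ := (volume : Measure E3))
      (f := fun x : E3 => wt x * x j) (g := F) (v := v) ?_ ?_ ?_ ?_ ?_
    · rw [this]; simp only [hd]
    · simp only [hd]
      refine hint _ _ ?_ ?_ hf.continuousOn
      · have : Continuous fun x : E3 => fderiv ℝ wt x v :=
          (contDiff_wt.continuous_fderiv (by simp)).clm_apply continuous_const
        exact (this.mul (by fun_prop)).add (contDiff_wt.continuous.mul continuous_const)
      · intro x hx; simp [hz x hx, wt_eq_zero hx]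
    · exact hint _ _ (hwx j).continuous (fun x hx => by simp [wt_eq_zero hx]) (hFc v)
    · exact hint _ _ (hwx j).continuous (fun x hx => by simp [wt_eq_zero hx]) hf.continuousOn
    · intro x _; exact ((hwx j).differentiable (by simp)) x
    · intro x hx
      refine hf.differentiableAt (ne_zero_of_mem_annulus ?_)
      exact tsupport_wt (tsupport_mul_subset_left hx)
  have hrot : ∀ x, fderiv ℝ wt x (rot i x) = 0 := by
    intro x
    have h1 : HasFDerivAt (fun x : E3 => ‖x‖ ^ 2) (2 • (innerSL ℝ x)) x :=
      (hasStrictFDerivAt_norm_sq x).hasFDerivAt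
    have h2 := ((radialBump.contDiff (n := 1)).differentiable (by simp) (‖x‖ ^ 2)).hasDerivAt
    have h3 := (h2.comp_hasFDerivAt x h1).fderiv
    simp only [Function.comp_def] at h3
    change fderiv ℝ (fun x => radialBump (‖x‖ ^ 2)) x (rot i x) = 0
    rw [h3]
    simp [rot_apply, inner_sub_right, inner_smul_right, EuclideanSpace.inner_single_right]
    right; ring
  have e0 : avg (rotD i f) = ∫ x, ((wt x * x (i + 1)) * fderiv ℝ F x (EuclideanSpace.single (i + 2) 1)
      - (wt x * x (i + 2)) * fderiv ℝ F x (EuclideanSpace.single (i + 1) 1)) := by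
    refine integral_congr_ae (Filter.Eventually.of_forall fun x => ?_)
    by_cases hx : x = 0
    · simp [hx, wt_eq_zero zero_notMem_annulus]
    · simp only [rotD_sphereProj i f hx]
      rw [rot_apply, map_sub, map_smul, map_smul, smul_eq_mul, smul_eq_mul]
      ring
  rw [e0, integral_sub, parts, parts, sub_neg_eq_add, neg_add_eq_sub, ← integral_sub]
  · refine integral_eq_zero_of_ae (Filter.Eventually.of_forall fun x => ?_)
    have h := hrot x
    rw [rot_apply, map_sub, map_smul, map_smul, smul_eq_mul, smul_eq_mul] at h
    simp only [PiLp.single_apply, Pi.zero_apply]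
    have e1 : ¬ (i + 1 = i + 2) := by simp
    have e2 : ¬ (i + 2 = i + 1) := by simp
    simp only [e1, e2, if_false]
    linear_combination (-F x) * h
  all_goals
    refine hint _ _ ?_ ?_ ?_
  all_goals first
    | exact hf.continuousOn
    | exact hFc _
    | (intro x hx; simp [hz x hx, wt_eq_zero hx])
    | exact (hwx _).continuous
    | exact (((contDiff_wt.continuous_fderiv (by simp)).clm_apply continuous_const).mul
        (by fun_prop)).add (contDiff_wt.continuous.mul continuous_const)

theorem avg_rotD_mul {f g : S2 → ℝ} (hf : SmoothS f) (hg : SmoothS g) (i : Fin 3) :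
    avg (fun s => rotD i f s * g s) = -avg (fun s => f s * rotD i g s) := by
  have h := avg_rotD (hf.mul hg) i
  have e : rotD i (fun s => f s * g s) = fun s => rotD i f s * g s + f s * rotD i g s :=
    funext fun s => rotD_mul hf hg i s
  rw [e, avg_add ((hf.rotD i).mul hg) (hf.mul (hg.rotD i))] at h
  linarith

theorem avg_rotLap_mul {f g : S2 → ℝ} (hf : SmoothS f) (hg : SmoothS g) :
    avg (fun s => rotLap f s * g s) = -∑ i, avg (fun s => rotD i f s * rotD i g s) := by
  simp only [rotLap, Finset.sum_mul]
  rw [avg_sum fun i => ((hf.rotD i).rotD i).mul hg, ← Finset.sum_neg_distrib]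
  exact Finset.sum_congr rfl fun i _ => avg_rotD_mul (hf.rotD i) hg i

/-- The Laplacian of the sphere is symmetric. -/
theorem avg_rotLap_symm {f g : S2 → ℝ} (hf : SmoothS f) (hg : SmoothS g) :
    avg (fun s => rotLap f s * g s) = avg (fun s => f s * rotLap g s) := by
  have h1 := avg_rotLap_mul hf hg
  have h2 := avg_rotLap_mul hg hf
  simp only [mul_comm (rotLap g _)] at h2
  rw [h1, h2]
  simp only [mul_comm]

theorem avg_rotLap {f : S2 → ℝ} (hf : SmoothS f) : avg (rotLap f) = 0 := by
  have := avg_sum fun i => (hf.rotD i).rotD i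
  simp only [avg_rotD (hf.rotD _), Finset.sum_const_zero] at this
  exact this

/-- The rotation fields span the tangent spaces, and the complement of the origin in `ℝ³` is
connected. -/
theorem eq_const_of_rotD_eq_zero {f : S2 → ℝ} (hf : SmoothS f) (h : ∀ i s, rotD i f s = 0) :
    ∃ c, ∀ s, f s = c := by
  have h0 : Set.EqOn (fderiv ℝ (fun x => f (sphereProj x))) 0 {0}ᶜ := by
    intro x hx
    have hx' : x ≠ 0 := hx
    have hn : 0 < ‖x‖⁻¹ := by positivity
    rw [← fderiv_ext_smul f hn x, ← coe_sphereProj hx']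
    have : fderiv ℝ (fun x => f (sphereProj x)) (sphereProj x : E3) = 0 := by
      ext v; rw [fderiv_ext_eq hf]; simp [h]
    rw [this]; simp
  have hpre : IsPreconnected ({0}ᶜ : Set E3) := by
    refine (isConnected_compl_singleton_of_one_lt_rank ?_ 0).isPreconnected
    rw [← Module.finrank_eq_rank]; simp
  refine ⟨f ⟨EuclideanSpace.single 0 1, by simp⟩, fun s => ?_⟩
  have := isOpen_compl_zero.is_const_of_fderiv_eq_zero (𝕜 := ℝ) hpre
    (fun x hx => (hf.differentiableAt hx).differentiableWithinAt) h0 (S2.coe_ne_zero s)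
    (S2.coe_ne_zero ⟨EuclideanSpace.single 0 1, by simp⟩)
  rwa [sphereProj_coe, sphereProj_coe] at this

/-- Harmonic functions on the sphere are constant. -/
theorem eq_const_of_rotLap_eq_zero {f : S2 → ℝ} (hf : SmoothS f) (h : ∀ s, rotLap f s = 0) :
    ∃ c, ∀ s, f s = c := by
  have h1 := avg_rotLap_mul hf hf
  have h2 : avg (fun s => rotLap f s * f s) = 0 := by simp [h, avg]
  rw [h2, eq_comm, neg_eq_zero] at h1
  have h3 : ∀ i, 0 ≤ avg (fun s => rotD i f s * rotD i f s) := fun i =>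
    integral_nonneg fun x => mul_nonneg (wt_nonneg x) (mul_self_nonneg _)
  rw [Finset.sum_eq_zero_iff_of_nonneg fun i _ => h3 i] at h1
  refine eq_const_of_rotD_eq_zero hf fun i s => ?_
  exact congrFun (avg_sq_eq_zero (hf.rotD i) (h1 i (Finset.mem_univ i))) s

/-- A function on the sphere with mean zero is determined by its Laplacian. -/
theorem eq_of_rotLap_eq {f g : S2 → ℝ} (hf : SmoothS f) (hg : SmoothS g)
    (hf0 : avg f = 0) (hg0 : avg g = 0) (h : ∀ s, rotLap f s = rotLap g s) : f = g := by
  have hfg := hf.sub hg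
  have h1 : ∀ s, rotLap (fun s => f s - g s) s = 0 := by
    intro s
    have e : ∀ i, rotD i (fun s => f s - g s) = fun s => rotD i f s - rotD i g s :=
      fun i => funext fun s => rotD_sub hf hg i s
    simp only [rotLap, e, rotD_sub (hf.rotD _) (hg.rotD _), Finset.sum_sub_distrib]
    have := h s
    simp only [rotLap] at this
    rw [this, sub_self]
  obtain ⟨c, hc⟩ := eq_const_of_rotLap_eq_zero hfg h1
  have h2 := avg_sub hf hg
  rw [hf0, hg0, funext hc, avg_const, sub_zero] at h2
  have hc0 : c = 0 := by simpa [avg_one_pos.ne'] using h2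
  funext s
  have := hc s
  rw [hc0] at this
  linarith

/-! ### Integrals depending on a parameter -/

section Param
variable {Q : Type*} [NormedAddCommGroup Q] [NormedSpace ℝ Q]

theorem contDiffOn_wt_mul_neg {s : Set Q} (hs : IsOpen s) {h : Q × E3 → ℝ}
    (hh : ContDiffOn ℝ ∞ h (s ×ˢ {0}ᶜ)) :
    ContDiffOn ℝ ∞ (fun z : Q × E3 => wt z.2 * h (z.1, -z.2)) (s ×ˢ Set.univ) := by
  rintro ⟨q, x⟩ ⟨hq, -⟩
  refine ContDiffAt.contDiffWithinAt ?_
  by_cases hx : x = 0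
  · subst hx
    refine (contDiffAt_const (c := (0 : ℝ))).congr_of_eventuallyEq ?_
    have : ∀ᶠ z : Q × E3 in nhds (q, (0 : E3)), wt z.2 = 0 :=
      (continuous_snd.tendsto (q, (0 : E3))).eventually wt_eventually_zero
    filter_upwards [this] with z hz; simp [hz]
  · have h1 : ContDiffAt ℝ ∞ h (q, -x) :=
      hh.contDiffAt ((hs.prod isOpen_compl_zero).mem_nhds ⟨hq, by simpa using hx⟩)
    exact (contDiff_wt.contDiffAt.comp _ contDiffAt_snd).mul
      (h1.comp (q, x) (f := fun z : Q × E3 => (z.1, -z.2)) (by fun_prop))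

/-- Smooth dependence on parameters of a weighted integral with a locally integrable kernel, which
is the value at the origin of a convolution. -/
theorem contDiffOn_integral_wt {s : Set Q} (hs : IsOpen s) {h : Q × E3 → ℝ}
    (hh : ContDiffOn ℝ ∞ h (s ×ˢ {0}ᶜ)) {k : E3 → ℝ} (hk : LocallyIntegrable k) :
    ContDiffOn ℝ ∞ (fun q => ∫ t, k t * (wt t * h (q, t))) s := by
  have := contDiffOn_convolution_right_with_param_comp (n := ⊤) (μ := (volume : Measure E3))
    (ContinuousLinearMap.mul ℝ ℝ) (v := fun _ : Q => (0 : E3)) contDiffOn_const (f := k)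
    (g := fun q x => wt x * h (q, -x)) hs isCompact_annulus
    (fun q x _ hx => by simp [wt_eq_zero hx]) hk (contDiffOn_wt_mul_neg hs hh)
  refine this.congr fun q _ => ?_
  simp [convolution, wt_neg]

/-- Differentiation under the integral sign. It is read off from the differentiability of a
convolution with parameters, evaluated at the origin; this is why the integrand is reflected. -/
theorem fderiv_integral_wt {s : Set Q} (hs : IsOpen s) {h : Q × E3 → ℝ}
    (hh : ContDiffOn ℝ ∞ h (s ×ˢ {0}ᶜ)) {q : Q} (hq : q ∈ s) (v : Q) :
    fderiv ℝ (fun q => ∫ t, wt t * h (q, t)) q v = ∫ t, wt t * fderiv ℝ h (q, t) (v, 0) := by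
  set g : Q → E3 → ℝ := fun q x => wt x * h (q, -x) with hg
  have hgc : ContDiffOn ℝ 1 (Function.uncurry g) (s ×ˢ Set.univ) :=
    (contDiffOn_wt_mul_neg hs hh).of_le (by exact_mod_cast le_top)
  have hgd : ∀ x, fderiv ℝ (Function.uncurry g) (q, -x) (v, 0)
      = wt x * fderiv ℝ h (q, x) (v, 0) := by
    intro x
    by_cases hx : x = 0
    · subst hx
      have : Function.uncurry g =ᶠ[nhds (q, -0)] fun _ => 0 := by
        rw [neg_zero]
        have : ∀ᶠ z : Q × E3 in nhds (q, (0 : E3)), wt z.2 = 0 :=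
          (continuous_snd.tendsto (q, (0 : E3))).eventually wt_eventually_zero
        filter_upwards [this] with z hz; simp [Function.uncurry, hg, hz]
      rw [this.fderiv_eq]
      simp [wt_eq_zero zero_notMem_annulus]
    · have h1 : HasFDerivAt h (fderiv ℝ h (q, x)) (q, - -x) := by
        rw [neg_neg]
        have hm : (q, x) ∈ s ×ˢ ({0}ᶜ : Set E3) := ⟨hq, hx⟩
        exact ((hh.contDiffAt ((hs.prod isOpen_compl_zero).mem_nhds hm)).differentiableAt
          (by simp)).hasFDerivAt
      have h2 : HasFDerivAt (fun z : Q × E3 => (z.1, -z.2))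
          ((ContinuousLinearMap.fst ℝ Q E3).prod (-ContinuousLinearMap.snd ℝ Q E3)) (q, -x) :=
        hasFDerivAt_fst.prodMk hasFDerivAt_snd.neg
      have h3 := h1.comp (q, -x) h2
      have h4 : HasFDerivAt (fun z : Q × E3 => wt z.2)
          ((fderiv ℝ wt (-x)).comp (ContinuousLinearMap.snd ℝ Q E3)) (q, -x) :=
        HasFDerivAt.comp (g := wt) (f := fun z : Q × E3 => z.2) (q, -x)
          ((contDiff_wt.differentiable (by simp)) (-x)).hasFDerivAt hasFDerivAt_snd
      have h5 := (h4.mul h3).fderiv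
      have h6 : Function.uncurry g = fun z : Q × E3 => wt z.2 * (h ∘ fun z => (z.1, -z.2)) z := by
        ext z; rfl
      rw [h6]
      erw [h5]
      simp [wt_neg]
  have key := hasFDerivAt_convolution_right_with_param (μ := (volume : Measure E3))
    (ContinuousLinearMap.mul ℝ ℝ) (f := fun _ => (1 : ℝ)) (g := g) hs isCompact_annulus
    (fun q x _ hx => by simp [hg, wt_eq_zero hx]) (locallyIntegrable_const 1) hgc (q, 0) hq
  have key2 := key.comp q (f := fun q : Q => (q, (0 : E3))) (hasFDerivAt_prodMk_left q 0)
  have e1 : ((fun q : Q × E3 => (convolution (fun _ => (1 : ℝ)) (g q.1)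
      (ContinuousLinearMap.mul ℝ ℝ) volume) q.2) ∘ fun q : Q => (q, (0 : E3)))
      = fun q => ∫ t, wt t * h (q, t) := by
    ext q; simp [convolution, hg, wt_neg]
  rw [e1] at key2
  rw [key2.fderiv]
  simp only [ContinuousLinearMap.comp_apply, ContinuousLinearMap.inl_apply, convolution]
  rw [ContinuousLinearMap.integral_apply]
  · refine integral_congr_ae (Filter.Eventually.of_forall fun x => ?_)
    have := hgd x
    simp only [zero_sub]
    rw [← this]
    simp [ContinuousLinearMap.precompR_apply]
    rfl
  · have hzero : ∀ x ∉ annulus, fderiv ℝ (Function.uncurry g) (q, -x) = 0 := by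
      intro x hx
      refine (hasFDerivAt_zero_of_eventually_const (0 : ℝ) ?_).fderiv
      have hx' : -x ∉ annulus := by simpa [annulus] using hx
      have : ∀ᶠ z : Q × E3 in nhds (q, -x), z.2 ∈ annulusᶜ :=
        (continuous_snd.tendsto (q, -x)).eventually
          (isCompact_annulus.isClosed.isOpen_compl.mem_nhds hx')
      filter_upwards [this] with z hz
      simp [Function.uncurry, hg, wt_eq_zero hz]
    have hcont : Continuous fun x : E3 => fderiv ℝ (Function.uncurry g) (q, -x) := by
      have := (hgc.continuousOn_fderiv_of_isOpen (hs.prod isOpen_univ) (by simp))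
      exact this.comp_continuous (f := fun x : E3 => (q, -x)) (by fun_prop) fun x => ⟨hq, trivial⟩
    refine Continuous.integrable_of_hasCompactSupport ?_
      (HasCompactSupport.intro isCompact_annulus fun x hx => ?_)
    · simp only [zero_sub]
      exact (((ContinuousLinearMap.mul ℝ ℝ).precompR (Q × E3)) 1).continuous.comp hcont
    · simp only [zero_sub]
      have := hzero x hx
      erw [this]
      simp

end Param

variable {P : Type*} [NormedAddCommGroup P] [NormedSpace ℝ P]

theorem SmoothFam.contDiffOn_avg {U : Set P} (hU : IsOpen U) {f : P → S2 → ℝ}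
    (hf : SmoothFam U f) : ContDiffOn ℝ ∞ (fun y => avg (f y)) U := by
  have := contDiffOn_integral_wt hU hf (locallyIntegrable_const (1 : ℝ))
  simpa [avg] using this

theorem SmoothFam.avg_parD {U : Set P} (hU : IsOpen U) {f : P → S2 → ℝ}
    (hf : SmoothFam U f) {y : P} (hy : y ∈ U) (v : P) :
    avg (Electro.parD v f y) = fderiv ℝ (fun y => avg (f y)) y v := by
  have := fderiv_integral_wt hU hf hy v
  simp only [avg]
  rw [this]
  refine integral_congr_ae (Filter.Eventually.of_forall fun x => ?_)
  by_cases hx : x = 0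
  · simp [hx, wt_eq_zero zero_notMem_annulus]
  · simp only [hf.parD_eq hU v hy hx]

end

section

/-! ### Covector fields on the sphere in the rotation frame -/

/-- The divergence of a covector field on the sphere with components `b i` along the rotation
fields. -/
def rotDiv (b : Fin 3 → S2 → ℝ) (s : S2) : ℝ := ∑ i, rotD i (b i) s

/-- The scalar curl `n · (D × b)` of a covector field on the sphere with components `b i` along the
rotation fields. -/
def rotCurl (b : Fin 3 → S2 → ℝ) (s : S2) : ℝ :=
  ∑ i, s.1 i * (rotD (i + 1) (b (i + 2)) s - rotD (i + 2) (b (i + 1)) s)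

/-- The components `(Dν × n)_i` of the co-exact field `ε_B^C ∇_C ν` along the rotation fields. -/
def rotStar (ν : S2 → ℝ) (i : Fin 3) (s : S2) : ℝ :=
  rotD (i + 1) ν s * s.1 (i + 2) - rotD (i + 2) ν s * s.1 (i + 1)

theorem rotCurl_eq (b : Fin 3 → S2 → ℝ) (s : S2) : rotCurl b s =
    s.1 0 * (rotD 1 (b 2) s - rotD 2 (b 1) s) + s.1 1 * (rotD 2 (b 0) s - rotD 0 (b 2) s)
      + s.1 2 * (rotD 0 (b 1) s - rotD 1 (b 0) s) := by
  simp only [rotCurl, Fin.sum_univ_three]; rfl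

theorem SmoothS.rotStar {ν : S2 → ℝ} (hν : SmoothS ν) (i : Fin 3) : SmoothS (rotStar ν i) :=
  ((hν.rotD _).mul (SmoothS.coord _)).sub ((hν.rotD _).mul (SmoothS.coord _))

theorem rotD_rotStar {ν : S2 → ℝ} (hν : SmoothS ν) (j i : Fin 3) (s : S2) :
    rotD j (rotStar ν i) s =
      rotD j (rotD (i + 1) ν) s * s.1 (i + 2) + rotD (i + 1) ν s * rot j s (i + 2)
        - (rotD j (rotD (i + 2) ν) s * s.1 (i + 1) + rotD (i + 2) ν s * rot j s (i + 1)) := by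
  have e : rotStar ν i = fun s => rotD (i + 1) ν s * s.1 (i + 2) - rotD (i + 2) ν s * s.1 (i + 1) :=
    rfl
  rw [e, rotD_sub ((hν.rotD _).mul (SmoothS.coord _)) ((hν.rotD _).mul (SmoothS.coord _)),
    rotD_mul (hν.rotD _) (SmoothS.coord _), rotD_mul (hν.rotD _) (SmoothS.coord _), rotD_coord,
    rotD_coord]

theorem coord_mul_rotStar (ν : S2 → ℝ) (s : S2) :
    s.1 0 * rotStar ν 0 s + s.1 1 * rotStar ν 1 s + s.1 2 * rotStar ν 2 s = 0 := by
  simp only [rotStar, Fin.isValue, zero_add, Fin.reduceAdd]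
  ring

/-- The derivative of the relation `n · b = 0`. -/
theorem coord_mul_rotD_of_tangent {b : Fin 3 → S2 → ℝ} (hb : ∀ i, SmoothS (b i))
    (ht : ∀ s : S2, s.1 0 * b 0 s + s.1 1 * b 1 s + s.1 2 * b 2 s = 0) (i : Fin 3) (s : S2) :
    s.1 0 * rotD i (b 0) s + s.1 1 * rotD i (b 1) s + s.1 2 * rotD i (b 2) s
      + (rot i s 0 * b 0 s + rot i s 1 * b 1 s + rot i s 2 * b 2 s) = 0 := by
  have h : rotD i (fun s => s.1 0 * b 0 s + s.1 1 * b 1 s + s.1 2 * b 2 s) s = 0 := by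
    rw [funext ht, rotD_const]
  have hm : ∀ j, SmoothS fun s => s.1 j * b j s := fun j => (SmoothS.coord j).mul (hb j)
  rw [rotD_add ((hm 0).add (hm 1)) (hm 2), rotD_add (hm 0) (hm 1),
    rotD_mul (SmoothS.coord 0) (hb 0), rotD_mul (SmoothS.coord 1) (hb 1),
    rotD_mul (SmoothS.coord 2) (hb 2), rotD_coord, rotD_coord, rotD_coord] at h
  linear_combination h

theorem rotLap_eq (f : S2 → ℝ) (s : S2) : rotLap f s =
    rotD 0 (rotD 0 f) s + rotD 1 (rotD 1 f) s + rotD 2 (rotD 2 f) s := by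
  simp only [rotLap, Fin.sum_univ_three]

theorem rotDiv_rotStar {ν : S2 → ℝ} (hν : SmoothS ν) (s : S2) : rotDiv (rotStar ν) s = 0 := by
  have h01 := rotD_comm01 hν s
  have h12 := rotD_comm12 hν s
  have h20 := rotD_comm20 hν s
  have h := coord_mul_rotD ν s
  simp only [rotDiv, Fin.sum_univ_three, rotD_rotStar hν, Fin.isValue, zero_add, Fin.reduceAdd,
    rot_zero, rot_one, rot_two, h01, h12, h20]
  simp
  linear_combination h

theorem rotCurl_rotD {μ : S2 → ℝ} (hμ : SmoothS μ) (s : S2) :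
    rotCurl (fun i => rotD i μ) s = 0 := by
  have h := coord_mul_rotD μ s
  rw [rotCurl_eq, rotD_comm01 hμ, rotD_comm12 hμ, rotD_comm20 hμ]
  linear_combination -h

theorem rotCurl_rotStar {ν : S2 → ℝ} (hν : SmoothS ν) (s : S2) :
    rotCurl (rotStar ν) s = -rotLap ν s := by
  have hn := S2.sum_sq s
  have h := coord_mul_rotD_of_tangent (b := fun i => rotD i ν) (hν.rotD) (coord_mul_rotD ν)
  have h0 := h 0 s
  have h1 := h 1 s
  have h2 := h 2 s
  rw [rotCurl_eq, rotLap_eq]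
  simp only [rotD_rotStar hν, Fin.isValue, zero_add, Fin.reduceAdd, rot_zero, rot_one, rot_two]
    at h0 h1 h2 ⊢
  simp at h0 h1 h2 ⊢
  linear_combination s.1 0 * h0 + s.1 1 * h1 + s.1 2 * h2 -
    (rotD 0 (rotD 0 ν) s + rotD 1 (rotD 1 ν) s + rotD 2 (rotD 2 ν) s) * hn

theorem rotDiv_add {b c : Fin 3 → S2 → ℝ} (hb : ∀ i, SmoothS (b i)) (hc : ∀ i, SmoothS (c i))
    (s : S2) : rotDiv (fun i s => b i s + c i s) s = rotDiv b s + rotDiv c s := by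
  simp only [rotDiv, rotD_add (hb _) (hc _), Finset.sum_add_distrib]

theorem rotDiv_sub {b c : Fin 3 → S2 → ℝ} (hb : ∀ i, SmoothS (b i)) (hc : ∀ i, SmoothS (c i))
    (s : S2) : rotDiv (fun i s => b i s - c i s) s = rotDiv b s - rotDiv c s := by
  simp only [rotDiv, rotD_sub (hb _) (hc _), Finset.sum_sub_distrib]

theorem rotCurl_add {b c : Fin 3 → S2 → ℝ} (hb : ∀ i, SmoothS (b i)) (hc : ∀ i, SmoothS (c i))
    (s : S2) : rotCurl (fun i s => b i s + c i s) s = rotCurl b s + rotCurl c s := by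
  simp only [rotCurl_eq, rotD_add (hb _) (hc _)]; ring

theorem rotCurl_sub {b c : Fin 3 → S2 → ℝ} (hb : ∀ i, SmoothS (b i)) (hc : ∀ i, SmoothS (c i))
    (s : S2) : rotCurl (fun i s => b i s - c i s) s = rotCurl b s - rotCurl c s := by
  simp only [rotCurl_eq, rotD_sub (hb _) (hc _)]; ring

/-- There are no harmonic one-forms on the sphere: if `b` is closed and co-closed, its components
along the rotation fields are harmonic functions, hence constants, and the relation `n · b = 0` makes
them vanish. -/
theorem eq_zero_of_harmonic {b : Fin 3 → S2 → ℝ} (hb : ∀ i, SmoothS (b i))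
    (ht : ∀ s : S2, s.1 0 * b 0 s + s.1 1 * b 1 s + s.1 2 * b 2 s = 0)
    (hdiv : ∀ s, rotDiv b s = 0) (hcurl : ∀ s, rotCurl b s = 0) (i : Fin 3) (s : S2) :
    b i s = 0 := by
  -- closedness in the rotation frame, where the structure constants enter
  have hX : ∀ s : S2, rotD 0 (b 1) s - rotD 1 (b 0) s + b 2 s = 0 ∧
      rotD 1 (b 2) s - rotD 2 (b 1) s + b 0 s = 0 ∧
      rotD 2 (b 0) s - rotD 0 (b 2) s + b 1 s = 0 := by
    intro s
    have hn := S2.sum_sq s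
    have hw := hcurl s
    rw [rotCurl_eq] at hw
    have h := ht s
    have t := coord_mul_rotD_of_tangent hb ht
    have t0 := t 0 s
    have t1 := t 1 s
    have t2 := t 2 s
    have d0 := coord_mul_rotD (b 0) s
    have d1 := coord_mul_rotD (b 1) s
    have d2 := coord_mul_rotD (b 2) s
    simp only [rot_zero, rot_one, rot_two] at t0 t1 t2
    simp at t0 t1 t2
    set X2 := rotD 0 (b 1) s - rotD 1 (b 0) s + b 2 s with hX2
    set X0 := rotD 1 (b 2) s - rotD 2 (b 1) s + b 0 s with hX0
    set X1 := rotD 2 (b 0) s - rotD 0 (b 2) s + b 1 s with hX1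
    have w : s.1 0 * X0 + s.1 1 * X1 + s.1 2 * X2 = 0 := by
      rw [hX0, hX1, hX2]; linear_combination hw + h
    have c0 : s.1 1 * X2 - s.1 2 * X1 = 0 := by rw [hX2, hX1]; linear_combination t0 - d0
    have c1 : s.1 2 * X0 - s.1 0 * X2 = 0 := by rw [hX2, hX0]; linear_combination t1 - d1
    have c2 : s.1 0 * X1 - s.1 1 * X0 = 0 := by rw [hX0, hX1]; linear_combination t2 - d2
    refine ⟨?_, ?_, ?_⟩
    · linear_combination s.1 2 * w + s.1 1 * c0 - s.1 0 * c1 - X2 * hn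
    · linear_combination s.1 0 * w + s.1 2 * c1 - s.1 1 * c2 - X0 * hn
    · linear_combination s.1 1 * w + s.1 0 * c2 - s.1 2 * c0 - X1 * hn
  have hdiv' : (fun s => rotD 0 (b 0) s + rotD 1 (b 1) s + rotD 2 (b 2) s) = fun _ => 0 := by
    funext s; have := hdiv s; simpa only [rotDiv, Fin.sum_univ_three] using this
  have hD : ∀ i s, rotD i (rotD 0 (b 0)) s + rotD i (rotD 1 (b 1)) s
      + rotD i (rotD 2 (b 2)) s = 0 := by
    intro i s
    have h1 : ∀ j, SmoothS (rotD j (b j)) := fun j => (hb j).rotD j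
    rw [← rotD_add (h1 0) (h1 1), ← rotD_add ((h1 0).add (h1 1)) (h1 2), hdiv', rotD_const]
  have e1 : rotD 1 (b 0) = fun s => rotD 0 (b 1) s + b 2 s := by
    funext s; linear_combination -(hX s).1
  have e2 : rotD 2 (b 0) = fun s => rotD 0 (b 2) s - b 1 s := by
    funext s; linear_combination (hX s).2.2
  have e3 : rotD 2 (b 1) = fun s => rotD 1 (b 2) s + b 0 s := by
    funext s; linear_combination -(hX s).2.1
  have e4 : rotD 0 (b 1) = fun s => rotD 1 (b 0) s - b 2 s := by
    funext s; linear_combination (hX s).1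
  have e5 : rotD 0 (b 2) = fun s => rotD 2 (b 0) s + b 1 s := by
    funext s; linear_combination -(hX s).2.2
  have e6 : rotD 1 (b 2) = fun s => rotD 2 (b 1) s - b 0 s := by
    funext s; linear_combination (hX s).2.1
  have lap : ∀ i s, rotLap (b i) s = 0 := by
    intro i s
    rw [rotLap_eq]
    fin_cases i
    · simp only [Fin.zero_eta]
      rw [e1, e2, rotD_add ((hb 1).rotD 0) (hb 2), rotD_sub ((hb 2).rotD 0) (hb 1)]
      linear_combination hD 0 s - rotD_comm01 (hb 1) s + rotD_comm20 (hb 2) s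
    · simp only [Fin.mk_one]
      rw [e4, e3, rotD_sub ((hb 0).rotD 1) (hb 2), rotD_add ((hb 2).rotD 1) (hb 0)]
      linear_combination hD 1 s + rotD_comm01 (hb 0) s - rotD_comm12 (hb 2) s
    · simp only [Fin.reduceFinMk]
      rw [e5, e6, rotD_add ((hb 0).rotD 2) (hb 1), rotD_sub ((hb 1).rotD 2) (hb 0)]
      linear_combination hD 2 s + rotD_comm12 (hb 1) s - rotD_comm20 (hb 0) s
  choose c hc using fun i => eq_const_of_rotLap_eq_zero (hb i) (lap i)
  have := ht ⟨EuclideanSpace.single i 1, by simp⟩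
  rw [hc i]
  fin_cases i <;> simpa [hc] using this

/-- A covector field on the sphere is determined by its divergence and its curl. -/
theorem eq_of_rotDiv_rotCurl {b c : Fin 3 → S2 → ℝ} (hb : ∀ i, SmoothS (b i))
    (hc : ∀ i, SmoothS (c i))
    (hbt : ∀ s : S2, s.1 0 * b 0 s + s.1 1 * b 1 s + s.1 2 * b 2 s = 0)
    (hct : ∀ s : S2, s.1 0 * c 0 s + s.1 1 * c 1 s + s.1 2 * c 2 s = 0)
    (hdiv : ∀ s, rotDiv b s = rotDiv c s) (hcurl : ∀ s, rotCurl b s = rotCurl c s)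
    (i : Fin 3) (s : S2) : b i s = c i s := by
  have := eq_zero_of_harmonic (b := fun i s => b i s - c i s) (fun i => (hb i).sub (hc i))
    (fun s => by linear_combination hbt s - hct s)
    (fun s => by rw [rotDiv_sub hb hc, hdiv, sub_self])
    (fun s => by rw [rotCurl_sub hb hc, hcurl, sub_self]) i s
  linarith

/-- The divergence of a covector field sees only its even potential. -/
theorem rotDiv_potentials {μ ν : S2 → ℝ} (hμ : SmoothS μ) (hν : SmoothS ν) (s : S2) :
    rotDiv (fun i s => rotD i μ s + rotStar ν i s) s = rotLap μ s := by
  rw [rotDiv_add hμ.rotD hν.rotStar, rotDiv_rotStar hν, add_zero]; rfl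

/-- The curl of a covector field sees only its odd potential. -/
theorem rotCurl_potentials {μ ν : S2 → ℝ} (hμ : SmoothS μ) (hν : SmoothS ν) (s : S2) :
    rotCurl (fun i s => rotD i μ s + rotStar ν i s) s = -rotLap ν s := by
  rw [rotCurl_add hμ.rotD hν.rotStar, rotCurl_rotStar hν, rotCurl_rotD hμ, zero_add]

/-- Uniqueness of the scalar potentials of a covector field on the sphere. -/
theorem potentials_unique {μ ν μ' ν' : S2 → ℝ} (hμ : SmoothS μ) (hν : SmoothS ν)
    (hμ' : SmoothS μ') (hν' : SmoothS ν') (aμ : avg μ = 0) (aν : avg ν = 0) (aμ' : avg μ' = 0)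
    (aν' : avg ν' = 0) (h : ∀ i s, rotD i μ s + rotStar ν i s = rotD i μ' s + rotStar ν' i s) :
    μ = μ' ∧ ν = ν' := by
  have e : (fun i s => rotD i μ s + rotStar ν i s) = fun i s => rotD i μ' s + rotStar ν' i s :=
    funext fun i => funext fun s => h i s
  refine ⟨eq_of_rotLap_eq hμ hμ' aμ aμ' fun s => ?_, eq_of_rotLap_eq hν hν' aν aν' fun s => ?_⟩
  · rw [← rotDiv_potentials hμ hν, e, rotDiv_potentials hμ' hν']
  · rw [← neg_inj, ← rotCurl_potentials hμ hν, e, rotCurl_potentials hμ' hν']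

theorem avg_rotDiv {b : Fin 3 → S2 → ℝ} (hb : ∀ i, SmoothS (b i)) : avg (rotDiv b) = 0 := by
  have := avg_sum fun i => (hb i).rotD i
  simp only [avg_rotD (hb _), Finset.sum_const_zero] at this
  exact this

theorem avg_rotCurl {b : Fin 3 → S2 → ℝ} (hb : ∀ i, SmoothS (b i))
    (ht : ∀ s : S2, s.1 0 * b 0 s + s.1 1 * b 1 s + s.1 2 * b 2 s = 0) : avg (rotCurl b) = 0 := by
  -- up to a multiple of `n · b`, the curl is the divergence of `b × n`
  set a : Fin 3 → S2 → ℝ := fun i s => s.1 (i + 2) * b (i + 1) s - s.1 (i + 1) * b (i + 2) s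
    with ha
  have hm : ∀ j k, SmoothS fun s => s.1 j * b k s := fun j k => (SmoothS.coord j).mul (hb k)
  have h1 := avg_rotDiv (b := a) fun i => (hm _ _).sub (hm _ _)
  have e : rotDiv a = rotCurl b := by
    funext s
    rw [rotCurl_eq]
    simp only [rotDiv, Fin.sum_univ_three, ha, Fin.isValue, zero_add, Fin.reduceAdd]
    rw [rotD_sub (hm _ _) (hm _ _), rotD_sub (hm _ _) (hm _ _), rotD_sub (hm _ _) (hm _ _)]
    simp only [rotD_mul (SmoothS.coord _) (hb _), rotD_coord, rot_zero, rot_one, rot_two]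
    have := ht s
    simp
    linear_combination 2 * this
  rwa [e] at h1

theorem SmoothS.rotDiv {b : Fin 3 → S2 → ℝ} (hb : ∀ i, SmoothS (b i)) : SmoothS (rotDiv b) :=
  SmoothS.sum fun i => (hb i).rotD i

end

section

open MeasureTheory

/-! ### The logarithmic kernel on the sphere -/

/-- `1 - cos θ`, where `θ` is the angle between two non-zero vectors. -/
def gap (x t : E3) : ℝ := 1 - ‖x‖⁻¹ * ‖t‖⁻¹ * inner ℝ x t

theorem gap_comm (x t : E3) : gap x t = gap t x := by
  simp only [gap, real_inner_comm]; ring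

theorem gap_nonneg (x t : E3) : 0 ≤ gap x t := by
  have h := real_inner_le_norm x t
  have h2 : ‖x‖⁻¹ * ‖t‖⁻¹ * inner ℝ x t ≤ ‖x‖⁻¹ * ‖t‖⁻¹ * (‖x‖ * ‖t‖) := by gcongr
  have h3 : ‖x‖⁻¹ * ‖t‖⁻¹ * (‖x‖ * ‖t‖) ≤ 1 := by
    rw [mul_mul_mul_comm]
    exact mul_le_one₀ inv_mul_le_one (by positivity) inv_mul_le_one
  rw [gap]; linarith

theorem gap_le_two (x t : E3) : gap x t ≤ 2 := by
  have h := neg_le_of_abs_le (abs_real_inner_le_norm x t)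
  have h2 : ‖x‖⁻¹ * ‖t‖⁻¹ * (-(‖x‖ * ‖t‖)) ≤ ‖x‖⁻¹ * ‖t‖⁻¹ * inner ℝ x t := by gcongr
  have h3 : ‖x‖⁻¹ * ‖t‖⁻¹ * (‖x‖ * ‖t‖) ≤ 1 := by
    rw [mul_mul_mul_comm]
    exact mul_le_one₀ inv_mul_le_one (by positivity) inv_mul_le_one
  rw [gap]; linarith

theorem gap_map (φ : E3 ≃ₗᵢ[ℝ] E3) (x t : E3) : gap (φ x) (φ t) = gap x t := by
  simp [gap]

theorem gap_sphereProj_right (x : E3) {t : E3} (ht : t ≠ 0) : gap x (sphereProj t) = gap x t := by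
  rw [gap, gap, S2.norm_coe, coe_sphereProj ht, real_inner_smul_right]
  ring

theorem gap_coe (s s' : S2) : gap s s' = 1 - inner ℝ (s : E3) (s' : E3) := by
  simp [gap]

theorem dist_sq_eq_gap (s s' : S2) : ‖(s' : E3) - s‖ ^ 2 = 2 * gap s s' := by
  rw [norm_sub_sq_real, S2.norm_coe, S2.norm_coe, gap_coe, real_inner_comm]; ring

theorem measurable_gap : Measurable fun z : E3 × E3 => gap z.1 z.2 := by
  unfold gap; fun_prop

theorem measurable_gap_right (x : E3) : Measurable fun t : E3 => gap x t := by
  unfold gap; fun_prop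

/-- The integrable singularity which dominates the logarithmic kernel. -/
def singKernel (x t : E3) : ℝ := annulus.indicator (fun t => (√(gap x t))⁻¹) t

theorem singKernel_nonneg (x t : E3) : 0 ≤ singKernel x t :=
  Set.indicator_nonneg (fun _ _ => by positivity) _

theorem measurableSet_annulus : MeasurableSet annulus := isCompact_annulus.isClosed.measurableSet

theorem annulus_map (φ : E3 ≃ₗᵢ[ℝ] E3) (t : E3) : φ t ∈ annulus ↔ t ∈ annulus := by
  simp [annulus]

theorem singKernel_map (φ : E3 ≃ₗᵢ[ℝ] E3) (x t : E3) :
    singKernel (φ x) (φ t) = singKernel x t := by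
  by_cases h : t ∈ annulus
  · simp [singKernel, h, (annulus_map φ t).2 h, gap_map]
  · simp [singKernel, h, (annulus_map φ t).not.2 h]

theorem measurable_singKernel : Measurable fun z : E3 × E3 => singKernel z.1 z.2 := by
  have : (fun z : E3 × E3 => singKernel z.1 z.2) =
      (Prod.snd ⁻¹' annulus).indicator fun z => (√(gap z.1 z.2))⁻¹ := by
    rfl
  rw [this]
  exact Measurable.indicator (measurable_gap.sqrt.inv) (measurable_snd measurableSet_annulus)

theorem integrable_inv_sqrt_abs :
    Integrable ((Metric.ball (0 : ℝ) 2).indicator fun t => (√|t|)⁻¹) := by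
  rw [integrable_indicator_iff Metric.isOpen_ball.measurableSet]
  have h := (integrableOn_fun_norm_addHaar (E := ℝ) (μ := volume) (r := 2)
    (f := fun t : ℝ => (√t)⁻¹)).2
  refine h ?_
  have h1 := intervalIntegral.intervalIntegrable_rpow' (a := 0) (b := 2) (r := -(1 / 2))
    (by norm_num)
  rw [intervalIntegrable_iff_integrableOn_Ioo_of_le (by norm_num)] at h1
  refine h1.congr_fun (fun t ht => ?_) measurableSet_Ioo
  simp [Real.sqrt_eq_rpow, Real.rpow_neg ht.1.le]

/-- For the pole `e₀`, the bound `|x₁| |x₂| / 4 ≤ 1 - cos θ` on the annulus dominates the kernel by a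
product of integrable functions of one variable. -/
theorem integrable_singKernel_single :
    Integrable fun t => singKernel (EuclideanSpace.single (0 : Fin 3) 1) t := by
  set g : Fin 3 → ℝ → ℝ := ![(Metric.ball (0 : ℝ) 2).indicator fun _ => 2,
    (Metric.ball (0 : ℝ) 2).indicator fun t => (√|t|)⁻¹,
    (Metric.ball (0 : ℝ) 2).indicator fun t => (√|t|)⁻¹] with hg
  have hgi : ∀ i, Integrable (g i) := by
    intro i
    fin_cases i
    · simp only [hg, Fin.zero_eta, Matrix.cons_val_zero]
      rw [integrable_indicator_iff Metric.isOpen_ball.measurableSet]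
      exact integrableOn_const (by simp [ENNReal.mul_eq_top])
    · exact integrable_inv_sqrt_abs
    · exact integrable_inv_sqrt_abs
  have h1 : Integrable (fun x : Fin 3 → ℝ => ∏ i, g i (x i)) := Integrable.fintype_prod hgi
  have h2 : Integrable (fun x : E3 => ∏ i, g i (x i)) :=
    (PiLp.volume_preserving_ofLp (Fin 3)).integrable_comp_of_integrable h1
  have hnull : ∀ i : Fin 3, ∀ᵐ x : E3, x i ≠ 0 := by
    intro i
    have h3 := Measure.addHaar_submodule (volume : Measure E3)
      (LinearMap.ker (EuclideanSpace.proj i : E3 →L[ℝ] ℝ).toLinearMap) (by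
        intro h
        have : EuclideanSpace.single i (1 : ℝ) ∈
          LinearMap.ker (EuclideanSpace.proj i : E3 →L[ℝ] ℝ).toLinearMap := h ▸ trivial
        simp at this)
    rw [ae_iff]
    convert! h3 using 2
    ext x; simp
  refine h2.mono' ?_ ?_
  · exact (measurable_singKernel.comp (measurable_prodMk_left
      (x := EuclideanSpace.single (0 : Fin 3) (1 : ℝ)))).aestronglyMeasurable
  · filter_upwards [hnull 1, hnull 2] with x h1 h2
    rw [Real.norm_of_nonneg (singKernel_nonneg _ _), singKernel]
    by_cases hx : x ∈ annulus
    swap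
    · rw [Set.indicator_of_notMem hx]
      refine Finset.prod_nonneg fun i _ => ?_
      fin_cases i
      · exact Set.indicator_nonneg (f := fun _ => (2 : ℝ)) (fun _ _ => by positivity) _
      · exact Set.indicator_nonneg (f := fun t : ℝ => (√|t|)⁻¹) (fun _ _ => by positivity) _
      · exact Set.indicator_nonneg (f := fun t : ℝ => (√|t|)⁻¹) (fun _ _ => by positivity) _
    rw [Set.indicator_of_mem hx]
    have hx0 := ne_zero_of_mem_annulus hx
    have hn : ‖x‖ ^ 2 = x 0 ^ 2 + x 1 ^ 2 + x 2 ^ 2 := by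
      rw [EuclideanSpace.norm_sq_eq]; simp [Fin.sum_univ_three]
    have hb : ∀ i, x i ∈ Metric.ball (0 : ℝ) 2 := by
      intro i
      rw [mem_ball_zero_iff, Real.norm_eq_abs]
      refine abs_lt_of_sq_lt_sq ?_ (by norm_num)
      have := hx.2
      fin_cases i <;> simp <;> nlinarith [sq_nonneg (x 0), sq_nonneg (x 1), sq_nonneg (x 2)]
    have hprod : ∏ i, g i (x i) = 2 * (√|x 1|)⁻¹ * (√|x 2|)⁻¹ := by
      simp [Fin.prod_univ_three, hg, -Metric.mem_ball, hb]
    rw [hprod]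
    have hgap : |x 1| * |x 2| / 4 ≤ gap (EuclideanSpace.single 0 1) x := by
      have hpos : 0 < ‖x‖ := norm_pos_iff.2 hx0
      have e : gap (EuclideanSpace.single 0 1) x = 1 - x 0 / ‖x‖ := by
        simp [gap, EuclideanSpace.inner_single_left]; ring
      rw [e, le_sub_iff_add_le, ← le_sub_iff_add_le', div_le_iff₀ hpos]
      have ha := abs_mul_abs_self (x 1)
      have hb := abs_mul_abs_self (x 2)
      have h5 : |x 1| * |x 2| ≤ (x 1 ^ 2 + x 2 ^ 2) / 2 := by
        nlinarith [sq_nonneg (|x 1| - |x 2|)]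
      have h6 : |x 0| ≤ ‖x‖ := by
        refine abs_le_of_sq_le_sq ?_ hpos.le; nlinarith [sq_nonneg (x 1), sq_nonneg (x 2)]
      have h8 := le_abs_self (x 0)
      have h9 : ‖x‖ ≤ 5 / 4 := by nlinarith [hx.2]
      have h10 := sq_abs (x 0)
      nlinarith [abs_nonneg (x 0), mul_nonneg (abs_nonneg (x 1)) (abs_nonneg (x 2)),
        mul_nonneg (sub_nonneg.2 h6) hpos.le]
    have h4 : (√(gap (EuclideanSpace.single 0 1) x))⁻¹ ≤ (√(|x 1| * |x 2| / 4))⁻¹ := by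
      gcongr
    refine h4.trans (le_of_eq ?_)
    rw [Real.sqrt_div' _ (by norm_num), Real.sqrt_mul (abs_nonneg _),
      show (4 : ℝ) = 2 ^ 2 by norm_num, Real.sqrt_sq (by norm_num)]
    field_simp

theorem exists_isometry_single (s : S2) :
    ∃ φ : E3 ≃ₗᵢ[ℝ] E3, φ (EuclideanSpace.single 0 1) = s :=
  ⟨_, Submodule.reflection_sub (by simp)⟩

theorem integrable_singKernel (s : S2) : Integrable fun t => singKernel s t := by
  obtain ⟨φ, hφ⟩ := exists_isometry_single s
  have h := φ.measurePreserving.integrable_comp_emb φ.toMeasurableEquiv.measurableEmbedding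
    (g := fun t => singKernel s t)
  refine h.1 ?_
  refine integrable_singKernel_single.congr (Filter.Eventually.of_forall fun t => ?_)
  simp only [Function.comp_apply, ← hφ, singKernel_map]

theorem integral_singKernel (s : S2) :
    ∫ t, singKernel s t = ∫ t, singKernel (EuclideanSpace.single (0 : Fin 3) 1) t := by
  obtain ⟨φ, hφ⟩ := exists_isometry_single s
  rw [← φ.measurePreserving.integral_comp φ.toMeasurableEquiv.measurableEmbedding]
  simp only [← hφ, singKernel_map]

/-- The logarithmic kernel, shifted by `ε`, is dominated by the integrable singularity uniformly in
`ε`. -/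
theorem abs_log_add_le {d ε : ℝ} (hd : 0 < d) (hd2 : d ≤ 2) (hε : 0 ≤ ε) (hε1 : ε ≤ 1) :
    |Real.log (d + ε)| ≤ 2 * (√d)⁻¹ := by
  have hs : 0 < √d := Real.sqrt_pos.2 hd
  have hsq : √d * √d = d := Real.mul_self_sqrt hd.le
  rw [abs_le]
  constructor
  · have h1 : Real.log d ≤ Real.log (d + ε) := Real.log_le_log hd (by linarith)
    have h2 : Real.log (√d)⁻¹ ≤ (√d)⁻¹ - 1 := Real.log_le_sub_one_of_pos (by positivity)
    rw [Real.log_inv, Real.log_sqrt hd.le] at h2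
    linarith
  · have h1 : Real.log (√(d + ε)) ≤ √(d + ε) - 1 := Real.log_le_sub_one_of_pos (by positivity)
    rw [Real.log_sqrt (by positivity)] at h1
    have h3 : √(d + ε) ≤ 1.74 := by rw [Real.sqrt_le_left (by norm_num)]; norm_num; linarith
    have h4 : √d ≤ 1.42 := by rw [Real.sqrt_le_left (by norm_num)]; norm_num; linarith
    have h5 : 1.48 / 2 ≤ (√d)⁻¹ * 1.06 := by
      rw [inv_mul_eq_div, div_le_div_iff₀ (by norm_num) hs]; linarith
    have h6 : (0.7 : ℝ) ≤ (√d)⁻¹ := by rw [le_inv_comm₀ (by norm_num) hs]; norm_num; linarith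
    have h7 : Real.log (d + ε) ≤ Real.log 3 := Real.log_le_log (by linarith) (by linarith)
    have h8 : Real.log 3 < 1.4 := by
      rw [Real.log_lt_iff_lt_exp (by norm_num)]
      have := Real.quadratic_le_exp_of_nonneg (show (0 : ℝ) ≤ 1.4 by norm_num)
      norm_num at this ⊢; linarith
    linarith

theorem abs_log_le {d : ℝ} (hd : 0 ≤ d) (hd2 : d ≤ 2) : |Real.log d| ≤ 2 * (√d)⁻¹ := by
  rcases hd.eq_or_lt with h | h
  · simp [← h]
  · simpa using abs_log_add_le h hd2 le_rfl zero_le_one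

theorem SmoothS.exists_bound {f : S2 → ℝ} (hf : SmoothS f) : ∃ C, 0 ≤ C ∧ ∀ s, |f s| ≤ C := by
  obtain ⟨C, hC⟩ := isCompact_univ.exists_bound_of_continuousOn hf.continuous.continuousOn
  exact ⟨max C 0, le_max_right _ _, fun s => (hC s trivial).trans (le_max_left _ _)⟩

theorem SmoothS.exists_lipschitz {f : S2 → ℝ} (hf : SmoothS f) :
    ∃ C, 0 ≤ C ∧ ∀ s s' : S2, |f s' - f s| ≤ C * ‖(s' : E3) - s‖ := by
  have hl : LocallyLipschitzOn (Metric.sphere (0 : E3) 1) fun x => f (sphereProj x) := by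
    intro x hx
    have hx0 : x ≠ 0 := S2.coe_ne_zero ⟨x, hx⟩
    have h1 : ContDiffAt ℝ 1 (fun x => f (sphereProj x)) x :=
      (hf.contDiffAt (isOpen_compl_zero.mem_nhds hx0)).of_le (by exact_mod_cast le_top)
    obtain ⟨K, t, ht, hK⟩ := h1.exists_lipschitzOnWith
    exact ⟨K, t, mem_nhdsWithin_of_mem_nhds ht, hK⟩
  obtain ⟨K, hK⟩ := hl.exists_lipschitzOnWith_of_compact (isCompact_sphere _ _)
  refine ⟨K, K.2, fun s s' => ?_⟩
  have := hK.dist_le_mul _ s'.2 _ s.2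
  simpa [Real.dist_eq, dist_eq_norm] using this

/-- The convolution of a function on the sphere with the logarithmic kernel `log (1 - cos θ)`, a
Green function of the Laplacian up to normalization. -/
def logConv (f : S2 → ℝ) (s : S2) : ℝ := ∫ t, Real.log (gap s t) * (wt t * f (sphereProj t))

theorem abs_wt_mul_le {C : ℝ} {a : ℝ} (ha : |a| ≤ C) (t : E3) :
    |wt t * a| ≤ annulus.indicator (fun _ => C) t := by
  by_cases h : t ∈ annulus
  · rw [Set.indicator_of_mem h, abs_mul, abs_of_nonneg (wt_nonneg t)]
    calc wt t * |a| ≤ 1 * C := by gcongr; exact wt_le_one t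
      _ = C := one_mul C
  · simp [h, wt_eq_zero h]

theorem abs_logKernel_le {C : ℝ} {a : ℝ} (ha : |a| ≤ C) (x t : E3) :
    |Real.log (gap x t) * (wt t * a)| ≤ 2 * C * singKernel x t := by
  by_cases h : t ∈ annulus
  · have h1 := abs_wt_mul_le ha t
    rw [Set.indicator_of_mem h] at h1
    rw [singKernel, Set.indicator_of_mem h, abs_mul]
    have h2 := abs_log_le (gap_nonneg x t) (gap_le_two x t)
    calc _ ≤ (2 * (√(gap x t))⁻¹) * C := by gcongr
      _ = _ := by ring
  · simp [h, wt_eq_zero h, singKernel]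

theorem SmoothS.measurable_wt_mul {f : S2 → ℝ} (hf : SmoothS f) :
    Measurable fun t => wt t * f (sphereProj t) :=
  (continuous_wt_mul hf.continuousOn).measurable

theorem ae_gap_ne_zero (s : S2) : ∀ᵐ t : E3, gap s t ≠ 0 := by
  have h3 := Measure.addHaar_submodule (volume : Measure E3) (Submodule.span ℝ {(s : E3)}) (by
    intro h
    have h1 := finrank_span_singleton (K := ℝ) (S2.coe_ne_zero s)
    rw [h, finrank_top] at h1
    simp at h1)
  rw [ae_iff]
  refine measure_mono_null (fun t ht => ?_) h3
  have h0 : gap s t = 0 := by simpa using ht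
  by_cases ht0 : t = 0
  · rw [ht0]; exact Submodule.zero_mem _
  rw [← gap_sphereProj_right _ ht0] at h0
  have h4 := dist_sq_eq_gap s (sphereProj t)
  rw [h0, mul_zero, sq_eq_zero_iff, norm_eq_zero, sub_eq_zero, coe_sphereProj ht0] at h4
  refine Submodule.mem_span_singleton.2 ⟨‖t‖, ?_⟩
  rw [← h4, smul_smul, mul_inv_cancel₀ (norm_ne_zero_iff.2 ht0), one_smul]

/-- The convolution with the logarithmic kernel is symmetric. -/
theorem avg_logConv_symm {f g : S2 → ℝ} (hf : SmoothS f) (hg : SmoothS g) :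
    avg (fun s => g s * logConv f s) = avg (fun s => f s * logConv g s) := by
  obtain ⟨C, hC, hfC⟩ := hf.exists_bound
  obtain ⟨D, hD, hgD⟩ := hg.exists_bound
  set H : E3 → E3 → ℝ := fun x t =>
    (wt x * g (sphereProj x)) * (Real.log (gap x t) * (wt t * f (sphereProj t))) with hH
  have hHm : Measurable (Function.uncurry H) :=
    (hg.measurable_wt_mul.comp measurable_fst).mul
      (measurable_gap.log.mul (hf.measurable_wt_mul.comp measurable_snd))
  have hsing : Integrable (fun z : E3 × E3 =>
      annulus.indicator (fun x => singKernel x z.2) z.1) (volume.prod volume) := by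
    have hm : Measurable fun z : E3 × E3 => annulus.indicator (fun x => singKernel x z.2) z.1 := by
      have : (fun z : E3 × E3 => annulus.indicator (fun x => singKernel x z.2) z.1) =
          (Prod.fst ⁻¹' annulus).indicator fun z : E3 × E3 => singKernel z.1 z.2 := by
        rfl
      rw [this]
      exact measurable_singKernel.indicator (measurable_fst measurableSet_annulus)
    have hproj : ∀ x ∈ annulus, ∀ t, singKernel x t = singKernel (sphereProj x) t := by
      intro x hx t
      by_cases h : t ∈ annulus
      · simp only [singKernel, Set.indicator_of_mem h]
        rw [gap_comm, ← gap_sphereProj_right t (ne_zero_of_mem_annulus hx), gap_comm]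
      · simp [singKernel, h]
    refine (integrable_prod_iff hm.aestronglyMeasurable).2 ⟨Filter.Eventually.of_forall fun x => ?_, ?_⟩
    · by_cases hx : x ∈ annulus
      · simp only [Set.indicator_of_mem hx, hproj x hx]
        exact integrable_singKernel _
      · simp [hx]
    · have : (fun x => ∫ t, ‖annulus.indicator (fun x => singKernel x t) x‖) =
          annulus.indicator fun _ => ∫ t, singKernel (EuclideanSpace.single (0 : Fin 3) 1) t := by
        ext x
        by_cases hx : x ∈ annulus
        · simp only [Set.indicator_of_mem hx, hproj x hx]
          rw [← integral_singKernel (sphereProj x)]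
          simp only [Real.norm_of_nonneg (singKernel_nonneg _ _)]
        · simp [hx]
      simp only [this]
      rw [integrable_indicator_iff measurableSet_annulus]
      exact integrableOn_const (hs := isCompact_annulus.measure_lt_top.ne)
  have hHi : Integrable (Function.uncurry H) (volume.prod volume) := by
    refine (hsing.const_mul (D * (2 * C))).mono' hHm.aestronglyMeasurable
      (Filter.Eventually.of_forall fun z => ?_)
    have h1 := abs_logKernel_le (hfC (sphereProj z.2)) z.1 z.2
    have h2 := abs_wt_mul_le (hgD (sphereProj z.1)) z.1
    simp only [Function.uncurry, hH, Real.norm_eq_abs, abs_mul (wt z.1 * g (sphereProj z.1))]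
    by_cases hx : z.1 ∈ annulus
    · rw [Set.indicator_of_mem hx] at h2 ⊢
      calc _ ≤ D * (2 * C * singKernel z.1 z.2) := by gcongr
        _ = _ := by ring
    · rw [Set.indicator_of_notMem hx] at h2 ⊢
      have := le_antisymm h2 (abs_nonneg _)
      rw [this]; simp
  have hswap := integral_integral_swap hHi
  have hgp : ∀ {x : E3}, x ≠ 0 → ∀ t, gap (sphereProj x) t = gap x t := fun hx t => by
    rw [gap_comm, gap_sphereProj_right _ hx, gap_comm]
  have e1 : avg (fun s => g s * logConv f s) = ∫ x, ∫ t, H x t := by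
    refine integral_congr_ae (Filter.Eventually.of_forall fun x => ?_)
    simp only [hH, integral_const_mul]
    by_cases hx : x = 0
    · simp [hx, wt_eq_zero zero_notMem_annulus]
    · simp only [logConv, hgp hx]; ring
  have e2 : avg (fun s => f s * logConv g s) = ∫ t, ∫ x, H x t := by
    refine integral_congr_ae (Filter.Eventually.of_forall fun t => ?_)
    have : ∀ x, H x t = (wt t * f (sphereProj t)) *
        (Real.log (gap t x) * (wt x * g (sphereProj x))) := fun x => by
      simp only [hH]; rw [gap_comm]; ring
    simp only [this, integral_const_mul]
    by_cases ht : t = 0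
    · simp [ht, wt_eq_zero zero_notMem_annulus]
    · simp only [logConv, hgp ht]; ring
  rw [e1, e2, hswap]

end

section

open MeasureTheory Filter Topology

/-! ### The Poisson equation on the sphere -/

variable {P : Type*} [NormedAddCommGroup P] [NormedSpace ℝ P]

theorem SmoothFam.of_locally {U : Set P} {f : P → S2 → ℝ}
    (h : ∀ y ∈ U, ∀ x : E3, x ≠ 0 → ∃ V ∈ 𝓝 (y, x),
      ContDiffOn ℝ ∞ (fun z : P × E3 => f z.1 (sphereProj z.2)) V) : SmoothFam U f := by
  rintro ⟨y, x⟩ ⟨hy, hx⟩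
  obtain ⟨V, hV, hf⟩ := h y hy x hx
  exact (hf.contDiffAt hV).contDiffWithinAt

/-- The logarithmic potential of a smooth family is a smooth family. Near a given direction the pole
of the kernel is moved to a fixed point by a reflection which depends smoothly on the direction. -/
theorem SmoothFam.logConv {U : Set P} (hU : IsOpen U) {f : P → S2 → ℝ} (hf : SmoothFam U f) :
    SmoothFam U fun y => logConv (f y) := by
  refine SmoothFam.of_locally fun y₀ hy₀ x₀ hx₀ => ?_
  -- the antipode of the direction, so that the reflection below is regular near it
  set e : S2 := -sphereProj x₀ with he
  set V : Set (P × E3) := {z | z.1 ∈ U ∧ z.2 ≠ 0 ∧ (e : E3) ≠ ‖z.2‖⁻¹ • z.2} with hV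
  have hVo : IsOpen V := by
    have h1 : IsOpen (U ×ˢ ({0}ᶜ : Set E3)) := hU.prod isOpen_compl_zero
    have h2 : ContinuousOn (fun z : P × E3 => ‖z.2‖⁻¹ • z.2) (U ×ˢ ({0}ᶜ : Set E3)) := by
      refine ContinuousOn.smul (f := fun z : P × E3 => ‖z.2‖⁻¹) (g := fun z : P × E3 => z.2)
        (ContinuousOn.inv₀ (f := fun z : P × E3 => ‖z.2‖) (by fun_prop) ?_) (by fun_prop)
      rintro z ⟨-, hz⟩; exact norm_ne_zero_iff.2 hz
    have h3 := h2.isOpen_inter_preimage h1 (isOpen_compl_singleton (x := (e : E3)))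
    convert! h3 using 1
    ext z
    simp only [hV, Set.mem_ofPred_eq, Set.mem_inter_iff, Set.mem_prod, Set.mem_compl_iff,
      Set.mem_singleton_iff, Set.mem_preimage, and_assoc, ne_eq, eq_comm]
  have hmem : (y₀, x₀) ∈ V := by
    refine ⟨hy₀, hx₀, fun h => ?_⟩
    rw [← coe_sphereProj hx₀, he] at h
    have h' : -(sphereProj x₀ : E3) = sphereProj x₀ := h
    have h2 : (2 : ℝ) • (sphereProj x₀ : E3) = 0 := by
      rw [two_smul]; nth_rewrite 1 [← h']; simp
    exact S2.coe_ne_zero _ ((smul_eq_zero.1 h2).resolve_left two_ne_zero)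
  refine ⟨V, hVo.mem_nhds hmem, ?_⟩
  -- `R z` is the reflection which exchanges `e` with the direction of `z.2`
  set u : P × E3 → E3 := fun z => (e : E3) - ‖z.2‖⁻¹ • z.2 with hu
  set R : P × E3 → (E3 ≃ₗᵢ[ℝ] E3) := fun z => (Submodule.span ℝ {u z})ᗮ.reflection with hR
  have hRa : ∀ z t, R z t = t - (2 * (inner ℝ (u z) t / ‖u z‖ ^ 2)) • u z := by
    intro z t
    simp only [hR]
    rw [Submodule.reflection_orthogonal_apply, Submodule.reflection_singleton_apply]
    simp only [RCLike.ofReal_real_eq_id, id]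
    rw [two_smul, mul_smul, two_smul]
    abel
  have hus : ContDiffOn ℝ ∞ u V := by
    rintro ⟨y, x⟩ ⟨-, hx, -⟩
    refine ContDiffAt.contDiffWithinAt (contDiffAt_const.sub ?_)
    have hn : ContDiffAt ℝ ∞ (fun z : P × E3 => ‖z.2‖) (y, x) :=
      (contDiffAt_norm ℝ hx).comp (y, x) contDiffAt_snd
    exact (hn.inv (norm_ne_zero_iff.2 hx)).smul contDiffAt_snd
  have hh : ContDiffOn ℝ ∞ (fun q : (P × E3) × E3 => f q.1.1 (sphereProj (R q.1 q.2)))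
      (V ×ˢ {0}ᶜ) := by
    refine ContDiffOn.comp (g := fun z : P × E3 => f z.1 (sphereProj z.2)) hf
      (f := fun q : (P × E3) × E3 => (q.1.1, R q.1 q.2)) ?_ ?_
    · refine ContDiffOn.prodMk (by fun_prop) ?_
      simp only [hRa]
      have hus' : ContDiffOn ℝ ∞ (fun q : (P × E3) × E3 => u q.1) (V ×ˢ {0}ᶜ) :=
        hus.comp contDiffOn_fst fun q hq => hq.1
      refine contDiffOn_snd.sub (ContDiffOn.smul (contDiffOn_const.mul (ContDiffOn.div
        (hus'.inner ℝ contDiffOn_snd) (hus'.norm_sq ℝ) ?_)) hus')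
      rintro q ⟨⟨-, -, hq⟩, -⟩
      exact pow_ne_zero 2 (norm_ne_zero_iff.2 (sub_ne_zero.2 hq))
    · rintro q ⟨⟨hq, -, -⟩, hq2⟩
      exact ⟨hq, by simpa using hq2⟩
  have hk : LocallyIntegrable (annulus.indicator fun t => Real.log (gap e t)) := by
    refine Integrable.locallyIntegrable ?_
    refine ((integrable_singKernel e).const_mul 2).mono'
      ((measurable_gap_right _).log.indicator measurableSet_annulus).aestronglyMeasurable
      (Eventually.of_forall fun t => ?_)
    by_cases h : t ∈ annulus
    · simpa [singKernel, h] using abs_log_le (gap_nonneg e t) (gap_le_two e t)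
    · simp [singKernel, h]
  refine (contDiffOn_integral_wt hVo hh hk).congr fun z hz => ?_
  have hRe : R z e = sphereProj z.2 := by
    rw [coe_sphereProj hz.2.1]
    exact Submodule.reflection_sub (by
      rw [S2.norm_coe, ← coe_sphereProj hz.2.1, S2.norm_coe])
  rw [Electro.logConv,
    ← (R z).measurePreserving.integral_comp (R z).toMeasurableEquiv.measurableEmbedding]
  refine integral_congr_ae (Eventually.of_forall fun t => ?_)
  simp only [← hRe, gap_map]
  have : wt (R z t) = wt t := by simp [wt]
  rw [this]
  by_cases h : t ∈ annulus
  · simp [h]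
  · simp [h, wt_eq_zero h]

theorem SmoothS.logConv {f : S2 → ℝ} (hf : SmoothS f) : SmoothS (logConv f) :=
  (SmoothFam.logConv (P := ℝ) isOpen_univ (hf.fam Set.univ)).slice (Set.mem_univ 0)

theorem inner_eq_sum (s s' : E3) : inner ℝ s s' = s 0 * s' 0 + s 1 * s' 1 + s 2 * s' 2 := by
  simp [PiLp.inner_apply, Fin.sum_univ_three, mul_comm]

theorem SmoothS.inner_left (s : S2) : SmoothS fun s' => inner ℝ (s : E3) (s' : E3) := by
  simp only [inner_eq_sum]
  exact (((SmoothS.const _).mul (SmoothS.coord 0)).add ((SmoothS.const _).mul (SmoothS.coord 1))).add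
    ((SmoothS.const _).mul (SmoothS.coord 2))

theorem SmoothS.comp {f : S2 → ℝ} (hf : SmoothS f) {φ : ℝ → ℝ}
    (hφ : ∀ s, ContDiffAt ℝ ∞ φ (f s)) : SmoothS fun s => φ (f s) := fun x hx =>
  ((hφ (sphereProj x)).comp x (hf.contDiffAt (isOpen_compl_zero.mem_nhds hx))).contDiffWithinAt

theorem rotD_inner (s s' : S2) (i : Fin 3) :
    rotD i (fun s' => inner ℝ (s : E3) (s' : E3)) s' = inner ℝ (s : E3) (rot i s') := by
  have h : ∀ j, SmoothS fun s' => s.1 j * s'.1 j := fun j =>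
    (SmoothS.const _).mul (SmoothS.coord j)
  simp only [inner_eq_sum]
  rw [rotD_add ((h 0).add (h 1)) (h 2), rotD_add (h 0) (h 1), rotD_const_mul (SmoothS.coord _),
    rotD_const_mul (SmoothS.coord _), rotD_const_mul (SmoothS.coord _), rotD_coord, rotD_coord,
    rotD_coord]

theorem one_add_sub_pos {ε : ℝ} (hε : 0 < ε) (s s' : S2) :
    0 < 1 + ε - inner ℝ (s : E3) (s' : E3) := by
  have := gap_nonneg s s'; rw [gap_coe] at this; linarith

/-- The regularized logarithmic kernel. -/
def logReg (ε : ℝ) (s s' : S2) : ℝ := Real.log (1 + ε - inner ℝ (s : E3) (s' : E3))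

theorem SmoothS.affine_inner (ε : ℝ) (s : S2) :
    SmoothS fun s' => 1 + ε - inner ℝ (s : E3) (s' : E3) :=
  (SmoothS.const _).sub (SmoothS.inner_left s)

theorem SmoothS.logReg {ε : ℝ} (hε : 0 < ε) (s : S2) : SmoothS (logReg ε s) :=
  (SmoothS.affine_inner ε s).comp fun s' =>
    Real.contDiffAt_log.2 (one_add_sub_pos hε s s').ne'

theorem SmoothS.inv_affine {ε : ℝ} (hε : 0 < ε) (s : S2) :
    SmoothS fun s' => (1 + ε - inner ℝ (s : E3) (s' : E3))⁻¹ :=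
  (SmoothS.affine_inner ε s).comp fun s' =>
    contDiffAt_inv (𝕜 := ℝ) (𝕜' := ℝ) (one_add_sub_pos hε s s').ne'

/-- The Laplacian of the regularized kernel is, up to the constant `-1`, an approximate identity. -/
theorem rotLap_logReg {ε : ℝ} (hε : 0 < ε) (s s' : S2) :
    rotLap (logReg ε s) s' =
      ε * (2 + ε) / (1 + ε - inner ℝ (s : E3) (s' : E3)) ^ 2 - 1 := by
  have hA := SmoothS.affine_inner ε s
  have hI := SmoothS.inv_affine hε s
  have hrot : ∀ i, SmoothS fun s' => inner ℝ (s : E3) (rot i s') := by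
    intro i
    have := (SmoothS.inner_left s).rotD i
    simpa only [funext fun s' => rotD_inner s s' i] using this
  have dA : ∀ i s', rotD i (fun s' => 1 + ε - inner ℝ (s : E3) (s' : E3)) s' =
      -inner ℝ (s : E3) (rot i s') := by
    intro i s'
    rw [rotD_sub (SmoothS.const _) (SmoothS.inner_left s), rotD_const, rotD_inner, zero_sub]
  have d1 : ∀ i, rotD i (logReg ε s) = fun s' : S2 =>
      (1 + ε - inner ℝ (s : E3) (s' : E3))⁻¹ * -inner ℝ (s : E3) (rot i s') := by
    intro i; funext s'
    have := rotD_comp hA s' (Real.hasDerivAt_log (one_add_sub_pos hε s s').ne') i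
    rw [dA] at this
    exact this
  have dI : ∀ i s', rotD i (fun s' => (1 + ε - inner ℝ (s : E3) (s' : E3))⁻¹) s' =
      -((1 + ε - inner ℝ (s : E3) (s' : E3)) ^ 2)⁻¹ * -inner ℝ (s : E3) (rot i s') := by
    intro i s'
    have := rotD_comp hA s' (hasDerivAt_inv (one_add_sub_pos hε s s').ne') i
    rw [dA] at this
    exact this
  have dr : ∀ i s', rotD i (fun s' => inner ℝ (s : E3) (rot i s')) s' =
      inner ℝ (s : E3) (rot i (rot i s')) := by
    intro i s'
    have h : ∀ j k, SmoothS fun s' => s.1 j * s'.1 k := fun j k =>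
      (SmoothS.const _).mul (SmoothS.coord k)
    have e : (fun s' : S2 => inner ℝ (s : E3) (rot i s')) = fun s' =>
        s.1 (i + 2) * s'.1 (i + 1) - s.1 (i + 1) * s'.1 (i + 2) := by
      funext s'
      rw [rot_apply, inner_sub_right, inner_smul_right, inner_smul_right]
      simp [EuclideanSpace.inner_single_right, mul_comm]
    rw [e, rotD_sub (h _ _) (h _ _), rotD_const_mul (SmoothS.coord _),
      rotD_const_mul (SmoothS.coord _), rotD_coord, rotD_coord, rot_apply i (rot i _),
      inner_sub_right, inner_smul_right, inner_smul_right]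
    simp [EuclideanSpace.inner_single_right, mul_comm]
  have hp := one_add_sub_pos hε s s'
  have h1 := S2.sum_sq s
  have h2 := S2.sum_sq s'
  simp only [rotLap, Fin.sum_univ_three, d1]
  rw [rotD_mul hI (hrot 0).neg, rotD_mul hI (hrot 1).neg, rotD_mul hI (hrot 2).neg,
    rotD_neg, rotD_neg, rotD_neg, dI, dI, dI, dr, dr, dr]
  set A := 1 + ε - inner ℝ (s : E3) (s' : E3) with hA'
  have eA : inner ℝ (s : E3) (s' : E3) = 1 + ε - A := by rw [hA']; ring
  have lagr : inner ℝ (s : E3) (rot 0 s') ^ 2 + inner ℝ (s : E3) (rot 1 s') ^ 2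
      + inner ℝ (s : E3) (rot 2 s') ^ 2 = 1 - (1 + ε - A) ^ 2 := by
    rw [← eA]
    simp only [inner_eq_sum, rot_zero, rot_one, rot_two]
    simp
    linear_combination (s'.1 0 ^ 2 + s'.1 1 ^ 2 + s'.1 2 ^ 2) * h1 + h2
  have tr : inner ℝ (s : E3) (rot 0 (rot 0 s')) + inner ℝ (s : E3) (rot 1 (rot 1 s'))
      + inner ℝ (s : E3) (rot 2 (rot 2 s')) = -2 * (1 + ε - A) := by
    rw [← eA]
    simp only [inner_eq_sum, rot_zero, rot_one, rot_two]
    simp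
    ring
  field_simp
  linear_combination (-1) * lagr - A * tr

theorem logReg_eq {ε : ℝ} (s : S2) {t : E3} (ht : t ≠ 0) :
    logReg ε s (sphereProj t) = Real.log (gap s t + ε) := by
  rw [logReg, ← gap_sphereProj_right _ ht, gap_coe]; congr 1; ring

/-- The logarithmic kernel is a Green function: `logConv` inverts the Laplacian up to a constant
factor and constants. -/
theorem logConv_rotLap {f : S2 → ℝ} (hf : SmoothS f) (s : S2) :
    logConv (rotLap f) s = (avg fun _ => 1) * f s - avg f := by
  set ε : ℕ → ℝ := fun n => 1 / ((n : ℝ) + 1) with hε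
  have hε0 : ∀ n, 0 < ε n := fun n => by positivity
  have hε1 : ∀ n, ε n ≤ 1 := fun n => by
    simp only [hε]; rw [div_le_one (by positivity)]; linarith [(Nat.cast_nonneg n : (0 : ℝ) ≤ n)]
  have hεl : Tendsto ε atTop (𝓝 0) := tendsto_one_div_add_atTop_nhds_zero_nat
  obtain ⟨C, hC, hfC⟩ := hf.rotLap.exists_bound
  obtain ⟨D, hD, hfD⟩ := hf.exists_lipschitz
  set δ : ℕ → S2 → ℝ := fun n s' =>
    ε n * (2 + ε n) * ((1 + ε n - inner ℝ (s : E3) (s' : E3))⁻¹ ^ 2) with hδ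
  have hδs : ∀ n, SmoothS (δ n) := fun n => by
    simp only [hδ, pow_two]
    exact (SmoothS.const _).mul ((SmoothS.inv_affine (hε0 n) s).mul (SmoothS.inv_affine (hε0 n) s))
  have hlap : ∀ n, rotLap (logReg (ε n) s) = fun s' => δ n s' - 1 := fun n => by
    funext s'; rw [rotLap_logReg (hε0 n)]; simp only [hδ]; rw [inv_pow, div_eq_mul_inv]
  have hδ1 : ∀ n, avg (δ n) = avg fun _ => 1 := by
    intro n
    have h := avg_rotLap (SmoothS.logReg (hε0 n) s)
    rw [hlap, avg_sub (hδs n) (SmoothS.const 1)] at h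
    linarith
  -- the regularized identity, by symmetry of the Laplacian
  have hreg : ∀ n, avg (fun s' => logReg (ε n) s s' * rotLap f s') =
      avg (fun s' => δ n s' * (f s' - f s)) + (avg fun _ => 1) * f s - avg f := by
    intro n
    rw [← avg_rotLap_symm (SmoothS.logReg (hε0 n) s) hf, hlap]
    have e : (fun s' => (δ n s' - 1) * f s') =
        fun s' => (δ n s' * (f s' - f s) + f s * δ n s') - f s' := by funext s'; ring
    rw [e, avg_sub (((hδs n).mul (hf.sub (SmoothS.const _))).add ((SmoothS.const _).mul (hδs n))) hf,
      avg_add ((hδs n).mul (hf.sub (SmoothS.const _))) ((SmoothS.const _).mul (hδs n)),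
      avg_const_mul, hδ1]
    ring
  -- the regularized kernels converge to the logarithmic kernel
  have lim1 : Tendsto (fun n => avg (fun s' => logReg (ε n) s s' * rotLap f s')) atTop
      (𝓝 (logConv (rotLap f) s)) := by
    refine tendsto_integral_filter_of_dominated_convergence (fun t => 2 * C * singKernel s t)
      (Eventually.of_forall fun n =>
        ((SmoothS.logReg (hε0 n) s).mul hf.rotLap).integrable.aestronglyMeasurable)
      (Eventually.of_forall fun n => ?_) ((integrable_singKernel s).const_mul _) ?_
    · filter_upwards [ae_gap_ne_zero s] with t ht
      by_cases h : t ∈ annulus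
      · rw [logReg_eq s (ne_zero_of_mem_annulus h), singKernel, Set.indicator_of_mem h,
          Real.norm_eq_abs, abs_mul, abs_mul, abs_of_nonneg (wt_nonneg t)]
        have h2 := abs_log_add_le (lt_of_le_of_ne (gap_nonneg s t) ht.symm) (gap_le_two s t)
          (hε0 n).le (hε1 n)
        calc _ ≤ 1 * ((2 * (√(gap s t))⁻¹) * C) := by
              gcongr
              · exact wt_le_one t
              · exact hfC _
          _ = _ := by ring
      · simp [wt_eq_zero h, singKernel, h]
    · filter_upwards [ae_gap_ne_zero s] with t ht
      by_cases h : t = 0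
      · simp [h, wt_eq_zero zero_notMem_annulus]
      · simp only [logReg_eq s h]
        have h3 : Tendsto (fun n => Real.log (gap s t + ε n)) atTop (𝓝 (Real.log (gap s t))) := by
          have h4 : Tendsto (fun n => gap s t + ε n) atTop (𝓝 (gap s t)) := by
            simpa using hεl.const_add (gap s t)
          exact h4.log ht
        have h5 := (h3.mul_const (rotLap f (sphereProj t))).const_mul (wt t)
        convert! h5 using 2
        ring
  -- `δ n` is an approximate identity at `s`, and `f` is Lipschitz there
  have lim2 : Tendsto (fun n => avg (fun s' => δ n s' * (f s' - f s))) atTop (𝓝 0) := by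
    have h0 : (0 : ℝ) = ∫ _ : E3, (0 : ℝ) := by simp
    rw [h0]
    have hgapinv : ∀ n {t : E3}, t ≠ 0 → δ n (sphereProj t) =
        ε n * (2 + ε n) / (gap s t + ε n) ^ 2 := by
      intro n t ht
      simp only [hδ]
      rw [← gap_sphereProj_right _ ht, gap_coe, inv_pow, ← div_eq_mul_inv]
      congr 2; ring
    have hfgap : ∀ {t : E3}, t ≠ 0 → |f (sphereProj t) - f s| ≤ D * (√2 * √(gap s t)) := by
      intro t ht
      refine (hfD s (sphereProj t)).trans ?_
      gcongr
      rw [← Real.sqrt_mul (by norm_num), ← gap_sphereProj_right _ ht, ← dist_sq_eq_gap,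
        Real.sqrt_sq (norm_nonneg _)]
    refine tendsto_integral_filter_of_dominated_convergence
      (fun t => 3 * D * √2 * singKernel s t)
      (Eventually.of_forall fun n =>
        ((hδs n).mul (hf.sub (SmoothS.const _))).integrable.aestronglyMeasurable)
      (Eventually.of_forall fun n => ?_) ((integrable_singKernel s).const_mul _) ?_
    · filter_upwards [ae_gap_ne_zero s] with t hgt
      by_cases h : t ∈ annulus
      · have ht := ne_zero_of_mem_annulus h
        have hg : 0 < gap s t := lt_of_le_of_ne (gap_nonneg s t) hgt.symm
        have hsg : 0 < √(gap s t) := Real.sqrt_pos.2 hg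
        have hss : √(gap s t) * √(gap s t) = gap s t := Real.mul_self_sqrt hg.le
        have hδb : |δ n (sphereProj t)| ≤ 3 / gap s t := by
          rw [hgapinv n ht, abs_of_nonneg (by have := hε0 n; positivity),
            div_le_div_iff₀ (by have := hε0 n; positivity) hg]
          have := hε0 n
          have := hε1 n
          nlinarith [mul_pos (hε0 n) hg, sq_nonneg (gap s t), sq_nonneg (ε n)]
        rw [singKernel, Set.indicator_of_mem h, Real.norm_eq_abs, abs_mul, abs_mul,
          abs_of_nonneg (wt_nonneg t)]
        calc _ ≤ 1 * (3 / gap s t * (D * (√2 * √(gap s t)))) := by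
              gcongr
              · exact wt_le_one t
              · exact hfgap ht
          _ = _ := by
              nth_rewrite 1 [← hss]; field_simp
      · simp [wt_eq_zero h, singKernel, h]
    · filter_upwards [ae_gap_ne_zero s] with t hgt
      by_cases h : t = 0
      · simp [h, wt_eq_zero zero_notMem_annulus]
      · simp only [hgapinv _ h]
        have h4 : Tendsto (fun n => gap s t + ε n) atTop (𝓝 (gap s t)) := by
          simpa using hεl.const_add (gap s t)
        have h5 : Tendsto (fun n => ε n * (2 + ε n) / (gap s t + ε n) ^ 2) atTop (𝓝 0) := by
          have h6 := (hεl.mul (hεl.const_add 2)).div (h4.pow 2) (pow_ne_zero 2 hgt)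
          rw [zero_mul, zero_div] at h6
          exact h6
        simpa using (h5.mul_const (f (sphereProj t) - f s)).const_mul (wt t)
  have lim3 := (lim2.add_const ((avg fun _ => 1) * f s)).sub_const (avg f)
  rw [zero_add] at lim3
  exact tendsto_nhds_unique lim1 (lim3.congr fun n => (hreg n).symm)

/-- The logarithmic potential solves the Poisson equation, up to a constant factor. -/
theorem rotLap_logConv {f : S2 → ℝ} (hf : SmoothS f) (h0 : avg f = 0) (s : S2) :
    rotLap (logConv f) s = (avg fun _ => 1) * f s := by
  set c := avg fun _ => (1 : ℝ)
  have hG : SmoothS fun s => rotLap (logConv f) s - c * f s :=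
    hf.logConv.rotLap.sub ((SmoothS.const c).mul hf)
  set G := fun s => rotLap (logConv f) s - c * f s with hGdef
  -- the equation holds weakly, by symmetry of both operators
  have key : avg (fun s => G s * G s) = 0 := by
    have e : (fun s => G s * G s) = fun s => rotLap (logConv f) s * G s - c * (f s * G s) := by
      funext s; simp only [hGdef]; ring
    have e1 : (fun s => f s * logConv (rotLap G) s) =
        fun s => c * (f s * G s) - avg G * f s := by
      funext s; rw [logConv_rotLap hG]; ring
    have e2 : (fun s => logConv f s * rotLap G s) = fun s => rotLap G s * logConv f s := by
      funext s; ring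
    rw [e, avg_sub (hf.logConv.rotLap.mul hG) ((SmoothS.const c).mul (hf.mul hG)),
      avg_rotLap_symm hf.logConv hG, e2, avg_logConv_symm hf hG.rotLap, e1,
      avg_sub ((SmoothS.const c).mul (hf.mul hG)) ((SmoothS.const _).mul hf), avg_const_mul,
      avg_const_mul, h0]
    ring
  have := congrFun (avg_sq_eq_zero hG key) s
  simp only [hGdef, Pi.zero_apply] at this
  linarith

/-- The solution operator of the Poisson equation on the sphere: the solution with mean zero. -/
def invLap (f : S2 → ℝ) (s : S2) : ℝ :=
  (avg fun _ => 1)⁻¹ * (logConv f s - (avg fun _ => 1)⁻¹ * avg (logConv f))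

theorem SmoothFam.invLap {U : Set P} (hU : IsOpen U) {f : P → S2 → ℝ} (hf : SmoothFam U f) :
    SmoothFam U fun y => invLap (f y) :=
  (SmoothFam.of_param contDiffOn_const).mul ((hf.logConv hU).sub
    (SmoothFam.of_param (contDiffOn_const.mul ((hf.logConv hU).contDiffOn_avg hU))))

theorem SmoothS.invLap {f : S2 → ℝ} (hf : SmoothS f) : SmoothS (invLap f) :=
  (SmoothS.const _).mul (hf.logConv.sub (SmoothS.const _))

theorem avg_invLap {f : S2 → ℝ} (hf : SmoothS f) : avg (invLap f) = 0 := by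
  have := avg_one_pos.ne'
  rw [show invLap f = fun s => (avg fun _ => 1)⁻¹ *
    (logConv f s - (avg fun _ => 1)⁻¹ * avg (logConv f)) from rfl, avg_const_mul,
    avg_sub hf.logConv (SmoothS.const _),
    avg_const ((avg fun _ => 1)⁻¹ * avg (logConv f))]
  set c := avg fun _ => (1 : ℝ)
  field_simp
  simp

theorem rotLap_invLap {f : S2 → ℝ} (hf : SmoothS f) (h0 : avg f = 0) (s : S2) :
    rotLap (invLap f) s = f s := by
  have e : ∀ i, rotD i (invLap f) = fun s => (avg fun _ => 1)⁻¹ * rotD i (logConv f) s := by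
    intro i; funext s
    rw [show invLap f = fun s => (avg fun _ => 1)⁻¹ *
      (logConv f s - (avg fun _ => 1)⁻¹ * avg (logConv f)) from rfl,
      rotD_const_mul (hf.logConv.sub (SmoothS.const _)), rotD_sub hf.logConv (SmoothS.const _),
      rotD_const, sub_zero]
  have h := rotLap_logConv hf h0 s
  simp only [rotLap, e, rotD_const_mul (hf.logConv.rotD _), ← Finset.mul_sum] at h ⊢
  rw [h, inv_mul_cancel_left₀ avg_one_pos.ne']

end

section

/-! ### Coordinate vectors and components in a chart -/

section Charts

open Topology

variable {ι E H N : Type*} [NormedAddCommGroup E] [NormedSpace ℝ E]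
  [TopologicalSpace H] {I : ModelWithCorners ℝ E H} [I.Boundaryless]
  [TopologicalSpace N] [ChartedSpace H N]

theorem mdifferentiableAt_extChartAt_symm [IsManifold I ∞ N] {p : N} {y : E}
    (hy : y ∈ (extChartAt I p).target) :
    MDifferentiableAt 𝓘(ℝ, E) I (extChartAt I p).symm y := by
  have : IsManifold I 1 N := IsManifold.of_le (n := ∞) (by simp)
  have h := mdifferentiableWithinAt_extChartAt_symm hy
  rwa [I.range_eq_univ, mdifferentiableWithinAt_univ] at h

theorem coordVec_extChartAt_self [IsManifold I ∞ N] (b : Module.Basis ι ℝ E) (p : N) (i : ι) :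
    (coordVec I b p i (extChartAt I p p) : E) = b i := by
  have : IsManifold I 1 N := IsManifold.of_le (n := ∞) (by simp)
  have h := mfderivWithin_range_extChartAt_symm (I := I) (x := p)
  rw [I.range_eq_univ, mfderivWithin_univ] at h
  exact congrArg (fun L : E →L[ℝ] E => L (b i)) h

theorem contMDiffAt_extChartAt_symm [IsManifold I ∞ N] {p : N} {y : E}
    (hy : y ∈ (extChartAt I p).target) :
    ContMDiffAt 𝓘(ℝ, E) I ∞ (extChartAt I p).symm y :=
  (contMDiffOn_extChartAt_symm p).contMDiffAt ((isOpen_extChartAt_target p).mem_nhds hy)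

theorem ContMDiff.contDiffOn_chart [IsManifold I ∞ N] {F : Type*} [NormedAddCommGroup F]
    [NormedSpace ℝ F] {f : N → F} (hf : ContMDiff I 𝓘(ℝ, F) ∞ f) (p : N) :
    ContDiffOn ℝ ∞ (fun y => f ((extChartAt I p).symm y)) (extChartAt I p).target := fun _ hy =>
  (ContMDiffAt.contDiffAt (hf.contMDiffAt.comp _ (contMDiffAt_extChartAt_symm hy))).contDiffWithinAt

theorem contMDiff_of_contDiffOn_chart [IsManifold I ∞ N] {F : Type*} [NormedAddCommGroup F]
    [NormedSpace ℝ F] {f : N → F}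
    (hf : ∀ p, ContDiffOn ℝ ∞ (fun y => f ((extChartAt I p).symm y)) (extChartAt I p).target) :
    ContMDiff I 𝓘(ℝ, F) ∞ f := by
  intro p
  have h1 : ContMDiffAt 𝓘(ℝ, E) 𝓘(ℝ, F) ∞ (fun y => f ((extChartAt I p).symm y))
      (extChartAt I p p) :=
    ((hf p).contDiffAt ((isOpen_extChartAt_target p).mem_nhds (mem_extChartAt_target p))).contMDiffAt
  refine (h1.comp p (contMDiffAt_extChartAt (I := I) (x := p))).congr_of_eventuallyEq ?_
  filter_upwards [extChartAt_source_mem_nhds (I := I) p] with q hq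
  exact congrArg f ((extChartAt I p).left_inv hq).symm

/-- The chain rule for the coordinate vectors. -/
theorem mfderiv_coordVec [IsManifold I ∞ N] {F : Type*} [NormedAddCommGroup F] [NormedSpace ℝ F]
    {f : N → F} (b : Module.Basis ι ℝ E) {p : N} (i : ι) {y : E}
    (hy : y ∈ (extChartAt I p).target)
    (hf : MDifferentiableAt I 𝓘(ℝ, F) f ((extChartAt I p).symm y)) :
    mfderiv I 𝓘(ℝ, F) f ((extChartAt I p).symm y) (coordVec I b p i y) =
      fderiv ℝ (fun y => f ((extChartAt I p).symm y)) y (b i) := by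
  have h := mfderiv_comp y hf (mdifferentiableAt_extChartAt_symm hy)
  rw [← mfderiv_eq_fderiv]
  exact (congrArg (fun L : E →L[ℝ] F => L (b i)) h).symm

theorem comp₁_dfun [IsManifold I ∞ N] {f : N → ℝ} (b : Module.Basis ι ℝ E) {p : N} (i : ι) {y : E}
    (hy : y ∈ (extChartAt I p).target)
    (hf : MDifferentiableAt I 𝓘(ℝ, ℝ) f ((extChartAt I p).symm y)) :
    comp₁ b (dfun I f) p i y = pderiv b i (fun y => f ((extChartAt I p).symm y)) y :=
  mfderiv_coordVec b i hy hf

/-- The coordinate vectors at a point of the chart, as a linear equivalence from the model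
space. -/
theorem exists_coordEquiv [IsManifold I ∞ N] (p : N) {y : E} (hy : y ∈ (extChartAt I p).target) :
    ∃ L : E ≃L[ℝ] E, ∀ (b : Module.Basis ι ℝ E) (i : ι), (coordVec I b p i y : E) = L (b i) := by
  have : IsManifold I 1 N := IsManifold.of_le (n := ∞) (by simp)
  obtain ⟨L, hL⟩ := isInvertible_mfderivWithin_extChartAt_symm (I := I) hy
  rw [I.range_eq_univ, mfderivWithin_univ] at hL
  exact ⟨L, fun b i => (congrArg (fun L : E →L[ℝ] E => L (b i)) hL).symm⟩

/-- Two covectors agree if they agree on the coordinate vectors. -/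
theorem covector_ext [IsManifold I ∞ N] (b : Module.Basis ι ℝ E) {p : N} {y : E}
    (hy : y ∈ (extChartAt I p).target)
    {v w : E →L[ℝ] ℝ} (h : ∀ i, v (coordVec I b p i y : E) = w (coordVec I b p i y : E)) :
    v = w := by
  obtain ⟨L, hL⟩ := exists_coordEquiv (ι := ι) p hy
  have : (v.comp (L : E →L[ℝ] E)) = w.comp (L : E →L[ℝ] E) := by
    refine ContinuousLinearMap.coe_injective (b.ext fun i => ?_)
    simpa [hL] using h i
  ext u
  simpa using congrArg (fun A : E →L[ℝ] ℝ => A (L.symm u)) this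

/-- The transition from the chart at `p` to the chart at `q`. -/
def transition (I : ModelWithCorners ℝ E H) (p q : N) (y : E) : E :=
  extChartAt I q ((extChartAt I p).symm y)

theorem contDiffAt_transition [IsManifold I ∞ N] {p q : N} {y : E}
    (hy : y ∈ (extChartAt I p).target) (hq : (extChartAt I p).symm y ∈ (extChartAt I q).source) :
    ContDiffAt ℝ ∞ (transition I p q) y :=
  ContMDiffAt.contDiffAt ((contMDiffAt_extChartAt' (by simpa using hq)).comp y
    (contMDiffAt_extChartAt_symm hy))

omit [I.Boundaryless] in
theorem transition_mem_target {p q : N} {y : E}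
    (hq : (extChartAt I p).symm y ∈ (extChartAt I q).source) :
    transition I p q y ∈ (extChartAt I q).target :=
  (extChartAt I q).map_source hq

omit [I.Boundaryless] in
theorem symm_transition {p q : N} {y : E}
    (hq : (extChartAt I p).symm y ∈ (extChartAt I q).source) :
    (extChartAt I q).symm (transition I p q y) = (extChartAt I p).symm y :=
  (extChartAt I q).left_inv hq

theorem eventually_symm_mem_source [IsManifold I ∞ N] {p q : N} {y : E}
    (hy : y ∈ (extChartAt I p).target) (hq : (extChartAt I p).symm y ∈ (extChartAt I q).source) :
    ∀ᶠ z in 𝓝 y, (extChartAt I p).symm z ∈ (extChartAt I q).source :=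
  (contMDiffAt_extChartAt_symm hy).continuousAt.preimage_mem_nhds
    ((isOpen_extChartAt_source q).mem_nhds hq)

/-- The coordinate vectors of two charts are related by the derivative of the transition map. -/
theorem mfderiv_symm_eq_transition [IsManifold I ∞ N] {p q : N} {y : E}
    (hy : y ∈ (extChartAt I p).target) (hq : (extChartAt I p).symm y ∈ (extChartAt I q).source)
    (u : E) :
    (mfderiv 𝓘(ℝ, E) I (extChartAt I p).symm y u : E) =
      mfderiv 𝓘(ℝ, E) I (extChartAt I q).symm (transition I p q y)
        (fderiv ℝ (transition I p q) y u) := by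
  have h1 : (extChartAt I p).symm =ᶠ[𝓝 y] (extChartAt I q).symm ∘ transition I p q := by
    filter_upwards [eventually_symm_mem_source hy hq] with z hz
    exact (symm_transition hz).symm
  have h2 : MDifferentiableAt 𝓘(ℝ, E) 𝓘(ℝ, E) (transition I p q) y :=
    ((contDiffAt_transition hy hq).differentiableAt (by simp)).mdifferentiableAt
  have h3 := mfderiv_comp y
    (mdifferentiableAt_extChartAt_symm (I := I) (transition_mem_target hq)) h2
  have h4 := h1.mfderiv_eq (I := 𝓘(ℝ, E)) (I' := I)
  rw [mfderiv_eq_fderiv] at h3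
  exact congrArg (fun L : E →L[ℝ] E => L u) (h4.trans h3)

omit [I.Boundaryless] in
theorem oneForm_congr (w : OneForm I N) {q q' : N} (h : q = q') (v : E) :
    (w q : E →L[ℝ] ℝ) v = (w q' : E →L[ℝ] ℝ) v := by subst h; rfl

omit [I.Boundaryless] in
theorem twoTensor_congr (T : TwoTensor I N) {q q' : N} (h : q = q') (u v : E) :
    (T q : E →ₗ[ℝ] E →ₗ[ℝ] ℝ) u v = (T q' : E →ₗ[ℝ] E →ₗ[ℝ] ℝ) u v := by subst h; rfl

theorem linear_comp_eq_sum_repr [Fintype ι] (b : Module.Basis ι ℝ E) (A : E →L[ℝ] ℝ)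
    (D : E →L[ℝ] E) (u : E) : A (D u) = ∑ k, b.repr u k * A (D (b k)) := by
  conv_lhs => rw [← b.sum_repr u]
  simp only [map_sum, map_smul, smul_eq_mul]

theorem bilinear_comp_eq_sum_repr [Fintype ι] (b : Module.Basis ι ℝ E) (A : E →ₗ[ℝ] E →ₗ[ℝ] ℝ)
    (D : E →L[ℝ] E) (u v : E) :
    A (D u) (D v) = ∑ k, ∑ l, b.repr u k * b.repr v l * A (D (b k)) (D (b l)) := by
  conv_lhs => rw [← b.sum_repr u, ← b.sum_repr v]
  simp only [map_sum, map_smul, smul_eq_mul, LinearMap.sum_apply, LinearMap.smul_apply,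
    Finset.mul_sum]
  rw [Finset.sum_comm]
  exact Finset.sum_congr rfl fun k _ => Finset.sum_congr rfl fun l _ => by ring

theorem comp₁_transition [Fintype ι] [IsManifold I ∞ N] (b : Module.Basis ι ℝ E) (w : OneForm I N)
    {p q : N} {y : E} (hy : y ∈ (extChartAt I p).target)
    (hq : (extChartAt I p).symm y ∈ (extChartAt I q).source) (i : ι) :
    comp₁ b w p i y = ∑ k, b.repr (fderiv ℝ (transition I p q) y (b i)) k *
      comp₁ b w q k (transition I p q y) := by
  have h1 : comp₁ b w p i y = (w ((extChartAt I p).symm y) : E →L[ℝ] ℝ) _ :=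
    congrArg (w ((extChartAt I p).symm y) : E →L[ℝ] ℝ) (mfderiv_symm_eq_transition hy hq (b i))
  exact (h1.trans (oneForm_congr w (symm_transition hq) _).symm).trans
    (linear_comp_eq_sum_repr b _ (mfderiv 𝓘(ℝ, E) I (extChartAt I q).symm (transition I p q y)) _)

theorem comp₂_transition [Fintype ι] [IsManifold I ∞ N] (b : Module.Basis ι ℝ E) (T : TwoTensor I N)
    {p q : N} {y : E} (hy : y ∈ (extChartAt I p).target)
    (hq : (extChartAt I p).symm y ∈ (extChartAt I q).source) (i j : ι) :
    comp₂ b T p i j y = ∑ k, ∑ l, b.repr (fderiv ℝ (transition I p q) y (b i)) k *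
      b.repr (fderiv ℝ (transition I p q) y (b j)) l *
      comp₂ b T q k l (transition I p q y) := by
  have h1 : comp₂ b T p i j y = (T ((extChartAt I p).symm y) : E →ₗ[ℝ] E →ₗ[ℝ] ℝ) _ _ :=
    congrArg₂ (fun x z => (T ((extChartAt I p).symm y) : E →ₗ[ℝ] E →ₗ[ℝ] ℝ) x z)
      (mfderiv_symm_eq_transition hy hq (b i)) (mfderiv_symm_eq_transition hy hq (b j))
  exact (h1.trans (twoTensor_congr T (symm_transition hq) _ _).symm).trans
    (bilinear_comp_eq_sum_repr b _ (mfderiv 𝓘(ℝ, E) I (extChartAt I q).symm (transition I p q y))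
      _ _)

end Charts

end

/-! ### Stereographic charts of the sphere -/

section

/-- The model space of two-dimensional manifolds. -/
abbrev E2 : Type := EuclideanSpace ℝ (Fin 2)

/-- The `i`-th component of the cross product in `ℝ³`. -/
def cr (u v : E3) (i : Fin 3) : ℝ := u (i + 1) * v (i + 2) - u (i + 2) * v (i + 1)

theorem cr_zero (u v : E3) : cr u v 0 = u 1 * v 2 - u 2 * v 1 := rfl
theorem cr_one (u v : E3) : cr u v 1 = u 2 * v 0 - u 0 * v 2 := rfl
theorem cr_two (u v : E3) : cr u v 2 = u 0 * v 1 - u 1 * v 0 := rfl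

/-- The inverse of the chart of the sphere centred at `s`, as a map into `ℝ³`. -/
def sphereParam (s : S2) (w : E2) : E3 := ((extChartAt (𝓡 2) s).symm w : S2)

theorem extChartAt_sphere_target (s : S2) : (extChartAt (𝓡 2) s).target = Set.univ := by
  have h : (chartAt E2 s).target = Set.univ := stereographic'_target (-s)
  simp only [extChartAt, OpenPartialHomeomorph.extend, PartialEquiv.trans_target, h]
  simp

/-- The inverse stereographic projection, in terms of an isometry `J` onto the tangent plane. -/
theorem exists_sphereParam_eq (s : S2) : ∃ J : E2 →ₗᵢ[ℝ] E3, (∀ w, inner ℝ (s : E3) (J w) = 0) ∧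
    ∀ w, sphereParam s w =
      (4 * (‖w‖ ^ 2 + 4)⁻¹) • J w + (8 * (‖w‖ ^ 2 + 4)⁻¹ - 1) • (s : E3) := by
  let U : ((ℝ ∙ ((-s : S2) : E3))ᗮ) ≃ₗᵢ[ℝ] E2 :=
    (OrthonormalBasis.fromOrthogonalSpanSingleton (𝕜 := ℝ) 2 (ne_zero_of_mem_unit_sphere (-s))).repr
  let J : E2 →ₗᵢ[ℝ] E3 := (Submodule.subtypeₗᵢ _).comp U.symm.toLinearIsometry
  have hJ : ∀ w, ((U.symm w : _) : E3) = J w := fun _ => rfl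
  refine ⟨J, fun w => ?_, fun w => ?_⟩
  · have h := (U.symm w).2
    rw [Submodule.mem_orthogonal_singleton_iff_inner_right, hJ, coe_neg_sphere, inner_neg_left,
      neg_eq_zero] at h
    exact h
  · have h : sphereParam s w = (‖((U.symm w : _) : E3)‖ ^ 2 + 4)⁻¹ • (4 : ℝ) •
        ((U.symm w : _) : E3) + (‖((U.symm w : _) : E3)‖ ^ 2 + 4)⁻¹ •
          (‖((U.symm w : _) : E3)‖ ^ 2 - 4) • (-s : S2).val :=
      stereographic'_symm_apply (n := 2) (-s) w
    have h0 : ‖w‖ ^ 2 + 4 ≠ 0 := by positivity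
    have e : (‖w‖ ^ 2 + 4)⁻¹ * (‖w‖ ^ 2 - 4) = -(8 * (‖w‖ ^ 2 + 4)⁻¹ - 1) := by
      field_simp; ring
    rw [h, hJ, J.norm_map, coe_neg_sphere, smul_smul _ (‖w‖ ^ 2 - 4), e, smul_smul,
      mul_comm _ (4 : ℝ), neg_smul, smul_neg, neg_neg]

theorem extChartAt_sphere_apply (s : S2) : ∃ U : ((ℝ ∙ ((-s : S2) : E3))ᗮ) ≃ₗᵢ[ℝ] E2, ∀ q : S2,
    extChartAt (𝓡 2) s q = U (stereoToFun ((-s : S2) : E3) (q : E3)) :=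
  ⟨(OrthonormalBasis.fromOrthogonalSpanSingleton (𝕜 := ℝ) 2
    (ne_zero_of_mem_unit_sphere (-s))).repr, fun _ => rfl⟩

theorem sphere_ne_neg_of_mem_source {s q : S2} (h : q ∈ (extChartAt (𝓡 2) s).source) : q ≠ -s := by
  rw [extChartAt_source] at h
  have h' : q ∈ (stereographic' 2 (-s)).source := h
  simpa using h'

theorem extChartAt_sphere_self (s : S2) : extChartAt (𝓡 2) s s = 0 := by
  obtain ⟨U, hU⟩ := extChartAt_sphere_apply s
  rw [hU]
  have := stereographic_apply_neg (-s)
  rw [neg_neg] at this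
  exact (congrArg U this).trans (map_zero U)

theorem contDiff_sphereParam (s : S2) : ContDiff ℝ ∞ (sphereParam s) := by
  obtain ⟨J, -, hJ⟩ := exists_sphereParam_eq s
  rw [funext hJ]
  have h1 : ContDiff ℝ ∞ fun w : E2 => ‖w‖ ^ 2 := contDiff_norm_sq ℝ
  have h2 : ContDiff ℝ ∞ (J : E2 → E3) := J.toContinuousLinearMap.contDiff
  have h3 : ContDiff ℝ ∞ fun w : E2 => (‖w‖ ^ 2 + 4)⁻¹ :=
    (h1.add contDiff_const).inv fun w => by positivity
  exact ((contDiff_const.mul h3).smul h2).add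
    (((contDiff_const.mul h3).sub contDiff_const).smul contDiff_const)

theorem sphereParam_zero (s : S2) : sphereParam s 0 = s := by
  have := (extChartAt (𝓡 2) s).left_inv (mem_extChartAt_source s)
  rw [extChartAt_sphere_self] at this
  exact congrArg Subtype.val this

theorem sphereParam_ne_zero (s : S2) (w : E2) : sphereParam s w ≠ 0 := S2.coe_ne_zero _

theorem sphereProj_sphereParam (s : S2) (w : E2) :
    sphereProj (sphereParam s w) = (extChartAt (𝓡 2) s).symm w := sphereProj_coe _

/-- The tangent vector `∂_B σ` of the parametrisation. -/
def dParam (s : S2) (B : Fin 2) (w : E2) : E3 := fderiv ℝ (sphereParam s) w (b2 B)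

theorem contDiff_dParam (s : S2) (B : Fin 2) : ContDiff ℝ ∞ (dParam s B) := by
  have := (contDiff_sphereParam s).fderiv_right (m := ∞) (by simp)
  exact this.clm_apply contDiff_const

theorem sphereIncl_coordVec (s : S2) (B : Fin 2) (w : E2) :
    sphereIncl ((extChartAt (𝓡 2) s).symm w) (coordVec (𝓡 2) b2 s B w) = dParam s B w := by
  have h : MDifferentiableAt (𝓡 2) 𝓘(ℝ, E3) (fun x : S2 => (x : E3))
      ((extChartAt (𝓡 2) s).symm w) :=
    (contMDiff_coe_sphere (n := 2) (m := ∞)).mdifferentiableAt (by simp)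
  have : IsManifold (𝓡 2) ∞ S2 := IsManifold.of_le (n := ω) le_top
  exact mfderiv_coordVec b2 B (by rw [extChartAt_sphere_target]; trivial) h

/-- The tangent frame at the centre of a chart of the sphere. -/
def frame (s : S2) (B : Fin 2) : E3 := sphereIncl s (b2 B)

theorem b2_inner (A B : Fin 2) : inner ℝ (b2 A) (b2 B) = if A = B then (1 : ℝ) else 0 := by
  fin_cases A <;> fin_cases B <;> simp [b2, EuclideanSpace.inner_single_left]

/-- The first and second derivatives of the parametrisation at the centre: its tangent vectors are
orthonormal there, and their derivatives are normal, so that the Christoffel symbols vanish. -/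
theorem dParam_jets (s : S2) : (∀ A B, inner ℝ (dParam s A 0) (dParam s B 0) =
      if A = B then (1 : ℝ) else 0) ∧ (∀ A, inner ℝ (s : E3) (dParam s A 0) = 0) ∧
    ∀ A B, fderiv ℝ (dParam s B) 0 (b2 A) = -(if A = B then (1 : ℝ) else 0) • (s : E3) := by
  obtain ⟨J, hJs, hJ⟩ := exists_sphereParam_eq s
  set f : E2 → ℝ := fun w => (‖w‖ ^ 2 + 4)⁻¹ with hf
  have hf1 : ∀ w, HasFDerivAt f ((-(2 * f w ^ 2)) • innerSL ℝ w) w := by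
    intro w
    have h1 : HasFDerivAt (fun w : E2 => ‖w‖ ^ 2 + 4) (2 • (innerSL ℝ w)) w :=
      (hasStrictFDerivAt_norm_sq w).hasFDerivAt.add_const 4
    have h2 := (hasDerivAt_inv (show ‖w‖ ^ 2 + 4 ≠ 0 by positivity)).comp_hasFDerivAt w h1
    refine h2.congr_fderiv ?_
    ext v; simp [f]; ring
  have hf0 : f 0 = 4⁻¹ := by simp [f]
  have hJ1 : ∀ w, HasFDerivAt (J : E2 → E3) J.toContinuousLinearMap w := fun w =>
    J.toContinuousLinearMap.hasFDerivAt
  have hd : ∀ w v, fderiv ℝ (sphereParam s) w v =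
      (4 * (-(2 * f w ^ 2) * inner ℝ w v)) • J w + (4 * f w) • J v
        + (8 * (-(2 * f w ^ 2) * inner ℝ w v)) • (s : E3) := by
    intro w v
    have h4 := (((hf1 w).const_mul 4).smul (hJ1 w)).add
      ((((hf1 w).const_mul 8).sub_const 1).smul_const (s : E3))
    have h6 : fderiv ℝ (sphereParam s) w = _ := (h4.congr_of_eventuallyEq (.of_forall hJ)).fderiv
    rw [h6]
    simp
    module
  have hd0 : ∀ A, dParam s A 0 = J (b2 A) := by
    intro A
    rw [dParam, hd, hf0]
    simp
  refine ⟨fun A B => ?_, fun A => ?_, fun A B => ?_⟩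
  · rw [hd0, hd0, J.inner_map_map, b2_inner]
  · rw [hd0, hJs]
  · have hin : HasFDerivAt (fun w : E2 => inner ℝ w (b2 B)) (innerSL ℝ (b2 B)) (0 : E2) := by
      refine (innerSL ℝ (b2 B)).hasFDerivAt.congr_of_eventuallyEq (.of_forall fun w => ?_)
      simp [real_inner_comm]
    have hg : HasFDerivAt (fun w : E2 => -(2 * f w ^ 2) * inner ℝ w (b2 B))
        ((-(1 / 8 : ℝ)) • innerSL ℝ (b2 B)) 0 := by
      have h1 := ((((hf1 0).pow 2).const_mul 2).neg).mul hin
      refine h1.congr_fderiv ?_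
      ext v; simp [hf0]; norm_num
    have h := (((hg.const_mul 4).smul (hJ1 0)).add (((hf1 0).const_mul 4).smul_const (J (b2 B)))).add
      ((hg.const_mul 8).smul_const (s : E3))
    have h6 : fderiv ℝ (dParam s B) 0 = _ :=
      (h.congr_of_eventuallyEq (.of_forall fun w => hd w (b2 B))).fderiv
    rw [h6, ← b2_inner]
    simp [real_inner_comm]

end

/-! ### The rotation frame in a chart of the sphere -/

section

theorem sphereIncl_congr {q q' : S2} (h : q = q') (v : E2) :
    (sphereIncl q : E2 →L[ℝ] E3) v = (sphereIncl q' : E2 →L[ℝ] E3) v := by subst h; rfl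

theorem symm_zero_sphere (s : S2) : (extChartAt (𝓡 2) s).symm 0 = s :=
  Subtype.ext (sphereParam_zero s)

instance : IsManifold (𝓡 2) ∞ S2 := IsManifold.of_le (n := ω) le_top

theorem coordVec_sphere_zero (s : S2) (B : Fin 2) :
    (coordVec (𝓡 2) b2 s B 0 : E2) = b2 B := by
  have h : ∀ y, y = extChartAt (𝓡 2) s s → (coordVec (𝓡 2) b2 s B y : E2) = b2 B := by
    rintro _ rfl; exact coordVec_extChartAt_self b2 s B
  exact h 0 (extChartAt_sphere_self s).symm

theorem frame_eq (s : S2) (B : Fin 2) : frame s B = dParam s B 0 := by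
  rw [← sphereIncl_coordVec, frame]
  refine (sphereIncl_congr (symm_zero_sphere s).symm (b2 B)).trans ?_
  exact congrArg (sphereIncl ((extChartAt (𝓡 2) s).symm 0) : E2 →L[ℝ] E3)
    (coordVec_sphere_zero s B).symm

theorem inner_frame (s : S2) (A B : Fin 2) :
    inner ℝ (frame s A) (frame s B) = if A = B then (1 : ℝ) else 0 := by
  rw [frame_eq, frame_eq]; exact (dParam_jets s).1 A B

theorem inner_coe_frame (s : S2) (A : Fin 2) : inner ℝ (s : E3) (frame s A) = 0 := by
  rw [frame_eq]; exact (dParam_jets s).2.1 A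

theorem fderiv_dParam_zero (s : S2) (A B : Fin 2) :
    fderiv ℝ (dParam s B) 0 (b2 A) = -(if A = B then (1 : ℝ) else 0) • (s : E3) :=
  (dParam_jets s).2.2 A B

/-- The determinant of three vectors in `ℝ³`. -/
def det3 (x u v : E3) : ℝ := Matrix.det !![x 0, x 1, x 2; u 0, u 1, u 2; v 0, v 1, v 2]

theorem det3_eq (x u v : E3) : det3 x u v =
    (x 1 * u 2 - x 2 * u 1) * v 0 + (x 2 * u 0 - x 0 * u 2) * v 1
      + (x 0 * u 1 - x 1 * u 0) * v 2 := by
  rw [det3, Matrix.det_fin_three]; simp; ring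

/-- The orientation `±1` of the frame at the centre of a chart of the sphere. -/
def orient (s : S2) : ℝ := det3 s (frame s 0) (frame s 1)

/-- Completeness of the orthonormal frame `s, T₀, T₁`. -/
theorem frame_complete (s : S2) (i j : Fin 3) :
    s.1 i * s.1 j + frame s 0 i * frame s 0 j + frame s 1 i * frame s 1 j =
      if i = j then 1 else 0 := by
  set Q : Matrix (Fin 3) (Fin 3) ℝ := !![s.1 0, s.1 1, s.1 2;
    frame s 0 0, frame s 0 1, frame s 0 2; frame s 1 0, frame s 1 1, frame s 1 2] with hQ
  have h00 := inner_frame s 0 0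
  have h01 := inner_frame s 0 1
  have h11 := inner_frame s 1 1
  have hs0 := inner_coe_frame s 0
  have hs1 := inner_coe_frame s 1
  have hss := S2.sum_sq s
  rw [inner_eq_sum] at h00 h01 h11 hs0 hs1
  simp only [if_true, Fin.zero_eq_one_iff, OfNat.ofNat_ne_one, if_false] at h00 h01 h11
  have h : Q * Q.transpose = 1 := by
    ext a b
    fin_cases a <;> fin_cases b <;>
      simp [hQ, Matrix.mul_apply, Fin.sum_univ_three] <;> linarith
  have h' := congrArg (fun A : Matrix (Fin 3) (Fin 3) ℝ => A i j) (mul_eq_one_comm.1 h)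
  simp only [Matrix.one_apply, Matrix.mul_apply, Fin.sum_univ_three] at h'
  rw [← h']
  fin_cases i <;> fin_cases j <;> simp [hQ]

theorem cr_frame_zero (s : S2) (i : Fin 3) : cr s (frame s 0) i = orient s * frame s 1 i := by
  have h0 := frame_complete s i 0
  have h1 := frame_complete s i 1
  have h2 := frame_complete s i 2
  have e : cr s (frame s 0) 0 * (s.1 i * s.1 0 + frame s 0 i * frame s 0 0
        + frame s 1 i * frame s 1 0)
      + cr s (frame s 0) 1 * (s.1 i * s.1 1 + frame s 0 i * frame s 0 1
        + frame s 1 i * frame s 1 1)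
      + cr s (frame s 0) 2 * (s.1 i * s.1 2 + frame s 0 i * frame s 0 2
        + frame s 1 i * frame s 1 2) = orient s * frame s 1 i := by
    rw [orient, det3_eq, cr_zero, cr_one, cr_two]; ring
  rw [← e, h0, h1, h2]
  fin_cases i <;> simp

theorem cr_frame_one (s : S2) (i : Fin 3) : cr s (frame s 1) i = -orient s * frame s 0 i := by
  have h0 := frame_complete s i 0
  have h1 := frame_complete s i 1
  have h2 := frame_complete s i 2
  have e : cr s (frame s 1) 0 * (s.1 i * s.1 0 + frame s 0 i * frame s 0 0
        + frame s 1 i * frame s 1 0)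
      + cr s (frame s 1) 1 * (s.1 i * s.1 1 + frame s 0 i * frame s 0 1
        + frame s 1 i * frame s 1 1)
      + cr s (frame s 1) 2 * (s.1 i * s.1 2 + frame s 0 i * frame s 0 2
        + frame s 1 i * frame s 1 2) = -orient s * frame s 0 i := by
    rw [orient, det3_eq, cr_zero, cr_one, cr_two]; ring
  rw [← e, h0, h1, h2]
  fin_cases i <;> simp

theorem orient_sq (s : S2) : orient s * orient s = 1 := by
  have h : inner ℝ (frame s 1) (frame s 1) = (1 : ℝ) := by simpa using inner_frame s 1 1
  have hss := S2.sum_sq s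
  have h00 := inner_frame s 0 0
  have hs0 := inner_coe_frame s 0
  rw [inner_eq_sum] at h00 hs0 h
  simp only [if_true] at h00
  have c0 := cr_frame_zero s 0
  have c1 := cr_frame_zero s 1
  have c2 := cr_frame_zero s 2
  rw [cr_zero] at c0
  rw [cr_one] at c1
  rw [cr_two] at c2
  have e : (orient s * frame s 1 0) ^ 2 + (orient s * frame s 1 1) ^ 2
      + (orient s * frame s 1 2) ^ 2 = 1 := by
    rw [← c0, ← c1, ← c2]
    linear_combination (frame s 0 0 * frame s 0 0 + frame s 0 1 * frame s 0 1
      + frame s 0 2 * frame s 0 2) * hss + h00 - (s.1 0 * frame s 0 0 + s.1 1 * frame s 0 1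
      + s.1 2 * frame s 0 2) * hs0
  linear_combination e - orient s * orient s * h

/-- The components in the chart at `s` of the covector field whose components along the rotation
fields are `b i`. -/
def angular (b : Fin 3 → S2 → ℝ) (s : S2) (B : Fin 2) (w : E2) : ℝ :=
  ∑ i, b i ((extChartAt (𝓡 2) s).symm w) * cr (sphereParam s w) (dParam s B w) i

theorem SmoothS.contDiff_symm {f : S2 → ℝ} (hf : SmoothS f) (s : S2) :
    ContDiff ℝ ∞ fun w => f ((extChartAt (𝓡 2) s).symm w) := by
  have := ContDiffOn.comp_contDiff hf (contDiff_sphereParam s) (sphereParam_ne_zero s)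
  simpa only [Function.comp_def, sphereProj_sphereParam] using this

theorem SmoothS.contMDiff {f : S2 → ℝ} (hf : SmoothS f) : ContMDiff (𝓡 2) 𝓘(ℝ, ℝ) ∞ f :=
  contMDiff_of_contDiffOn_chart fun s => (hf.contDiff_symm s).contDiffOn

/-- The components of the differential of a function along the rotation fields are its rotation
derivatives. -/
theorem pderiv_symm_sphere {f : S2 → ℝ} (hf : SmoothS f) (s : S2) (A : Fin 2) (w : E2) :
    pderiv b2 A (fun w => f ((extChartAt (𝓡 2) s).symm w)) w =
      angular (fun i => rotD i f) s A w := by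
  have h1 := (hf.differentiableAt (sphereParam_ne_zero s w)).hasFDerivAt
  have h2 := ((contDiff_sphereParam s).differentiable (by simp) w).hasFDerivAt
  have h3 := h1.comp w h2
  have e : (fun w => f ((extChartAt (𝓡 2) s).symm w)) =
      (fun x => f (sphereProj x)) ∘ sphereParam s := by
    funext w; simp [sphereProj_sphereParam]
  rw [pderiv, e, h3.fderiv]
  refine (fderiv_ext_eq hf ((extChartAt (𝓡 2) s).symm w) (dParam s A w)).trans ?_
  simp only [angular, Fin.sum_univ_three, cr_zero, cr_one, cr_two]
  rfl

theorem contDiff_cr {F : Type*} [NormedAddCommGroup F] [NormedSpace ℝ F] {u v : F → E3}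
    (hu : ContDiff ℝ ∞ u) (hv : ContDiff ℝ ∞ v) (i : Fin 3) :
    ContDiff ℝ ∞ fun w => cr (u w) (v w) i := by
  have hu' := contDiff_euclidean.1 hu
  have hv' := contDiff_euclidean.1 hv
  exact ((hu' _).mul (hv' _)).sub ((hu' _).mul (hv' _))

theorem fderiv_cr {u v : E2 → E3} (hu : ContDiff ℝ ∞ u) (hv : ContDiff ℝ ∞ v) (i : Fin 3)
    (w x : E2) : fderiv ℝ (fun w => cr (u w) (v w) i) w x =
      cr (fderiv ℝ u w x) (v w) i + cr (u w) (fderiv ℝ v w x) i := by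
  have hu' : ∀ j, HasFDerivAt (fun w => u w j) _ w := fun j =>
    (EuclideanSpace.proj j : E3 →L[ℝ] ℝ).hasFDerivAt.comp w
      (hu.differentiable (by simp) w).hasFDerivAt
  have hv' : ∀ j, HasFDerivAt (fun w => v w j) _ w := fun j =>
    (EuclideanSpace.proj j : E3 →L[ℝ] ℝ).hasFDerivAt.comp w
      (hv.differentiable (by simp) w).hasFDerivAt
  have h := ((hu' (i + 1)).mul (hv' (i + 2))).sub ((hu' (i + 2)).mul (hv' (i + 1)))
  rw [show (fun w => cr (u w) (v w) i) = _ from rfl]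
  erw [h.fderiv]
  simp [cr]
  ring

theorem pderiv_angular {b : Fin 3 → S2 → ℝ} (hb : ∀ i, SmoothS (b i)) (s : S2)
    (A B : Fin 2) (w : E2) : pderiv b2 A (angular b s B) w =
      ∑ i, (angular (fun j => rotD j (b i)) s A w * cr (sphereParam s w) (dParam s B w) i
        + b i ((extChartAt (𝓡 2) s).symm w) * (cr (dParam s A w) (dParam s B w) i
          + cr (sphereParam s w) (fderiv ℝ (dParam s B) w (b2 A)) i)) := by
  have h1 : ∀ i, DifferentiableAt ℝ (fun w => b i ((extChartAt (𝓡 2) s).symm w)) w := fun i =>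
    ((hb i).contDiff_symm s).differentiable (by simp) w
  have h2 : ∀ i, DifferentiableAt ℝ (fun w => cr (sphereParam s w) (dParam s B w) i) w := fun i =>
    (contDiff_cr (contDiff_sphereParam s) (contDiff_dParam s B) i).differentiable (by simp) w
  have h3 : fderiv ℝ (angular b s B) w = _ := fderiv_fun_sum fun i _ => (h1 i).mul (h2 i)
  rw [pderiv, h3, _root_.sum_apply]
  refine Finset.sum_congr rfl fun i _ => ?_
  have h4 := pderiv_symm_sphere (hb i) s A w
  rw [pderiv] at h4
  have h5 := fderiv_cr (contDiff_sphereParam s) (contDiff_dParam s B) i w (b2 A)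
  rw [fderiv_fun_mul (h1 i) (h2 i)]
  simp only [_root_.add_apply, _root_.smul_apply, smul_eq_mul]
  rw [h4, h5]
  simp only [dParam]
  ring

theorem cr_self (u : E3) (i : Fin 3) : cr u u i = 0 := by simp [cr, mul_comm]
theorem cr_smul_right (c : ℝ) (u v : E3) (i : Fin 3) : cr u (c • v) i = c * cr u v i := by
  simp [cr]; ring

theorem angular_zero (b : Fin 3 → S2 → ℝ) (s : S2) (B : Fin 2) :
    angular b s B 0 = ∑ i, b i s * cr s (frame s B) i := by
  simp only [angular, symm_zero_sphere, sphereParam_zero, frame_eq]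

theorem cr_frame_complete (s : S2) (i j : Fin 3) :
    cr s (frame s 0) i * cr s (frame s 0) j + cr s (frame s 1) i * cr s (frame s 1) j
      = (if i = j then 1 else 0) - s.1 i * s.1 j := by
  rw [cr_frame_zero, cr_frame_zero, cr_frame_one, cr_frame_one, ← frame_complete s i j]
  linear_combination (frame s 1 i * frame s 1 j + frame s 0 i * frame s 0 j) * orient_sq s

/-- In the chart centred at `s` the divergence of a covector field at `s` is the sum of the
partial derivatives of its components. -/
theorem sum_pderiv_angular {b : Fin 3 → S2 → ℝ} (hb : ∀ i, SmoothS (b i)) (s : S2) :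
    ∑ A, pderiv b2 A (angular b s A) 0 = rotDiv b s := by
  have h : ∀ A, pderiv b2 A (angular b s A) 0 =
      ∑ i, ∑ j, rotD j (b i) s * (cr s (frame s A) j * cr s (frame s A) i) := by
    intro A
    rw [pderiv_angular hb]
    refine Finset.sum_congr rfl fun i _ => ?_
    rw [cr_self, fderiv_dParam_zero, sphereParam_zero, cr_smul_right, cr_self, angular_zero,
      ← frame_eq, Finset.sum_mul]
    simp [mul_assoc]
  have e : ∀ i, ∑ j, rotD j (b i) s * (s.1 i * s.1 j) = 0 := by
    intro i
    rw [Fin.sum_univ_three]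
    linear_combination s.1 i * coord_mul_rotD (b i) s
  have h2 : ∀ i, ∑ j, rotD j (b i) s * (cr s (frame s 0) j * cr s (frame s 0) i) +
      ∑ j, rotD j (b i) s * (cr s (frame s 1) j * cr s (frame s 1) i) = rotD i (b i) s := by
    intro i
    rw [← Finset.sum_add_distrib]
    calc _ = ∑ j, (rotD j (b i) s * (if j = i then 1 else 0) - rotD j (b i) s * (s.1 i * s.1 j)) :=
          Finset.sum_congr rfl fun j _ => by
            rw [← mul_add, cr_frame_complete]; ring
      _ = _ := by rw [Finset.sum_sub_distrib, e]; simp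
  rw [Fin.sum_univ_two, h, h, ← Finset.sum_add_distrib]
  exact Finset.sum_congr rfl fun i _ => h2 i

theorem fderiv_dParam_symm (s : S2) (A B : Fin 2) (w : E2) :
    fderiv ℝ (dParam s B) w (b2 A) = fderiv ℝ (dParam s A) w (b2 B) := by
  have h := ((contDiff_sphereParam s).contDiffAt (x := w)).isSymmSndFDerivAt
    (by simpa using two_le_infty) (b2 A) (b2 B)
  have hd : DifferentiableAt ℝ (fderiv ℝ (sphereParam s)) w :=
    ((contDiff_sphereParam s).fderiv_right (m := ∞) (by simp)).differentiable (by simp) w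
  have e : ∀ A B : Fin 2, fderiv ℝ (dParam s B) w (b2 A) =
      fderiv ℝ (fderiv ℝ (sphereParam s)) w (b2 A) (b2 B) := by
    intro A B
    have : fderiv ℝ (dParam s B) w = _ :=
      (hd.hasFDerivAt.clm_apply (hasFDerivAt_const (b2 B) w)).fderiv
    rw [this]; simp
  rw [e, e]; exact h

/-- The tangent vectors of the parametrisation are orthogonal to the position vector. -/
theorem inner_sphereParam_dParam (s : S2) (A : Fin 2) (w : E2) :
    inner ℝ (sphereParam s w) (dParam s A w) = 0 := by
  have h1 : (fun w => inner ℝ (sphereParam s w) (sphereParam s w)) = fun _ => (1 : ℝ) := by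
    funext w; rw [real_inner_self_eq_norm_sq]; simp [sphereParam]
  have hd := (contDiff_sphereParam s).differentiable (by simp) w
  have h2 := fderiv_inner_apply ℝ hd hd (b2 A)
  rw [h1] at h2
  simp only [fderiv_fun_const, Pi.zero_apply, _root_.zero_apply] at h2
  rw [real_inner_comm (fderiv ℝ (sphereParam s) w (b2 A))] at h2
  rw [real_inner_comm]
  simp only [dParam]
  linarith

/-- The exterior derivative of a covector field in a chart of the sphere. -/
theorem pderiv_angular_antisymm {b : Fin 3 → S2 → ℝ} (hb : ∀ i, SmoothS (b i))
    (ht : ∀ s : S2, s.1 0 * b 0 s + s.1 1 * b 1 s + s.1 2 * b 2 s = 0) (s : S2) (w : E2) :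
    pderiv b2 0 (angular b s 1) w - pderiv b2 1 (angular b s 0) w =
      det3 (sphereParam s w) (dParam s 0 w) (dParam s 1 w) *
        rotCurl b ((extChartAt (𝓡 2) s).symm w) := by
  rw [pderiv_angular hb, pderiv_angular hb, fderiv_dParam_symm s 0 1, rotCurl_eq]
  set q := (extChartAt (𝓡 2) s).symm w with hq
  have hq' : (q : E3) = sphereParam s w := rfl
  have hn := S2.sum_sq q
  have h0 := inner_sphereParam_dParam s 0 w
  have h1 := inner_sphereParam_dParam s 1 w
  have hb' := ht q
  simp only [angular, Fin.sum_univ_three, cr_zero, cr_one, cr_two, det3_eq, inner_eq_sum,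
    ← hq, ← hq'] at h0 h1 ⊢
  generalize dParam s 0 w = u at *
  generalize dParam s 1 w = v at *
  -- `u × v` is a multiple of the position vector, to which `b` is orthogonal
  linear_combination (-2 * (b 0 q * (u 1 * v 2 - u 2 * v 1) + b 1 q * (u 2 * v 0 - u 0 * v 2)
      + b 2 q * (u 0 * v 1 - u 1 * v 0))) * hn
    + (2 * (q.1 0 * (u 1 * v 2 - u 2 * v 1) + q.1 1 * (u 2 * v 0 - u 0 * v 2)
      + q.1 2 * (u 0 * v 1 - u 1 * v 0))) * hb'
    - (2 * (b 0 q * (q.1 1 * u 2 - q.1 2 * u 1) + b 1 q * (q.1 2 * u 0 - q.1 0 * u 2)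
      + b 2 q * (q.1 0 * u 1 - q.1 1 * u 0))) * h1
    + (2 * (b 0 q * (q.1 1 * v 2 - q.1 2 * v 1) + b 1 q * (q.1 2 * v 0 - q.1 0 * v 2)
      + b 2 q * (q.1 0 * v 1 - q.1 1 * v 0))) * h0

end

/-! ### The round metric at the centre of a chart -/

section

open Topology

/-- The area density of the chart of the sphere is stationary at the centre. -/
theorem fderiv_det3_param (s : S2) (C : Fin 2) :
    fderiv ℝ (fun w => det3 (sphereParam s w) (dParam s 0 w) (dParam s 1 w)) 0 (b2 C) = 0 := by
  have hx : ∀ j, HasFDerivAt (fun w => sphereParam s w j) _ 0 := fun j =>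
    (EuclideanSpace.proj j : E3 →L[ℝ] ℝ).hasFDerivAt.comp 0
      ((contDiff_sphereParam s).differentiable (by simp) 0).hasFDerivAt
  have hu : ∀ A j, HasFDerivAt (fun w => dParam s A w j) _ 0 := fun A j =>
    (EuclideanSpace.proj j : E3 →L[ℝ] ℝ).hasFDerivAt.comp 0
      ((contDiff_dParam s A).differentiable (by simp) 0).hasFDerivAt
  have h := (((((hx 1).mul (hu 0 2)).sub ((hx 2).mul (hu 0 1))).mul (hu 1 0)).add
    ((((hx 2).mul (hu 0 0)).sub ((hx 0).mul (hu 0 2))).mul (hu 1 1))).add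
    ((((hx 0).mul (hu 0 1)).sub ((hx 1).mul (hu 0 0))).mul (hu 1 2))
  have h' := h.congr_of_eventuallyEq (.of_forall fun w =>
    det3_eq (sphereParam s w) (dParam s 0 w) (dParam s 1 w))
  have e0 : fderiv ℝ (sphereParam s) 0 (b2 C) = frame s C := (frame_eq s C).symm
  rw [h'.fderiv]
  simp only [_root_.add_apply, _root_.smul_apply, _root_.sub_apply, ContinuousLinearMap.comp_apply,
    PiLp.proj_apply, Pi.mul_apply, Pi.sub_apply, e0, fderiv_dParam_zero, ← frame_eq,
    sphereParam_zero, smul_eq_mul]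
  fin_cases C <;> simp <;> ring

/-- The derivative at the centre of the components of the exterior derivative. -/
theorem pderiv_curl_angular {b : Fin 3 → S2 → ℝ} (hb : ∀ i, SmoothS (b i))
    (ht : ∀ s : S2, s.1 0 * b 0 s + s.1 1 * b 1 s + s.1 2 * b 2 s = 0)
    (hc : SmoothS (rotCurl b)) (s : S2) (C : Fin 2) :
    pderiv b2 C (fun w => pderiv b2 0 (angular b s 1) w - pderiv b2 1 (angular b s 0) w) 0 =
      orient s * angular (fun i => rotD i (rotCurl b)) s C 0 := by
  rw [funext (pderiv_angular_antisymm hb ht s), pderiv]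
  have h1 : DifferentiableAt ℝ
      (fun w => det3 (sphereParam s w) (dParam s 0 w) (dParam s 1 w)) 0 := by
    have h0 := contDiff_euclidean.1 (contDiff_sphereParam s)
    have h1 := fun A => contDiff_euclidean.1 (contDiff_dParam s A)
    simp only [det3_eq]
    refine ContDiff.differentiable (n := ∞) ?_ (by simp) 0
    exact (((((h0 1).mul (h1 0 2)).sub ((h0 2).mul (h1 0 1))).mul (h1 1 0)).add
      ((((h0 2).mul (h1 0 0)).sub ((h0 0).mul (h1 0 2))).mul (h1 1 1))).add
      ((((h0 0).mul (h1 0 1)).sub ((h0 1).mul (h1 0 0))).mul (h1 1 2))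
  have h2 : DifferentiableAt ℝ (fun w => rotCurl b ((extChartAt (𝓡 2) s).symm w)) 0 :=
    (hc.contDiff_symm s).differentiable (by simp) 0
  have h3 := pderiv_symm_sphere hc s C 0
  rw [pderiv] at h3
  rw [fderiv_fun_mul h1 h2]
  simp only [_root_.add_apply, _root_.smul_apply, smul_eq_mul]
  rw [fderiv_det3_param, h3, sphereParam_zero, ← frame_eq, ← frame_eq, orient]
  ring

theorem comp₂_sphereMetric (s : S2) (A B : Fin 2) (w : E2) :
    comp₂ b2 sphereMetric s A B w = inner ℝ (dParam s A w) (dParam s B w) := by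
  rw [← sphereIncl_coordVec, ← sphereIncl_coordVec]; rfl

theorem comp₂_sphereMetric_zero (s : S2) (A B : Fin 2) :
    comp₂ b2 sphereMetric s A B 0 = if A = B then 1 else 0 := by
  rw [comp₂_sphereMetric, ← frame_eq, ← frame_eq, inner_frame]

theorem pderiv_sphereMetric_zero (s : S2) (A B C : Fin 2) :
    pderiv b2 C (comp₂ b2 sphereMetric s A B) 0 = 0 := by
  rw [funext (comp₂_sphereMetric s A B), pderiv,
    fderiv_inner_apply ℝ ((contDiff_dParam s A).differentiable (by simp) 0)
      ((contDiff_dParam s B).differentiable (by simp) 0), fderiv_dParam_zero, fderiv_dParam_zero,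
    inner_smul_right, inner_smul_left, ← frame_eq, ← frame_eq, real_inner_comm, inner_coe_frame,
    inner_coe_frame]
  simp

theorem ginv_sphereMetric_zero (s : S2) (A B : Fin 2) :
    ginv (comp₂ b2 sphereMetric s) A B 0 = if A = B then 1 else 0 := by
  have : (Matrix.of fun k l => comp₂ b2 sphereMetric s k l 0) = 1 := by
    ext i j; simp [comp₂_sphereMetric_zero, Matrix.one_apply]
  rw [ginv, this, inv_one, Matrix.one_apply]

theorem christoffel_sphere_zero (s : S2) (A B C : Fin 2) :
    christoffel b2 (comp₂ b2 sphereMetric s) A B C 0 = 0 := by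
  simp [christoffel, pderiv_sphereMetric_zero]

theorem comp₁_dfun_sphere {f : S2 → ℝ} (hf : SmoothS f) (s : S2) (A : Fin 2) :
    comp₁ b2 (dfun (𝓡 2) f) s A = angular (fun i => rotD i f) s A := by
  funext w
  rw [comp₁_dfun b2 A (by rw [extChartAt_sphere_target]; trivial)
    (hf.contMDiff.mdifferentiable (by simp) _), pderiv_symm_sphere hf]

theorem laplacian_sphere {f : S2 → ℝ} (hf : SmoothS f) (s : S2) :
    laplacian b2 sphereMetric f s = rotLap f s := by
  have := sum_pderiv_angular hf.rotD s
  simp only [laplacian, divergence, extChartAt_sphere_self, ginv_sphereMetric_zero, covDeriv₁,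
    christoffel_sphere_zero, comp₁_dfun_sphere hf, zero_mul, Finset.sum_const_zero, sub_zero,
    ite_mul, one_mul, Finset.sum_ite_eq, Finset.mem_univ, if_true]
  exact this

/-- To express a covector through its components along the rotation fields it suffices to do so on
a basis. -/
theorem covector_eq_sum_cr {β : E2 →L[ℝ] ℝ} {L : E2 →L[ℝ] E3} {x : E3} {c : Fin 3 → ℝ}
    (h : ∀ A, β (b2 A) = ∑ i, c i * cr x (L (b2 A)) i) (v : E2) :
    β v = ∑ i, c i * cr x (L v) i := by
  have h0 := h 0
  have h1 := h 1
  simp only [Fin.sum_univ_three, cr_zero, cr_one, cr_two] at h0 h1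
  rw [← b2.sum_repr v]
  simp only [map_add, map_smul, Fin.sum_univ_two, Fin.sum_univ_three, cr_zero, cr_one, cr_two,
    PiLp.add_apply, PiLp.smul_apply, smul_eq_mul, h0, h1]
  ring

/-- The differential of a function through its derivatives along the rotation fields. -/
theorem dfun_apply {f : S2 → ℝ} (hf : SmoothS f) (s : S2) (v : E2) :
    (dfun (𝓡 2) f s : E2 →L[ℝ] ℝ) v =
      ∑ i, rotD i f s * cr s ((sphereIncl s : E2 →L[ℝ] E3) v) i := by
  refine covector_eq_sum_cr (fun A => ?_) v
  have e : comp₁ b2 (dfun (𝓡 2) f) s A 0 = _ := congrFun (comp₁_dfun_sphere hf s A) 0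
  rw [angular_zero, comp₁] at e
  refine Eq.trans ?_ e
  exact (oneForm_congr (dfun (𝓡 2) f) (symm_zero_sphere s).symm (b2 A)).trans
    (congrArg (dfun (𝓡 2) f ((extChartAt (𝓡 2) s).symm 0) : E2 →L[ℝ] ℝ)
      (coordVec_sphere_zero s A).symm)

/-- The rotation field `e_i × s` as a tangent vector of the sphere. -/
def rotField (i : Fin 3) (s : S2) : E2 := ∑ B, cr s (frame s B) i • b2 B

theorem sphereIncl_rotField (i : Fin 3) (s : S2) :
    (sphereIncl s : E2 →L[ℝ] E3) (rotField i s) = rot i s := by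
  have h : (sphereIncl s : E2 →L[ℝ] E3) (rotField i s) = ∑ B, cr s (frame s B) i • frame s B := by
    have : ∀ L : E2 →L[ℝ] E3, L (∑ B, cr s (frame s B) i • b2 B) =
      ∑ B, cr s (frame s B) i • L (b2 B) := fun L => by simp only [map_sum, map_smul]
    exact this _
  rw [h, Fin.sum_univ_two, rot_apply]
  ext j
  have h1 := frame_complete s (i + 1) j
  have h2 := frame_complete s (i + 2) j
  simp only [PiLp.add_apply, PiLp.sub_apply, PiLp.smul_apply, smul_eq_mul, cr,
    PiLp.single_apply, eq_comm (a := j)]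
  linear_combination s.1 (i + 1) * h2 - s.1 (i + 2) * h1

end

/-! ### Covectors on the sphere in the rotation frame -/

section

open Topology

theorem sum_cr_frame (s : S2) (A B : Fin 2) :
    ∑ i, cr s (frame s A) i * cr s (frame s B) i = if A = B then 1 else 0 := by
  have h := fun A B => inner_frame s A B
  simp only [inner_eq_sum] at h
  have o := orient_sq s
  have h00 := h 0 0; have h01 := h 0 1; have h10 := h 1 0; have h11 := h 1 1
  fin_cases A <;> fin_cases B <;>
    simp [Fin.sum_univ_three, cr_frame_zero, cr_frame_one] at h00 h01 h10 h11 ⊢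
  · linear_combination orient s * orient s * h11 + o
  · linear_combination -orient s * orient s * h10
  · linear_combination -orient s * orient s * h01
  · linear_combination orient s * orient s * h00 + o

theorem apply_rotField (β : E2 →L[ℝ] ℝ) (i : Fin 3) (s : S2) :
    β (rotField i s) = cr s (frame s 0) i * β (b2 0) + cr s (frame s 1) i * β (b2 1) := by
  simp only [rotField, map_smul, Fin.sum_univ_two, map_add, smul_eq_mul]

/-- A covector on the sphere is determined by its components along the rotation fields. -/
theorem covector_eq_sum_rotField (s : S2) (β : E2 →L[ℝ] ℝ) (v : E2) :
    β v = ∑ i, β (rotField i s) * cr s ((sphereIncl s : E2 →L[ℝ] E3) v) i := by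
  refine covector_eq_sum_cr (fun A => ?_) v
  have h : ∀ B A, ∑ i, cr s (frame s B) i * cr s (sphereIncl s (b2 A)) i = if B = A then 1 else 0 :=
    fun B A => sum_cr_frame s B A
  simp only [apply_rotField, add_mul, Finset.sum_add_distrib]
  have e : ∀ B, ∑ i, cr s (frame s B) i * β (b2 B) * cr s (sphereIncl s (b2 A)) i =
      β (b2 B) * if B = A then 1 else 0 := by
    intro B
    rw [← h, Finset.mul_sum]
    exact Finset.sum_congr rfl fun i _ => by ring
  refine Eq.trans ?_ (congrArg₂ (· + ·) (e 0) (e 1)).symm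
  fin_cases A <;> simp

theorem coord_mul_rotField (s : S2) (β : E2 →L[ℝ] ℝ) :
    s.1 0 * β (rotField 0 s) + s.1 1 * β (rotField 1 s) + s.1 2 * β (rotField 2 s) = 0 := by
  simp only [apply_rotField, cr_zero, cr_one, cr_two]; ring

/-- The component along the `i`-th rotation field of the covector with tangential components
`c`. -/
theorem sum_mul_cr_rot (s : S2) {c : Fin 3 → ℝ} (hc : s.1 0 * c 0 + s.1 1 * c 1 + s.1 2 * c 2 = 0)
    (i : Fin 3) : ∑ j, c j * cr s (rot i s) j = c i := by
  have hn := S2.sum_sq s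
  rw [Fin.sum_univ_three, cr_zero, cr_one, cr_two]
  fin_cases i <;> simp [rot_zero, rot_one, rot_two]
  · linear_combination c 0 * hn - s.1 0 * hc
  · linear_combination c 1 * hn - s.1 1 * hc
  · linear_combination c 2 * hn - s.1 2 * hc

/-- Tangential components along the rotation fields can be read off from the covector. -/
theorem eq_apply_rotField {s : S2} {β : E2 →L[ℝ] ℝ} {c : Fin 3 → ℝ}
    (hc : s.1 0 * c 0 + s.1 1 * c 1 + s.1 2 * c 2 = 0)
    (h : ∀ v, β v = ∑ i, c i * cr s ((sphereIncl s : E2 →L[ℝ] E3) v) i) (i : Fin 3) :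
    c i = β (rotField i s) := by
  rw [h, sphereIncl_rotField, sum_mul_cr_rot s hc]

theorem injective_of_orthonormal {L : E2 →L[ℝ] E3}
    (h : ∀ A B, inner ℝ (L (b2 A)) (L (b2 B)) = if A = B then (1 : ℝ) else 0) {u v : E2}
    (huv : L u = L v) : u = v := by
  refine b2.ext_elem fun A => ?_
  have h' : ∀ u, inner ℝ (L (b2 A)) (L u) = b2.repr u A := by
    intro u
    conv_lhs => rw [← b2.sum_repr u]
    simp only [map_add, map_smul, Fin.sum_univ_two, inner_add_right, inner_smul_right, h]
    fin_cases A <;> simp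
  rw [← h', ← h', huv]

theorem sphereIncl_injective (s : S2) {u v : E2}
    (h : (sphereIncl s : E2 →L[ℝ] E3) u = (sphereIncl s : E2 →L[ℝ] E3) v) : u = v :=
  injective_of_orthonormal (inner_frame s) h

/-- The co-exact covector `ε_B^C ∇_C ν` has the components `rotStar ν` along the rotation
fields. -/
theorem sphereVol_gradient {f : S2 → ℝ} (hf : SmoothS f) (s : S2) (v : E2) :
    (sphereVol s : E2 →ₗ[ℝ] E2 →ₗ[ℝ] ℝ) v (gradient b2 sphereMetric f s) =
      ∑ i, rotStar f i s * cr s ((sphereIncl s : E2 →L[ℝ] E3) v) i := by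
  have h1 : (Matrix.of fun k l => sphereMetric s (b2 k) (b2 l)) = 1 := by
    ext k l; rw [Matrix.one_apply]; exact inner_frame s k l
  have h2 : (gradient b2 sphereMetric f s : E2) =
      ∑ A, (dfun (𝓡 2) f s : E2 →L[ℝ] ℝ) (b2 A) • b2 A := by
    rw [gradient, h1, inv_one]
    refine Finset.sum_congr rfl fun A _ => ?_
    have e : ∀ (c : Fin 2 → ℝ) (x : E2), ∑ j, ((1 : Matrix (Fin 2) (Fin 2) ℝ) A j * c j) • x =
        c A • x := by
      intro c x; simp [Matrix.one_apply]
    exact e _ _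
  have h3 : ∀ L : E2 →L[ℝ] E3, ∀ j, L (gradient b2 sphereMetric f s : E2) j =
      (dfun (𝓡 2) f s : E2 →L[ℝ] ℝ) (b2 0) * L (b2 0) j
        + (dfun (𝓡 2) f s : E2 →L[ℝ] ℝ) (b2 1) * L (b2 1) j := by
    intro L j
    rw [h2]
    simp only [map_add, map_smul, Fin.sum_univ_two, PiLp.add_apply, PiLp.smul_apply, smul_eq_mul]
  have h4 : ∀ A, (dfun (𝓡 2) f s : E2 →L[ℝ] ℝ) (b2 A) = ∑ i, rotD i f s * cr s (frame s A) i :=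
    fun A => dfun_apply hf s (b2 A)
  have h5 : ∀ j, (sphereIncl s : E2 →L[ℝ] E3) (gradient b2 sphereMetric f s) j =
      ∑ i, rotD i f s * rot i s j := by
    intro j
    have h3' : (sphereIncl s : E2 →L[ℝ] E3) (gradient b2 sphereMetric f s) j =
        (dfun (𝓡 2) f s : E2 →L[ℝ] ℝ) (b2 0) * frame s 0 j
          + (dfun (𝓡 2) f s : E2 →L[ℝ] ℝ) (b2 1) * frame s 1 j := h3 (sphereIncl s) j
    refine h3'.trans ?_
    rw [h4, h4]
    have h6 : ∀ i, rot i s j =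
        cr s (frame s 0) i * frame s 0 j + cr s (frame s 1) i * frame s 1 j := by
      intro i
      have hL : ∀ L : E2 →L[ℝ] E3, L (rotField i s) j =
          cr s (frame s 0) i * L (b2 0) j + cr s (frame s 1) i * L (b2 1) j := by
        intro L
        simp only [rotField, map_add, map_smul, Fin.sum_univ_two, PiLp.add_apply, PiLp.smul_apply,
          smul_eq_mul]
      rw [← sphereIncl_rotField]; exact hL _
    simp only [h6, Fin.sum_univ_three]
    ring
  have h7 : (sphereVol s : E2 →ₗ[ℝ] E2 →ₗ[ℝ] ℝ) v (gradient b2 sphereMetric f s) =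
    det3 s ((sphereIncl s : E2 →L[ℝ] E3) v)
      ((sphereIncl s : E2 →L[ℝ] E3) (gradient b2 sphereMetric f s)) := rfl
  rw [h7, det3_eq, h5, h5, h5]
  simp [Fin.sum_univ_three, cr_zero, cr_one, cr_two, rotStar, rot_zero, rot_one, rot_two]
  ring

/-! ### Stereographic coordinates as functions on `ℝ³` -/

theorem continuousOn_sphereProj : ContinuousOn sphereProj {0}ᶜ := by
  have h := contDiffOn_coe_sphereProj.continuousOn
  exact continuousOn_iff_continuous_domRestrict.2 (Continuous.subtype_mk
    (continuousOn_iff_continuous_domRestrict.1 h) _)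

/-- The set of vectors whose direction lies in the chart of the sphere centred at `s`. -/
def chartCone (s : S2) : Set E3 := {0}ᶜ ∩ sphereProj ⁻¹' (extChartAt (𝓡 2) s).source

theorem isOpen_chartCone (s : S2) : IsOpen (chartCone s) :=
  continuousOn_sphereProj.isOpen_inter_preimage isOpen_compl_zero (isOpen_extChartAt_source s)

theorem mem_chartCone {x : E3} (hx : x ≠ 0) : x ∈ chartCone (sphereProj x) :=
  ⟨hx, mem_extChartAt_source _⟩

/-- The stereographic coordinates of the direction of a vector. -/
def chartProj (s : S2) (x : E3) : E2 := extChartAt (𝓡 2) s (sphereProj x)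

theorem symm_chartProj {s : S2} {x : E3} (hx : x ∈ chartCone s) :
    (extChartAt (𝓡 2) s).symm (chartProj s x) = sphereProj x :=
  (extChartAt (𝓡 2) s).left_inv hx.2

theorem sphereParam_chartProj {s : S2} {x : E3} (hx : x ∈ chartCone s) :
    sphereParam s (chartProj s x) = sphereProj x := congrArg Subtype.val (symm_chartProj hx)

theorem contDiffOn_chartProj (s : S2) : ContDiffOn ℝ ∞ (chartProj s) (chartCone s) := by
  obtain ⟨U, hU⟩ := extChartAt_sphere_apply s
  have h1 : ContDiffOn ℝ ∞ (stereoToFun ((-s : S2) : E3))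
      {x : E3 | innerSL ℝ ((-s : S2) : E3) x ≠ (1 : ℝ)} := contDiffOn_stereoToFun
  have h2 : ContDiffOn ℝ ∞ (fun x => (sphereProj x : E3)) (chartCone s) :=
    contDiffOn_coe_sphereProj.mono Set.inter_subset_left
  have h3 := h1.comp h2 fun x hx => by
    have h := sphere_ne_neg_of_mem_source hx.2
    rw [Ne, sphere_ext_iff] at h
    simpa [real_inner_comm] using h
  have h4 := U.toContinuousLinearEquiv.contDiff (n := ∞) |>.comp_contDiffOn h3
  exact h4.congr fun x _ => hU _

/-- The coefficients of the rotation field `e_i × x` with respect to the coordinate vectors. -/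
def rotCoeff (s : S2) (i : Fin 3) (x : E3) : E2 :=
  fderiv ℝ (chartProj s) (sphereProj x : E3) (rot i (sphereProj x : E3))

theorem coe_sphereProj_mem_chartCone {s : S2} {x : E3} (hx : x ∈ chartCone s) :
    (sphereProj x : E3) ∈ chartCone s := by
  refine ⟨S2.coe_ne_zero _, ?_⟩
  rw [Set.mem_preimage, sphereProj_coe]; exact hx.2

theorem contDiffOn_rotCoeff (s : S2) (i : Fin 3) : ContDiffOn ℝ ∞ (rotCoeff s i) (chartCone s) := by
  have h1 : ContDiffOn ℝ ∞ (fderiv ℝ (chartProj s)) (chartCone s) :=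
    (contDiffOn_chartProj s).fderiv_of_isOpen (isOpen_chartCone s) (by simp)
  have h2 : ContDiffOn ℝ ∞ (fun x => (sphereProj x : E3)) (chartCone s) :=
    contDiffOn_coe_sphereProj.mono Set.inter_subset_left
  exact (h1.comp h2 fun x hx => coe_sphereProj_mem_chartCone hx).clm_apply
    ((rot i).contDiff.comp_contDiffOn h2)

/-- The rotation fields in terms of the coordinate vectors of a fixed chart. -/
theorem rotField_eq_coordVec {s : S2} {x : E3} (hx : x ∈ chartCone s) (i : Fin 3) :
    rotField i (sphereProj x) =
      (mfderiv 𝓘(ℝ, E2) (𝓡 2) (extChartAt (𝓡 2) s).symm (chartProj s x) : E2 →L[ℝ] E2)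
        (rotCoeff s i x) := by
  set q := sphereProj x with hq
  have hq' := coe_sphereProj_mem_chartCone hx
  have hκ : chartProj s (q : E3) = chartProj s x := by simp [chartProj, sphereProj_coe, hq]
  refine sphereIncl_injective q ?_
  rw [sphereIncl_rotField]
  have h1 : ∀ c : E2, (sphereIncl q : E2 →L[ℝ] E3)
      ((mfderiv 𝓘(ℝ, E2) (𝓡 2) (extChartAt (𝓡 2) s).symm (chartProj s x) : E2 →L[ℝ] E2) c) =
        fderiv ℝ (sphereParam s) (chartProj s x) c := by
    intro c
    have hm : MDifferentiableAt (𝓡 2) 𝓘(ℝ, E3) (fun x : S2 => (x : E3))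
        ((extChartAt (𝓡 2) s).symm (chartProj s x)) :=
      (contMDiff_coe_sphere (n := 2) (m := ∞)).mdifferentiableAt (by simp)
    have h := mfderiv_comp (chartProj s x) hm (mdifferentiableAt_extChartAt_symm (I := 𝓡 2)
      (by rw [extChartAt_sphere_target]; trivial))
    have h' : fderiv ℝ (sphereParam s) (chartProj s x) = _ := mfderiv_eq_fderiv.symm.trans h
    exact (sphereIncl_congr (symm_chartProj hx).symm _).trans
      (congrArg (fun L : E2 →L[ℝ] E3 => L c) h').symm
  refine Eq.trans ?_ (h1 _).symm
  have h2 : HasFDerivAt (chartProj s) _ (q : E3) :=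
    (((contDiffOn_chartProj s).contDiffAt ((isOpen_chartCone s).mem_nhds hq')).differentiableAt
      (by simp)).hasFDerivAt
  have h3 : HasFDerivAt (sphereParam s) _ (chartProj s (q : E3)) :=
    ((contDiff_sphereParam s).differentiable (by simp) _).hasFDerivAt
  have h4 : HasFDerivAt (fun x => (sphereProj x : E3)) _ (q : E3) :=
    (h3.comp (q : E3) h2).congr_of_eventuallyEq (by
      filter_upwards [(isOpen_chartCone s).mem_nhds hq'] with z hz
      exact (sphereParam_chartProj hz).symm)
  ext j
  rw [← rotD_coord, rotD]
  have h5 := (EuclideanSpace.proj j : E3 →L[ℝ] ℝ).hasFDerivAt.comp (q : E3) h4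
  have h6 : fderiv ℝ (fun x : E3 => (sphereProj x : E3) j) q = _ := h5.fderiv
  rw [h6, hκ]
  rfl

end

section

/-! ### Components on the product with the sphere -/

section Product

open Topology

variable {M : Type*} [TopologicalSpace M] [ChartedSpace E2 M] [IsManifold (𝓡 2) ∞ M]

omit [IsManifold (𝓡 2) ∞ M] in
theorem extChartAt_prod_self (p : M) (s : S2) :
    extChartAt I4 (p, s) (p, s) = (extChartAt (𝓡 2) p p, (0 : E2)) := by
  rw [← extChartAt_sphere_self s]; rfl

omit [IsManifold (𝓡 2) ∞ M] in
theorem extChartAt_prod_target (p : M) (s : S2) :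
    (extChartAt I4 (p, s)).target = (extChartAt (𝓡 2) p).target ×ˢ Set.univ := by
  rw [extChartAt_prod, PartialEquiv.prod_target, extChartAt_sphere_target]

theorem mem_sphere_target (s : S2) (w : E2) : w ∈ (extChartAt (𝓡 2) s).target := by
  rw [extChartAt_sphere_target]; trivial

/-- The inverse of a chart of the product acts componentwise. -/
theorem mfderiv_symm_prod (p : M) (s : S2) {y : E2} (hy : y ∈ (extChartAt (𝓡 2) p).target)
    (w : E2) (u : E2 × E2) :
    ((mfderiv 𝓘(ℝ, E2 × E2) I4 (extChartAt I4 (p, s)).symm (y, w) :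
        E2 × E2 →L[ℝ] E2 × E2) u) =
      ((mfderiv 𝓘(ℝ, E2) (𝓡 2) (extChartAt (𝓡 2) p).symm y : E2 →L[ℝ] E2) u.1,
        (mfderiv 𝓘(ℝ, E2) (𝓡 2) (extChartAt (𝓡 2) s).symm w : E2 →L[ℝ] E2) u.2) := by
  have hφ : MDifferentiableAt 𝓘(ℝ, E2) (𝓡 2) (extChartAt (𝓡 2) p).symm y :=
    mdifferentiableAt_extChartAt_symm hy
  have hψ : MDifferentiableAt 𝓘(ℝ, E2) (𝓡 2) (extChartAt (𝓡 2) s).symm w :=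
    mdifferentiableAt_extChartAt_symm (mem_sphere_target s w)
  have hf : MDifferentiableAt 𝓘(ℝ, E2 × E2) 𝓘(ℝ, E2) (Prod.fst : E2 × E2 → E2) (y, w) :=
    differentiableAt_fst.mdifferentiableAt
  have hs : MDifferentiableAt 𝓘(ℝ, E2 × E2) 𝓘(ℝ, E2) (Prod.snd : E2 × E2 → E2) (y, w) :=
    differentiableAt_snd.mdifferentiableAt
  have h1 := mfderiv_comp (y, w) (f := (Prod.fst : E2 × E2 → E2)) hφ hf
  have h2 := mfderiv_comp (y, w) (f := (Prod.snd : E2 × E2 → E2)) hψ hs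
  have h3 := mfderiv_prodMk (MDifferentiableAt.comp (y, w) (f := (Prod.fst : E2 × E2 → E2)) hφ hf)
    (MDifferentiableAt.comp (y, w) (f := (Prod.snd : E2 × E2 → E2)) hψ hs)
  rw [h1, h2, mfderiv_eq_fderiv, mfderiv_eq_fderiv, fderiv_fst, fderiv_snd] at h3
  exact congrArg (fun L : E2 × E2 →L[ℝ] E2 × E2 => L u) h3

theorem b4_inl (L₁ L₂ : E2 →L[ℝ] E2) (a : Fin 2) :
    (L₁ (b4 (Sum.inl a)).1, L₂ (b4 (Sum.inl a)).2) = (L₁ (b2 a), (0 : E2)) := by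
  simp [b4]

theorem b4_inr (L₁ L₂ : E2 →L[ℝ] E2) (B : Fin 2) :
    (L₁ (b4 (Sum.inr B)).1, L₂ (b4 (Sum.inr B)).2) = ((0 : E2), L₂ (b2 B)) := by
  simp [b4]

theorem coordVec_inl (p : M) (s : S2) (a : Fin 2) {y : E2}
    (hy : y ∈ (extChartAt (𝓡 2) p).target) (w : E2) :
    (coordVec I4 b4 (p, s) (Sum.inl a) (y, w) : E2 × E2) =
      ((coordVec (𝓡 2) b2 p a y : E2), (0 : E2)) :=
  (mfderiv_symm_prod p s hy w (b4 (Sum.inl a))).trans (b4_inl _ _ a)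

theorem coordVec_inr (p : M) (s : S2) (B : Fin 2) {y : E2}
    (hy : y ∈ (extChartAt (𝓡 2) p).target) (w : E2) :
    (coordVec I4 b4 (p, s) (Sum.inr B) (y, w) : E2 × E2) =
      ((0 : E2), (coordVec (𝓡 2) b2 s B w : E2)) :=
  (mfderiv_symm_prod p s hy w (b4 (Sum.inr B))).trans (b4_inr _ _ B)

theorem comp₁_inl (A : OneForm I4 (M × S2)) (p : M) (s : S2) (a : Fin 2) {y : E2}
    (hy : y ∈ (extChartAt (𝓡 2) p).target) (w : E2) :
    comp₁ b4 A (p, s) (Sum.inl a) (y, w) =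
      comp₁ b2 (orbitPart A ((extChartAt (𝓡 2) s).symm w)) p a y :=
  congrArg (A ((extChartAt I4 (p, s)).symm (y, w)) : E2 × E2 →L[ℝ] ℝ) (coordVec_inl p s a hy w)

theorem comp₁_inr (A : OneForm I4 (M × S2)) (p : M) (s : S2) (B : Fin 2) {y : E2}
    (hy : y ∈ (extChartAt (𝓡 2) p).target) (w : E2) :
    comp₁ b4 A (p, s) (Sum.inr B) (y, w) =
      comp₁ b2 (spherePart A ((extChartAt (𝓡 2) p).symm y)) s B w :=
  congrArg (A ((extChartAt I4 (p, s)).symm (y, w)) : E2 × E2 →L[ℝ] ℝ) (coordVec_inr p s B hy w)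

/-- The components of `α_a dx^a` in the chart at `p`, as a family of functions on the sphere. -/
def orbitFam (α : AngularOneForm M) (p : M) (a : Fin 2) (y : E2) (s : S2) : ℝ :=
  comp₁ b2 (α s) p a y

/-- The components of the angular part of `A` along the rotation fields. -/
def angFam (A : OneForm I4 (M × S2)) (q : M) (i : Fin 3) (s : S2) : ℝ :=
  (spherePart A q s : E2 →L[ℝ] ℝ) (rotField i s)

/-- A scalar field, in the chart at `p`, as a family of functions on the sphere. -/
def scalarFam (f : M × S2 → ℝ) (p : M) (y : E2) (s : S2) : ℝ := f ((extChartAt (𝓡 2) p).symm y, s)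

omit [IsManifold (𝓡 2) ∞ M] in
theorem coord_mul_angFam (A : OneForm I4 (M × S2)) (q : M) (s : S2) :
    s.1 0 * angFam A q 0 s + s.1 1 * angFam A q 1 s + s.1 2 * angFam A q 2 s = 0 :=
  coord_mul_rotField s _

omit [IsManifold (𝓡 2) ∞ M] in
theorem comp₁_spherePart (A : OneForm I4 (M × S2)) (q : M) (s : S2) (B : Fin 2) :
    comp₁ b2 (spherePart A q) s B = angular (angFam A q) s B := by
  funext w
  refine (covector_eq_sum_rotField ((extChartAt (𝓡 2) s).symm w) _ _).trans ?_
  have h := sphereIncl_coordVec s B w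
  exact Finset.sum_congr rfl fun i _ => congrArg
    (fun v => angFam A q i ((extChartAt (𝓡 2) s).symm w) * cr (sphereParam s w) v i) h

/-- Smoothness in the charts of the product is smoothness as a family of functions on the
sphere. -/
theorem smoothFam_iff_contDiffOn {U : Set E2} {f : E2 → S2 → ℝ} : SmoothFam U f ↔
    ∀ s, ContDiffOn ℝ ∞ (fun z : E2 × E2 => f z.1 ((extChartAt (𝓡 2) s).symm z.2))
      (U ×ˢ Set.univ) := by
  refine ⟨fun h s => ?_, fun h => ?_⟩
  · have h1 : ContDiffOn ℝ ∞ (fun z : E2 × E2 => (z.1, sphereParam s z.2)) (U ×ˢ Set.univ) :=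
      (contDiff_fst.prodMk ((contDiff_sphereParam s).comp contDiff_snd)).contDiffOn
    have h2 := ContDiffOn.comp (g := fun z : E2 × E3 => f z.1 (sphereProj z.2)) h h1
      fun z hz => ⟨hz.1, sphereParam_ne_zero s z.2⟩
    simpa only [Function.comp_def, sphereProj_sphereParam] using h2
  · rintro ⟨y, x⟩ ⟨hy, hx⟩
    have h1 : ContDiffOn ℝ ∞ (fun z : E2 × E3 => (z.1, chartProj (sphereProj x) z.2))
        (U ×ˢ chartCone (sphereProj x)) :=
      contDiffOn_fst.prodMk ((contDiffOn_chartProj _).comp contDiffOn_snd fun z hz => hz.2)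
    have h2 := (h (sphereProj x)).comp h1 fun z hz => ⟨hz.1, trivial⟩
    have h3 : ContDiffWithinAt ℝ ∞ (fun z : E2 × E3 => f z.1 (sphereProj z.2))
        (U ×ˢ chartCone (sphereProj x)) (y, x) :=
      (h2.congr fun z hz => by simp only [Function.comp_def, symm_chartProj hz.2]) (y, x)
        ⟨hy, mem_chartCone hx⟩
    refine h3.mono_of_mem_nhdsWithin ?_
    rw [nhdsWithin_prod_eq]
    exact Filter.prod_mem_prod self_mem_nhdsWithin
      (mem_nhdsWithin_of_mem_nhds ((isOpen_chartCone _).mem_nhds (mem_chartCone hx)))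

theorem smoothScalar_iff {f : M × S2 → ℝ} :
    SmoothScalar f ↔ ∀ p, SmoothFam (extChartAt (𝓡 2) p).target (scalarFam f p) := by
  constructor
  · intro h p
    refine smoothFam_iff_contDiffOn.2 fun s => ?_
    have := ContMDiff.contDiffOn_chart (I := I4) h (p, s)
    rwa [extChartAt_prod_target] at this
  · intro h
    refine contMDiff_of_contDiffOn_chart (I := I4) fun x => ?_
    rw [show x = (x.1, x.2) from rfl, extChartAt_prod_target]
    exact smoothFam_iff_contDiffOn.1 (h x.1) x.2

/-- A one-form on the product is smooth if and only if its components along the coordinate vectors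
of `M` and along the rotation fields are smooth families of functions on the sphere. -/
theorem smooth₁_iff {A : OneForm I4 (M × S2)} : Smooth₁ b4 A ↔
    (∀ p a, SmoothFam (extChartAt (𝓡 2) p).target (orbitFam (orbitPart A) p a)) ∧
    ∀ p i, SmoothFam (extChartAt (𝓡 2) p).target
      fun y => angFam A ((extChartAt (𝓡 2) p).symm y) i := by
  constructor
  · intro h
    refine ⟨fun p a => smoothFam_iff_contDiffOn.2 fun s => ?_, fun p i => ?_⟩
    · have := h (p, s) (Sum.inl a)
      rw [extChartAt_prod_target] at this
      exact this.congr fun z hz => (comp₁_inl A p s a hz.1 z.2).symm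
    · rintro ⟨y, x⟩ ⟨hy, hx⟩
      set U := (extChartAt (𝓡 2) p).target
      set s := sphereProj x with hs
      have h1 : ContDiffOn ℝ ∞ (fun z : E2 × E3 => (z.1, chartProj s z.2)) (U ×ˢ chartCone s) :=
        contDiffOn_fst.prodMk ((contDiffOn_chartProj _).comp contDiffOn_snd fun z hz => hz.2)
      have h2 : ∀ B, ContDiffOn ℝ ∞ (fun z : E2 × E3 =>
          comp₁ b4 A (p, s) (Sum.inr B) (z.1, chartProj s z.2)) (U ×ˢ chartCone s) := fun B => by
        have := h (p, s) (Sum.inr B)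
        rw [extChartAt_prod_target] at this
        exact this.comp h1 fun z hz => ⟨hz.1, trivial⟩
      have h4 : ∀ B, ContDiffOn ℝ ∞ (fun z : E2 × E3 => rotCoeff s i z.2 B) (U ×ˢ chartCone s) :=
        fun B => (contDiffOn_euclidean.1 (contDiffOn_rotCoeff s i) B).comp contDiffOn_snd
          fun z hz => hz.2
      have h5 : ContDiffOn ℝ ∞ (fun z : E2 × E3 => ∑ B, rotCoeff s i z.2 B *
          comp₁ b4 A (p, s) (Sum.inr B) (z.1, chartProj s z.2)) (U ×ˢ chartCone s) :=
        ContDiffOn.sum fun B _ => (h4 B).mul (h2 B)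
      have h3 : ContDiffWithinAt ℝ ∞ (fun z : E2 × E3 =>
          angFam A ((extChartAt (𝓡 2) p).symm z.1) i (sphereProj z.2))
          (U ×ˢ chartCone s) (y, x) := by
        refine (h5.congr fun z hz => ?_) (y, x) ⟨hy, mem_chartCone hx⟩
        set β := spherePart A ((extChartAt (𝓡 2) p).symm z.1)
        have e1 : angFam A ((extChartAt (𝓡 2) p).symm z.1) i (sphereProj z.2) =
            (β (sphereProj z.2) : E2 →L[ℝ] ℝ) _ :=
          congrArg (β (sphereProj z.2) : E2 →L[ℝ] ℝ) (rotField_eq_coordVec hz.2 i)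
        have e2 := linear_comp_eq_sum_repr b2
          (β ((extChartAt (𝓡 2) s).symm (chartProj s z.2)) : E2 →L[ℝ] ℝ)
          (mfderiv 𝓘(ℝ, E2) (𝓡 2) (extChartAt (𝓡 2) s).symm (chartProj s z.2)) (rotCoeff s i z.2)
        refine e1.trans ((oneForm_congr β (symm_chartProj hz.2).symm _).trans (e2.trans ?_))
        exact Finset.sum_congr rfl fun B _ => congrArg₂ (· * ·) rfl
          (comp₁_inr A p s B hz.1 _).symm
      refine h3.mono_of_mem_nhdsWithin ?_
      rw [nhdsWithin_prod_eq]
      exact Filter.prod_mem_prod self_mem_nhdsWithin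
        (mem_nhdsWithin_of_mem_nhds ((isOpen_chartCone _).mem_nhds (mem_chartCone hx)))
  · rintro ⟨h1, h2⟩ ⟨p, s⟩ (a | B)
    · rw [extChartAt_prod_target]
      exact (smoothFam_iff_contDiffOn.1 (h1 p a) s).congr fun z hz => comp₁_inl A p s a hz.1 z.2
    · rw [extChartAt_prod_target]
      have h3 : ContDiffOn ℝ ∞ (fun z : E2 × E2 =>
          angular (angFam A ((extChartAt (𝓡 2) p).symm z.1)) s B z.2)
          ((extChartAt (𝓡 2) p).target ×ˢ Set.univ) :=
        ContDiffOn.sum fun i _ => (smoothFam_iff_contDiffOn.1 (h2 p i) s).mul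
          (((contDiff_cr (contDiff_sphereParam s) (contDiff_dParam s B) i).comp
            contDiff_snd).contDiffOn)
      refine h3.congr fun z hz => ?_
      rw [← comp₁_spherePart]
      exact comp₁_inr A p s B hz.1 z.2

theorem angularOneForm_smooth_iff {α : AngularOneForm M} :
    α.Smooth ↔ ∀ p a, SmoothFam (extChartAt (𝓡 2) p).target (orbitFam α p a) := by
  rw [AngularOneForm.Smooth, smooth₁_iff]
  refine ⟨fun h => h.1, fun h => ⟨h, fun p i => ?_⟩⟩
  refine ((SmoothS.const 0).fam _).congr fun y _ => ?_
  funext s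
  exact map_zero (α s ((extChartAt (𝓡 2) p).symm y) : E2 →L[ℝ] ℝ)

end Product

end

/-! ### Scalar potentials of the angular part of a one-form -/

section

section Potentials

variable {M : Type*} [TopologicalSpace M] [ChartedSpace E2 M]

section
variable [IsManifold (𝓡 2) ∞ M]

omit [IsManifold (𝓡 2) ∞ M] in
theorem symm_extChartAt_self (p : M) :
    (extChartAt (𝓡 2) p).symm (extChartAt (𝓡 2) p p) = p :=
  (extChartAt (𝓡 2) p).left_inv (mem_extChartAt_source p)

theorem SmoothScalar.slice {f : M × S2 → ℝ} (hf : SmoothScalar f) (q : M) :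
    SmoothS fun s => f (q, s) := by
  have h := (smoothScalar_iff.1 hf q).slice (mem_extChartAt_target q)
  have e : scalarFam f q (extChartAt (𝓡 2) q q) = fun s => f (q, s) := by
    funext s; rw [scalarFam, symm_extChartAt_self]
  rwa [e] at h

theorem Smooth₁.angFam {A : OneForm I4 (M × S2)} (hA : Smooth₁ b4 A) (q : M) (i : Fin 3) :
    SmoothS (angFam A q i) := by
  have h := ((smooth₁_iff.1 hA).2 q i).slice (mem_extChartAt_target q)
  simpa only [symm_extChartAt_self] using h
end

/-- The Helmholtz–Hodge decomposition of a tangential covector field on the sphere. -/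
theorem hodge {b : Fin 3 → S2 → ℝ} (hb : ∀ i, SmoothS (b i))
    (ht : ∀ s : S2, s.1 0 * b 0 s + s.1 1 * b 1 s + s.1 2 * b 2 s = 0) (i : Fin 3) (s : S2) :
    b i s = rotD i (invLap (rotDiv b)) s + rotStar (invLap fun s => -rotCurl b s) i s := by
  have hd : SmoothS (rotDiv b) := .rotDiv hb
  have hc : SmoothS fun s => -rotCurl b s := by
    refine SmoothS.neg (SmoothS.sum fun i => (SmoothS.coord i).mul ?_)
    exact ((hb _).rotD _).sub ((hb _).rotD _)
  have ac : avg (fun s => -rotCurl b s) = 0 := by rw [avg_neg, avg_rotCurl hb ht, neg_zero]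
  have hct : ∀ s : S2, s.1 0 * (rotD 0 (invLap (rotDiv b)) s +
      rotStar (invLap fun s => -rotCurl b s) 0 s) + s.1 1 * (rotD 1 (invLap (rotDiv b)) s +
      rotStar (invLap fun s => -rotCurl b s) 1 s) + s.1 2 * (rotD 2 (invLap (rotDiv b)) s +
      rotStar (invLap fun s => -rotCurl b s) 2 s) = 0 := fun s => by
    linear_combination coord_mul_rotD (invLap (rotDiv b)) s
      + coord_mul_rotStar (invLap fun s => -rotCurl b s) s
  have h := eq_of_rotDiv_rotCurl (c := fun i s => rotD i (invLap (rotDiv b)) s +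
    rotStar (invLap fun s => -rotCurl b s) i s) hb
    (fun i => (hd.invLap.rotD i).add (hc.invLap.rotStar i)) ht hct
    (fun s => by rw [rotDiv_potentials hd.invLap hc.invLap, rotLap_invLap hd (avg_rotDiv hb)])
    (fun s => by rw [rotCurl_potentials hd.invLap hc.invLap, rotLap_invLap hc ac, neg_neg])
  exact h i s

theorem SmoothFam.rotDiv {U : Set E2} (hU : IsOpen U) {b : Fin 3 → E2 → S2 → ℝ}
    (hb : ∀ i, SmoothFam U (b i)) : SmoothFam U fun y => rotDiv fun i => b i y :=
  SmoothFam.sum fun i => (hb i).rotD hU i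

theorem SmoothFam.rotCurl {U : Set E2} (hU : IsOpen U) {b : Fin 3 → E2 → S2 → ℝ}
    (hb : ∀ i, SmoothFam U (b i)) : SmoothFam U fun y => rotCurl fun i => b i y :=
  SmoothFam.sum fun i => ((SmoothS.coord i).fam U).mul
    (((hb _).rotD hU _).sub ((hb _).rotD hU _))

/-- The decomposition `β_B = ∇_B μ + ε_B^C ∇_C ν` in the rotation frame. -/
theorem angular_decomp_iff (A : OneForm I4 (M × S2)) {μ ν : M × S2 → ℝ} {q : M}
    (hμ : SmoothS fun s => μ (q, s)) (hν : SmoothS fun s => ν (q, s)) :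
    (∀ (s : S2) (v : TangentSpace (𝓡 2) s),
      spherePart A q s v = dfun (𝓡 2) (fun s' => μ (q, s')) s v
        + sphereVol s v (gradient b2 sphereMetric (fun s' => ν (q, s')) s)) ↔
    ∀ i s, angFam A q i s = rotD i (fun s => μ (q, s)) s + rotStar (fun s => ν (q, s)) i s := by
  have e : ∀ (s : S2) (v : E2), dfun (𝓡 2) (fun s' => μ (q, s')) s v
        + sphereVol s v (gradient b2 sphereMetric (fun s' => ν (q, s')) s) =
      ∑ i, (rotD i (fun s => μ (q, s)) s + rotStar (fun s => ν (q, s)) i s) *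
        cr s ((sphereIncl s : E2 →L[ℝ] E3) v) i := by
    intro s v
    simp only [add_mul, Finset.sum_add_distrib]
    exact congrArg₂ (· + ·) (dfun_apply hμ s v) (sphereVol_gradient hν s v)
  constructor
  · intro h i s
    refine (eq_apply_rotField (β := spherePart A q s) (c := fun i =>
      rotD i (fun s => μ (q, s)) s + rotStar (fun s => ν (q, s)) i s) ?_
      (fun v => (h s v).trans (e s v)) i).symm
    linear_combination coord_mul_rotD (fun s => μ (q, s)) s
      + coord_mul_rotStar (fun s => ν (q, s)) s
  · intro h s v
    refine Eq.trans ?_ (e s v).symm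
    refine (covector_eq_sum_rotField s (spherePart A q s) v).trans ?_
    exact Finset.sum_congr rfl fun i _ => congrArg (· * _) (h i s)

variable [IsManifold (𝓡 2) ∞ M]

omit [TopologicalSpace M] [ChartedSpace E2 M] [IsManifold (𝓡 2) ∞ M] in
theorem MonopoleFree.avg {f : M × S2 → ℝ} (hf : MonopoleFree f) (q : M) :
    avg (fun s => f (q, s)) = 0 := (zeroMean_iff _).1 (hf q)

theorem IsAngularPotentials.angFam_eq {A : OneForm I4 (M × S2)} {μ ν : M × S2 → ℝ}
    (h : IsAngularPotentials A μ ν) (q : M) (i : Fin 3) (s : S2) :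
    angFam A q i s = rotD i (fun s => μ (q, s)) s + rotStar (fun s => ν (q, s)) i s :=
  (angular_decomp_iff A (h.smooth_even.slice q) (h.smooth_odd.slice q)).1 (h.decomp q) i s

theorem IsAngularPotentials.unique {A : OneForm I4 (M × S2)} {μ ν μ' ν' : M × S2 → ℝ}
    (h : IsAngularPotentials A μ ν) (h' : IsAngularPotentials A μ' ν') : μ = μ' ∧ ν = ν' := by
  have e : ∀ q, (fun s => μ (q, s)) = (fun s => μ' (q, s)) ∧
      (fun s => ν (q, s)) = (fun s => ν' (q, s)) := fun q =>
    potentials_unique (h.smooth_even.slice q) (h.smooth_odd.slice q) (h'.smooth_even.slice q)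
      (h'.smooth_odd.slice q) (h.monopoleFree_even.avg q) (h.monopoleFree_odd.avg q)
      (h'.monopoleFree_even.avg q) (h'.monopoleFree_odd.avg q)
      fun i s => by rw [← h.angFam_eq, ← h'.angFam_eq]
  exact ⟨funext fun x => congrFun (e x.1).1 x.2, funext fun x => congrFun (e x.1).2 x.2⟩

/-- The potentials solve Poisson equations, whose sources are the divergence and the curl of the
angular part. -/
theorem exists_angularPotentials {A : OneForm I4 (M × S2)} (hA : Smooth₁ b4 A) :
    ∃ μ ν, IsAngularPotentials A μ ν := by
  have hs := (smooth₁_iff.1 hA).2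
  have hμ : SmoothScalar fun x : M × S2 => invLap (rotDiv (angFam A x.1)) x.2 :=
    smoothScalar_iff.2 fun p => SmoothFam.invLap (isOpen_extChartAt_target p)
      (SmoothFam.rotDiv (isOpen_extChartAt_target p) (hs p))
  have hν : SmoothScalar fun x : M × S2 => invLap (fun s => -rotCurl (angFam A x.1) s) x.2 :=
    smoothScalar_iff.2 fun p => SmoothFam.invLap (isOpen_extChartAt_target p)
      (SmoothFam.rotCurl (isOpen_extChartAt_target p) (hs p)).neg
  have aμ : ∀ q, avg (invLap (rotDiv (angFam A q))) = 0 := fun q =>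
    avg_invLap (SmoothS.rotDiv (hA.angFam q))
  have aν : ∀ q, avg (invLap fun s => -rotCurl (angFam A q) s) = 0 := fun q => by
    refine avg_invLap (SmoothS.neg (SmoothS.sum fun i => (SmoothS.coord i).mul ?_))
    exact ((hA.angFam q _).rotD _).sub ((hA.angFam q _).rotD _)
  have hd := fun q : M => (angular_decomp_iff A
    (μ := fun x : M × S2 => invLap (rotDiv (angFam A x.1)) x.2)
    (ν := fun x : M × S2 => invLap (fun s => -rotCurl (angFam A x.1) s) x.2)
    (hμ.slice q) (hν.slice q)).2 fun i s => hodge (hA.angFam q) (coord_mul_angFam A q) i s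
  exact ⟨_, _, hμ, hν, fun q => (zeroMean_iff _).2 (aμ q), fun q => (zeroMean_iff _).2 (aν q), hd⟩

end Potentials

end

/-! ### Two-dimensional Lorentzian metrics in coordinates -/

section

open Topology

/-- The divergence `g^{ij} ∇_i w_j` in coordinates. -/
def coordDiv {ι E : Type*} [Fintype ι] [DecidableEq ι] [NormedAddCommGroup E] [NormedSpace ℝ E]
    (b : Module.Basis ι ℝ E) (G : ι → ι → E → ℝ) (w : ι → E → ℝ) (y : E) : ℝ :=
  ∑ i, ∑ j, ginv G i j y * covDeriv₁ b G w i j y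

/-- The components, in a chart with image `U`, of a smooth two-dimensional Lorentzian metric `G`
and of its volume form `V`. -/
structure LorentzChart (U : Set E2) (G V : Fin 2 → Fin 2 → E2 → ℝ) : Prop where
  isOpen : IsOpen U
  contDiffOn_metric : ∀ i j, ContDiffOn ℝ ∞ (G i j) U
  contDiffOn_vol : ∀ i j, ContDiffOn ℝ ∞ (V i j) U
  symm : G 1 0 = G 0 1
  vol_diag : ∀ i, V i i = 0
  vol_anti : V 1 0 = -V 0 1
  vol_sq : ∀ y ∈ U, G 0 1 y ^ 2 - G 0 0 y * G 1 1 y = V 0 1 y ^ 2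
  vol_ne : ∀ y ∈ U, V 0 1 y ≠ 0

/-- The components `√|g| g^{ab} w_b` of a covector field, as a vector density. -/
def flux (G V : Fin 2 → Fin 2 → E2 → ℝ) (w : Fin 2 → E2 → ℝ) (a : Fin 2) (y : E2) : ℝ :=
  if a = 0 then (G 0 1 y * w 1 y - G 1 1 y * w 0 y) / V 0 1 y
  else (G 0 1 y * w 0 y - G 0 0 y * w 1 y) / V 0 1 y

theorem flux_zero (G V : Fin 2 → Fin 2 → E2 → ℝ) (w : Fin 2 → E2 → ℝ) (y : E2) :
    flux G V w 0 y = (G 0 1 y * w 1 y - G 1 1 y * w 0 y) / V 0 1 y := rfl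
theorem flux_one (G V : Fin 2 → Fin 2 → E2 → ℝ) (w : Fin 2 → E2 → ℝ) (y : E2) :
    flux G V w 1 y = (G 0 1 y * w 0 y - G 0 0 y * w 1 y) / V 0 1 y := rfl

/-- The components of the dual covector `ε_{ab} w^a`. -/
def dual (G V : Fin 2 → Fin 2 → E2 → ℝ) (w : Fin 2 → E2 → ℝ) (b : Fin 2) (y : E2) : ℝ :=
  if b = 0 then -flux G V w 1 y else flux G V w 0 y

theorem dual_zero (G V : Fin 2 → Fin 2 → E2 → ℝ) (w : Fin 2 → E2 → ℝ) (y : E2) :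
    dual G V w 0 y = -flux G V w 1 y := rfl
theorem dual_one (G V : Fin 2 → Fin 2 → E2 → ℝ) (w : Fin 2 → E2 → ℝ) (y : E2) :
    dual G V w 1 y = flux G V w 0 y := rfl

namespace LorentzChart

variable {U : Set E2} {G V : Fin 2 → Fin 2 → E2 → ℝ} (h : LorentzChart U G V)
include h

theorem ginv_eq {y : E2} (hy : y ∈ U) : ginv G 0 0 y = -G 1 1 y / V 0 1 y ^ 2 ∧
    ginv G 0 1 y = G 0 1 y / V 0 1 y ^ 2 ∧ ginv G 1 0 y = G 0 1 y / V 0 1 y ^ 2 ∧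
    ginv G 1 1 y = -G 0 0 y / V 0 1 y ^ 2 := by
  have hs := h.vol_sq y hy
  have hd : (Matrix.of fun k l => G k l y).det = -V 0 1 y ^ 2 := by
    rw [Matrix.det_fin_two]; simp [h.symm]; linear_combination -hs
  have hv := h.vol_ne y hy
  simp only [ginv, Matrix.inv_def, hd, Ring.inverse_eq_inv', Matrix.smul_apply, smul_eq_mul,
    Matrix.adjugate_fin_two]
  simp only [Matrix.of_apply, Matrix.cons_val', Matrix.cons_val_zero, Matrix.cons_val_one,
    h.symm, Matrix.cons_val_fin_one]
  refine ⟨?_, ?_, ?_, ?_⟩ <;> field_simp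

theorem differentiableAt_metric {y : E2} (hy : y ∈ U) (i j : Fin 2) :
    DifferentiableAt ℝ (G i j) y :=
  ((h.contDiffOn_metric i j).contDiffAt (h.isOpen.mem_nhds hy)).differentiableAt (by simp)

theorem differentiableAt_vol {y : E2} (hy : y ∈ U) (i j : Fin 2) :
    DifferentiableAt ℝ (V i j) y :=
  ((h.contDiffOn_vol i j).contDiffAt (h.isOpen.mem_nhds hy)).differentiableAt (by simp)

/-- The derivative of the relation `(V 0 1)² = -det G`. -/
theorem pderiv_vol {y : E2} (hy : y ∈ U) (i : Fin 2) :
    2 * V 0 1 y * pderiv b2 i (V 0 1) y = 2 * G 0 1 y * pderiv b2 i (G 0 1) y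
      - (pderiv b2 i (G 0 0) y * G 1 1 y + G 0 0 y * pderiv b2 i (G 1 1) y) := by
  have hG := fun i j => (h.differentiableAt_metric hy i j).hasFDerivAt
  have hV := (h.differentiableAt_vol hy 0 1).hasFDerivAt
  have h1 := ((hG 0 1).pow 2).sub ((hG 0 0).mul (hG 1 1))
  have h2 := (hV.pow 2).congr_of_eventuallyEq (f₁ := fun y => G 0 1 y ^ 2 - G 0 0 y * G 1 1 y) (by
    filter_upwards [h.isOpen.mem_nhds hy] with z hz using h.vol_sq z hz)
  have h3 := congrArg (fun L : E2 →L[ℝ] ℝ => L (b2 i)) (h1.unique h2)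
  simp only [_root_.sub_apply, _root_.smul_apply, _root_.add_apply, smul_eq_mul, nsmul_eq_mul,
    pow_one, Nat.cast_ofNat, Nat.add_one_sub_one] at h3
  simp only [pderiv]
  linear_combination -h3

theorem pderiv_flux {y : E2} (hy : y ∈ U) {w : Fin 2 → E2 → ℝ}
    (hw : ∀ i, DifferentiableAt ℝ (w i) y) :
    pderiv b2 0 (flux G V w 0) y + pderiv b2 1 (flux G V w 1) y =
      ((pderiv b2 0 (G 0 1) y * w 1 y + G 0 1 y * pderiv b2 0 (w 1) y
        - (pderiv b2 0 (G 1 1) y * w 0 y + G 1 1 y * pderiv b2 0 (w 0) y)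
        + (pderiv b2 1 (G 0 1) y * w 0 y + G 0 1 y * pderiv b2 1 (w 0) y
        - (pderiv b2 1 (G 0 0) y * w 1 y + G 0 0 y * pderiv b2 1 (w 1) y))) * V 0 1 y
        - (G 0 1 y * w 1 y - G 1 1 y * w 0 y) * pderiv b2 0 (V 0 1) y
        - (G 0 1 y * w 0 y - G 0 0 y * w 1 y) * pderiv b2 1 (V 0 1) y) / V 0 1 y ^ 2 := by
  have hG := fun i j => (h.differentiableAt_metric hy i j).hasFDerivAt
  have hV := (h.differentiableAt_vol hy 0 1).hasFDerivAt
  have hw' := fun i => (hw i).hasFDerivAt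
  have hv := h.vol_ne y hy
  have hVi : HasFDerivAt (fun y => (V 0 1 y)⁻¹) _ y := (hasDerivAt_inv hv).comp_hasFDerivAt y hV
  have e0 : flux G V w 0 = fun y => (G 0 1 y * w 1 y - G 1 1 y * w 0 y) * (V 0 1 y)⁻¹ := by
    funext z; rw [flux_zero, div_eq_mul_inv]
  have e1 : flux G V w 1 = fun y => (G 0 1 y * w 0 y - G 0 0 y * w 1 y) * (V 0 1 y)⁻¹ := by
    funext z; rw [flux_one, div_eq_mul_inv]
  have h0 : HasFDerivAt (flux G V w 0) _ y :=
    ((((hG 0 1).mul (hw' 1)).sub ((hG 1 1).mul (hw' 0))).mul hVi).congr_of_eventuallyEq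
      (.of_forall (congrFun e0))
  have h1 : HasFDerivAt (flux G V w 1) _ y :=
    ((((hG 0 1).mul (hw' 0)).sub ((hG 0 0).mul (hw' 1))).mul hVi).congr_of_eventuallyEq
      (.of_forall (congrFun e1))
  simp only [pderiv]
  rw [h0.fderiv, h1.fderiv]
  simp only [_root_.sub_apply, _root_.smul_apply, _root_.add_apply, smul_eq_mul, Pi.mul_apply,
    Pi.sub_apply]
  field_simp
  ring

/-- The divergence of a covector field is the coordinate divergence of its density. -/
theorem coordDiv_eq {y : E2} (hy : y ∈ U) {w : Fin 2 → E2 → ℝ}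
    (hw : ∀ i, DifferentiableAt ℝ (w i) y) :
    coordDiv b2 G w y =
      (pderiv b2 0 (flux G V w 0) y + pderiv b2 1 (flux G V w 1) y) / V 0 1 y := by
  rw [h.pderiv_flux hy hw]
  obtain ⟨i00, i01, i10, i11⟩ := h.ginv_eq hy
  have hv := h.vol_ne y hy
  have hs := h.vol_sq y hy
  have p0 := h.pderiv_vol hy 0
  have p1 := h.pderiv_vol hy 1
  simp only [coordDiv, covDeriv₁, christoffel, Fin.sum_univ_two, h.symm, i00, i01, i10, i11]
  generalize pderiv b2 0 (V 0 1) y = v0 at *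
  generalize pderiv b2 1 (V 0 1) y = v1 at *
  generalize V 0 1 y = v at *
  have q0 : v0 = (2 * G 0 1 y * pderiv b2 0 (G 0 1) y
      - (pderiv b2 0 (G 0 0) y * G 1 1 y + G 0 0 y * pderiv b2 0 (G 1 1) y)) / (2 * v) := by
    field_simp; linear_combination p0
  have q1 : v1 = (2 * G 0 1 y * pderiv b2 1 (G 0 1) y
      - (pderiv b2 1 (G 0 0) y * G 1 1 y + G 0 0 y * pderiv b2 1 (G 1 1) y)) / (2 * v) := by
    field_simp; linear_combination p1
  rw [q0, q1]
  clear p0 p1 q0 q1 i00 i01 i10 i11 hw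
  field_simp
  simp only [show v ^ 2 = G 0 1 y ^ 2 - G 0 0 y * G 1 1 y from hs.symm]
  ring

/-- The curl of a covector field in coordinates. -/
theorem coordCurl_eq {y : E2} (hy : y ∈ U) (w : Fin 2 → E2 → ℝ) :
    ∑ i, ∑ j, (∑ k, ∑ l, ginv G i k y * ginv G j l y * V k l y) * covDeriv₁ b2 G w i j y =
      -(pderiv b2 0 (w 1) y - pderiv b2 1 (w 0) y) / V 0 1 y := by
  obtain ⟨i00, i01, i10, i11⟩ := h.ginv_eq hy
  have hv := h.vol_ne y hy
  have hs := h.vol_sq y hy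
  have d0 : V 0 0 y = 0 := by rw [h.vol_diag]; rfl
  have d1 : V 1 1 y = 0 := by rw [h.vol_diag]; rfl
  have d2 : V 1 0 y = -V 0 1 y := by rw [h.vol_anti]; rfl
  have e : ∀ k, christoffel b2 G k 1 0 y = christoffel b2 G k 0 1 y := fun k => by
    simp only [christoffel, h.symm, add_comm]
  simp only [covDeriv₁, Fin.sum_univ_two, e, i00, i01, i10, i11, d0, d1, d2]
  generalize V 0 1 y = v at *
  clear i00 i01 i10 i11
  field_simp
  linear_combination (v * (pderiv b2 1 (w 0) y - pderiv b2 0 (w 1) y)) * hs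

/-- The divergence of a two-form `f dx⁰ ∧ dx¹` is the dual of the differential of the scalar
`f / V 0 1`. -/
theorem sum_covDeriv₂_eq {y : E2} (hy : y ∈ U) {f : E2 → ℝ} (hf : DifferentiableAt ℝ f y)
    {T : Fin 2 → Fin 2 → E2 → ℝ} (h00 : T 0 0 = 0) (h11 : T 1 1 = 0) (h01 : T 0 1 = f)
    (h10 : T 1 0 = -f) (j : Fin 2) :
    ∑ k, ∑ i, ginv G k i y * covDeriv₂ b2 G T k i j y =
      dual G V (fun i => pderiv b2 i fun y => f y / V 0 1 y) j y := by
  obtain ⟨i00, i01, i10, i11⟩ := h.ginv_eq hy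
  have hv := h.vol_ne y hy
  have hs := h.vol_sq y hy
  have p0 := h.pderiv_vol hy 0
  have p1 := h.pderiv_vol hy 1
  have hV := (h.differentiableAt_vol hy 0 1).hasFDerivAt
  have hVi : HasFDerivAt (fun y => (V 0 1 y)⁻¹) _ y := (hasDerivAt_inv hv).comp_hasFDerivAt y hV
  have hq : ∀ i, pderiv b2 i (fun y => f y / V 0 1 y) y =
      (pderiv b2 i f y * V 0 1 y - f y * pderiv b2 i (V 0 1) y) / V 0 1 y ^ 2 := by
    intro i
    have h1 : HasFDerivAt (fun y => f y / V 0 1 y) _ y :=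
      (hf.hasFDerivAt.mul hVi).congr_of_eventuallyEq (.of_forall fun z => div_eq_mul_inv _ _)
    rw [pderiv, h1.fderiv]
    simp only [pderiv, _root_.smul_apply, _root_.add_apply, smul_eq_mul]
    field_simp
    ring
  have z0 : ∀ i, pderiv b2 i (0 : E2 → ℝ) y = 0 := fun i => by
    simp [pderiv, show (0 : E2 → ℝ) = fun _ => 0 from rfl]
  have zn : ∀ i, pderiv b2 i (-f) y = -pderiv b2 i f y := fun i => by
    simp [pderiv, fderiv_neg]
  have e : ∀ k, christoffel b2 G k 1 0 y = christoffel b2 G k 0 1 y := fun k => by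
    simp only [christoffel, h.symm, add_comm]
  have key : ∀ j, dual G V (fun i => pderiv b2 i fun y => f y / V 0 1 y) j y = if j = 0 then
      -((G 0 1 y * ((pderiv b2 0 f y * V 0 1 y - f y * pderiv b2 0 (V 0 1) y) / V 0 1 y ^ 2)
        - G 0 0 y * ((pderiv b2 1 f y * V 0 1 y - f y * pderiv b2 1 (V 0 1) y) / V 0 1 y ^ 2))
          / V 0 1 y)
      else (G 0 1 y * ((pderiv b2 1 f y * V 0 1 y - f y * pderiv b2 1 (V 0 1) y) / V 0 1 y ^ 2)
        - G 1 1 y * ((pderiv b2 0 f y * V 0 1 y - f y * pderiv b2 0 (V 0 1) y) / V 0 1 y ^ 2))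
          / V 0 1 y := by
    intro j
    fin_cases j
    · simp only [dual, flux, hq]; simp
    · simp only [dual, flux, hq]; simp
  rw [key]
  have q0 : pderiv b2 0 (V 0 1) y = (2 * G 0 1 y * pderiv b2 0 (G 0 1) y
      - (pderiv b2 0 (G 0 0) y * G 1 1 y + G 0 0 y * pderiv b2 0 (G 1 1) y)) / (2 * V 0 1 y) := by
    field_simp; linear_combination p0
  have q1 : pderiv b2 1 (V 0 1) y = (2 * G 0 1 y * pderiv b2 1 (G 0 1) y
      - (pderiv b2 1 (G 0 0) y * G 1 1 y + G 0 0 y * pderiv b2 1 (G 1 1) y)) / (2 * V 0 1 y) := by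
    field_simp; linear_combination p1
  rw [q0, q1]
  clear p0 p1 q0 q1 hq key e
  generalize V 0 1 y = v at *
  fin_cases j
  · simp only [covDeriv₂, christoffel, Fin.sum_univ_two, h.symm, i00, i01, i10, i11, h00, h01, h10,
      h11, z0, zn, Pi.zero_apply, Pi.neg_apply, Fin.zero_eta, if_true, mul_zero]
    clear i00 i01 i10 i11
    field_simp
    simp only [show v ^ 2 = G 0 1 y ^ 2 - G 0 0 y * G 1 1 y from hs.symm]
    ring
  · simp only [covDeriv₂, christoffel, Fin.sum_univ_two, h.symm, i00, i01, i10, i11, h00, h01, h10,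
      h11, z0, Pi.zero_apply, Pi.neg_apply, Fin.mk_one, if_false, mul_zero, one_ne_zero]
    clear i00 i01 i10 i11
    field_simp
    simp only [show v ^ 2 = G 0 1 y ^ 2 - G 0 0 y * G 1 1 y from hs.symm]
    ring

/-- Taking the dual twice is the identity, for a metric of signature `(-,+)`. -/
theorem flux_zero_dual {y : E2} (hy : y ∈ U) (w : Fin 2 → E2 → ℝ) :
    flux G V (dual G V w) 0 y = w 1 y := by
  have hv := h.vol_ne y hy
  rw [flux_zero, dual_zero, dual_one, flux_zero, flux_one]
  field_simp
  linear_combination (w 1 y) * h.vol_sq y hy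

theorem flux_one_dual {y : E2} (hy : y ∈ U) (w : Fin 2 → E2 → ℝ) :
    flux G V (dual G V w) 1 y = -w 0 y := by
  have hv := h.vol_ne y hy
  rw [flux_one, dual_zero, dual_one, flux_zero, flux_one]
  field_simp
  linear_combination (-w 0 y) * h.vol_sq y hy

end LorentzChart

end

/-! ### The orbit metric in a chart -/

section

open Topology

theorem b2_repr (u : E2) (k : Fin 2) : b2.repr u k = u k := by simp [b2]

theorem bilin_expand (T : E2 →ₗ[ℝ] E2 →ₗ[ℝ] ℝ) (L : E2 →L[ℝ] E2) (u v : E2) :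
    T (L u) (L v) = u 0 * v 0 * T (L (b2 0)) (L (b2 0)) + u 0 * v 1 * T (L (b2 0)) (L (b2 1))
      + u 1 * v 0 * T (L (b2 1)) (L (b2 0)) + u 1 * v 1 * T (L (b2 1)) (L (b2 1)) := by
  rw [bilinear_comp_eq_sum_repr b2 T L u v]
  simp only [Fin.sum_univ_two, b2_repr]
  ring

theorem antisymm_of_alt (T : E2 →ₗ[ℝ] E2 →ₗ[ℝ] ℝ) (hT : ∀ u, T u u = 0) (u v : E2) :
    T v u = -T u v := by
  have h1 := hT (u + v)
  simp only [map_add, LinearMap.add_apply, hT] at h1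
  linarith

/-- A symmetric form which takes values of both signs on two orthogonal vectors has negative Gram
determinant in every basis. -/
theorem gram_neg (T : E2 →ₗ[ℝ] E2 →ₗ[ℝ] ℝ) (hs : ∀ u v, T u v = T v u)
    (hl : ∃ u v, T u v = 0 ∧ T u u < 0 ∧ 0 < T v v) (L : E2 ≃L[ℝ] E2) :
    T (L (b2 0)) (L (b2 0)) * T (L (b2 1)) (L (b2 1)) - T (L (b2 0)) (L (b2 1)) ^ 2 < 0 := by
  obtain ⟨u, v, h0, hu, hv⟩ := hl
  have e := fun u v => bilin_expand T (L : E2 →L[ℝ] E2) (L.symm u) (L.symm v)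
  simp only [ContinuousLinearEquiv.coe_coe, L.apply_symm_apply] at e
  have e0 := e u v
  have eu := e u u
  have ev := e v v
  rw [hs (L (b2 1)) (L (b2 0))] at e0 eu ev
  generalize T (L (b2 0)) (L (b2 0)) = a at *
  generalize T (L (b2 0)) (L (b2 1)) = b at *
  generalize T (L (b2 1)) (L (b2 1)) = c at *
  generalize L.symm u = x at *
  generalize L.symm v = z at *
  have hm : T u u * T v v < 0 := mul_neg_of_neg_of_pos hu hv
  have hk : T u u * T v v = (x 0 * z 1 - x 1 * z 0) ^ 2 * (a * c - b ^ 2) := by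
    have : T u u * T v v = T u u * T v v - T u v ^ 2 := by rw [h0]; ring
    rw [this, e0, eu, ev]; ring
  rw [hk] at hm
  by_contra hcon
  exact absurd hm (not_lt.2 (mul_nonneg (sq_nonneg _) (not_lt.1 hcon)))

/-- In every basis the Gram determinant of the metric is minus the square of the volume. -/
theorem vol_gram (T W : E2 →ₗ[ℝ] E2 →ₗ[ℝ] ℝ) (hs : ∀ u v, T u v = T v u)
    (hl : ∃ u v, T u v = 0 ∧ T u u < 0 ∧ 0 < T v v)
    (hW : ∀ u v, W u v ^ 2 = |T u u * T v v - T u v * T v u|) (L : E2 ≃L[ℝ] E2) :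
    T (L (b2 0)) (L (b2 1)) ^ 2 - T (L (b2 0)) (L (b2 0)) * T (L (b2 1)) (L (b2 1))
      = W (L (b2 0)) (L (b2 1)) ^ 2 ∧ W (L (b2 0)) (L (b2 1)) ≠ 0 := by
  have h1 := gram_neg T hs hl L
  have h2 := hW (L (b2 0)) (L (b2 1))
  rw [hs (L (b2 1)) (L (b2 0)), ← pow_two, abs_of_neg h1] at h2
  refine ⟨by rw [h2]; ring, fun h0 => ?_⟩
  rw [h0] at h2
  linarith

section Spacetime

variable {M : Type*} [TopologicalSpace M] [ChartedSpace E2 M] [IsManifold (𝓡 2) ∞ M]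

theorem SphSymSpacetime.lorentzChart (B : SphSymSpacetime M) (p : M) :
    LorentzChart (extChartAt (𝓡 2) p).target (comp₂ b2 B.g p) (comp₂ b2 B.vol p) where
  isOpen := isOpen_extChartAt_target p
  contDiffOn_metric := B.g_smooth p
  contDiffOn_vol := B.vol_smooth p
  symm := funext fun _ => B.g_symm _ _ _
  vol_diag i := funext fun _ => B.vol_alt _ _
  vol_anti := by
    funext y
    exact antisymm_of_alt (B.vol _) (B.vol_alt _) _ _
  vol_sq y hy := by
    obtain ⟨L, hL⟩ := exists_coordEquiv (I := 𝓡 2) (ι := Fin 2) p hy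
    have h := (vol_gram (B.g ((extChartAt (𝓡 2) p).symm y)) (B.vol ((extChartAt (𝓡 2) p).symm y))
      (B.g_symm _) (B.g_lorentzian _) (B.vol_sq _) L).1
    rw [← hL b2 0, ← hL b2 1] at h
    exact h
  vol_ne y hy := by
    obtain ⟨L, hL⟩ := exists_coordEquiv (I := 𝓡 2) (ι := Fin 2) p hy
    have h := (vol_gram (B.g ((extChartAt (𝓡 2) p).symm y)) (B.vol ((extChartAt (𝓡 2) p).symm y))
      (B.g_symm _) (B.g_lorentzian _) (B.vol_sq _) L).2
    rw [← hL b2 0, ← hL b2 1] at h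
    exact h

end Spacetime

end

/-! ### The curl under changes of charts -/

section

open Topology

theorem fderiv_eq_sum_pderiv {f : E2 → ℝ} {y u : E2} : fderiv ℝ f y u = ∑ k, u k * pderiv b2 k f y := by
  conv_lhs => rw [← b2.sum_repr u]
  simp only [map_sum, map_smul, smul_eq_mul, b2_repr, pderiv]

section Spacetime

variable {M : Type*} [TopologicalSpace M] [ChartedSpace E2 M] [IsManifold (𝓡 2) ∞ M]

/-- The transformation law of the partial derivatives of the components of a one-form; the second
derivatives of the transition map enter symmetrically. -/
theorem pderiv_comp₁_transition (w : OneForm (𝓡 2) M) {p q : M} {y : E2}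
    (hy : y ∈ (extChartAt (𝓡 2) p).target)
    (hq : (extChartAt (𝓡 2) p).symm y ∈ (extChartAt (𝓡 2) q).source)
    (hw : ∀ k, DifferentiableAt ℝ (comp₁ b2 w q k) (transition (𝓡 2) p q y)) (i j : Fin 2) :
    pderiv b2 j (comp₁ b2 w p i) y =
      ∑ k, (fderiv ℝ (fderiv ℝ (transition (𝓡 2) p q)) y (b2 j) (b2 i) k *
        comp₁ b2 w q k (transition (𝓡 2) p q y) +
      fderiv ℝ (transition (𝓡 2) p q) y (b2 i) k *
        ∑ l, fderiv ℝ (transition (𝓡 2) p q) y (b2 j) l *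
          pderiv b2 l (comp₁ b2 w q k) (transition (𝓡 2) p q y)) := by
  have hτ := contDiffAt_transition (I := 𝓡 2) hy hq
  have hD : HasFDerivAt (fderiv ℝ (transition (𝓡 2) p q)) _ y :=
    ((hτ.fderiv_right (m := ∞) (by simp)).differentiableAt (by simp)).hasFDerivAt
  have hev : comp₁ b2 w p i =ᶠ[𝓝 y] fun z => ∑ k, fderiv ℝ (transition (𝓡 2) p q) z (b2 i) k *
      comp₁ b2 w q k (transition (𝓡 2) p q z) := by
    filter_upwards [(isOpen_extChartAt_target p).mem_nhds hy, eventually_symm_mem_source hy hq]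
      with z hz hz'
    rw [comp₁_transition b2 w hz hz']
    simp only [b2_repr]
  have h1 : ∀ k, HasFDerivAt (fun z => fderiv ℝ (transition (𝓡 2) p q) z (b2 i) k) _ y := fun k =>
    (EuclideanSpace.proj k : E2 →L[ℝ] ℝ).hasFDerivAt.comp y
      (hD.clm_apply (hasFDerivAt_const (b2 i) y))
  have h2 : ∀ k, HasFDerivAt (fun z => comp₁ b2 w q k (transition (𝓡 2) p q z)) _ y := fun k =>
    (hw k).hasFDerivAt.comp y (hτ.differentiableAt (by simp)).hasFDerivAt
  have h3 := (HasFDerivAt.fun_sum (u := Finset.univ) fun k _ =>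
    (h1 k).mul (h2 k)).congr_of_eventuallyEq hev
  rw [pderiv, h3.fderiv]
  simp only [_root_.sum_apply, _root_.add_apply, _root_.smul_apply, ContinuousLinearMap.comp_apply,
    smul_eq_mul, fderiv_eq_sum_pderiv]
  refine Finset.sum_congr rfl fun k _ => ?_
  simp
  ring

/-- Under a change of charts, the components of the exterior derivative of a one-form and of a
two-form are multiplied by the Jacobian determinant. -/
theorem exists_jacobian_curl (ε : TwoTensor (𝓡 2) M) (hε : ∀ q u, ε q u u = 0)
    (w : OneForm (𝓡 2) M) {p q : M} {y : E2}
    (hy : y ∈ (extChartAt (𝓡 2) p).target)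
    (hq : (extChartAt (𝓡 2) p).symm y ∈ (extChartAt (𝓡 2) q).source)
    (hw : ∀ k, DifferentiableAt ℝ (comp₁ b2 w q k) (transition (𝓡 2) p q y)) :
    ∃ d : ℝ, pderiv b2 0 (comp₁ b2 w p 1) y - pderiv b2 1 (comp₁ b2 w p 0) y =
        d * (pderiv b2 0 (comp₁ b2 w q 1) (transition (𝓡 2) p q y)
          - pderiv b2 1 (comp₁ b2 w q 0) (transition (𝓡 2) p q y)) ∧
      comp₂ b2 ε p 0 1 y = d * comp₂ b2 ε q 0 1 (transition (𝓡 2) p q y) := by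
  have hτ := contDiffAt_transition (I := 𝓡 2) hy hq
  have hs : fderiv ℝ (fderiv ℝ (transition (𝓡 2) p q)) y (b2 0) (b2 1) =
      fderiv ℝ (fderiv ℝ (transition (𝓡 2) p q)) y (b2 1) (b2 0) :=
    (hτ.isSymmSndFDerivAt (by simp; exact WithTop.coe_le_coe.2 le_top)) _ _
  have e0 : ∀ i, comp₂ b2 ε q i i (transition (𝓡 2) p q y) = 0 := fun i => hε _ _
  have e1 : comp₂ b2 ε q 1 0 (transition (𝓡 2) p q y)
      = -comp₂ b2 ε q 0 1 (transition (𝓡 2) p q y) := antisymm_of_alt (ε _) (hε _) _ _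
  -- the Jacobian determinant of the transition map
  refine ⟨fderiv ℝ (transition (𝓡 2) p q) y (b2 0) 0 * fderiv ℝ (transition (𝓡 2) p q) y (b2 1) 1
    - fderiv ℝ (transition (𝓡 2) p q) y (b2 0) 1 * fderiv ℝ (transition (𝓡 2) p q) y (b2 1) 0,
    ?_, ?_⟩
  · rw [pderiv_comp₁_transition w hy hq hw, pderiv_comp₁_transition w hy hq hw]
    simp only [Fin.sum_univ_two, hs]
    ring
  · rw [comp₂_transition b2 ε hy hq]
    simp only [Fin.sum_univ_two, e0, e1, b2_repr]
    ring

namespace SphSymSpacetime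

variable (B : SphSymSpacetime M)

theorem curl_center (w : OneForm (𝓡 2) M) (p : M) : curl b2 B.g B.vol w p =
    -(pderiv b2 0 (comp₁ b2 w p 1) (extChartAt (𝓡 2) p p)
      - pderiv b2 1 (comp₁ b2 w p 0) (extChartAt (𝓡 2) p p))
      / comp₂ b2 B.vol p 0 1 (extChartAt (𝓡 2) p p) :=
  (B.lorentzChart p).coordCurl_eq (mem_extChartAt_target p) _

/-- The curl may be computed in any chart. -/
theorem curl_chart (w : OneForm (𝓡 2) M) {p : M} {y : E2}
    (hy : y ∈ (extChartAt (𝓡 2) p).target) (hw : ∀ q k, DifferentiableAt ℝ (comp₁ b2 w q k)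
      (extChartAt (𝓡 2) q q)) :
    curl b2 B.g B.vol w ((extChartAt (𝓡 2) p).symm y) =
      -(pderiv b2 0 (comp₁ b2 w p 1) y - pderiv b2 1 (comp₁ b2 w p 0) y)
        / comp₂ b2 B.vol p 0 1 y := by
  obtain ⟨d, h1, h2⟩ := exists_jacobian_curl B.vol B.vol_alt w (q := (extChartAt (𝓡 2) p).symm y)
    hy (mem_extChartAt_source _) (hw _)
  have hv := (B.lorentzChart p).vol_ne y hy
  rw [curl_center, h1, h2]
  rw [h2] at hv
  have hd : d ≠ 0 := left_ne_zero_of_mul hv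
  have hv' := right_ne_zero_of_mul hv
  change -(_ - _) / comp₂ b2 B.vol _ 0 1 (transition (𝓡 2) p _ y) = _
  simp only [transition] at *
  field_simp

end SphSymSpacetime
end Spacetime

end

/-! ### The dual of the gradient -/

section

open Topology

/-- Lowering the index of the vector obtained from a covector by raising its index gives back the
covector. -/
theorem raise_apply (T : E2 →ₗ[ℝ] E2 →ₗ[ℝ] ℝ) (hs : ∀ u v, T u v = T v u)
    (hl : ∃ u v, T u v = 0 ∧ T u u < 0 ∧ 0 < T v v) (l : E2 →L[ℝ] ℝ) (u : E2) :
    T (∑ i, ∑ j, ((Matrix.of fun k m => T (b2 k) (b2 m))⁻¹ i j * l (b2 j)) • b2 i) u = l u := by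
  have h1 := gram_neg T hs hl (ContinuousLinearEquiv.refl ℝ E2)
  simp only [ContinuousLinearEquiv.coe_refl', id_eq] at h1
  set Q : Matrix (Fin 2) (Fin 2) ℝ := Matrix.of fun k m => T (b2 k) (b2 m) with hQ
  have hdet : IsUnit Q.det := by
    rw [Matrix.det_fin_two]
    simp only [hQ, Matrix.of_apply, hs (b2 1) (b2 0)]
    exact (ne_of_lt (by linarith [h1])).isUnit
  have hi : ∀ m j, ∑ i, Q m i * Q⁻¹ i j = if m = j then 1 else 0 := fun m j => by
    rw [← Matrix.mul_apply, Matrix.mul_nonsing_inv _ hdet, Matrix.one_apply]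
  obtain ⟨R, hR⟩ : ∃ R : Fin 2 → Fin 2 → ℝ, ∀ i j, Q⁻¹ i j = R i j := ⟨_, fun _ _ => rfl⟩
  simp only [hR] at hi ⊢
  have q : ∀ i m, T (b2 i) (b2 m) = Q m i := fun i m => by rw [hs]; rfl
  have hb : ∀ m, T (∑ i, ∑ j, (R i j * l (b2 j)) • b2 i) (b2 m) = l (b2 m) := by
    intro m
    have h00 := hi m 0
    have h11 := hi m 1
    rw [Fin.sum_univ_two] at h00 h11
    simp only [map_add, map_smul, LinearMap.add_apply, LinearMap.smul_apply, smul_eq_mul,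
      Fin.sum_univ_two, q]
    have : l (b2 m) = (if m = 0 then 1 else 0) * l (b2 0) + (if m = 1 then 1 else 0) * l (b2 1) := by
      fin_cases m <;> simp
    rw [this]
    linear_combination l (b2 0) * h00 + l (b2 1) * h11
  have : T (∑ i, ∑ j, (R i j * l (b2 j)) • b2 i) = (l : E2 →ₗ[ℝ] ℝ) := b2.ext hb
  rw [this]; rfl

/-- The components of `ε_{ab} l^a` in the basis `L (b2 0), L (b2 1)`, where `X` is the vector
`l^a`. -/
theorem vol_raise (T W : E2 →ₗ[ℝ] E2 →ₗ[ℝ] ℝ) (hs : ∀ u v, T u v = T v u)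
    (hl : ∃ u v, T u v = 0 ∧ T u u < 0 ∧ 0 < T v v)
    (hW : ∀ u v, W u v ^ 2 = |T u u * T v v - T u v * T v u|) (ha : ∀ u, W u u = 0)
    (L : E2 ≃L[ℝ] E2) (l : E2 →L[ℝ] ℝ) (X : E2) (hX : ∀ u, T X u = l u) (b : Fin 2) :
    W X (L (b2 b)) = if b = 0 then
      -((T (L (b2 0)) (L (b2 1)) * l (L (b2 0)) - T (L (b2 0)) (L (b2 0)) * l (L (b2 1)))
        / W (L (b2 0)) (L (b2 1)))
      else (T (L (b2 0)) (L (b2 1)) * l (L (b2 1)) - T (L (b2 1)) (L (b2 1)) * l (L (b2 0)))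
        / W (L (b2 0)) (L (b2 1)) := by
  obtain ⟨h1, h2⟩ := vol_gram T W hs hl hW L
  have e1 := fun m => bilin_expand T (L : E2 →L[ℝ] E2) (L.symm X) (b2 m)
  have e2 := fun m => bilin_expand W (L : E2 →L[ℝ] E2) (L.symm X) (b2 m)
  have hn : W (L (b2 1)) (L (b2 0)) = -W (L (b2 0)) (L (b2 1)) := antisymm_of_alt W ha _ _
  simp only [ContinuousLinearEquiv.coe_coe, L.apply_symm_apply, hX, ha, hn,
    hs (L (b2 1)) (L (b2 0))] at e1 e2
  have e10 := e1 0
  have e11 := e1 1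
  rw [e2]
  have k00 : (b2 0 : E2) 0 = 1 := by simp [b2]
  have k01 : (b2 0 : E2) 1 = 0 := by simp [b2]
  have k10 : (b2 1 : E2) 0 = 0 := by simp [b2]
  have k11 : (b2 1 : E2) 1 = 1 := by simp [b2]
  simp only [k00, k01, k10, k11] at e10 e11
  generalize T (L (b2 0)) (L (b2 0)) = t00 at *
  generalize T (L (b2 0)) (L (b2 1)) = t01 at *
  generalize T (L (b2 1)) (L (b2 1)) = t11 at *
  generalize W (L (b2 0)) (L (b2 1)) = v at *
  generalize L.symm X = x at *
  rw [e10, e11]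
  clear e1 e2 hn hX e10 e11
  fin_cases b
  · simp only [Fin.zero_eta, if_true, k00, k01]
    field_simp
    linear_combination x 1 * h1
  · simp only [Fin.mk_one, if_false, k10, k11, one_ne_zero]
    field_simp
    linear_combination -x 0 * h1

section Spacetime

variable {M : Type*} [TopologicalSpace M] [ChartedSpace E2 M] [IsManifold (𝓡 2) ∞ M]

namespace SphSymSpacetime

variable (B : SphSymSpacetime M)

/-- The components of `ε_{ab} ∇^a f` in a chart. -/
theorem vol_gradient_chart (f : M → ℝ) {p : M} {y : E2} (hy : y ∈ (extChartAt (𝓡 2) p).target)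
    (hf : MDifferentiableAt (𝓡 2) 𝓘(ℝ, ℝ) f ((extChartAt (𝓡 2) p).symm y)) (b : Fin 2) :
    B.vol ((extChartAt (𝓡 2) p).symm y) (gradient b2 B.g f ((extChartAt (𝓡 2) p).symm y))
      (coordVec (𝓡 2) b2 p b y) = dual (comp₂ b2 B.g p) (comp₂ b2 B.vol p)
        (fun i => pderiv b2 i fun y => f ((extChartAt (𝓡 2) p).symm y)) b y := by
  obtain ⟨L, hL⟩ := exists_coordEquiv (I := 𝓡 2) (ι := Fin 2) p hy
  set q := (extChartAt (𝓡 2) p).symm y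
  have h := vol_raise (B.g q) (B.vol q) (B.g_symm q) (B.g_lorentzian q) (B.vol_sq q)
    (B.vol_alt q) L (dfun (𝓡 2) f q) (gradient b2 B.g f q)
    (fun u => raise_apply (B.g q) (B.g_symm q) (B.g_lorentzian q) (dfun (𝓡 2) f q) u) b
  simp only [← hL b2] at h
  have hd := fun i => comp₁_dfun b2 i hy hf
  refine Eq.trans h ?_
  have hd0 := hd 0
  have hd1 := hd 1
  by_cases hb : b = 0
  · simp only [dual, flux, hb, if_true, ← hd0, ← hd1, one_ne_zero, if_false]
    rfl
  · simp only [dual, flux, hb, if_true, ← hd0, ← hd1, if_false]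
    rfl

end SphSymSpacetime
end Spacetime

end

/-! ### First-order operators on families of functions on the sphere -/

section

open Topology Filter

/-- A linear functional on covector fields which depends on the components and their first
derivatives at the point `y` only, such as the divergence and the curl at `y`. -/
def IsFirstOrder (y : E2) (D : (Fin 2 → E2 → ℝ) → ℝ) : Prop :=
  ∃ (c : Fin 2 → Fin 2 → ℝ) (d : Fin 2 → ℝ), ∀ w,
    D w = ∑ i, ∑ j, c i j * pderiv b2 i (w j) y + ∑ k, d k * w k y

theorem isFirstOrder_coordDiv (G : Fin 2 → Fin 2 → E2 → ℝ) (y : E2) :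
    IsFirstOrder y fun w => coordDiv b2 G w y := by
  refine ⟨fun i j => ginv G i j y,
    fun k => -∑ i, ∑ j, ginv G i j y * christoffel b2 G k i j y, fun w => ?_⟩
  simp only [coordDiv, covDeriv₁, Fin.sum_univ_two]
  ring

/-- The curl `-(∂₀ w₁ - ∂₁ w₀) / ε₀₁` in coordinates. -/
def coordCurl (V : Fin 2 → Fin 2 → E2 → ℝ) (w : Fin 2 → E2 → ℝ) (y : E2) : ℝ :=
  -(pderiv b2 0 (w 1) y - pderiv b2 1 (w 0) y) / V 0 1 y

theorem isFirstOrder_coordCurl (V : Fin 2 → Fin 2 → E2 → ℝ) (y : E2) :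
    IsFirstOrder y fun w => coordCurl V w y := by
  refine ⟨fun i j => if i = 0 then (if j = 1 then -1 / V 0 1 y else 0)
    else (if j = 0 then 1 / V 0 1 y else 0), 0, fun w => ?_⟩
  simp only [coordCurl, Fin.sum_univ_two]
  simp
  ring

theorem pderiv_congr {f g : E2 → ℝ} {y : E2} (h : f =ᶠ[𝓝 y] g) (i : Fin 2) :
    pderiv b2 i f y = pderiv b2 i g y := by
  rw [pderiv, h.fderiv_eq, pderiv]

theorem contDiffOn_pderiv {U : Set E2} (hU : IsOpen U) {f : E2 → ℝ} (hf : ContDiffOn ℝ ∞ f U)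
    (i : Fin 2) : ContDiffOn ℝ ∞ (pderiv b2 i f) U :=
  (hf.fderiv_of_isOpen hU (by simp)).clm_apply contDiffOn_const

theorem pderiv_comm {U : Set E2} (hU : IsOpen U) {f : E2 → ℝ} (hf : ContDiffOn ℝ ∞ f U) {y : E2}
    (hy : y ∈ U) (i j : Fin 2) :
    pderiv b2 i (pderiv b2 j f) y = pderiv b2 j (pderiv b2 i f) y := by
  have hc := hf.contDiffAt (hU.mem_nhds hy)
  have hD : HasFDerivAt (fderiv ℝ f) _ y :=
    ((hc.fderiv_right (m := ∞) (by simp)).differentiableAt (by simp)).hasFDerivAt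
  have hs : fderiv ℝ (fderiv ℝ f) y (b2 i) (b2 j) = fderiv ℝ (fderiv ℝ f) y (b2 j) (b2 i) :=
    (hc.isSymmSndFDerivAt (by simp; exact WithTop.coe_le_coe.2 le_top)) _ _
  have q : ∀ i j, pderiv b2 j (pderiv b2 i f) y = fderiv ℝ (fderiv ℝ f) y (b2 j) (b2 i) :=
    fun i j => by
      have := (hD.clm_apply (hasFDerivAt_const (b2 i) y)).fderiv
      change fderiv ℝ (fun z => fderiv ℝ f z (b2 i)) y (b2 j) = _
      rw [this]
      simp
  rw [q, q, hs]

namespace IsFirstOrder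

variable {y : E2} {D : (Fin 2 → E2 → ℝ) → ℝ} (hD : IsFirstOrder y D)
include hD

theorem congr {w w' : Fin 2 → E2 → ℝ} (h : ∀ k, w k =ᶠ[𝓝 y] w' k) : D w = D w' := by
  obtain ⟨c, d, e⟩ := hD
  simp only [e, pderiv_congr (h _), (h _).self_of_nhds]

theorem add {w w' : Fin 2 → E2 → ℝ} (h : ∀ k, DifferentiableAt ℝ (w k) y)
    (h' : ∀ k, DifferentiableAt ℝ (w' k) y) : D (fun k z => w k z + w' k z) = D w + D w' := by
  obtain ⟨c, d, e⟩ := hD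
  have : ∀ i k, pderiv b2 i (fun z => w k z + w' k z) y =
      pderiv b2 i (w k) y + pderiv b2 i (w' k) y := fun i k => by
    rw [pderiv, fderiv_fun_add (h k) (h' k)]; rfl
  simp only [e, this, Fin.sum_univ_two]
  ring

theorem const_mul {w : Fin 2 → E2 → ℝ} (h : ∀ k, DifferentiableAt ℝ (w k) y) (a : ℝ) :
    D (fun k z => a * w k z) = a * D w := by
  obtain ⟨c, d, e⟩ := hD
  have : ∀ i k, pderiv b2 i (fun z => a * w k z) y = a * pderiv b2 i (w k) y := fun i k => by
    rw [pderiv, fderiv_const_mul (h k)]; rfl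
  simp only [e, this, Fin.sum_univ_two]
  ring

theorem zero : D (fun _ _ => 0) = 0 := by
  obtain ⟨c, d, e⟩ := hD
  simp [e, pderiv]

theorem sub {w w' : Fin 2 → E2 → ℝ} (h : ∀ k, DifferentiableAt ℝ (w k) y)
    (h' : ∀ k, DifferentiableAt ℝ (w' k) y) : D (fun k z => w k z - w' k z) = D w - D w' := by
  have h1 := hD.add h (w' := fun k z => (-1) * w' k z) fun k => (h' k).const_mul _
  rw [hD.const_mul h'] at h1
  rw [sub_eq_add_neg, ← neg_one_mul, ← h1]
  congr 1
  funext k z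
  ring

theorem sum {κ : Type*} (t : Finset κ) {w : κ → Fin 2 → E2 → ℝ}
    (h : ∀ m k, DifferentiableAt ℝ (w m k) y) :
    D (fun k z => ∑ m ∈ t, w m k z) = ∑ m ∈ t, D (w m) := by
  classical
  induction t using Finset.induction_on with
  | empty => simpa using hD.zero
  | insert a t ha ih =>
    simp only [Finset.sum_insert ha]
    rw [hD.add (h a) fun k => DifferentiableAt.fun_sum fun m _ => h m k, ih]

variable {U : Set E2} (hU : IsOpen U) (hy : y ∈ U) {F : Fin 2 → E2 → S2 → ℝ}
  (hF : ∀ k, SmoothFam U (F k))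
include hU hy hF

theorem smoothS : SmoothS fun s => D fun k z => F k z s := by
  obtain ⟨c, d, e⟩ := hD
  simp only [e]
  exact (SmoothS.sum fun i => SmoothS.sum fun j => (SmoothS.const _).mul
    (((hF j).parD hU (b2 i)).slice hy)).add
    (SmoothS.sum fun k => (SmoothS.const _).mul ((hF k).slice hy))

theorem rotD (m : Fin 3) (s : S2) :
    rotD m (fun s => D fun k z => F k z s) s = D fun k z => Electro.rotD m (F k z) s := by
  obtain ⟨c, d, e⟩ := hD
  simp only [e]
  have h1 : ∀ i j, SmoothS (parD (b2 i) (F j) y) := fun i j => ((hF j).parD hU (b2 i)).slice hy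
  have h2 : ∀ k, SmoothS (F k y) := fun k => (hF k).slice hy
  have h3 : ∀ i j, Electro.rotD m (parD (b2 i) (F j) y) s =
      pderiv b2 i (fun z => Electro.rotD m (F j z) s) y := fun i j =>
    (hF j).rotD_parD hU (b2 i) m hy s
  have h4 : (fun s => ∑ i, ∑ j, c i j * pderiv b2 i (fun z => F j z s) y + ∑ k, d k * F k y s) =
      fun s => (∑ i, ∑ j, c i j * parD (b2 i) (F j) y s) + ∑ k, d k * F k y s := rfl
  rw [h4, rotD_add (SmoothS.sum fun i => SmoothS.sum fun j => (SmoothS.const _).mul (h1 i j))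
    (SmoothS.sum fun k => (SmoothS.const _).mul (h2 k)),
    rotD_sum fun i => SmoothS.sum fun j => (SmoothS.const _).mul (h1 i j),
    rotD_sum fun k => (SmoothS.const _).mul (h2 k)]
  refine congrArg₂ (· + ·) (Finset.sum_congr rfl fun i _ => ?_) (Finset.sum_congr rfl fun k _ => ?_)
  · rw [rotD_sum fun j => (SmoothS.const _).mul (h1 i j)]
    exact Finset.sum_congr rfl fun j _ => by rw [rotD_const_mul (h1 i j), h3]
  · rw [rotD_const_mul (h2 k)]

theorem rotLap (s : S2) :
    rotLap (fun s => D fun k z => F k z s) s = D fun k z => Electro.rotLap (F k z) s := by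
  have h1 : ∀ m, Electro.rotD m (Electro.rotD m fun s => D fun k z => F k z s) s =
      D fun k z => Electro.rotD m (Electro.rotD m (F k z)) s := fun m => by
    rw [← hD.rotD hU hy (fun k => (hF k).rotD hU m) m s]
    exact congrFun (congrArg _ (funext (hD.rotD hU hy hF m))) s
  simp only [Electro.rotLap, h1]
  exact (hD.sum Finset.univ fun m k =>
    (((hF k).rotD hU m).rotD hU m).differentiableAt_param hU hy s).symm

theorem rotStar (m : Fin 3) (s : S2) :
    rotStar (fun s => D fun k z => F k z s) m s = D fun k z => Electro.rotStar (F k z) m s := by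
  have hd : ∀ n k, DifferentiableAt ℝ (fun z => Electro.rotD n (F k z) s) y := fun n k =>
    ((hF k).rotD hU n).differentiableAt_param hU hy s
  simp only [Electro.rotStar, hD.rotD hU hy hF]
  have h1 := hD.sub (fun k => (hd (m + 1) k).const_mul (s.1 (m + 2)))
    (fun k => (hd (m + 2) k).const_mul (s.1 (m + 1)))
  rw [hD.const_mul (hd _), hD.const_mul (hd _)] at h1
  simp only [mul_comm _ (s.1 _)]
  exact h1.symm

theorem avg_eq_zero (h : ∀ k, ∀ z ∈ U, avg (F k z) = 0) :
    avg (fun s => D fun k z => F k z s) = 0 := by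
  obtain ⟨c, d, e⟩ := hD
  simp only [e]
  have h1 : ∀ i j, SmoothS (parD (b2 i) (F j) y) := fun i j => ((hF j).parD hU (b2 i)).slice hy
  have h2 : ∀ k, SmoothS (F k y) := fun k => (hF k).slice hy
  have h3 : ∀ i j, avg (parD (b2 i) (F j) y) = 0 := fun i j => by
    rw [(hF j).avg_parD hU hy]
    have : (fun z => avg (F j z)) =ᶠ[𝓝 y] fun _ => 0 := by
      filter_upwards [hU.mem_nhds hy] with z hz using h j z hz
    rw [this.fderiv_eq]
    simp
  have h4 : (fun s => ∑ i, ∑ j, c i j * pderiv b2 i (fun z => F j z s) y + ∑ k, d k * F k y s) =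
      fun s => (∑ i, ∑ j, c i j * parD (b2 i) (F j) y s) + ∑ k, d k * F k y s := rfl
  rw [h4, avg_add (SmoothS.sum fun i => SmoothS.sum fun j => (SmoothS.const _).mul (h1 i j))
    (SmoothS.sum fun k => (SmoothS.const _).mul (h2 k)),
    avg_sum fun i => SmoothS.sum fun j => (SmoothS.const _).mul (h1 i j),
    avg_sum fun k => (SmoothS.const _).mul (h2 k)]
  have h5 : ∀ i, avg (fun s => ∑ j, c i j * parD (b2 i) (F j) y s) = 0 := fun i => by
    rw [avg_sum fun j => (SmoothS.const _).mul (h1 i j)]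
    exact Finset.sum_eq_zero fun j _ => by rw [avg_const_mul, h3, mul_zero]
  have h6 : ∀ k, avg (fun s => d k * F k y s) = 0 := fun k => by
    rw [avg_const_mul, h k y hy, mul_zero]
  rw [Finset.sum_eq_zero fun i _ => h5 i, Finset.sum_eq_zero fun k _ => h6 k, add_zero]

end IsFirstOrder

namespace LorentzChart

variable {U : Set E2} {G V : Fin 2 → Fin 2 → E2 → ℝ} (h : LorentzChart U G V)
include h

theorem contDiffOn_flux {w : Fin 2 → E2 → ℝ} (hw : ∀ i, ContDiffOn ℝ ∞ (w i) U) (a : Fin 2) :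
    ContDiffOn ℝ ∞ (flux G V w a) U := by
  have hG := h.contDiffOn_metric
  have hV := h.contDiffOn_vol 0 1
  fin_cases a
  · exact (((hG 0 1).mul (hw 1)).sub ((hG 1 1).mul (hw 0))).div hV h.vol_ne
  · exact (((hG 0 1).mul (hw 0)).sub ((hG 0 0).mul (hw 1))).div hV h.vol_ne

theorem contDiffOn_dual {w : Fin 2 → E2 → ℝ} (hw : ∀ i, ContDiffOn ℝ ∞ (w i) U) (a : Fin 2) :
    ContDiffOn ℝ ∞ (dual G V w a) U := by
  fin_cases a
  · exact (h.contDiffOn_flux hw 1).neg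
  · exact h.contDiffOn_flux hw 0

/-- The curl of the dual covector is minus the divergence. -/
theorem coordCurl_dual {y : E2} (hy : y ∈ U) {w : Fin 2 → E2 → ℝ}
    (hw : ∀ i, DifferentiableAt ℝ (w i) y) :
    coordCurl V (dual G V w) y = -coordDiv b2 G w y := by
  rw [h.coordDiv_eq hy hw, coordCurl, show dual G V w 1 = flux G V w 0 from rfl,
    show dual G V w 0 = fun y => -flux G V w 1 y from rfl]
  have : pderiv b2 1 (fun y => -flux G V w 1 y) y = -pderiv b2 1 (flux G V w 1) y := by
    rw [pderiv, fderiv_fun_neg]; rfl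
  rw [this]
  ring

/-- The dual of an exact form is divergence-free. -/
theorem coordDiv_dual_pderiv {y : E2} (hy : y ∈ U) {f : E2 → ℝ} (hf : ContDiffOn ℝ ∞ f U) :
    coordDiv b2 G (dual G V fun i => pderiv b2 i f) y = 0 := by
  have hd := contDiffOn_pderiv h.isOpen hf
  have hda : ∀ i, DifferentiableAt ℝ (dual G V (fun i => pderiv b2 i f) i) y := fun i =>
    ((h.contDiffOn_dual hd i).contDiffAt (h.isOpen.mem_nhds hy)).differentiableAt (by simp)
  rw [h.coordDiv_eq hy hda]
  have e0 : flux G V (dual G V fun i => pderiv b2 i f) 0 =ᶠ[𝓝 y] pderiv b2 1 f := by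
    filter_upwards [h.isOpen.mem_nhds hy] with z hz using h.flux_zero_dual hz _
  have e1 : flux G V (dual G V fun i => pderiv b2 i f) 1 =ᶠ[𝓝 y] fun z => -pderiv b2 0 f z := by
    filter_upwards [h.isOpen.mem_nhds hy] with z hz using h.flux_one_dual hz _
  rw [pderiv_congr e0, pderiv_congr e1]
  have qn : pderiv b2 1 (fun z => -pderiv b2 0 f z) y = -pderiv b2 1 (pderiv b2 0 f) y := by
    rw [pderiv, fderiv_fun_neg]; rfl
  rw [qn, pderiv_comm h.isOpen hf hy]
  simp

end LorentzChart

end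

/-! ### The master operator and the reconstruction equation -/

section

open Topology Filter

theorem SmoothFam.pderiv {U : Set E2} (hU : IsOpen U) {f : E2 → S2 → ℝ} (hf : SmoothFam U f)
    (i : Fin 2) : SmoothFam U fun y s => pderiv b2 i (fun z => f z s) y :=
  hf.parD hU (b2 i)

theorem rotLap_sum_mul {κ : Type*} [Fintype κ] {f : κ → S2 → ℝ} (hf : ∀ k, SmoothS (f k))
    (c : κ → ℝ) (s : S2) : rotLap (fun s => ∑ k, c k * f k s) s = ∑ k, c k * rotLap (f k) s := by
  have e : ∀ {g : κ → S2 → ℝ}, (∀ k, SmoothS (g k)) → ∀ i,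
      rotD i (fun s => ∑ k, c k * g k s) = fun s => ∑ k, c k * rotD i (g k) s := fun hg i => by
    funext s
    rw [rotD_sum fun k => (SmoothS.const _).mul (hg k)]
    exact Finset.sum_congr rfl fun k _ => rotD_const_mul (hg k) _ _ _
  simp only [rotLap, e hf, fun i => e fun k => (hf k).rotD i, Finset.mul_sum]
  exact Finset.sum_comm

section Spacetime

variable {M : Type*} [TopologicalSpace M] [ChartedSpace E2 M] [IsManifold (𝓡 2) ∞ M]

theorem SmoothScalar.orbit {f : M × S2 → ℝ} (hf : SmoothScalar f) (s : S2) :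
    ContMDiff (𝓡 2) 𝓘(ℝ, ℝ) ∞ fun p => f (p, s) := by
  refine contMDiff_of_contDiffOn_chart (I := 𝓡 2) fun p => ?_
  exact (smoothScalar_iff.1 hf p).contDiffOn_param s

theorem SmoothScalar.mdifferentiableAt_orbit {f : M × S2 → ℝ} (hf : SmoothScalar f) (s : S2)
    (q : M) : MDifferentiableAt (𝓡 2) 𝓘(ℝ, ℝ) (fun p => f (p, s)) q :=
  (hf.orbit s).mdifferentiableAt (by simp)

theorem AngularOneForm.Smooth.orbitFam {α : AngularOneForm M} (hα : α.Smooth) (p : M) (a : Fin 2) :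
    SmoothFam (extChartAt (𝓡 2) p).target (orbitFam α p a) :=
  angularOneForm_smooth_iff.1 hα p a

theorem AngularOneForm.Smooth.differentiableAt {α : AngularOneForm M} (hα : α.Smooth) (p : M)
    (a : Fin 2) (s : S2) {y : E2} (hy : y ∈ (extChartAt (𝓡 2) p).target) :
    DifferentiableAt ℝ (comp₁ b2 (α s) p a) y :=
  (hα.orbitFam p a).differentiableAt_param (isOpen_extChartAt_target p) hy s

theorem Smooth₁.orbitPart {A : OneForm I4 (M × S2)} (hA : Smooth₁ b4 A) :
    (orbitPart A).Smooth :=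
  angularOneForm_smooth_iff.2 (smooth₁_iff.1 hA).1

/-- Two `AngularOneForm`s agree if their components at the centres of the charts do. -/
theorem AngularOneForm.ext_center {α α' : AngularOneForm M}
    (h : ∀ p a s, orbitFam α p a (extChartAt (𝓡 2) p p) s =
      orbitFam α' p a (extChartAt (𝓡 2) p p) s) : α = α' := by
  funext s p
  have h1 : ∀ q : M, (extChartAt (𝓡 2) p).symm (extChartAt (𝓡 2) p p) = q →
      (α s q : E2 →L[ℝ] ℝ) = α' s q := by
    rintro q rfl
    exact covector_ext (I := 𝓡 2) b2 (mem_extChartAt_target p) fun a => h p a s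
  exact h1 p (symm_extChartAt_self p)

omit [IsManifold (𝓡 2) ∞ M] in
theorem AngularOneForm.MonopoleFree.avg {α : AngularOneForm M} (hα : α.MonopoleFree) (p : M)
    (a : Fin 2) (y : E2) : avg (Electro.orbitFam α p a y) = 0 :=
  (zeroMean_iff _).1 (hα _ _)

namespace SphSymSpacetime

variable (B : SphSymSpacetime M)

/-- The square `r²` of the areal radius in the chart at `p`. -/
def rsq (p : M) (y : E2) : ℝ := B.r ((extChartAt (𝓡 2) p).symm y) ^ 2

omit [IsManifold (𝓡 2) ∞ M] in
theorem rsq_pos (p : M) (y : E2) : 0 < B.rsq p y := pow_pos (B.r_pos _) 2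

theorem contDiffOn_rsq (p : M) : ContDiffOn ℝ ∞ (B.rsq p) (extChartAt (𝓡 2) p).target :=
  (ContMDiff.contDiffOn_chart (I := 𝓡 2) B.r_smooth p).pow 2

omit [IsManifold (𝓡 2) ∞ M] in
theorem rsq_self (p : M) : B.rsq p (extChartAt (𝓡 2) p p) = B.r p ^ 2 := by
  rw [rsq, symm_extChartAt_self]

/-- The scalar `r² ε^{ab} ∇_a α_b` in a chart. -/
theorem phi_chart {α : AngularOneForm M} (hα : α.Smooth) {p : M} {y : E2}
    (hy : y ∈ (extChartAt (𝓡 2) p).target) (s : S2) :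
    scalarFam (B.phi α) p y s =
      B.rsq p y * coordCurl (comp₂ b2 B.vol p) (fun a z => orbitFam α p a z s) y :=
  congrArg (B.rsq p y * ·) (B.curl_chart (α s) hy fun q k =>
    hα.differentiableAt q k s (mem_extChartAt_target q))

theorem smoothFam_coordCurl {F : Fin 2 → E2 → S2 → ℝ} {p : M}
    (hF : ∀ a, SmoothFam (extChartAt (𝓡 2) p).target (F a)) :
    SmoothFam (extChartAt (𝓡 2) p).target
      fun y s => coordCurl (comp₂ b2 B.vol p) (fun a z => F a z s) y := by
  have hU := isOpen_extChartAt_target (I := 𝓡 2) p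
  have hV : SmoothFam (extChartAt (𝓡 2) p).target fun y _ => (comp₂ b2 B.vol p 0 1 y)⁻¹ :=
    SmoothFam.of_param ((B.vol_smooth p 0 1).inv (B.lorentzChart p).vol_ne)
  exact ((((hF 1).pderiv hU 0).sub ((hF 0).pderiv hU 1)).neg.mul hV).congr fun y _ => by
    funext s; rw [coordCurl, div_eq_mul_inv]

theorem smooth_phi {α : AngularOneForm M} (hα : α.Smooth) : SmoothScalar (B.phi α) :=
  smoothScalar_iff.2 fun p => ((SmoothFam.of_param (B.contDiffOn_rsq p)).mul
    (B.smoothFam_coordCurl (hα.orbitFam p))).congr fun _ hy => funext fun s => B.phi_chart hα hy s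

theorem phi_center (α : AngularOneForm M) (p : M) (s : S2) :
    B.phi α (p, s) = B.r p ^ 2 * coordCurl (comp₂ b2 B.vol p) (fun a z => orbitFam α p a z s)
      (extChartAt (𝓡 2) p p) :=
  congrArg (B.r p ^ 2 * ·) (B.curl_center (α s) p)

theorem monopoleFree_phi {α : AngularOneForm M} (hα : α.Smooth) (h : α.MonopoleFree) :
    MonopoleFree (B.phi α) := fun p => by
  rw [zeroMean_iff]
  simp only [B.phi_center]
  rw [avg_const_mul, (isFirstOrder_coordCurl _ _).avg_eq_zero (isOpen_extChartAt_target p)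
    (mem_extChartAt_target p) (hα.orbitFam p) fun a z _ => h.avg p a z, mul_zero]

omit [IsManifold (𝓡 2) ∞ M] in
theorem divergence_eq (w : OneForm (𝓡 2) M) (p : M) : divergence b2 B.g w p =
    coordDiv b2 (comp₂ b2 B.g p) (comp₁ b2 w p) (extChartAt (𝓡 2) p p) := rfl

theorem avg_divergence {α : AngularOneForm M} (hα : α.Smooth) (h : α.MonopoleFree) (p : M) :
    avg (fun s => divergence b2 B.g (α s) p) = 0 :=
  (isFirstOrder_coordDiv _ _).avg_eq_zero (isOpen_extChartAt_target p)
    (mem_extChartAt_target p) (hα.orbitFam p) fun a z _ => h.avg p a z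

theorem smoothS_divergence {α : AngularOneForm M} (hα : α.Smooth) (p : M) :
    SmoothS (fun s => divergence b2 B.g (α s) p) :=
  (isFirstOrder_coordDiv _ _).smoothS (isOpen_extChartAt_target p)
    (mem_extChartAt_target p) (hα.orbitFam p)

/-- The master operator at the centre of a chart. -/
theorem masterOp_center {f : M × S2 → ℝ} (hf : SmoothScalar f) (p : M) (s : S2) :
    B.masterOp f p s = -coordDiv b2 (comp₂ b2 B.g p)
        (fun i => pderiv b2 i fun y => scalarFam f p y s) (extChartAt (𝓡 2) p p)
      - (B.r p ^ 2)⁻¹ * rotLap (fun s => f (p, s)) s := by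
  rw [masterOp, sphereLap, laplacian_sphere (hf.slice p), dAlembertian, laplacian, divergence_eq]
  rw [(isFirstOrder_coordDiv _ _).congr fun k => ?_]
  filter_upwards [(isOpen_extChartAt_target p).mem_nhds (mem_extChartAt_target p)] with y hy
  exact comp₁_dfun b2 k hy (hf.mdifferentiableAt_orbit s _)

theorem smoothS_masterOp {f : M × S2 → ℝ} (hf : SmoothScalar f) (p : M) :
    SmoothS (B.masterOp f p) := by
  rw [show B.masterOp f p = fun s => _ from funext (B.masterOp_center hf p)]
  have hU := isOpen_extChartAt_target (I := 𝓡 2) p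
  exact ((isFirstOrder_coordDiv _ _).smoothS hU (mem_extChartAt_target p)
    fun k => (smoothScalar_iff.1 hf p).pderiv hU k).neg.sub
    ((SmoothS.const _).mul (hf.slice p).rotLap)

theorem avg_masterOp {f : M × S2 → ℝ} (hf : SmoothScalar f) (h : MonopoleFree f) (p : M) :
    avg (B.masterOp f p) = 0 := by
  rw [show B.masterOp f p = fun s => _ from funext (B.masterOp_center hf p)]
  have hU := isOpen_extChartAt_target (I := 𝓡 2) p
  have hF := fun k => (smoothScalar_iff.1 hf p).pderiv hU k
  have h1 : ∀ k, ∀ z ∈ (extChartAt (𝓡 2) p).target,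
      avg (fun s => pderiv b2 k (fun y => scalarFam f p y s) z) = 0 := fun k z hz => by
    refine ((smoothScalar_iff.1 hf p).avg_parD hU hz (b2 k)).trans ?_
    have : (fun y => avg (scalarFam f p y)) = fun _ => 0 := funext fun y => h.avg _
    rw [this]; simp
  rw [avg_sub ((isFirstOrder_coordDiv _ _).smoothS hU (mem_extChartAt_target p) hF).neg
    ((SmoothS.const _).mul (hf.slice p).rotLap), avg_neg, avg_const_mul, avg_rotLap (hf.slice p),
    (isFirstOrder_coordDiv _ _).avg_eq_zero hU (mem_extChartAt_target p) hF h1]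
  simp

/-- The reconstruction equation, with its first term in a chart. -/
theorem reconstruction_iff {Φ : M × S2 → ℝ} (hΦ : SmoothScalar Φ) {α : AngularOneForm M}
    (hα : α.Smooth) {J : OneForm I4 (M × S2)} {p : M} {y : E2}
    (hy : y ∈ (extChartAt (𝓡 2) p).target) (s : S2) (a : Fin 2) :
    (B.vol ((extChartAt (𝓡 2) p).symm y) (gradient b2 B.g (fun p' => Φ (p', s))
        ((extChartAt (𝓡 2) p).symm y)) (coordVec (𝓡 2) b2 p a y)
      - laplacian b2 sphereMetric
        (fun s' => α s' ((extChartAt (𝓡 2) p).symm y) (coordVec (𝓡 2) b2 p a y)) s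
      = B.r ((extChartAt (𝓡 2) p).symm y) ^ 2 *
        orbitPart J s ((extChartAt (𝓡 2) p).symm y) (coordVec (𝓡 2) b2 p a y)) ↔
    dual (comp₂ b2 B.g p) (comp₂ b2 B.vol p) (fun i => pderiv b2 i fun y => scalarFam Φ p y s) a y
      - rotLap (orbitFam α p a y) s = B.rsq p y * orbitFam (orbitPart J) p a y s := by
  rw [B.vol_gradient_chart (fun p' => Φ (p', s)) hy (hΦ.mdifferentiableAt_orbit s _),
    show laplacian b2 sphereMetric (fun s' => α s' ((extChartAt (𝓡 2) p).symm y)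
      (coordVec (𝓡 2) b2 p a y)) s = rotLap (orbitFam α p a y) s from
      laplacian_sphere ((hα.orbitFam p a).slice hy) s]
  exact Iff.rfl

theorem Reconstruction.chart {B : SphSymSpacetime M} {Φ : M × S2 → ℝ} (hΦ : SmoothScalar Φ)
    {α : AngularOneForm M} (hα : α.Smooth) {J : OneForm I4 (M × S2)} (h : B.Reconstruction Φ α J)
    {p : M} {y : E2} (hy : y ∈ (extChartAt (𝓡 2) p).target) (s : S2) (a : Fin 2) :
    dual (comp₂ b2 B.g p) (comp₂ b2 B.vol p) (fun i => pderiv b2 i fun y => scalarFam Φ p y s) a y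
      - rotLap (orbitFam α p a y) s = B.rsq p y * orbitFam (orbitPart J) p a y s :=
  (B.reconstruction_iff hΦ hα hy s a).1 (h _ _ _)

/-- The reconstruction equation follows from its components at the centres of the charts. -/
theorem reconstruction_of_center {Φ : M × S2 → ℝ} (hΦ : SmoothScalar Φ)
    {α : AngularOneForm M} (hα : α.Smooth) {J : OneForm I4 (M × S2)}
    (h : ∀ (p : M) (s : S2) (a : Fin 2),
      dual (comp₂ b2 B.g p) (comp₂ b2 B.vol p) (fun i => pderiv b2 i fun y => scalarFam Φ p y s) a
        (extChartAt (𝓡 2) p p) - rotLap (orbitFam α p a (extChartAt (𝓡 2) p p)) s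
        = B.r p ^ 2 * orbitFam (orbitPart J) p a (extChartAt (𝓡 2) p p) s) :
    B.Reconstruction Φ α J := by
  intro p s
  have hy := mem_extChartAt_target (I := 𝓡 2) p
  obtain ⟨L, hL⟩ := exists_coordEquiv (I := 𝓡 2) (ι := Fin 2) p hy
  have key : ∀ q : M, (extChartAt (𝓡 2) p).symm (extChartAt (𝓡 2) p p) = q → ∀ u : E2,
      (B.vol q : E2 →ₗ[ℝ] E2 →ₗ[ℝ] ℝ) (gradient b2 B.g (fun p' => Φ (p', s)) q) u
      - laplacian b2 sphereMetric (fun s' => (α s' q : E2 →L[ℝ] ℝ) u) s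
      = B.r q ^ 2 * (orbitPart J s q : E2 →L[ℝ] ℝ) u := by
    rintro q rfl u
    have hc := fun a => (B.reconstruction_iff (J := J) hΦ hα hy s a).2
      (by rw [rsq_self]; exact h p s a)
    have hu : u = ∑ k, L.symm u k • L (b2 k) := by
      conv_lhs => rw [← L.apply_symm_apply u, ← b2.sum_repr (L.symm u)]
      simp only [map_sum, map_smul, b2_repr]
    have hl : ∀ l : E2 →ₗ[ℝ] ℝ, l u = ∑ k, L.symm u k * l (L (b2 k)) := fun l => by
      conv_lhs => rw [hu]
      simp only [map_sum, map_smul, smul_eq_mul]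
    have hlc : ∀ l : E2 →L[ℝ] ℝ, l u = ∑ k, L.symm u k * l (L (b2 k)) := fun l => hl l
    set q := (extChartAt (𝓡 2) p).symm (extChartAt (𝓡 2) p p) with hq
    have hs : ∀ k, SmoothS fun s' => (α s' q : E2 →L[ℝ] ℝ) (L (b2 k)) := fun k => by
      have := (hα.orbitFam p k).slice hy
      rw [← hL b2 k]
      exact this
    have hs' : (fun s' => (α s' q : E2 →L[ℝ] ℝ) u) =
        fun s' => ∑ k, L.symm u k * (α s' q : E2 →L[ℝ] ℝ) (L (b2 k)) :=
      funext fun s' => hlc (α s' q : E2 →L[ℝ] ℝ)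
    have hlap : laplacian b2 sphereMetric (fun s' => (α s' q : E2 →L[ℝ] ℝ) u) s =
        ∑ k, L.symm u k * laplacian b2 sphereMetric
          (fun s' => (α s' q : E2 →L[ℝ] ℝ) (L (b2 k))) s := by
      rw [hs', laplacian_sphere (SmoothS.sum fun k => (SmoothS.const _).mul (hs k)),
        rotLap_sum_mul hs]
      simp only [laplacian_sphere (hs _)]
    have hv := hl ((B.vol q : E2 →ₗ[ℝ] E2 →ₗ[ℝ] ℝ) (gradient b2 B.g (fun p' => Φ (p', s)) q))
    have hj := hlc (orbitPart J s q : E2 →L[ℝ] ℝ)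
    refine (congrArg₂ (· - ·) hv hlap).trans (Eq.trans ?_ (congrArg (B.r q ^ 2 * ·) hj).symm)
    beta_reduce
    rw [← Finset.sum_sub_distrib, Finset.mul_sum]
    refine Finset.sum_congr rfl fun k _ => ?_
    have hk := hc k
    rw [hL b2 k] at hk
    rw [← mul_sub]
    refine (congrArg (L.symm u k * ·) hk).trans ?_
    exact mul_left_comm _ _ _
  exact key p (symm_extChartAt_self p)

/-- The curl of the reconstruction equation. -/
theorem Reconstruction.curl_eq {B : SphSymSpacetime M} {Φ : M × S2 → ℝ} (hΦ : SmoothScalar Φ)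
    {α : AngularOneForm M} (hα : α.Smooth) {J : OneForm I4 (M × S2)} (hJ : Smooth₁ b4 J)
    (h : B.Reconstruction Φ α J) (p : M) (s : S2) :
    dAlembertian b2 B.g (fun p' => Φ (p', s)) p =
      curl b2 B.g B.vol (fun p' => B.r p' ^ 2 • orbitPart J s p') p
        + rotLap (fun s => coordCurl (comp₂ b2 B.vol p) (fun a z => orbitFam α p a z s)
          (extChartAt (𝓡 2) p p)) s := by
  have hU := isOpen_extChartAt_target (I := 𝓡 2) p
  have hy := mem_extChartAt_target (I := 𝓡 2) p
  have hD := isFirstOrder_coordCurl (comp₂ b2 B.vol p) (extChartAt (𝓡 2) p p)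
  have hΦd : ∀ i, DifferentiableAt ℝ (pderiv b2 i fun y => scalarFam Φ p y s)
      (extChartAt (𝓡 2) p p) := fun i =>
    ((smoothScalar_iff.1 hΦ p).pderiv hU i).differentiableAt_param hU hy s
  have h1 := hD.congr (w := dual (comp₂ b2 B.g p) (comp₂ b2 B.vol p)
    (fun i => pderiv b2 i fun y => scalarFam Φ p y s))
    (w' := fun a z => B.rsq p z * orbitFam (orbitPart J) p a z s + rotLap (orbitFam α p a z) s)
    fun a => by
      filter_upwards [hU.mem_nhds hy] with z hz
      linear_combination h.chart hΦ hα hz s a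
  have hρ := SmoothFam.of_param (B.contDiffOn_rsq p)
  rw [(B.lorentzChart p).coordCurl_dual hy hΦd, hD.add
    (fun a => (hρ.mul (hJ.orbitPart.orbitFam p a)).differentiableAt_param hU hy s)
    (fun a => ((hα.orbitFam p a).rotLap hU).differentiableAt_param hU hy s)] at h1
  rw [hD.rotLap hU hy (hα.orbitFam p), dAlembertian, laplacian, divergence_eq,
    (isFirstOrder_coordDiv _ _).congr fun k => ?_]
  · rw [h1]
    exact congrArg (· + _)
      (B.curl_center (fun p' => B.r p' ^ 2 • orbitPart J s p') p).symm
  · filter_upwards [hU.mem_nhds hy] with y hy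
    exact comp₁_dfun b2 k hy (hΦ.mdifferentiableAt_orbit s _)

/-- The divergence of the reconstruction equation. -/
theorem Reconstruction.div_eq {B : SphSymSpacetime M} {Φ : M × S2 → ℝ} (hΦ : SmoothScalar Φ)
    {α : AngularOneForm M} (hα : α.Smooth) {J : OneForm I4 (M × S2)} (hJ : Smooth₁ b4 J)
    (h : B.Reconstruction Φ α J) (p : M) (s : S2) :
    coordDiv b2 (comp₂ b2 B.g p) (fun a z => B.rsq p z * orbitFam (orbitPart J) p a z s)
        (extChartAt (𝓡 2) p p) + rotLap (fun s => divergence b2 B.g (α s) p) s = 0 := by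
  have hU := isOpen_extChartAt_target (I := 𝓡 2) p
  have hy := mem_extChartAt_target (I := 𝓡 2) p
  have hD := isFirstOrder_coordDiv (comp₂ b2 B.g p) (extChartAt (𝓡 2) p p)
  have h1 := hD.congr (w := dual (comp₂ b2 B.g p) (comp₂ b2 B.vol p)
    (fun i => pderiv b2 i fun y => scalarFam Φ p y s))
    (w' := fun a z => B.rsq p z * orbitFam (orbitPart J) p a z s + rotLap (orbitFam α p a z) s)
    fun a => by
      filter_upwards [hU.mem_nhds hy] with z hz
      linear_combination h.chart hΦ hα hz s a
  have hρ := SmoothFam.of_param (B.contDiffOn_rsq p)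
  rw [(B.lorentzChart p).coordDiv_dual_pderiv hy ((smoothScalar_iff.1 hΦ p).contDiffOn_param s),
    hD.add
    (fun a => (hρ.mul (hJ.orbitPart.orbitFam p a)).differentiableAt_param hU hy s)
    (fun a => ((hα.orbitFam p a).rotLap hU).differentiableAt_param hU hy s)] at h1
  exact (congrArg (_ + ·) (hD.rotLap hU hy (hα.orbitFam p) s)).trans h1.symm

end SphSymSpacetime
end Spacetime

end

/-! ### Warped product metrics -/

section

open Topology Filter

/-- The one-jet, at the point `(y, 0)`, of a warped product metric `g_{ab} dx^a dx^b + ρ h`, in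
coordinates of the second factor for which the metric `h` is standard to first order at `0`. -/
structure WarpedAt (g : Fin 2 → Fin 2 → E2 → ℝ) (ρ : E2 → ℝ)
    (G : Fin 2 ⊕ Fin 2 → Fin 2 ⊕ Fin 2 → E2 × E2 → ℝ) (y : E2) : Prop where
  val_ll : ∀ a b, G (.inl a) (.inl b) (y, 0) = g a b y
  val_lr : ∀ a C, G (.inl a) (.inr C) (y, 0) = 0
  val_rl : ∀ A b, G (.inr A) (.inl b) (y, 0) = 0
  val_rr : ∀ A C, G (.inr A) (.inr C) (y, 0) = if A = C then ρ y else 0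
  deriv_ll_inl : ∀ a b c, pderiv b4 (.inl c) (G (.inl a) (.inl b)) (y, 0) = pderiv b2 c (g a b) y
  deriv_ll_inr : ∀ a b C, pderiv b4 (.inr C) (G (.inl a) (.inl b)) (y, 0) = 0
  deriv_lr : ∀ a C k, pderiv b4 k (G (.inl a) (.inr C)) (y, 0) = 0
  deriv_rl : ∀ A b k, pderiv b4 k (G (.inr A) (.inl b)) (y, 0) = 0
  deriv_rr_inl : ∀ A C c, pderiv b4 (.inl c) (G (.inr A) (.inr C)) (y, 0) =
    if A = C then pderiv b2 c ρ y else 0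
  deriv_rr_inr : ∀ A C k, pderiv b4 (.inr k) (G (.inr A) (.inr C)) (y, 0) = 0
  isUnit_det : IsUnit (Matrix.of fun k l => g k l y).det
  ginv_comm : ginv g 1 0 y = ginv g 0 1 y
  ne_zero : ρ y ≠ 0

namespace WarpedAt

variable {g : Fin 2 → Fin 2 → E2 → ℝ} {ρ : E2 → ℝ}
  {G : Fin 2 ⊕ Fin 2 → Fin 2 ⊕ Fin 2 → E2 × E2 → ℝ} {y : E2} (h : WarpedAt g ρ G y)
include h

theorem inv_eq : (Matrix.of fun k l => G k l (y, (0 : E2)))⁻¹ =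
    Matrix.fromBlocks (Matrix.of fun k l => g k l y)⁻¹ 0 0 ((ρ y)⁻¹ • 1) := by
  have e : (Matrix.of fun k l => G k l (y, (0 : E2))) =
      Matrix.fromBlocks (Matrix.of fun k l => g k l y) 0 0 (ρ y • 1) := by
    ext (a | A) (b | C)
    · simp [h.val_ll]
    · simp [h.val_lr]
    · simp [h.val_rl]
    · simp [h.val_rr, Matrix.one_apply]
  rw [e]
  refine Matrix.inv_eq_right_inv ?_
  rw [Matrix.fromBlocks_multiply, Matrix.mul_nonsing_inv _ h.isUnit_det]
  simp [h.ne_zero]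

theorem ginv_ll (a b : Fin 2) : ginv G (.inl a) (.inl b) (y, 0) = ginv g a b y := by
  rw [ginv, h.inv_eq]; rfl
theorem ginv_lr (a C : Fin 2) : ginv G (.inl a) (.inr C) (y, 0) = 0 := by
  rw [ginv, h.inv_eq]; rfl
theorem ginv_rl (A b : Fin 2) : ginv G (.inr A) (.inl b) (y, 0) = 0 := by
  rw [ginv, h.inv_eq]; rfl
theorem ginv_rr (A C : Fin 2) : ginv G (.inr A) (.inr C) (y, 0) = if A = C then (ρ y)⁻¹ else 0 := by
  rw [ginv, h.inv_eq, Matrix.fromBlocks_apply₂₂]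
  simp [Matrix.one_apply]

theorem christoffel_lll (c a b : Fin 2) :
    christoffel b4 G (.inl c) (.inl a) (.inl b) (y, 0) = christoffel b2 g c a b y := by
  simp only [christoffel, Fintype.sum_sum_type, h.ginv_ll, h.ginv_lr, h.deriv_ll_inl, zero_mul,
    Finset.sum_const_zero, add_zero]

theorem christoffel_llr (c a C : Fin 2) :
    christoffel b4 G (.inl c) (.inl a) (.inr C) (y, 0) = 0 := by
  simp only [christoffel, Fintype.sum_sum_type, h.ginv_ll, h.ginv_lr, h.deriv_ll_inr, h.deriv_rl,
    h.deriv_lr, zero_mul, Finset.sum_const_zero, add_zero, sub_zero, mul_zero]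

theorem christoffel_lrl (c a C : Fin 2) :
    christoffel b4 G (.inl c) (.inr C) (.inl a) (y, 0) = 0 := by
  simp only [christoffel, Fintype.sum_sum_type, h.ginv_ll, h.ginv_lr, h.deriv_ll_inr, h.deriv_rl,
    zero_mul, Finset.sum_const_zero, add_zero, sub_zero, mul_zero]

theorem christoffel_lrr (c A C : Fin 2) :
    christoffel b4 G (.inl c) (.inr A) (.inr C) (y, 0) =
      if A = C then -(1 / 2) * ∑ d, ginv g c d y * pderiv b2 d ρ y else 0 := by
  simp only [christoffel, Fintype.sum_sum_type, h.ginv_ll, h.ginv_lr, h.deriv_rl,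
    h.deriv_rr_inl, zero_mul, Finset.sum_const_zero, add_zero, zero_sub]
  split_ifs
  · simp only [mul_neg, Finset.sum_neg_distrib]; ring
  · simp

theorem christoffel_rll (C a b : Fin 2) :
    christoffel b4 G (.inr C) (.inl a) (.inl b) (y, 0) = 0 := by
  simp only [christoffel, Fintype.sum_sum_type, h.ginv_rl, h.deriv_ll_inr, h.deriv_lr,
    zero_mul, Finset.sum_const_zero, add_zero, sub_zero, mul_zero]

theorem christoffel_rlr (C a A : Fin 2) :
    christoffel b4 G (.inr C) (.inl a) (.inr A) (y, 0) =
      if C = A then 1 / 2 * ((ρ y)⁻¹ * pderiv b2 a ρ y) else 0 := by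
  simp only [christoffel, Fintype.sum_sum_type, h.ginv_rl, h.ginv_rr, h.deriv_rr_inl, h.deriv_lr,
    zero_mul, Finset.sum_const_zero, zero_add, sub_zero, add_zero, ite_mul, Finset.sum_ite_eq,
    Finset.mem_univ, if_true]
  simp only [eq_comm (a := A)]
  split_ifs <;> simp

theorem christoffel_rrl (C a A : Fin 2) :
    christoffel b4 G (.inr C) (.inr A) (.inl a) (y, 0) =
      if C = A then 1 / 2 * ((ρ y)⁻¹ * pderiv b2 a ρ y) else 0 := by
  simp only [christoffel, Fintype.sum_sum_type, h.ginv_rl, h.ginv_rr, h.deriv_rr_inl, h.deriv_lr,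
    h.deriv_rl, zero_mul, Finset.sum_const_zero, zero_add, sub_zero, ite_mul, Finset.sum_ite_eq,
    Finset.mem_univ, if_true]
  simp only [eq_comm (a := A)]
  split_ifs <;> simp

theorem christoffel_rrr (C A D : Fin 2) :
    christoffel b4 G (.inr C) (.inr A) (.inr D) (y, 0) = 0 := by
  simp only [christoffel, Fintype.sum_sum_type, h.ginv_rl, h.deriv_rr_inr,
    zero_mul, Finset.sum_const_zero, add_zero, sub_zero, mul_zero]

/-- The divergence of a covector field for a warped product metric. -/
theorem coordDiv_eq (J : Fin 2 ⊕ Fin 2 → E2 × E2 → ℝ) (w : Fin 2 → E2 → ℝ)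
    (hw : ∀ a, J (.inl a) (y, 0) = w a y)
    (hd : ∀ a c, pderiv b4 (.inl c) (J (.inl a)) (y, 0) = pderiv b2 c (w a) y)
    (hwd : ∀ a, DifferentiableAt ℝ (w a) y) (hρ : DifferentiableAt ℝ ρ y) :
    ρ y * coordDiv b4 G J (y, 0) = coordDiv b2 g (fun a z => ρ z * w a z) y
      + ∑ A, pderiv b4 (.inr A) (J (.inr A)) (y, 0) := by
  have hm : ∀ a c, pderiv b2 c (fun z => ρ z * w a z) y =
      ρ y * pderiv b2 c (w a) y + w a y * pderiv b2 c ρ y := fun a c => by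
    rw [pderiv, fderiv_fun_mul hρ (hwd a)]; rfl
  have hr := h.ne_zero
  simp only [coordDiv, covDeriv₁, Fintype.sum_sum_type, h.ginv_ll, h.ginv_lr, h.ginv_rl, h.ginv_rr,
    h.christoffel_lll, h.christoffel_llr, h.christoffel_lrl, h.christoffel_lrr, h.christoffel_rll,
    h.christoffel_rlr, h.christoffel_rrl, h.christoffel_rrr, hw, hd, hm, zero_mul,
    Finset.sum_const_zero, add_zero, zero_add, ite_mul, Finset.sum_ite_eq, Finset.mem_univ, if_true]
  simp only [Fin.sum_univ_two, h.ginv_comm]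
  field_simp
  ring

/-- The components along the first factor of the divergence of a two-form for a warped product
metric. -/
theorem sum_covDeriv₂_inl (T : Fin 2 ⊕ Fin 2 → Fin 2 ⊕ Fin 2 → E2 × E2 → ℝ)
    (hT : ∀ i j z, T i j z = -T j i z) (F : Fin 2 → Fin 2 → E2 → ℝ)
    (hF : ∀ a b, T (.inl a) (.inl b) (y, 0) = F a b y)
    (hd : ∀ a b c, pderiv b4 (.inl c) (T (.inl a) (.inl b)) (y, 0) = pderiv b2 c (F a b) y)
    (b : Fin 2) :
    ρ y * ∑ k, ∑ i, ginv G k i (y, 0) * covDeriv₂ b4 G T k i (.inl b) (y, 0) =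
      ρ y * ∑ c, ∑ a, ginv g c a y * covDeriv₂ b2 g F c a b y
      + ∑ d, ∑ c, ginv g d c y * pderiv b2 c ρ y * F d b y
      + ∑ A, pderiv b4 (.inr A) (T (.inr A) (.inl b)) (y, 0) := by
  have hr := h.ne_zero
  have h0 : ∀ A, T (.inr A) (.inr A) (y, 0) = 0 := fun A => by
    have := hT (.inr A) (.inr A) (y, 0); linarith
  simp only [covDeriv₂, Fintype.sum_sum_type, h.ginv_ll, h.ginv_lr, h.ginv_rl, h.ginv_rr,
    h.christoffel_lll, h.christoffel_llr, h.christoffel_lrl, h.christoffel_lrr, h.christoffel_rll,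
    h.christoffel_rlr, h.christoffel_rrl, h.christoffel_rrr, hF, hd, h0, zero_mul, mul_zero,
    Finset.sum_const_zero, add_zero, zero_add, ite_mul, Finset.sum_ite_eq, Finset.sum_ite_eq',
    Finset.mem_univ, if_true, sub_zero]
  simp only [Fin.sum_univ_two, h.ginv_comm]
  field_simp
  ring

/-- The components along the second factor of the divergence of a two-form for a warped product
metric. -/
theorem sum_covDeriv₂_inr (T : Fin 2 ⊕ Fin 2 → Fin 2 ⊕ Fin 2 → E2 × E2 → ℝ)
    (hT : ∀ i j z, T i j z = -T j i z) (C : Fin 2) (w : Fin 2 → E2 → ℝ)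
    (hw : ∀ a, T (.inl a) (.inr C) (y, 0) = w a y)
    (hd : ∀ a c, pderiv b4 (.inl c) (T (.inl a) (.inr C)) (y, 0) = pderiv b2 c (w a) y) :
    ∑ k, ∑ i, ginv G k i (y, 0) * covDeriv₂ b4 G T k i (.inr C) (y, 0) =
      coordDiv b2 g w y
      + (ρ y)⁻¹ * ∑ A, pderiv b4 (.inr A) (T (.inr A) (.inr C)) (y, 0) := by
  have hr := h.ne_zero
  have h1 : ∀ a, T (.inr C) (.inl a) (y, 0) = -w a y := fun a => by rw [hT, hw]
  simp only [coordDiv, covDeriv₁, covDeriv₂, Fintype.sum_sum_type, h.ginv_ll, h.ginv_lr, h.ginv_rl,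
    h.ginv_rr,
    h.christoffel_lll, h.christoffel_llr, h.christoffel_lrl, h.christoffel_lrr, h.christoffel_rll,
    h.christoffel_rlr, h.christoffel_rrl, h.christoffel_rrr, hw, hd, zero_mul,
    Finset.sum_const_zero, add_zero, zero_add, ite_mul, Finset.sum_ite_eq, Finset.sum_ite_eq',
    Finset.mem_univ, if_true]
  fin_cases C <;> simp only [Fin.sum_univ_two, h.ginv_comm, Fin.zero_eta, Fin.mk_one, zero_ne_one, one_ne_zero,
      if_true, if_false] at * <;> simp only [h1] <;> field_simp <;> ring

end WarpedAt

end

/-! ### The spacetime metric in a product chart -/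

section

open Topology Filter

theorem b4_inl_apply (a : Fin 2) : (b4 (.inl a) : E2 × E2) = (b2 a, 0) := by simp [b4]
theorem b4_inr_apply (A : Fin 2) : (b4 (.inr A) : E2 × E2) = (0, b2 A) := by simp [b4]

theorem pderiv_inl {f : E2 × E2 → ℝ} {y w : E2} (hf : DifferentiableAt ℝ f (y, w)) (c : Fin 2) :
    pderiv b4 (.inl c) f (y, w) = pderiv b2 c (fun z => f (z, w)) y := by
  have h := hf.hasFDerivAt.comp y (f := fun z : E2 => (z, w)) (hasFDerivAt_prodMk_left y w)
  rw [pderiv, pderiv, show fderiv ℝ (fun z => f (z, w)) y = _ from h.fderiv, b4_inl_apply]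
  rfl

theorem pderiv_inr {f : E2 × E2 → ℝ} {y w : E2} (hf : DifferentiableAt ℝ f (y, w)) (c : Fin 2) :
    pderiv b4 (.inr c) f (y, w) = pderiv b2 c (fun z => f (y, z)) w := by
  have h := hf.hasFDerivAt.comp w (f := fun z : E2 => (y, z)) (hasFDerivAt_prodMk_right y w)
  rw [pderiv, pderiv, show fderiv ℝ (fun z => f (y, z)) w = _ from h.fderiv, b4_inr_apply]
  rfl

theorem pderiv_const_fun (c : ℝ) (i : Fin 2) (y : E2) : pderiv b2 i (fun _ => c) y = 0 := by
  simp [pderiv]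

theorem pderiv_smul_const {f : E2 → ℝ} {y : E2} (i : Fin 2) (c : ℝ) (hf : DifferentiableAt ℝ f y) :
    pderiv b2 i (fun z => f z * c) y = pderiv b2 i f y * c := by
  rw [pderiv, fderiv_mul_const hf]
  simp [pderiv, mul_comm]

/-- The components of the exterior derivative; the Christoffel symbols drop out. -/
theorem covDeriv₁_sub_comm {ι E : Type*} [Fintype ι] [DecidableEq ι] [NormedAddCommGroup E]
    [NormedSpace ℝ E] (b : Module.Basis ι ℝ E) {G : ι → ι → E → ℝ} (hG : ∀ i j, G i j = G j i)
    (w : ι → E → ℝ) (i j : ι) (y : E) :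
    covDeriv₁ b G w i j y - covDeriv₁ b G w j i y = pderiv b i (w j) y - pderiv b j (w i) y := by
  have e : ∀ k, christoffel b G k i j y = christoffel b G k j i y := fun k => by
    simp only [christoffel, hG i j, add_comm]
  simp only [covDeriv₁, e]
  ring

section Spacetime

variable {M : Type*} [TopologicalSpace M] [ChartedSpace E2 M] [IsManifold (𝓡 2) ∞ M]

namespace SphSymSpacetime

variable (B : SphSymSpacetime M)

omit [IsManifold (𝓡 2) ∞ M] in
theorem metric4_apply (x : M × S2) (u v : E2 × E2) :
    (B.metric4 x : E2 × E2 →ₗ[ℝ] E2 × E2 →ₗ[ℝ] ℝ) u v =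
      (B.g x.1 : E2 →ₗ[ℝ] E2 →ₗ[ℝ] ℝ) u.1 v.1
        + B.r x.1 ^ 2 * (sphereMetric x.2 : E2 →ₗ[ℝ] E2 →ₗ[ℝ] ℝ) u.2 v.2 := rfl

omit [IsManifold (𝓡 2) ∞ M] in
theorem metric4_symm (x : M × S2) (u v : E2 × E2) :
    (B.metric4 x : E2 × E2 →ₗ[ℝ] E2 × E2 →ₗ[ℝ] ℝ) u v =
      (B.metric4 x : E2 × E2 →ₗ[ℝ] E2 × E2 →ₗ[ℝ] ℝ) v u := by
  have h : (sphereMetric x.2 : E2 →ₗ[ℝ] E2 →ₗ[ℝ] ℝ) u.2 v.2 =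
      (sphereMetric x.2 : E2 →ₗ[ℝ] E2 →ₗ[ℝ] ℝ) v.2 u.2 :=
    real_inner_comm (sphereIncl x.2 v.2) (sphereIncl x.2 u.2)
  rw [metric4_apply, metric4_apply, h]
  exact congrArg (· + _) (B.g_symm _ _ _)

omit [IsManifold (𝓡 2) ∞ M] in
theorem metric4_inl_inl (x : M × S2) (u v : E2) :
    (B.metric4 x : E2 × E2 →ₗ[ℝ] E2 × E2 →ₗ[ℝ] ℝ) (u, 0) (v, 0) =
      (B.g x.1 : E2 →ₗ[ℝ] E2 →ₗ[ℝ] ℝ) u v := by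
  have h : (sphereMetric x.2 : E2 →ₗ[ℝ] E2 →ₗ[ℝ] ℝ) 0 0 = 0 := map_zero _
  refine (B.metric4_apply x (u, 0) (v, 0)).trans
    ((congrArg (fun t => _ + B.r x.1 ^ 2 * t) h).trans ?_)
  rw [mul_zero, add_zero]

omit [IsManifold (𝓡 2) ∞ M] in
theorem metric4_inl_inr (x : M × S2) (u v : E2) :
    (B.metric4 x : E2 × E2 →ₗ[ℝ] E2 × E2 →ₗ[ℝ] ℝ) (u, 0) (0, v) = 0 := by
  have h : (B.g x.1 : E2 →ₗ[ℝ] E2 →ₗ[ℝ] ℝ) u 0 = 0 := map_zero _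
  have h' : (sphereMetric x.2 : E2 →ₗ[ℝ] E2 →ₗ[ℝ] ℝ) 0 v = 0 := LinearMap.map_zero₂ _ _
  refine (B.metric4_apply x (u, 0) (0, v)).trans
    ((congrArg₂ (fun r t => r + B.r x.1 ^ 2 * t) h h').trans ?_)
  rw [mul_zero, add_zero]

omit [IsManifold (𝓡 2) ∞ M] in
theorem metric4_inr_inr (x : M × S2) (u v : E2) :
    (B.metric4 x : E2 × E2 →ₗ[ℝ] E2 × E2 →ₗ[ℝ] ℝ) (0, u) (0, v) =
      B.r x.1 ^ 2 * (sphereMetric x.2 : E2 →ₗ[ℝ] E2 →ₗ[ℝ] ℝ) u v := by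
  have h : (B.g x.1 : E2 →ₗ[ℝ] E2 →ₗ[ℝ] ℝ) 0 0 = 0 := map_zero _
  refine (B.metric4_apply x (0, u) (0, v)).trans ((congrArg (· + _) h).trans ?_)
  rw [zero_add]

theorem comp₂_metric4_ll (p : M) (s : S2) (a b : Fin 2) {y : E2}
    (hy : y ∈ (extChartAt (𝓡 2) p).target) (w : E2) :
    comp₂ b4 B.metric4 (p, s) (.inl a) (.inl b) (y, w) = comp₂ b2 B.g p a b y := by
  refine (congrArg₂ (fun u v : E2 × E2 => (B.metric4 ((extChartAt I4 (p, s)).symm (y, w)) :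
    E2 × E2 →ₗ[ℝ] E2 × E2 →ₗ[ℝ] ℝ) u v) (coordVec_inl p s a hy w)
    (coordVec_inl p s b hy w)).trans
    (B.metric4_inl_inl _ _ _)

theorem comp₂_metric4_lr (p : M) (s : S2) (a C : Fin 2) {y : E2}
    (hy : y ∈ (extChartAt (𝓡 2) p).target) (w : E2) :
    comp₂ b4 B.metric4 (p, s) (.inl a) (.inr C) (y, w) = 0 := by
  refine (congrArg₂ (fun u v : E2 × E2 => (B.metric4 ((extChartAt I4 (p, s)).symm (y, w)) :
    E2 × E2 →ₗ[ℝ] E2 × E2 →ₗ[ℝ] ℝ) u v) (coordVec_inl p s a hy w)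
    (coordVec_inr p s C hy w)).trans
    (B.metric4_inl_inr _ _ _)

omit [IsManifold (𝓡 2) ∞ M] in
theorem comp₂_metric4_comm (p : M) (s : S2) (i j : Fin 2 ⊕ Fin 2) :
    comp₂ b4 B.metric4 (p, s) i j = comp₂ b4 B.metric4 (p, s) j i :=
  funext fun _ => B.metric4_symm _ _ _

theorem comp₂_metric4_rr (p : M) (s : S2) (A C : Fin 2) {y : E2}
    (hy : y ∈ (extChartAt (𝓡 2) p).target) (w : E2) :
    comp₂ b4 B.metric4 (p, s) (.inr A) (.inr C) (y, w) =
      B.rsq p y * comp₂ b2 sphereMetric s A C w := by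
  refine (congrArg₂ (fun u v : E2 × E2 => (B.metric4 ((extChartAt I4 (p, s)).symm (y, w)) :
    E2 × E2 →ₗ[ℝ] E2 × E2 →ₗ[ℝ] ℝ) u v) (coordVec_inr p s A hy w)
    (coordVec_inr p s C hy w)).trans
    (B.metric4_inr_inr _ _ _)

omit [IsManifold (𝓡 2) ∞ M] in
theorem eventually_target (p : M) (w : E2) : ∀ᶠ z : E2 × E2 in 𝓝 (extChartAt (𝓡 2) p p, w),
    z.1 ∈ (extChartAt (𝓡 2) p).target :=
  continuous_fst.continuousAt.preimage_mem_nhds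
    ((isOpen_extChartAt_target p).mem_nhds (mem_extChartAt_target p))

/-- In a product chart whose sphere factor is centred at `s`, the spacetime metric has over `(y, 0)`
the one-jet of a warped product with a flat fibre. -/
theorem warpedAt (p : M) (s : S2) : WarpedAt (comp₂ b2 B.g p) (B.rsq p)
    (comp₂ b4 B.metric4 (p, s)) (extChartAt (𝓡 2) p p) := by
  have hU := isOpen_extChartAt_target (I := 𝓡 2) p
  have hy := mem_extChartAt_target (I := 𝓡 2) p
  have hn := hU.mem_nhds hy
  have hL := B.lorentzChart p
  have ell : ∀ a b, comp₂ b4 B.metric4 (p, s) (.inl a) (.inl b) =ᶠ[𝓝 (extChartAt (𝓡 2) p p, 0)]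
      fun z => comp₂ b2 B.g p a b z.1 := fun a b => by
    filter_upwards [eventually_target p 0] with z hz using B.comp₂_metric4_ll p s a b hz z.2
  have elr : ∀ a b, comp₂ b4 B.metric4 (p, s) (.inl a) (.inr b) =ᶠ[𝓝 (extChartAt (𝓡 2) p p, 0)]
      fun _ => 0 := fun a b => by
    filter_upwards [eventually_target p 0] with z hz using B.comp₂_metric4_lr p s a b hz z.2
  have err : ∀ a b, comp₂ b4 B.metric4 (p, s) (.inr a) (.inr b) =ᶠ[𝓝 (extChartAt (𝓡 2) p p, 0)]
      fun z => B.rsq p z.1 * comp₂ b2 sphereMetric s a b z.2 := fun a b => by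
    filter_upwards [eventually_target p 0] with z hz using B.comp₂_metric4_rr p s a b hz z.2
  have hρ : DifferentiableAt ℝ (B.rsq p) (extChartAt (𝓡 2) p p) :=
    ((B.contDiffOn_rsq p).contDiffAt hn).differentiableAt (by simp)
  have hh : ∀ A C, Differentiable ℝ (comp₂ b2 sphereMetric s A C) := fun A C => by
    rw [funext (comp₂_sphereMetric s A C)]
    exact ((contDiff_dParam s A).differentiable (by simp)).inner ℝ
      ((contDiff_dParam s C).differentiable (by simp))
  have dll : ∀ a b, DifferentiableAt ℝ (fun z : E2 × E2 => comp₂ b2 B.g p a b z.1)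
      (extChartAt (𝓡 2) p p, 0) := fun a b =>
    (hL.differentiableAt_metric hy a b).comp (f := Prod.fst) (extChartAt (𝓡 2) p p, (0 : E2)) differentiableAt_fst
  have drr : ∀ a b, DifferentiableAt ℝ
      (fun z : E2 × E2 => B.rsq p z.1 * comp₂ b2 sphereMetric s a b z.2)
      (extChartAt (𝓡 2) p p, 0) := fun a b =>
    (hρ.comp (f := Prod.fst) (extChartAt (𝓡 2) p p, (0 : E2)) differentiableAt_fst).mul
      ((hh a b 0).comp (f := Prod.snd) (extChartAt (𝓡 2) p p, (0 : E2)) differentiableAt_snd)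
  have hp : ∀ (k : Fin 2 ⊕ Fin 2) {f g : E2 × E2 → ℝ} {z : E2 × E2}, f =ᶠ[𝓝 z] g →
      pderiv b4 k f z = pderiv b4 k g z := fun k f g z h => by
    rw [pderiv, h.fderiv_eq, pderiv]
  obtain ⟨i00, i01, i10, i11⟩ := hL.ginv_eq hy
  have hz : ∀ k, pderiv b4 k (fun _ : E2 × E2 => (0 : ℝ)) (extChartAt (𝓡 2) p p, 0) = 0 :=
    fun k => by simp [pderiv]
  exact
    { val_ll := fun a b => (ell a b).self_of_nhds
      val_lr := fun a b => (elr a b).self_of_nhds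
      val_rl := fun a b => by rw [comp₂_metric4_comm]; exact (elr b a).self_of_nhds
      val_rr := fun a b => by
        refine (err a b).self_of_nhds.trans ?_
        beta_reduce
        rw [comp₂_sphereMetric_zero]; simp
      deriv_ll_inl := fun a b c => by rw [hp _ (ell a b), pderiv_inl (dll a b)]
      deriv_ll_inr := fun a b c => by
        rw [hp _ (ell a b), pderiv_inr (dll a b)]
        exact pderiv_const_fun (comp₂ b2 B.g p a b (extChartAt (𝓡 2) p p)) c 0
      deriv_lr := fun a b k => by rw [hp _ (elr a b), hz]
      deriv_rl := fun a b k => by rw [comp₂_metric4_comm, hp _ (elr b a), hz]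
      deriv_rr_inl := fun a b c => by
        rw [hp _ (err a b), pderiv_inl (drr a b)]
        dsimp only
        rw [pderiv_smul_const c _ hρ, comp₂_sphereMetric_zero]
        simp
      deriv_rr_inr := fun a b c => by
        rw [hp _ (err a b), pderiv_inr (drr a b)]
        simp only [mul_comm (B.rsq p _)]
        rw [pderiv_smul_const c _ (hh a b 0), pderiv_sphereMetric_zero, zero_mul]
      isUnit_det := by
        rw [Matrix.det_fin_two]
        simp only [Matrix.of_apply, hL.symm]
        have h1 := hL.vol_sq _ hy
        have h2 := pow_ne_zero 2 (hL.vol_ne _ hy)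
        rw [← h1] at h2
        exact IsUnit.mk0 _ fun h0 => h2 (by linear_combination -h0)
      ginv_comm := by rw [i10, i01]
      ne_zero := (B.rsq_pos p _).ne' }

end SphSymSpacetime
end Spacetime

end

/-! ### The Faraday tensor -/

section

open Topology Filter

theorem sum_rotStar_mul_cr (f : S2 → ℝ) (s : S2) (C : Fin 2) :
    ∑ i, rotStar f i s * cr s (frame s C) i = -∑ i, rotD i f s * frame s C i := by
  have h0 := coord_mul_rotD f s
  have h1 := inner_coe_frame s C
  have h2 := S2.sum_sq s
  rw [inner_eq_sum] at h1
  simp only [rotStar, Fin.sum_univ_three, Fin.isValue, zero_add, Fin.reduceAdd, cr_zero, cr_one,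
    cr_two] at *
  linear_combination (s.1 0 * frame s C 0 + s.1 1 * frame s C 1 + s.1 2 * frame s C 2) * h0
    - (rotD 0 f s * frame s C 0 + rotD 1 f s * frame s C 1 + rotD 2 f s * frame s C 2) * h2

/-- The divergence of the exterior derivative of a covector field on the sphere. -/
theorem sum_pderiv_antisymm_angular {b : Fin 3 → S2 → ℝ} (hb : ∀ i, SmoothS (b i))
    (ht : ∀ s : S2, s.1 0 * b 0 s + s.1 1 * b 1 s + s.1 2 * b 2 s = 0)
    (hc : SmoothS (rotCurl b)) (s : S2) (C : Fin 2) :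
    ∑ A, pderiv b2 A (fun w => pderiv b2 A (angular b s C) w - pderiv b2 C (angular b s A) w) 0 =
      ∑ i, rotStar (fun s => -rotCurl b s) i s * cr s (frame s C) i := by
  have h := pderiv_curl_angular hb ht hc s
  have o := orient_sq s
  have hz : ∀ A, pderiv b2 A
      (fun w => pderiv b2 A (angular b s A) w - pderiv b2 A (angular b s A) w) 0 = 0 := fun A => by
    simp [pderiv]
  have hn : pderiv b2 1 (fun w => pderiv b2 1 (angular b s 0) w - pderiv b2 0 (angular b s 1) w) 0 =
      -pderiv b2 1 (fun w => pderiv b2 0 (angular b s 1) w - pderiv b2 1 (angular b s 0) w) 0 := by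
    rw [pderiv, pderiv, ← _root_.neg_apply, ← fderiv_fun_neg]
    simp only [neg_sub]
  have h0 := h 0
  have h1 := h 1
  rw [angular_zero] at h0 h1
  simp only [cr_frame_zero, cr_frame_one, Fin.sum_univ_three] at h0 h1
  rw [sum_rotStar_mul_cr]
  simp only [rotD_neg]
  rw [Fin.sum_univ_two, Fin.sum_univ_three]
  fin_cases C
  · simp only [Fin.zero_eta, hz, hn, h1]
    linear_combination (rotD 0 (rotCurl b) s * frame s 0 0 + rotD 1 (rotCurl b) s * frame s 0 1
      + rotD 2 (rotCurl b) s * frame s 0 2) * o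
  · simp only [Fin.mk_one, hz, h0]
    linear_combination (rotD 0 (rotCurl b) s * frame s 1 0 + rotD 1 (rotCurl b) s * frame s 1 1
      + rotD 2 (rotCurl b) s * frame s 1 2) * o

/-- A tangential field on the sphere is determined by its components in the chart centred at the
point. -/
theorem eq_of_angular_zero {b c : Fin 3 → S2 → ℝ} {s : S2}
    (hb : s.1 0 * b 0 s + s.1 1 * b 1 s + s.1 2 * b 2 s = 0)
    (hc : s.1 0 * c 0 s + s.1 1 * c 1 s + s.1 2 * c 2 s = 0)
    (h : ∀ C, angular b s C 0 = angular c s C 0) (i : Fin 3) : b i s = c i s := by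
  have e : ∀ b : Fin 3 → S2 → ℝ, s.1 0 * b 0 s + s.1 1 * b 1 s + s.1 2 * b 2 s = 0 →
      b i s = angular b s 0 0 * cr s (frame s 0) i + angular b s 1 0 * cr s (frame s 1) i := by
    intro b hb
    have q : b i s = (if (0 : Fin 3) = i then 1 else 0) * b 0 s
        + (if (1 : Fin 3) = i then 1 else 0) * b 1 s
        + (if (2 : Fin 3) = i then 1 else 0) * b 2 s := by fin_cases i <;> simp
    have k0 := cr_frame_complete s 0 i
    have k1 := cr_frame_complete s 1 i
    have k2 := cr_frame_complete s 2 i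
    rw [q, angular_zero, angular_zero, Fin.sum_univ_three, Fin.sum_univ_three]
    linear_combination s.1 i * hb - b 0 s * k0 - b 1 s * k1 - b 2 s * k2
  rw [e b hb, e c hc, h, h]

theorem contDiffOn_pderiv4 {U : Set (E2 × E2)} (hU : IsOpen U) {f : E2 × E2 → ℝ}
    (hf : ContDiffOn ℝ ∞ f U) (i : Fin 2 ⊕ Fin 2) : ContDiffOn ℝ ∞ (pderiv b4 i f) U :=
  (hf.fderiv_of_isOpen hU (by simp)).clm_apply contDiffOn_const

section Spacetime

variable {M : Type*} [TopologicalSpace M] [ChartedSpace E2 M] [IsManifold (𝓡 2) ∞ M]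

omit [IsManifold (𝓡 2) ∞ M] in
theorem Smooth₁.contDiffOn_prod {A : OneForm I4 (M × S2)} (hA : Smooth₁ b4 A) (p : M) (s : S2)
    (j : Fin 2 ⊕ Fin 2) : ContDiffOn ℝ ∞ (comp₁ b4 A (p, s) j)
      ((extChartAt (𝓡 2) p).target ×ˢ Set.univ) := by
  have := hA (p, s) j
  rwa [extChartAt_prod_target] at this

omit [IsManifold (𝓡 2) ∞ M] in
theorem isOpen_target_prod (p : M) :
    IsOpen ((extChartAt (𝓡 2) p).target ×ˢ (Set.univ : Set E2)) :=
  (isOpen_extChartAt_target p).prod isOpen_univ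

omit [IsManifold (𝓡 2) ∞ M] in
theorem Smooth₁.differentiableAt_prod {A : OneForm I4 (M × S2)} (hA : Smooth₁ b4 A) (p : M) (s : S2)
    (j : Fin 2 ⊕ Fin 2) {y : E2} (hy : y ∈ (extChartAt (𝓡 2) p).target) (w : E2) :
    DifferentiableAt ℝ (comp₁ b4 A (p, s) j) (y, w) :=
  ((hA.contDiffOn_prod p s j).contDiffAt ((isOpen_target_prod p).mem_nhds ⟨hy, trivial⟩)).differentiableAt
    (by simp)

theorem orbitFam_alphaInv {A : OneForm I4 (M × S2)} {μ : M × S2 → ℝ} (hμ : SmoothScalar μ) {p : M}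
    {y : E2} (hy : y ∈ (extChartAt (𝓡 2) p).target) (a : Fin 2) (s : S2) :
    orbitFam (alphaInv A μ) p a y s =
      orbitFam (orbitPart A) p a y s - pderiv b2 a (fun z => scalarFam μ p z s) y :=
  congrArg (orbitFam (orbitPart A) p a y s - ·)
    (comp₁_dfun b2 a hy (hμ.mdifferentiableAt_orbit s _))

theorem smooth_alphaInv {A : OneForm I4 (M × S2)} (hA : Smooth₁ b4 A) {μ : M × S2 → ℝ}
    (hμ : SmoothScalar μ) : (alphaInv A μ).Smooth :=
  angularOneForm_smooth_iff.2 fun p a => ((hA.orbitPart.orbitFam p a).sub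
    ((smoothScalar_iff.1 hμ p).pderiv (isOpen_extChartAt_target p) a)).congr fun _ hy =>
      funext fun s => orbitFam_alphaInv hμ hy a s

/-- The gauge-invariant expression, along the rotation fields, of the mixed components `F_{aB}` of
the Faraday tensor. -/
def crossFam (α : AngularOneForm M) (ν : M × S2 → ℝ) (p : M) (a : Fin 2) (i : Fin 3) (y : E2)
    (s : S2) : ℝ :=
  rotStar (fun s => pderiv b2 a (fun z => scalarFam ν p z s) y) i s - rotD i (orbitFam α p a y) s

theorem smoothFam_rotStar {U : Set E2} (hU : IsOpen U) {f : E2 → S2 → ℝ} (hf : SmoothFam U f)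
    (i : Fin 3) : SmoothFam U fun y => rotStar (f y) i :=
  ((hf.rotD hU _).mul ((SmoothS.coord _).fam U)).sub ((hf.rotD hU _).mul ((SmoothS.coord _).fam U))

theorem smooth_crossFam {α : AngularOneForm M} (hα : α.Smooth) {ν : M × S2 → ℝ}
    (hν : SmoothScalar ν) (p : M) (a : Fin 2) (i : Fin 3) :
    SmoothFam (extChartAt (𝓡 2) p).target (crossFam α ν p a i) := by
  have hU := isOpen_extChartAt_target (I := 𝓡 2) p
  exact (smoothFam_rotStar hU ((smoothScalar_iff.1 hν p).pderiv hU a) i).sub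
    ((hα.orbitFam p a).rotD hU i)

theorem parD_rotStar {U : Set E2} (hU : IsOpen U) {f : E2 → S2 → ℝ} (hf : SmoothFam U f)
    (i : Fin 3) (a : Fin 2) {y : E2} (hy : y ∈ U) (s : S2) :
    pderiv b2 a (fun z => rotStar (f z) i s) y =
      rotStar (fun s => pderiv b2 a (fun z => f z s) y) i s := by
  have hd : ∀ n, DifferentiableAt ℝ (fun z => rotD n (f z) s) y := fun n =>
    (hf.rotD hU n).differentiableAt_param hU hy s
  have h1 : ∀ n, pderiv b2 a (fun z => rotD n (f z) s) y =
      rotD n (fun s => pderiv b2 a (fun z => f z s) y) s := fun n =>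
    (hf.rotD_parD hU (b2 a) n hy s).symm
  simp only [rotStar]
  rw [← h1, ← h1, ← pderiv_smul_const a _ (hd _), ← pderiv_smul_const a _ (hd _)]
  simp only [pderiv]
  rw [fderiv_fun_sub ((hd _).mul_const _) ((hd _).mul_const _)]
  rfl

namespace SphSymSpacetime

variable (B : SphSymSpacetime M) {A : OneForm I4 (M × S2)} {μ ν : M × S2 → ℝ}

omit [IsManifold (𝓡 2) ∞ M] in
theorem faraday_eq (A : OneForm I4 (M × S2)) (p : M) (s : S2) (i j : Fin 2 ⊕ Fin 2) (z : E2 × E2) :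
    faraday b4 B.metric4 A (p, s) i j z =
      pderiv b4 i (comp₁ b4 A (p, s) j) z - pderiv b4 j (comp₁ b4 A (p, s) i) z :=
  covDeriv₁_sub_comm b4 (B.comp₂_metric4_comm p s) _ i j z

omit [IsManifold (𝓡 2) ∞ M] in
theorem differentiableAt_faraday (hA : Smooth₁ b4 A) (p : M) (s : S2) (i j : Fin 2 ⊕ Fin 2)
    {y : E2} (hy : y ∈ (extChartAt (𝓡 2) p).target) (w : E2) :
    DifferentiableAt ℝ (faraday b4 B.metric4 A (p, s) i j) (y, w) := by
  rw [funext (B.faraday_eq A p s i j)]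
  have hU := isOpen_target_prod p
  have h := (contDiffOn_pderiv4 hU (hA.contDiffOn_prod p s j) i).sub
    (contDiffOn_pderiv4 hU (hA.contDiffOn_prod p s i) j)
  exact (h.contDiffAt (hU.mem_nhds ⟨hy, trivial⟩)).differentiableAt (by simp)

/-- The orbit components of the Faraday tensor are the curl of `α^(inv)`. -/
theorem faraday_inl_inl (hA : Smooth₁ b4 A) (hμ : SmoothScalar μ) (p : M) (s : S2) (a b : Fin 2)
    {y : E2} (hy : y ∈ (extChartAt (𝓡 2) p).target) (w : E2) :
    faraday b4 B.metric4 A (p, s) (.inl a) (.inl b) (y, w) =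
      pderiv b2 a (fun z => orbitFam (alphaInv A μ) p b z ((extChartAt (𝓡 2) s).symm w)) y
      - pderiv b2 b (fun z => orbitFam (alphaInv A μ) p a z ((extChartAt (𝓡 2) s).symm w)) y := by
  have hU := isOpen_extChartAt_target (I := 𝓡 2) p
  have hm := (smoothScalar_iff.1 hμ p).contDiffOn_param ((extChartAt (𝓡 2) s).symm w)
  rw [faraday_eq, pderiv_inl (hA.differentiableAt_prod p s _ hy w),
    pderiv_inl (hA.differentiableAt_prod p s _ hy w)]
  have e : ∀ c d, pderiv b2 d (fun z => comp₁ b4 A (p, s) (.inl c) (z, w)) y =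
      pderiv b2 d (fun z => orbitFam (alphaInv A μ) p c z ((extChartAt (𝓡 2) s).symm w)) y +
      pderiv b2 d (pderiv b2 c fun z => scalarFam μ p z ((extChartAt (𝓡 2) s).symm w)) y := by
    intro c d
    have h1 : (fun z => comp₁ b4 A (p, s) (.inl c) (z, w)) =ᶠ[𝓝 y]
        fun z => orbitFam (alphaInv A μ) p c z ((extChartAt (𝓡 2) s).symm w) +
          pderiv b2 c (fun z => scalarFam μ p z ((extChartAt (𝓡 2) s).symm w)) z := by
      filter_upwards [hU.mem_nhds hy] with z hz
      rw [orbitFam_alphaInv hμ hz, comp₁_inl A p s c hz w, sub_add_cancel]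
      rfl
    rw [pderiv_congr h1, pderiv, fderiv_fun_add
      (((smooth_alphaInv hA hμ).orbitFam p c).differentiableAt_param hU hy _)
      (((contDiffOn_pderiv hU hm c).contDiffAt (hU.mem_nhds hy)).differentiableAt (by simp))]
    rfl
  rw [e, e, pderiv_comm hU hm hy a b]
  ring

/-- The mixed components of the Faraday tensor at the centre of the sphere chart. -/
theorem faraday_inl_inr (hA : Smooth₁ b4 A) (h : IsAngularPotentials A μ ν) (p : M) (s : S2)
    (a C : Fin 2) {y : E2} (hy : y ∈ (extChartAt (𝓡 2) p).target) (w : E2) :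
    faraday b4 B.metric4 A (p, s) (.inl a) (.inr C) (y, w) =
      angular (fun i => crossFam (alphaInv A μ) ν p a i y) s C w := by
  have hU := isOpen_extChartAt_target (I := 𝓡 2) p
  have hμ := smoothScalar_iff.1 h.smooth_even p
  have hν := smoothScalar_iff.1 h.smooth_odd p
  have hAo := hA.orbitPart.orbitFam p a
  rw [faraday_eq, pderiv_inl (hA.differentiableAt_prod p s _ hy w),
    pderiv_inr (hA.differentiableAt_prod p s _ hy w)]
  have e1 : (fun z => comp₁ b4 A (p, s) (.inr C) (z, w)) =ᶠ[𝓝 y] fun z =>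
      ∑ i, (rotD i (scalarFam μ p z) ((extChartAt (𝓡 2) s).symm w)
        + rotStar (scalarFam ν p z) i ((extChartAt (𝓡 2) s).symm w))
        * cr (sphereParam s w) (dParam s C w) i := by
    filter_upwards [hU.mem_nhds hy] with z hz
    rw [comp₁_inr A p s C hz w, comp₁_spherePart, angular]
    exact Finset.sum_congr rfl fun i _ => by rw [h.angFam_eq]; rfl
  have e2 : (fun w => comp₁ b4 A (p, s) (.inl a) (y, w)) =
      fun w => orbitFam (orbitPart A) p a y ((extChartAt (𝓡 2) s).symm w) :=
    funext fun w => comp₁_inl A p s a hy w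
  rw [pderiv_congr e1, e2, pderiv_symm_sphere (hAo.slice hy)]
  set σ := (extChartAt (𝓡 2) s).symm w with hσ
  have hd1 : ∀ i, DifferentiableAt ℝ (fun z => rotD i (scalarFam μ p z) σ) y := fun i =>
    (hμ.rotD hU i).differentiableAt_param hU hy σ
  have hd2 : ∀ i, DifferentiableAt ℝ (fun z => rotStar (scalarFam ν p z) i σ) y := fun i =>
    (smoothFam_rotStar hU hν i).differentiableAt_param hU hy σ
  have e3 : pderiv b2 a (fun z => ∑ i, (rotD i (scalarFam μ p z) σ
      + rotStar (scalarFam ν p z) i σ) * cr (sphereParam s w) (dParam s C w) i) y =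
      ∑ i, (rotD i (fun s => pderiv b2 a (fun z => scalarFam μ p z s) y) σ +
        rotStar (fun s => pderiv b2 a (fun z => scalarFam ν p z s) y) i σ)
        * cr (sphereParam s w) (dParam s C w) i := by
    have hd12 : ∀ i, DifferentiableAt ℝ (fun z => rotD i (scalarFam μ p z) σ
        + rotStar (scalarFam ν p z) i σ) y := fun i => (hd1 i).add (hd2 i)
    rw [pderiv, fderiv_fun_sum fun i _ => (hd12 i).mul_const _, _root_.sum_apply]
    refine Finset.sum_congr rfl fun i _ => ?_
    have h1 := pderiv_smul_const a (cr (sphereParam s w) (dParam s C w) i) (hd12 i)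
    refine h1.trans (congrArg (· * _) ?_)
    rw [pderiv, fderiv_fun_add (hd1 i) (hd2 i), _root_.add_apply]
    exact congrArg₂ (· + ·) (hμ.rotD_parD hU (b2 a) i hy σ).symm (parD_rotStar hU hν i a hy σ)
  rw [e3, angular, angular, ← Finset.sum_sub_distrib]
  refine Finset.sum_congr rfl fun i _ => ?_
  have e4 : orbitFam (alphaInv A μ) p a y = fun s => orbitFam (orbitPart A) p a y s -
      pderiv b2 a (fun z => scalarFam μ p z s) y :=
    funext fun s => orbitFam_alphaInv h.smooth_even hy a s
  rw [crossFam, e4, rotD_sub (hAo.slice hy) ((hμ.pderiv hU a).slice hy)]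
  ring

/-- The sphere components of the Faraday tensor at the centre of the sphere chart are the curl of the
angular part of `A`. -/
theorem faraday_inr_inr (hA : Smooth₁ b4 A) (p : M) (s : S2) (C D : Fin 2) {y : E2}
    (hy : y ∈ (extChartAt (𝓡 2) p).target) (w : E2) :
    faraday b4 B.metric4 A (p, s) (.inr C) (.inr D) (y, w) =
      pderiv b2 C (angular (angFam A ((extChartAt (𝓡 2) p).symm y)) s D) w
      - pderiv b2 D (angular (angFam A ((extChartAt (𝓡 2) p).symm y)) s C) w := by
  have e : ∀ C, (fun w => comp₁ b4 A (p, s) (.inr C) (y, w)) =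
      angular (angFam A ((extChartAt (𝓡 2) p).symm y)) s C := fun C => by
    rw [← comp₁_spherePart]
    exact funext fun w => comp₁_inr A p s C hy w
  rw [faraday_eq, pderiv_inr (hA.differentiableAt_prod p s _ hy w),
    pderiv_inr (hA.differentiableAt_prod p s _ hy w), e, e]

end SphSymSpacetime
end Spacetime

end

/-! ### The divergence of the Faraday tensor -/

section

open Topology Filter

/-- The divergence of `f dx⁰ ∧ dx¹`, with a weight `ρ`, as the dual of the differential of the
scalar `ρ f / ε₀₁`. -/
theorem LorentzChart.dual_weighted {U : Set E2} {G V : Fin 2 → Fin 2 → E2 → ℝ}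
    (h : LorentzChart U G V) {y : E2} (hy : y ∈ U) {ρ f Φ : E2 → ℝ}
    (hρ : DifferentiableAt ℝ ρ y) (hf : DifferentiableAt ℝ f y)
    (hΦ : Φ =ᶠ[𝓝 y] fun z => ρ z * (-f z / V 0 1 z))
    {T : Fin 2 → Fin 2 → E2 → ℝ} (h00 : T 0 0 = 0) (h11 : T 1 1 = 0) (h01 : T 0 1 = f)
    (h10 : T 1 0 = -f) (b : Fin 2) :
    ρ y * ∑ c, ∑ a, ginv G c a y * covDeriv₂ b2 G T c a b y
      + ∑ d, ∑ c, ginv G d c y * pderiv b2 c ρ y * T d b y =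
      -dual G V (fun i => pderiv b2 i Φ) b y := by
  obtain ⟨i00, i01, i10, i11⟩ := h.ginv_eq hy
  have hv := h.vol_ne y hy
  have hV := h.differentiableAt_vol hy 0 1
  have hq : DifferentiableAt ℝ (fun z => f z / V 0 1 z) y := by
    have h1 := hf.hasFDerivAt.mul ((hasDerivAt_inv hv).comp_hasFDerivAt y hV.hasFDerivAt)
    exact (h1.congr_of_eventuallyEq (.of_forall fun z => div_eq_mul_inv _ _)).differentiableAt
  have hp : ∀ i, pderiv b2 i Φ y = -(ρ y * pderiv b2 i (fun z => f z / V 0 1 z) y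
      + f y / V 0 1 y * pderiv b2 i ρ y) := fun i => by
    have e : (fun z => ρ z * (-f z / V 0 1 z)) = fun z => -(ρ z * (f z / V 0 1 z)) := by
      funext z; ring
    rw [pderiv_congr hΦ, e, pderiv, fderiv_fun_neg, fderiv_fun_mul hρ hq]
    rfl
  rw [h.sum_covDeriv₂_eq hy hf h00 h11 h01 h10]
  fin_cases b
  · simp only [Fin.zero_eta, dual_zero, flux_one, hp, Fin.sum_univ_two, h00, h10, i10, i11,
      Pi.zero_apply, Pi.neg_apply]
    field_simp
    ring
  · simp only [Fin.mk_one, dual_one, flux_zero, hp, Fin.sum_univ_two, h11, h01, i00, i01,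
      Pi.zero_apply]
    field_simp
    ring

section Spacetime

variable {M : Type*} [TopologicalSpace M] [ChartedSpace E2 M] [IsManifold (𝓡 2) ∞ M]

namespace SphSymSpacetime

variable (B : SphSymSpacetime M) {A : OneForm I4 (M × S2)} {μ ν : M × S2 → ℝ}

omit [IsManifold (𝓡 2) ∞ M] in
theorem faraday_antisymm (A : OneForm I4 (M × S2)) (x : M × S2) (i j : Fin 2 ⊕ Fin 2)
    (z : E2 × E2) : faraday b4 B.metric4 A x i j z = -faraday b4 B.metric4 A x j i z := by
  simp only [faraday, neg_sub]

/-- The components of `∇^μ F_{μb}` along the orbit space. -/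
theorem div_faraday_inl (hA : Smooth₁ b4 A) (h : IsAngularPotentials A μ ν) (p : M) (s : S2)
    (b : Fin 2) :
    B.r p ^ 2 * ∑ k, ∑ i, ginv (comp₂ b4 B.metric4 (p, s)) k i (extChartAt (𝓡 2) p p, 0) *
      covDeriv₂ b4 (comp₂ b4 B.metric4 (p, s)) (faraday b4 B.metric4 A (p, s)) k i (.inl b)
        (extChartAt (𝓡 2) p p, 0) =
    -(dual (comp₂ b2 B.g p) (comp₂ b2 B.vol p)
        (fun i => pderiv b2 i fun y => scalarFam (B.phi (alphaInv A μ)) p y s) b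
        (extChartAt (𝓡 2) p p)
      - rotLap (orbitFam (alphaInv A μ) p b (extChartAt (𝓡 2) p p)) s) := by
  have hU := isOpen_extChartAt_target (I := 𝓡 2) p
  have hy := mem_extChartAt_target (I := 𝓡 2) p
  have hα := smooth_alphaInv hA h.smooth_even
  have hL := B.lorentzChart p
  set α := alphaInv A μ with hαdef
  set F : Fin 2 → Fin 2 → E2 → ℝ := fun a b y =>
    pderiv b2 a (fun z => orbitFam α p b z s) y - pderiv b2 b (fun z => orbitFam α p a z s) y with hF
  have e0 : ∀ a b, ∀ y ∈ (extChartAt (𝓡 2) p).target,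
      faraday b4 B.metric4 A (p, s) (.inl a) (.inl b) (y, 0) = F a b y := fun a b y hy => by
    rw [B.faraday_inl_inl hA h.smooth_even p s a b hy 0, symm_zero_sphere]
  have hW := (B.warpedAt p s).sum_covDeriv₂_inl (faraday b4 B.metric4 A (p, s))
    (fun i j z => B.faraday_antisymm A (p, s) i j z) F (fun a b => e0 a b _ hy)
    (fun a b c => by
      rw [pderiv_inl (B.differentiableAt_faraday hA p s _ _ hy 0)]
      refine pderiv_congr ?_ c
      filter_upwards [hU.mem_nhds hy] with z hz using e0 a b z hz) b
  have hFd : ∀ a b, ContDiffOn ℝ ∞ (F a b) (extChartAt (𝓡 2) p).target := fun a b =>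
    (contDiffOn_pderiv hU ((hα.orbitFam p b).contDiffOn_param s) a).sub
      (contDiffOn_pderiv hU ((hα.orbitFam p a).contDiffOn_param s) b)
  have hρ : DifferentiableAt ℝ (B.rsq p) (extChartAt (𝓡 2) p p) :=
    ((B.contDiffOn_rsq p).contDiffAt (hU.mem_nhds hy)).differentiableAt (by simp)
  have hD := hL.dual_weighted hy (ρ := B.rsq p) (f := F 0 1)
    (Φ := fun y => scalarFam (B.phi α) p y s) hρ
    (((hFd 0 1).contDiffAt (hU.mem_nhds hy)).differentiableAt (by simp))
    (by
      filter_upwards [hU.mem_nhds hy] with z hz using B.phi_chart hα hz s)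
    (T := F) (by funext y; simp [hF]) (by funext y; simp [hF]) rfl
    (by funext y; simp [hF]) b
  have hS : ∑ C, pderiv b4 (.inr C) (faraday b4 B.metric4 A (p, s) (.inr C) (.inl b))
      (extChartAt (𝓡 2) p p, 0) = rotLap (orbitFam α p b (extChartAt (𝓡 2) p p)) s := by
    have hc : ∀ i, SmoothS (crossFam α ν p b i (extChartAt (𝓡 2) p p)) := fun i =>
      (smooth_crossFam hα h.smooth_odd p b i).slice hy
    have e : ∀ C, pderiv b4 (.inr C) (faraday b4 B.metric4 A (p, s) (.inr C) (.inl b))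
        (extChartAt (𝓡 2) p p, 0) =
        -pderiv b2 C (angular (fun i => crossFam α ν p b i (extChartAt (𝓡 2) p p)) s C) 0 := by
      intro C
      rw [pderiv_inr (B.differentiableAt_faraday hA p s _ _ hy 0)]
      have e1 : (fun w => faraday b4 B.metric4 A (p, s) (.inr C) (.inl b)
          (extChartAt (𝓡 2) p p, w)) =
          fun w => -angular (fun i => crossFam α ν p b i (extChartAt (𝓡 2) p p)) s C w :=
        funext fun w => by rw [B.faraday_antisymm, B.faraday_inl_inr hA h p s b C hy w]
      rw [e1, pderiv, fderiv_fun_neg]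
      rfl
    simp only [e, Finset.sum_neg_distrib]
    rw [sum_pderiv_angular hc]
    have hν := ((smoothScalar_iff.1 h.smooth_odd p).pderiv hU b).slice hy
    have hd := rotDiv_sub (fun i => hν.rotStar i) (fun i => ((hα.orbitFam p b).slice hy).rotD i) s
    rw [rotDiv_rotStar hν] at hd
    have e2 : rotDiv (fun i => crossFam α ν p b i (extChartAt (𝓡 2) p p)) s = _ := hd
    rw [e2, zero_sub, neg_neg]
    rfl
  rw [hS, hD, rsq_self] at hW
  rw [hW]
  ring

/-- The components of `∇^μ F_{μB}` along the sphere. -/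
theorem div_faraday_inr (hA : Smooth₁ b4 A) (h : IsAngularPotentials A μ ν) (p : M) (s : S2)
    (C : Fin 2) :
    ∑ k, ∑ i, ginv (comp₂ b4 B.metric4 (p, s)) k i (extChartAt (𝓡 2) p p, 0) *
      covDeriv₂ b4 (comp₂ b4 B.metric4 (p, s)) (faraday b4 B.metric4 A (p, s)) k i (.inr C)
        (extChartAt (𝓡 2) p p, 0) =
    -angular (fun i s => rotD i (fun s => divergence b2 B.g (alphaInv A μ s) p) s
      + rotStar (B.masterOp ν p) i s) s C 0 := by
  have hU := isOpen_extChartAt_target (I := 𝓡 2) p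
  have hy := mem_extChartAt_target (I := 𝓡 2) p
  have hα := smooth_alphaInv hA h.smooth_even
  set α := alphaInv A μ with hαdef
  have hν := h.smooth_odd
  have hνp := fun k => (smoothScalar_iff.1 hν p).pderiv hU k
  have hcd : ∀ i k, DifferentiableAt ℝ (fun y => crossFam α ν p k i y s) (extChartAt (𝓡 2) p p) :=
    fun i k => (smooth_crossFam hα hν p k i).differentiableAt_param hU hy s
  have e0 : ∀ a, ∀ y ∈ (extChartAt (𝓡 2) p).target,
      faraday b4 B.metric4 A (p, s) (.inl a) (.inr C) (y, 0) =
      ∑ i, cr s (frame s C) i * crossFam α ν p a i y s := fun a y hy => by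
    rw [B.faraday_inl_inr hA h p s a C hy 0, angular_zero]
    exact Finset.sum_congr rfl fun i _ => mul_comm _ _
  have hW := (B.warpedAt p s).sum_covDeriv₂_inr (faraday b4 B.metric4 A (p, s))
    (fun i j z => B.faraday_antisymm A (p, s) i j z) C
    (fun a y => ∑ i, cr s (frame s C) i * crossFam α ν p a i y s) (fun a => e0 a _ hy)
    (fun a c => by
      rw [pderiv_inl (B.differentiableAt_faraday hA p s _ _ hy 0)]
      refine pderiv_congr ?_ c
      filter_upwards [hU.mem_nhds hy] with z hz using e0 a z hz)
  have hD := isFirstOrder_coordDiv (comp₂ b2 B.g p) (extChartAt (𝓡 2) p p)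
  have hdiv : coordDiv b2 (comp₂ b2 B.g p)
      (fun a y => ∑ i, cr s (frame s C) i * crossFam α ν p a i y s) (extChartAt (𝓡 2) p p) =
      ∑ i, cr s (frame s C) i *
        (rotStar (fun s => coordDiv b2 (comp₂ b2 B.g p)
            (fun k => pderiv b2 k fun y => scalarFam ν p y s) (extChartAt (𝓡 2) p p)) i s
          - rotD i (fun s => divergence b2 B.g (α s) p) s) := by
    have h1 := hD.sum Finset.univ (w := fun i a y => cr s (frame s C) i * crossFam α ν p a i y s)
      fun i k => (hcd i k).const_mul _
    rw [h1]
    refine Finset.sum_congr rfl fun i _ => ?_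
    have h2 := hD.const_mul (hcd i) (cr s (frame s C) i)
    rw [h2]
    congr 1
    have h3 := hD.sub
      (w := fun k y => rotStar (fun s => pderiv b2 k (fun z => scalarFam ν p z s) y) i s)
      (w' := fun k y => rotD i (orbitFam α p k y) s)
      (fun k => (smoothFam_rotStar hU (hνp k) i).differentiableAt_param hU hy s)
      (fun k => ((hα.orbitFam p k).rotD hU i).differentiableAt_param hU hy s)
    refine h3.trans (congrArg₂ (· - ·) ?_ ?_)
    · exact (hD.rotStar hU hy hνp i s).symm
    · exact (hD.rotD hU hy (hα.orbitFam p) i s).symm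
  have hS : ∑ D, pderiv b4 (.inr D) (faraday b4 B.metric4 A (p, s) (.inr D) (.inr C))
      (extChartAt (𝓡 2) p p, 0) =
      ∑ i, rotStar (rotLap fun s => ν (p, s)) i s * cr s (frame s C) i := by
    have e : ∀ D, pderiv b4 (.inr D) (faraday b4 B.metric4 A (p, s) (.inr D) (.inr C))
        (extChartAt (𝓡 2) p p, 0) =
        pderiv b2 D (fun w => pderiv b2 D (angular (angFam A p) s C) w
          - pderiv b2 C (angular (angFam A p) s D) w) 0 := by
      intro D
      rw [pderiv_inr (B.differentiableAt_faraday hA p s _ _ hy 0)]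
      congr 1
      funext w
      rw [B.faraday_inr_inr hA p s D C hy w, symm_extChartAt_self]
    have hb := hA.angFam p
    have hcurl : (fun s => -rotCurl (angFam A p) s) = rotLap fun s => ν (p, s) := by
      funext σ
      have e1 : angFam A p = fun i s => rotD i (fun s => μ (p, s)) s
        + rotStar (fun s => ν (p, s)) i s := funext fun i => funext fun s => h.angFam_eq p i s
      rw [e1, rotCurl_potentials (h.smooth_even.slice p) (h.smooth_odd.slice p), neg_neg]
    have hc : SmoothS (rotCurl (angFam A p)) := by
      have := (h.smooth_odd.slice p).rotLap
      rw [← hcurl] at this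
      simpa using this.neg
    simp only [e]
    rw [sum_pderiv_antisymm_angular hb (coord_mul_angFam A p) hc, hcurl]
  rw [hS, hdiv, rsq_self] at hW
  rw [hW, angular_zero]
  have hm : B.masterOp ν p = fun s => -coordDiv b2 (comp₂ b2 B.g p)
        (fun i => pderiv b2 i fun y => scalarFam ν p y s) (extChartAt (𝓡 2) p p)
      - (B.r p ^ 2)⁻¹ * rotLap (fun s => ν (p, s)) s := funext (B.masterOp_center hν p)
  have hs1 := hD.smoothS hU hy hνp
  have hs2 := (hν.slice p).rotLap
  have hr : ∀ n, rotD n (B.masterOp ν p) s = -rotD n (fun s => coordDiv b2 (comp₂ b2 B.g p)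
        (fun i => pderiv b2 i fun y => scalarFam ν p y s) (extChartAt (𝓡 2) p p)) s
      - (B.r p ^ 2)⁻¹ * rotD n (rotLap (fun s => ν (p, s))) s := fun n => by
    rw [hm, rotD_sub hs1.neg ((SmoothS.const _).mul hs2), rotD_neg, rotD_const_mul hs2]
  simp only [rotStar, hr]
  simp only [Fin.sum_univ_three]
  ring

/-- Maxwell's equations for `A` are equivalent to the reconstruction equation, with the orbit part
of the current, together with an equation for the sphere part of the current, whose scalar
potentials are the divergence of `α^(inv)` and the master operator applied to `ν`. -/
theorem maxwell_iff (hA : Smooth₁ b4 A) (h : IsAngularPotentials A μ ν)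
    (J : OneForm I4 (M × S2)) : Maxwell b4 B.metric4 A J ↔
      B.Reconstruction (B.phi (alphaInv A μ)) (alphaInv A μ) J ∧
      ∀ p i s, angFam J p i s = rotD i (fun s => divergence b2 B.g (alphaInv A μ s) p) s
        + rotStar (B.masterOp ν p) i s := by
  have hα := smooth_alphaInv hA h.smooth_even
  have hΦ := B.smooth_phi hα
  have hJl : ∀ p s b, comp₁ b4 J (p, s) (.inl b) (extChartAt (𝓡 2) p p, 0) =
      orbitFam (orbitPart J) p b (extChartAt (𝓡 2) p p) s := fun p s b => by
    rw [comp₁_inl J p s b (mem_extChartAt_target p), symm_zero_sphere]; rfl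
  have hJr : ∀ p s C, comp₁ b4 J (p, s) (.inr C) (extChartAt (𝓡 2) p p, 0) =
      angular (angFam J p) s C 0 := fun p s C => by
    rw [comp₁_inr J p s C (mem_extChartAt_target p), comp₁_spherePart, symm_extChartAt_self]
  constructor
  · intro hM
    refine ⟨B.reconstruction_of_center hΦ hα fun p s b => ?_, fun p i s => ?_⟩
    · have h1 := hM (p, s) (.inl b)
      rw [extChartAt_prod_self, hJl] at h1
      have h2 := B.div_faraday_inl hA h p s b
      rw [← h1, mul_neg, h2, neg_neg]
    · refine eq_of_angular_zero (c := fun i s =>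
        rotD i (fun s => divergence b2 B.g (alphaInv A μ s) p) s
          + rotStar (B.masterOp ν p) i s) (coord_mul_angFam J p s) ?_ (fun C => ?_) i
      · linear_combination coord_mul_rotD (fun s => divergence b2 B.g (alphaInv A μ s) p) s
          + coord_mul_rotStar (B.masterOp ν p) s
      · have h1 := hM (p, s) (.inr C)
        rw [extChartAt_prod_self, hJr, B.div_faraday_inr hA h p s C, neg_neg] at h1
        exact h1.symm
  · rintro ⟨h1, h2⟩ ⟨p, s⟩ (b | C)
    · rw [extChartAt_prod_self, hJl]
      have h3 := B.div_faraday_inl hA h p s b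
      have h4 := h1.chart hΦ hα (mem_extChartAt_target p) s b
      rw [rsq_self] at h4
      rw [h4] at h3
      have hr : B.r p ^ 2 ≠ 0 := (pow_pos (B.r_pos p) 2).ne'
      refine mul_left_cancel₀ hr ?_
      rw [mul_neg, h3, neg_neg]
    · rw [extChartAt_prod_self, hJr, B.div_faraday_inr hA h p s C, neg_neg]
      congr 1
      funext i s
      exact (h2 p i s).symm

/-- The continuity equation. -/
theorem conserved_iff {J : OneForm I4 (M × S2)} {j k : M × S2 → ℝ} (hJ : Smooth₁ b4 J)
    (h : IsAngularPotentials J j k) : B.Conserved J ↔ ∀ p s,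
      coordDiv b2 (comp₂ b2 B.g p) (fun a z => B.rsq p z * orbitFam (orbitPart J) p a z s)
        (extChartAt (𝓡 2) p p) + rotLap (fun s => j (p, s)) s = 0 := by
  have key : ∀ p s, B.r p ^ 2 * divergence b4 B.metric4 J (p, s) =
      coordDiv b2 (comp₂ b2 B.g p) (fun a z => B.rsq p z * orbitFam (orbitPart J) p a z s)
        (extChartAt (𝓡 2) p p) + rotLap (fun s => j (p, s)) s := by
    intro p s
    have hU := isOpen_extChartAt_target (I := 𝓡 2) p
    have hy := mem_extChartAt_target (I := 𝓡 2) p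
    have e0 : ∀ a, ∀ y ∈ (extChartAt (𝓡 2) p).target, comp₁ b4 J (p, s) (.inl a) (y, 0) =
        orbitFam (orbitPart J) p a y s := fun a y hy => by
      rw [comp₁_inl J p s a hy, symm_zero_sphere]; rfl
    have hρ : DifferentiableAt ℝ (B.rsq p) (extChartAt (𝓡 2) p p) :=
      ((B.contDiffOn_rsq p).contDiffAt (hU.mem_nhds hy)).differentiableAt (by simp)
    have hW := (B.warpedAt p s).coordDiv_eq (comp₁ b4 J (p, s))
      (fun a y => orbitFam (orbitPart J) p a y s) (fun a => e0 a _ hy)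
      (fun a c => by
        rw [pderiv_inl (hJ.differentiableAt_prod p s _ hy 0)]
        refine pderiv_congr ?_ c
        filter_upwards [hU.mem_nhds hy] with z hz using e0 a z hz)
      (fun a => (hJ.orbitPart.orbitFam p a).differentiableAt_param hU hy s) hρ
    have hS : ∑ C, pderiv b4 (.inr C) (comp₁ b4 J (p, s) (.inr C)) (extChartAt (𝓡 2) p p, 0) =
        rotLap (fun s => j (p, s)) s := by
      have e : ∀ C, pderiv b4 (.inr C) (comp₁ b4 J (p, s) (.inr C)) (extChartAt (𝓡 2) p p, 0) =
          pderiv b2 C (angular (angFam J p) s C) 0 := fun C => by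
        rw [pderiv_inr (hJ.differentiableAt_prod p s _ hy 0)]
        congr 1
        funext w
        rw [comp₁_inr J p s C hy w, comp₁_spherePart, symm_extChartAt_self]
      simp only [e]
      have e1 : angFam J p = fun i s => rotD i (fun s => j (p, s)) s
        + rotStar (fun s => k (p, s)) i s := funext fun i => funext fun s => h.angFam_eq p i s
      rw [sum_pderiv_angular (hJ.angFam p), e1,
        rotDiv_potentials (h.smooth_even.slice p) (h.smooth_odd.slice p)]
    rw [hS, rsq_self] at hW
    rw [← hW, divergence, extChartAt_prod_self]
    rfl
  have hr : ∀ p, B.r p ^ 2 ≠ 0 := fun p => (pow_pos (B.r_pos p) 2).ne'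
  constructor
  · intro hc p s
    rw [← key, hc (p, s), mul_zero]
  · rintro hc ⟨p, s⟩
    have := key p s
    rw [hc] at this
    exact (mul_eq_zero.1 this).resolve_left (hr p)

end SphSymSpacetime
end Spacetime

end

/-! ### Solving the reconstruction equation -/

section

open Topology Filter

theorem invLap_sum_mul {κ : Type*} [Fintype κ] {f : κ → S2 → ℝ} (hf : ∀ k, SmoothS (f k))
    (h0 : ∀ k, avg (f k) = 0) (c : κ → ℝ) :
    invLap (fun s => ∑ k, c k * f k s) = fun s => ∑ k, c k * invLap (f k) s := by
  have hs : SmoothS fun s => ∑ k, c k * f k s := SmoothS.sum fun k => (SmoothS.const _).mul (hf k)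
  have ha : ∀ {g : κ → S2 → ℝ}, (∀ k, SmoothS (g k)) → (∀ k, avg (g k) = 0) →
      avg (fun s => ∑ k, c k * g k s) = 0 := fun hg h0 => by
    rw [avg_sum fun k => (SmoothS.const _).mul (hg k)]
    exact Finset.sum_eq_zero fun k _ => by rw [avg_const_mul, h0, mul_zero]
  refine eq_of_rotLap_eq hs.invLap
    (SmoothS.sum fun k => (SmoothS.const _).mul (hf k).invLap) (avg_invLap hs)
    (ha (fun k => (hf k).invLap) fun k => avg_invLap (hf k)) fun s => ?_
  rw [rotLap_invLap hs (ha hf h0), rotLap_sum_mul fun k => (hf k).invLap]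
  exact Finset.sum_congr rfl fun k _ => by rw [rotLap_invLap (hf k) (h0 k)]

section Spacetime

variable {M : Type*} [TopologicalSpace M] [ChartedSpace E2 M] [IsManifold (𝓡 2) ∞ M]

theorem orbitFam_center (α : AngularOneForm M) (p : M) (a : Fin 2) (s : S2) :
    orbitFam α p a (extChartAt (𝓡 2) p p) s = (α s p : E2 →L[ℝ] ℝ) (b2 a) :=
  (congrArg (α s ((extChartAt (𝓡 2) p).symm (extChartAt (𝓡 2) p p)) : E2 →L[ℝ] ℝ)
    (coordVec_extChartAt_self (I := 𝓡 2) b2 p a)).trans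
    (oneForm_congr (α s) (symm_extChartAt_self p) (b2 a))

theorem covector_apply (l : E2 →L[ℝ] ℝ) (u : E2) : l u = ∑ k, u k * l (b2 k) := by
  conv_lhs => rw [← b2.sum_repr u]
  simp only [map_sum, map_smul, smul_eq_mul, b2_repr]

theorem covector_sum_apply (c : Fin 2 → ℝ) (u : E2) :
    (∑ k, c k • (EuclideanSpace.proj k : E2 →L[ℝ] ℝ)) u = ∑ k, u k * c k := by
  simp [mul_comm]

theorem AngularOneForm.Smooth.basis {α : AngularOneForm M} (hα : α.Smooth) (q : M) (k : Fin 2) :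
    SmoothS fun s => (α s q : E2 →L[ℝ] ℝ) (b2 k) := by
  have h := (hα.orbitFam q k).slice (mem_extChartAt_target q)
  rwa [show Electro.orbitFam α q k (extChartAt (𝓡 2) q q) =
    fun s => (α s q : E2 →L[ℝ] ℝ) (b2 k) from funext fun s => orbitFam_center α q k s] at h

theorem monopoleFree_of_center {α : AngularOneForm M} (hα : α.Smooth)
    (h : ∀ p a, avg (orbitFam α p a (extChartAt (𝓡 2) p p)) = 0) : α.MonopoleFree := by
  intro p (u : E2)
  rw [zeroMean_iff]
  have e : (fun s => (α s p : E2 →L[ℝ] ℝ) u) =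
      fun s => ∑ k, u k * (α s p : E2 →L[ℝ] ℝ) (b2 k) :=
    funext fun s => covector_apply (α s p : E2 →L[ℝ] ℝ) u
  refine (congrArg avg e).trans ?_
  rw [avg_sum fun k => (SmoothS.const _).mul (hα.basis p k)]
  refine Finset.sum_eq_zero fun k _ => ?_
  rw [avg_const_mul, ← show orbitFam α p k (extChartAt (𝓡 2) p p) =
    fun s => (α s p : E2 →L[ℝ] ℝ) (b2 k) from funext fun s => orbitFam_center α p k s, h, mul_zero]

/-- The inverse of the Laplacian of the sphere, applied to the components of a monopole-free field
`β_a dx^a`. -/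
theorem exists_rotLap_eq {β : AngularOneForm M} (hβ : β.Smooth) (h0 : β.MonopoleFree) :
    ∃ α : AngularOneForm M, α.Smooth ∧ α.MonopoleFree ∧
      ∀ p a, ∀ y ∈ (extChartAt (𝓡 2) p).target, ∀ s,
        rotLap (orbitFam α p a y) s = orbitFam β p a y s := by
  let α : AngularOneForm M := fun s q =>
    (∑ k, invLap (fun s => (β s q : E2 →L[ℝ] ℝ) (b2 k)) s •
      (EuclideanSpace.proj k : E2 →L[ℝ] ℝ) : E2 →L[ℝ] ℝ)
  have hb0 : ∀ q k, avg (fun s => (β s q : E2 →L[ℝ] ℝ) (b2 k)) = 0 := fun q k =>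
    (zeroMean_iff _).1 (h0 q (b2 k))
  have happ : ∀ s q (u : E2), (α s q : E2 →L[ℝ] ℝ) u =
      invLap (fun s => (β s q : E2 →L[ℝ] ℝ) u) s := by
    intro s q u
    have e : (fun s => (β s q : E2 →L[ℝ] ℝ) u) =
        fun s => ∑ k, u k * (β s q : E2 →L[ℝ] ℝ) (b2 k) :=
      funext fun s => covector_apply (β s q : E2 →L[ℝ] ℝ) u
    rw [e, invLap_sum_mul (fun k => hβ.basis q k) (hb0 q)]
    exact covector_sum_apply _ u
  have hfam : ∀ p a y, orbitFam α p a y = invLap (orbitFam β p a y) := fun p a y =>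
    funext fun s => happ s _ (coordVec (𝓡 2) b2 p a y)
  have hα : α.Smooth := angularOneForm_smooth_iff.2 fun p a =>
    ((hβ.orbitFam p a).invLap (isOpen_extChartAt_target p)).congr fun y _ => hfam p a y
  refine ⟨α, hα, monopoleFree_of_center hα fun p a => ?_, fun p a y hy s => ?_⟩
  · rw [hfam]
    exact avg_invLap ((hβ.orbitFam p a).slice (mem_extChartAt_target p))
  · rw [hfam]
    exact rotLap_invLap ((hβ.orbitFam p a).slice hy) (h0.avg p a y) s

theorem avg_pderiv_scalarFam {f : M × S2 → ℝ} (hf : SmoothScalar f) (h : MonopoleFree f) {p : M}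
    {y : E2} (hy : y ∈ (extChartAt (𝓡 2) p).target) (k : Fin 2) :
    avg (fun s => pderiv b2 k (fun z => scalarFam f p z s) y) = 0 := by
  refine ((smoothScalar_iff.1 hf p).avg_parD (isOpen_extChartAt_target p) hy (b2 k)).trans ?_
  have : (fun y => avg (scalarFam f p y)) = fun _ => 0 := funext fun y => h.avg _
  rw [this]; simp

omit [IsManifold (𝓡 2) ∞ M] in
theorem orbitPart_dfun {ξ : M × S2 → ℝ} (hξ : SmoothScalar ξ) (p : M) (s : S2) :
    orbitPart (dfun I4 ξ) s p = dfun (𝓡 2) (fun p' => ξ (p', s)) p := by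
  have h1 : MDifferentiableAt I4 𝓘(ℝ, ℝ) ξ (p, s) := hξ.mdifferentiableAt (by simp)
  have h2 : MDifferentiableAt (𝓡 2) I4 (fun p' : M => (p', s)) p :=
    mdifferentiableAt_id.prodMk mdifferentiableAt_const
  have h3 := mfderiv_comp p (f := fun p' : M => (p', s)) h1 h2
  rw [mfderiv_prod_left] at h3
  exact h3.symm

omit [IsManifold (𝓡 2) ∞ M] in
theorem spherePart_dfun {ξ : M × S2 → ℝ} (hξ : SmoothScalar ξ) (p : M) (s : S2) :
    spherePart (dfun I4 ξ) p s = dfun (𝓡 2) (fun s' => ξ (p, s')) s := by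
  have h1 : MDifferentiableAt I4 𝓘(ℝ, ℝ) ξ (p, s) := hξ.mdifferentiableAt (by simp)
  have h2 : MDifferentiableAt (𝓡 2) I4 (fun s' : S2 => (p, s')) s :=
    mdifferentiableAt_const.prodMk mdifferentiableAt_id
  have h3 := mfderiv_comp s (f := fun s' : S2 => (p, s')) h1 h2
  rw [mfderiv_prod_right] at h3
  exact h3.symm

namespace SphSymSpacetime

variable (B : SphSymSpacetime M)

/-- A monopole-free solution of the reconstruction equation is unique. -/
theorem reconstruction_unique {Φ : M × S2 → ℝ} (hΦ : SmoothScalar Φ) {α α' : AngularOneForm M}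
    (hα : α.Smooth) (hα' : α'.Smooth) (h0 : α.MonopoleFree) (h0' : α'.MonopoleFree)
    {J : OneForm I4 (M × S2)} (h : B.Reconstruction Φ α J) (h' : B.Reconstruction Φ α' J) :
    α' = α := by
  refine AngularOneForm.ext_center fun p a s => ?_
  have hy := mem_extChartAt_target (I := 𝓡 2) p
  refine congrFun (eq_of_rotLap_eq ((hα'.orbitFam p a).slice hy) ((hα.orbitFam p a).slice hy)
    (h0'.avg p a _) (h0.avg p a _) fun s => ?_) s
  linear_combination h.chart hΦ hα hy s a - h'.chart hΦ hα' hy s a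

/-- A monopole-free solution of the reconstruction equation exists. -/
theorem exists_reconstruction {Φ : M × S2 → ℝ} (hΦ : SmoothScalar Φ) (hΦ0 : MonopoleFree Φ)
    {J : OneForm I4 (M × S2)} (hJ : Smooth₁ b4 J) (hJ0 : (orbitPart J).MonopoleFree) :
    ∃ α : AngularOneForm M, α.Smooth ∧ α.MonopoleFree ∧ B.Reconstruction Φ α J := by
  let W : S2 → M → (E2 →ₗ[ℝ] ℝ) := fun s q => B.vol q (gradient b2 B.g (fun p => Φ (p, s)) q)
  let l : S2 → M → (E2 →L[ℝ] ℝ) := orbitPart J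
  let γ : S2 → M → (E2 →L[ℝ] ℝ) := fun s q => (W s q).toContinuousLinearMap - B.r q ^ 2 • l s q
  let β : AngularOneForm M := γ
  have hU := fun p : M => isOpen_extChartAt_target (I := 𝓡 2) p
  have hw := fun p k => (smoothScalar_iff.1 hΦ p).pderiv (hU p) k
  have hβ : ∀ p a, ∀ y ∈ (extChartAt (𝓡 2) p).target, ∀ s, orbitFam β p a y s =
      dual (comp₂ b2 B.g p) (comp₂ b2 B.vol p) (fun i => pderiv b2 i fun y => scalarFam Φ p y s) a y
        - B.rsq p y * orbitFam (orbitPart J) p a y s := fun p a y hy s =>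
    congrArg (fun t => t - B.rsq p y * orbitFam (orbitPart J) p a y s) (B.vol_gradient_chart (fun p' => Φ (p', s)) hy
      (hΦ.mdifferentiableAt_orbit s _) a)
  -- the first term of the source is a linear combination of derivatives of `Φ`
  have hdual : ∀ p a, ∃ c : Fin 2 → E2 → ℝ,
      (∀ k, ContDiffOn ℝ ∞ (c k) (extChartAt (𝓡 2) p).target) ∧
      ∀ (w : Fin 2 → E2 → ℝ) y, dual (comp₂ b2 B.g p) (comp₂ b2 B.vol p) w a y =
        ∑ k, c k y * w k y := by
    intro p a
    have hG := fun i j => B.g_smooth p i j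
    have hV : ContDiffOn ℝ ∞ (fun y => (comp₂ b2 B.vol p 0 1 y)⁻¹)
        (extChartAt (𝓡 2) p).target := (B.vol_smooth p 0 1).inv (B.lorentzChart p).vol_ne
    have h01 := (hG 0 1).mul hV
    have h00 := (hG 0 0).mul hV
    have h11 := (hG 1 1).mul hV
    by_cases ha : a = 0
    · refine ⟨fun k y => if k = 0 then -(comp₂ b2 B.g p 0 1 y * (comp₂ b2 B.vol p 0 1 y)⁻¹)
        else comp₂ b2 B.g p 0 0 y * (comp₂ b2 B.vol p 0 1 y)⁻¹, fun k => ?_, fun w y => ?_⟩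
      · by_cases hk : k = 0
        · simpa only [hk, if_true] using h01.neg
        · simpa only [hk, if_false] using h00
      · rw [ha, dual_zero, flux_one, Fin.sum_univ_two]
        simp only [if_true, one_ne_zero, if_false]
        ring
    · refine ⟨fun k y => if k = 0 then -(comp₂ b2 B.g p 1 1 y * (comp₂ b2 B.vol p 0 1 y)⁻¹)
        else comp₂ b2 B.g p 0 1 y * (comp₂ b2 B.vol p 0 1 y)⁻¹, fun k => ?_, fun w y => ?_⟩
      · by_cases hk : k = 0
        · simpa only [hk, if_true] using h11.neg
        · simpa only [hk, if_false] using h01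
      · rw [dual, if_neg ha, flux_zero, Fin.sum_univ_two]
        simp only [if_true, one_ne_zero, if_false]
        ring
  have hβs : β.Smooth := angularOneForm_smooth_iff.2 fun p a => by
    obtain ⟨c, hc, e⟩ := hdual p a
    refine ((SmoothFam.sum fun k => (SmoothFam.of_param (hc k)).mul (hw p k)).sub
      ((SmoothFam.of_param (B.contDiffOn_rsq p)).mul (hJ.orbitPart.orbitFam p a))).congr
      fun y hy => funext fun s => ?_
    rw [hβ p a y hy, e]
  have hβ0 : β.MonopoleFree := monopoleFree_of_center hβs fun p a => by
    obtain ⟨c, hc, e⟩ := hdual p a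
    have hy := mem_extChartAt_target (I := 𝓡 2) p
    rw [funext fun s => hβ p a _ hy s]
    simp only [e]
    have hs := fun k => (SmoothS.const (c k (extChartAt (𝓡 2) p p))).mul ((hw p k).slice hy)
    rw [avg_sub (SmoothS.sum hs)
      ((SmoothS.const _).mul ((hJ.orbitPart.orbitFam p a).slice hy)), avg_sum hs, avg_const_mul,
      show avg (fun s => orbitFam (orbitPart J) p a (extChartAt (𝓡 2) p p) s) = 0 from
        hJ0.avg p a _, mul_zero, sub_zero]
    exact Finset.sum_eq_zero fun k _ => by
      rw [avg_const_mul, avg_pderiv_scalarFam hΦ hΦ0 hy, mul_zero]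
  obtain ⟨α, hα, hα0, h⟩ := exists_rotLap_eq hβs hβ0
  refine ⟨α, hα, hα0, B.reconstruction_of_center hΦ hα fun p s a => ?_⟩
  rw [h p a _ (mem_extChartAt_target p), hβ p a _ (mem_extChartAt_target p), rsq_self]
  ring

theorem phi_slice (α : AngularOneForm M) (p : M) : (fun s => B.phi α (p, s)) = fun s =>
    B.r p ^ 2 * coordCurl (comp₂ b2 B.vol p) (fun a z => orbitFam α p a z s)
      (extChartAt (𝓡 2) p p) := funext (B.phi_center α p)

theorem rotLap_phi {α : AngularOneForm M} (hα : α.Smooth) (p : M) (s : S2) :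
    rotLap (fun s => B.phi α (p, s)) s = B.r p ^ 2 *
      rotLap (fun s => coordCurl (comp₂ b2 B.vol p) (fun a z => orbitFam α p a z s)
        (extChartAt (𝓡 2) p p)) s := by
  have hs := (isFirstOrder_coordCurl (comp₂ b2 B.vol p) (extChartAt (𝓡 2) p p)).smoothS
    (isOpen_extChartAt_target p) (mem_extChartAt_target p) (hα.orbitFam p)
  rw [phi_slice]
  have := rotLap_sum_mul (κ := Unit) (fun _ => hs) (fun _ => B.r p ^ 2) s
  simpa using this

/-- For a solution of the reconstruction equation, the master equation for `Φ` says that `Φ` and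
`r² ε^{ab} ∇_a α_b` have the same Laplacian on the spheres. -/
theorem evenMaster_iff {Φ : M × S2 → ℝ} (hΦ : SmoothScalar Φ) {α : AngularOneForm M}
    (hα : α.Smooth) {J : OneForm I4 (M × S2)} (hJ : Smooth₁ b4 J) (h : B.Reconstruction Φ α J) :
    B.EvenMaster Φ J ↔
      ∀ p s, rotLap (fun s => B.phi α (p, s)) s = rotLap (fun s => Φ (p, s)) s := by
  refine forall_congr' fun p => forall_congr' fun s => ?_
  have hr : B.r p ^ 2 ≠ 0 := (pow_pos (B.r_pos p) 2).ne'
  rw [masterOp, sphereLap, laplacian_sphere (hΦ.slice p), h.curl_eq hΦ hα hJ, B.rotLap_phi hα]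
  generalize rotLap (fun s => coordCurl (comp₂ b2 B.vol p) (fun a z => orbitFam α p a z s)
        (extChartAt (𝓡 2) p p)) s = x
  generalize rotLap (fun s => Φ (p, s)) s = t
  constructor
  · intro h1
    have h2 : x = (B.r p ^ 2)⁻¹ * t := by linarith
    rw [h2, mul_inv_cancel_left₀ hr]
  · intro h1
    rw [← h1, inv_mul_cancel_left₀ hr]
    ring

/-- The Faraday tensor depends on the gauge invariants only. -/
theorem faraday_eq_of_hasInvariants {α : AngularOneForm M} {ν : M × S2 → ℝ}
    {A A' : OneForm I4 (M × S2)} (h : HasInvariants A α ν) (h' : HasInvariants A' α ν) (p : M)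
    (s : S2) (i j : Fin 2 ⊕ Fin 2) {y : E2} (hy : y ∈ (extChartAt (𝓡 2) p).target) (w : E2) :
    faraday b4 B.metric4 A (p, s) i j (y, w) = faraday b4 B.metric4 A' (p, s) i j (y, w) := by
  obtain ⟨hA, μ, hμ, rfl⟩ := h
  obtain ⟨hA', μ', hμ', e⟩ := h'
  have hlr : ∀ a C, faraday b4 B.metric4 A (p, s) (.inl a) (.inr C) (y, w) =
      faraday b4 B.metric4 A' (p, s) (.inl a) (.inr C) (y, w) := fun a C => by
    rw [B.faraday_inl_inr hA hμ p s a C hy w, B.faraday_inl_inr hA' hμ' p s a C hy w, e]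
  have h01 : ∀ {A : OneForm I4 (M × S2)} {μ : M × S2 → ℝ}, Smooth₁ b4 A →
      IsAngularPotentials A μ ν → faraday b4 B.metric4 A (p, s) (.inr 0) (.inr 1) (y, w) =
        det3 (sphereParam s w) (dParam s 0 w) (dParam s 1 w) *
        -rotLap (fun s => ν ((extChartAt (𝓡 2) p).symm y, s)) ((extChartAt (𝓡 2) s).symm w) := by
    intro A μ hA hμ
    have e1 : angFam A ((extChartAt (𝓡 2) p).symm y) = fun i s =>
        rotD i (fun s => μ ((extChartAt (𝓡 2) p).symm y, s)) s
        + rotStar (fun s => ν ((extChartAt (𝓡 2) p).symm y, s)) i s :=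
      funext fun i => funext fun s => hμ.angFam_eq _ i s
    rw [B.faraday_inr_inr hA p s 0 1 hy w, pderiv_angular_antisymm (hA.angFam _)
      (coord_mul_angFam A _), e1,
      rotCurl_potentials (hμ.smooth_even.slice _) (hμ.smooth_odd.slice _)]
  rcases i with a | C <;> rcases j with b | D
  · rw [B.faraday_inl_inl hA hμ.smooth_even p s a b hy w,
      B.faraday_inl_inl hA' hμ'.smooth_even p s a b hy w, e]
  · exact hlr a D
  · rw [B.faraday_antisymm, B.faraday_antisymm A', hlr]
  · have hz : ∀ (A : OneForm I4 (M × S2)) C,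
        faraday b4 B.metric4 A (p, s) (.inr C) (.inr C) (y, w) = 0 := fun A C => sub_self _
    have h10 : ∀ A : OneForm I4 (M × S2), faraday b4 B.metric4 A (p, s) (.inr 1) (.inr 0) (y, w) =
        -faraday b4 B.metric4 A (p, s) (.inr 0) (.inr 1) (y, w) := fun A =>
      B.faraday_antisymm A _ _ _ _
    have q := (h01 hA hμ).trans (h01 hA' hμ').symm
    fin_cases C <;> fin_cases D
    · exact (hz A 0).trans (hz A' 0).symm
    · exact q
    · exact (h10 A).trans ((congrArg Neg.neg q).trans (h10 A').symm)
    · exact (hz A 1).trans (hz A' 1).symm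

end SphSymSpacetime

/-- Every smooth `α_a dx^a` and every smooth monopole-free `ν` are the invariants of the one-form
`α_a dx^a + ε_B^C ∇_C ν dx^B`. -/
theorem exists_hasInvariants {α : AngularOneForm M} (hα : α.Smooth) {ν : M × S2 → ℝ}
    (hν : SmoothScalar ν) (hν0 : MonopoleFree ν) : ∃ A, HasInvariants A α ν := by
  let σ : (x : M × S2) → (E2 →L[ℝ] ℝ) := fun x => LinearMap.toContinuousLinearMap
    ((sphereVol x.2 : E2 →ₗ[ℝ] E2 →ₗ[ℝ] ℝ).flip (gradient b2 sphereMetric (fun s => ν (x.1, s)) x.2))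
  let A : OneForm I4 (M × S2) := fun x =>
    ((α x.2 x.1 : E2 →L[ℝ] ℝ).comp (ContinuousLinearMap.fst ℝ E2 E2)
      + (σ x).comp (ContinuousLinearMap.snd ℝ E2 E2) : E2 × E2 →L[ℝ] ℝ)
  have hl : orbitPart A = α := by
    funext s p
    refine ContinuousLinearMap.ext fun u => ?_
    have h0 : σ (p, s) 0 = 0 := map_zero _
    exact (congrArg ((α s p : E2 →L[ℝ] ℝ) u + ·) h0).trans (add_zero _)
  have hr : ∀ p s, (spherePart A p s : E2 →L[ℝ] ℝ) = σ (p, s) := fun p s => by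
    refine ContinuousLinearMap.ext fun u => ?_
    have h0 : (α s p : E2 →L[ℝ] ℝ) 0 = 0 := map_zero _
    exact (congrArg (· + σ (p, s) u) h0).trans (zero_add _)
  have h0 : SmoothScalar fun _ : M × S2 => (0 : ℝ) := contMDiff_const
  have hd : ∀ (p : M) (s : S2) (v : TangentSpace (𝓡 2) s),
      spherePart A p s v = dfun (𝓡 2) (fun _ => (0 : ℝ)) s v
        + sphereVol s v (gradient b2 sphereMetric (fun s' => ν (p, s')) s) := fun p s v => by
    have h1 : dfun (𝓡 2) (fun _ : S2 => (0 : ℝ)) s = 0 := mfderiv_const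
    rw [h1]
    refine (congrArg (fun l : E2 →L[ℝ] ℝ => l v) (hr p s)).trans ?_
    exact (zero_add _).symm
  have hang : ∀ q i s, angFam A q i s = rotStar (fun s => ν (q, s)) i s := fun q i s => by
    have := (angular_decomp_iff A (μ := fun _ => 0) (h0.slice q) (hν.slice q)).1 (hd q) i s
    rwa [rotD_const, zero_add] at this
  refine ⟨A, smooth₁_iff.2 ⟨?_, fun p i => ?_⟩, fun _ => 0, ⟨h0, hν, fun p => ?_, hν0, hd⟩, ?_⟩
  · rw [hl]
    exact angularOneForm_smooth_iff.1 hα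
  · refine (smoothFam_rotStar (isOpen_extChartAt_target p) (smoothScalar_iff.1 hν p) i).congr
      fun y _ => ?_
    exact funext fun s => hang _ i s
  · simp [ZeroMean]
  · funext s p
    have h1 : dfun (𝓡 2) (fun _ : M => (0 : ℝ)) p = 0 := mfderiv_const
    rw [alphaInv, h1, sub_zero, hl]

end Spacetime

end

/-! ### Gauge transformations -/

section

open Topology Filter

section Spacetime

variable {M : Type*} [TopologicalSpace M] [ChartedSpace E2 M] [IsManifold (𝓡 2) ∞ M]

/-- The Laplacians of the scalar potentials are determined by the angular part of the one-form, as
its divergence and its curl. -/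
theorem IsAngularPotentials.rotLap_eq {A : OneForm I4 (M × S2)} {μ ν : M × S2 → ℝ}
    (h : IsAngularPotentials A μ ν) {q : M} {f g : S2 → ℝ} (hf : SmoothS f) (hg : SmoothS g)
    (e : ∀ i s, angFam A q i s = rotD i f s + rotStar g i s) :
    (∀ s, rotLap (fun s => μ (q, s)) s = rotLap f s) ∧
      ∀ s, rotLap (fun s => ν (q, s)) s = rotLap g s := by
  have hμ := h.smooth_even.slice q
  have hν := h.smooth_odd.slice q
  have e' : (fun i s => rotD i (fun s => μ (q, s)) s + rotStar (fun s => ν (q, s)) i s) =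
      fun i s => rotD i f s + rotStar g i s :=
    funext fun i => funext fun s => (h.angFam_eq q i s).symm.trans (e i s)
  refine ⟨fun s => ?_, fun s => ?_⟩
  · rw [← rotDiv_potentials hμ hν, e', rotDiv_potentials hf hg]
  · rw [← neg_inj, ← rotCurl_potentials hμ hν, e', rotCurl_potentials hf hg]

theorem angFam_dfun {ξ : M × S2 → ℝ} (hξ : SmoothScalar ξ) (q : M) (i : Fin 3) (s : S2) :
    angFam (dfun I4 ξ) q i s = rotD i (fun s => ξ (q, s)) s := by
  refine (eq_apply_rotField (β := spherePart (dfun I4 ξ) q s)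
    (c := fun i => rotD i (fun s => ξ (q, s)) s) (coord_mul_rotD _ s) (fun v => ?_) i).symm
  refine Eq.trans ?_ (dfun_apply (hξ.slice q) s v)
  exact congrArg (fun l : E2 →L[ℝ] ℝ => l v) (spherePart_dfun hξ q s)

section Gauge

variable {A A' : OneForm I4 (M × S2)} {ξ μ ν μ' ν' : M × S2 → ℝ}

theorem angFam_gauge (hξ : SmoothScalar ξ) (hA' : ∀ x, A' x = A x + dfun I4 ξ x) (q : M)
    (i : Fin 3) (s : S2) :
    angFam A' q i s = angFam A q i s + rotD i (fun s => ξ (q, s)) s := by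
  rw [← angFam_dfun hξ]
  exact congrArg (fun l : E2 × E2 →L[ℝ] ℝ => l (0, rotField i s)) (hA' (q, s))

theorem orbitFam_gauge (hξ : SmoothScalar ξ) (hA' : ∀ x, A' x = A x + dfun I4 ξ x) {p : M} {y : E2}
    (hy : y ∈ (extChartAt (𝓡 2) p).target) (a : Fin 2) (s : S2) :
    orbitFam (orbitPart A') p a y s =
      orbitFam (orbitPart A) p a y s + pderiv b2 a (fun z => scalarFam ξ p z s) y := by
  rw [show pderiv b2 a (fun z => scalarFam ξ p z s) y =
    comp₁ b2 (dfun (𝓡 2) fun p' => ξ (p', s)) p a y from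
      (comp₁_dfun b2 a hy (hξ.mdifferentiableAt_orbit s _)).symm]
  have h := congrArg (fun l : E2 →L[ℝ] ℝ => l (coordVec (𝓡 2) b2 p a y))
    (orbitPart_dfun hξ ((extChartAt (𝓡 2) p).symm y) s)
  refine (congrArg (fun l : E2 × E2 →L[ℝ] ℝ => l (coordVec (𝓡 2) b2 p a y, 0)) (hA' _)).trans ?_
  exact congrArg (orbitFam (orbitPart A) p a y s + ·) h

/-- A gauge transformation adds an exact form to `α^(inv)`. -/
theorem orbitFam_alphaInv_gauge (hξ : SmoothScalar ξ) (hA' : ∀ x, A' x = A x + dfun I4 ξ x)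
    (hμ : SmoothScalar μ) (hμ' : SmoothScalar μ') {p : M} {y : E2}
    (hy : y ∈ (extChartAt (𝓡 2) p).target) (a : Fin 2) (s : S2) :
    orbitFam (alphaInv A' μ') p a y s = orbitFam (alphaInv A μ) p a y s
      + pderiv b2 a (fun z => scalarFam ξ p z s + scalarFam μ p z s - scalarFam μ' p z s) y := by
  have hd : ∀ {f : M × S2 → ℝ}, SmoothScalar f →
      DifferentiableAt ℝ (fun z => scalarFam f p z s) y := fun hf =>
    (smoothScalar_iff.1 hf p).differentiableAt_param (isOpen_extChartAt_target p) hy s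
  rw [orbitFam_alphaInv hμ' hy, orbitFam_alphaInv hμ hy, orbitFam_gauge hξ hA' hy,
    show pderiv b2 a (fun z => scalarFam ξ p z s + scalarFam μ p z s - scalarFam μ' p z s) y =
      pderiv b2 a (fun z => scalarFam ξ p z s) y + pderiv b2 a (fun z => scalarFam μ p z s) y
        - pderiv b2 a (fun z => scalarFam μ' p z s) y by
      rw [pderiv, fderiv_fun_sub ((hd hξ).fun_add (hd hμ)) (hd hμ'),
        fderiv_fun_add (hd hξ) (hd hμ)]
      rfl]
  ring

theorem odd_gaugeInvariant (hξ : SmoothScalar ξ) (hA' : ∀ x, A' x = A x + dfun I4 ξ x)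
    (h : IsAngularPotentials A μ ν) (h' : IsAngularPotentials A' μ' ν') : ν' = ν := by
  funext ⟨q, s⟩
  refine congrFun (eq_of_rotLap_eq (h'.smooth_odd.slice q) (h.smooth_odd.slice q)
    (h'.monopoleFree_odd.avg q) (h.monopoleFree_odd.avg q) ?_) s
  refine (h'.rotLap_eq ((h.smooth_even.slice q).add (hξ.slice q)) (h.smooth_odd.slice q)
    fun i s => ?_).2
  rw [angFam_gauge hξ hA', h.angFam_eq, rotD_add (h.smooth_even.slice q) (hξ.slice q)]
  ring

theorem alphaInv_gaugeInvariant (hξ : SmoothScalar ξ) (hξ0 : MonopoleFree ξ)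
    (hA' : ∀ x, A' x = A x + dfun I4 ξ x) (h : IsAngularPotentials A μ ν)
    (h' : IsAngularPotentials A' μ' ν') : alphaInv A' μ' = alphaInv A μ := by
  have e : μ' = fun x => ξ x + μ x := by
    funext ⟨q, s⟩
    refine congrFun (eq_of_rotLap_eq (h'.smooth_even.slice q)
      ((hξ.slice q).add (h.smooth_even.slice q)) (h'.monopoleFree_even.avg q) ?_ ?_) s
    · rw [avg_add (hξ.slice q) (h.smooth_even.slice q), hξ0.avg, h.monopoleFree_even.avg, add_zero]
    · refine (h'.rotLap_eq ((hξ.slice q).add (h.smooth_even.slice q)) (h.smooth_odd.slice q)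
        fun i s => ?_).1
      rw [angFam_gauge hξ hA', h.angFam_eq, rotD_add (hξ.slice q) (h.smooth_even.slice q)]
      ring
  refine AngularOneForm.ext_center fun p a s => ?_
  rw [orbitFam_alphaInv_gauge hξ hA' h.smooth_even h'.smooth_even (mem_extChartAt_target p)]
  simp only [e, scalarFam, sub_self]
  rw [pderiv_const_fun, add_zero]

/-- The curl of an exact form vanishes. -/
theorem phi_gaugeInvariant (B : SphSymSpacetime M) (hA : Smooth₁ b4 A) (hξ : SmoothScalar ξ)
    (hA' : ∀ x, A' x = A x + dfun I4 ξ x) (hμ : SmoothScalar μ) (hμ' : SmoothScalar μ') :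
    B.phi (alphaInv A' μ') = B.phi (alphaInv A μ) := by
  funext ⟨p, s⟩
  have hU := isOpen_extChartAt_target (I := 𝓡 2) p
  have hy := mem_extChartAt_target (I := 𝓡 2) p
  have hD := isFirstOrder_coordCurl (comp₂ b2 B.vol p) (extChartAt (𝓡 2) p p)
  have hχ : ContDiffOn ℝ ∞ (fun z => scalarFam ξ p z s + scalarFam μ p z s - scalarFam μ' p z s)
      (extChartAt (𝓡 2) p).target :=
    (((smoothScalar_iff.1 hξ p).contDiffOn_param s).add
      ((smoothScalar_iff.1 hμ p).contDiffOn_param s)).sub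
      ((smoothScalar_iff.1 hμ' p).contDiffOn_param s)
  rw [B.phi_center, B.phi_center, hD.congr fun a => (by
    filter_upwards [hU.mem_nhds hy] with z hz
    exact orbitFam_alphaInv_gauge hξ hA' hμ hμ' hz a s), hD.add
    (fun a => ((smooth_alphaInv hA hμ).orbitFam p a).differentiableAt_param hU hy s)
    (fun a => ((contDiffOn_pderiv hU hχ a).contDiffAt (hU.mem_nhds hy)).differentiableAt (by simp))]
  have h0 : coordCurl (comp₂ b2 B.vol p) (fun a z => pderiv b2 a
      (fun z => scalarFam ξ p z s + scalarFam μ p z s - scalarFam μ' p z s) z)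
      (extChartAt (𝓡 2) p p) = 0 := by
    rw [coordCurl, pderiv_comm hU hχ hy 0 1, sub_self, neg_zero, zero_div]
  rw [h0, add_zero]

end Gauge

theorem monopoleFree_alphaInv {A : OneForm I4 (M × S2)} {μ : M × S2 → ℝ} (hA : Smooth₁ b4 A)
    (hA0 : (orbitPart A).MonopoleFree) (hμ : SmoothScalar μ) (hμ0 : MonopoleFree μ) :
    (alphaInv A μ).MonopoleFree := by
  refine monopoleFree_of_center (smooth_alphaInv hA hμ) fun p a => ?_
  have hy := mem_extChartAt_target (I := 𝓡 2) p
  rw [show orbitFam (alphaInv A μ) p a (extChartAt (𝓡 2) p p) = fun s => _ from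
    funext fun s => orbitFam_alphaInv hμ hy a s, avg_sub
    ((hA.orbitPart.orbitFam p a).slice hy)
    (((smoothScalar_iff.1 hμ p).pderiv (isOpen_extChartAt_target p) a).slice hy),
    avg_pderiv_scalarFam hμ hμ0 hy, sub_zero]
  exact hA0.avg p a _

namespace SphSymSpacetime

variable (B : SphSymSpacetime M)

theorem oddMaster_of_maxwell {A J : OneForm I4 (M × S2)} {μ ν j k : M × S2 → ℝ}
    (hA : Smooth₁ b4 A) (h : IsAngularPotentials A μ ν) (hJ : IsAngularPotentials J j k)
    (hM : Maxwell b4 B.metric4 A J) : B.OddMaster ν k := fun p s => by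
  refine congrFun (eq_of_rotLap_eq (B.smoothS_masterOp h.smooth_odd p) (hJ.smooth_odd.slice p)
    (B.avg_masterOp h.smooth_odd h.monopoleFree_odd p) (hJ.monopoleFree_odd.avg p) fun s => ?_) s
  exact ((hJ.rotLap_eq (B.smoothS_divergence (smooth_alphaInv hA h.smooth_even) p)
    (B.smoothS_masterOp h.smooth_odd p) (((B.maxwell_iff hA h J).1 hM).2 p)).2 s).symm

theorem evenDivergence_of_rotLap_eq {α : AngularOneForm M} (hα : α.Smooth) (hα0 : α.MonopoleFree)
    {j : M × S2 → ℝ} (hj : SmoothScalar j) (hj0 : MonopoleFree j)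
    (h : ∀ p s, rotLap (fun s => divergence b2 B.g (α s) p) s = rotLap (fun s => j (p, s)) s) :
    B.EvenDivergence α j := fun p =>
  congrFun (eq_of_rotLap_eq (B.smoothS_divergence hα p) (hj.slice p) (B.avg_divergence hα hα0 p)
    (hj0.avg p) (h p))

end SphSymSpacetime

end Spacetime

end

end Electro

end

open Electro in
theorem mainTheorem8 {M : Type*} [TopologicalSpace M]
    [ChartedSpace (EuclideanSpace ℝ (Fin 2)) M] [IsManifold (𝓡 2) ∞ M]
    (B : SphSymSpacetime M) :
    -- every smooth one-form on `M × S²` has unique angular potentials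
    (∀ A : OneForm I4 (M × S2), Smooth₁ b4 A →
      ∃! μν : (M × S2 → ℝ) × (M × S2 → ℝ), IsAngularPotentials A μν.1 μν.2) ∧
    -- gauge invariance under `A ↦ A + dξ`
    (∀ (A A' : OneForm I4 (M × S2)) (ξ μ ν μ' ν' : M × S2 → ℝ),
      Smooth₁ b4 A → SmoothScalar ξ → (∀ x, A' x = A x + dfun I4 ξ x) →
      IsAngularPotentials A μ ν → IsAngularPotentials A' μ' ν' →
      ν' = ν ∧ B.phi (alphaInv A' μ') = B.phi (alphaInv A μ) ∧
        (MonopoleFree ξ → alphaInv A' μ' = alphaInv A μ)) ∧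
    -- Maxwell's equations imply the master equations
    (∀ (A J : OneForm I4 (M × S2)) (μ ν j k : M × S2 → ℝ),
      Smooth₁ b4 A → Smooth₁ b4 J →
      IsAngularPotentials A μ ν → IsAngularPotentials J j k →
      Maxwell b4 B.metric4 A J →
      SmoothScalar (B.phi (alphaInv A μ)) ∧
      B.OddMaster ν k ∧
      B.EvenMaster (B.phi (alphaInv A μ)) J ∧
      B.Reconstruction (B.phi (alphaInv A μ)) (alphaInv A μ) J ∧
      ((orbitPart A).MonopoleFree →
        (alphaInv A μ).Smooth ∧ (alphaInv A μ).MonopoleFree ∧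
        MonopoleFree (B.phi (alphaInv A μ)) ∧
        B.EvenDivergence (alphaInv A μ) j ∧
        ∀ α : AngularOneForm M, α.Smooth → α.MonopoleFree →
          B.Reconstruction (B.phi (alphaInv A μ)) α J → α = alphaInv A μ)) ∧
    -- conversely, solutions of the master equations give solutions of Maxwell's equations
    (∀ (J : OneForm I4 (M × S2)) (j k Φ ν : M × S2 → ℝ),
      Smooth₁ b4 J → B.Conserved J → (orbitPart J).MonopoleFree → IsAngularPotentials J j k →
      SmoothScalar Φ → MonopoleFree Φ → B.EvenMaster Φ J →
      SmoothScalar ν → MonopoleFree ν → B.OddMaster ν k →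
      ∃ α : AngularOneForm M,
        (α.Smooth ∧ α.MonopoleFree ∧ B.Reconstruction Φ α J) ∧
        (∀ α' : AngularOneForm M, α'.Smooth → α'.MonopoleFree → B.Reconstruction Φ α' J →
          α' = α) ∧
        B.phi α = Φ ∧
        B.EvenDivergence α j ∧
        (∃ A, HasInvariants A α ν) ∧
        (∀ A, HasInvariants A α ν → Maxwell b4 B.metric4 A J) ∧
        (∀ A A', HasInvariants A α ν → HasInvariants A' α ν → ∀ x i l,
          faraday b4 B.metric4 A x i l (extChartAt I4 x x)
            = faraday b4 B.metric4 A' x i l (extChartAt I4 x x))) := by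
  refine ⟨fun A hA => ?_, fun A A' ξ μ ν μ' ν' hA hξ hA' h h' => ?_,
    fun A J μ ν j k hA hJs h hJ hM => ?_,
    fun J j k Φ ν hJs hC hJ0 hJ hΦ hΦ0 hE hν hν0 hO => ?_⟩
  · obtain ⟨μ, ν, h⟩ := exists_angularPotentials hA
    refine ⟨(μ, ν), h, fun μν h' => ?_⟩
    have e := h'.unique h
    exact Prod.ext e.1 e.2
  · exact ⟨odd_gaugeInvariant hξ hA' h h',
      phi_gaugeInvariant B hA hξ hA' h.smooth_even h'.smooth_even,
      fun hξ0 => alphaInv_gaugeInvariant hξ hξ0 hA' h h'⟩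
  · have hα := smooth_alphaInv hA h.smooth_even
    have hΦ := B.smooth_phi hα
    obtain ⟨hR, hang⟩ := (B.maxwell_iff hA h J).1 hM
    refine ⟨hΦ, B.oddMaster_of_maxwell hA h hJ hM,
      (B.evenMaster_iff hΦ hα hJs hR).2 fun _ _ => rfl, hR, fun hA0 => ?_⟩
    have hα0 := monopoleFree_alphaInv hA hA0 h.smooth_even h.monopoleFree_even
    exact ⟨hα, hα0, B.monopoleFree_phi hα hα0,
      B.evenDivergence_of_rotLap_eq hα hα0 hJ.smooth_even hJ.monopoleFree_even fun p s =>
        ((hJ.rotLap_eq (B.smoothS_divergence hα p) (B.smoothS_masterOp h.smooth_odd p)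
          (hang p)).1 s).symm,
      fun α hαs hα0' hR' => B.reconstruction_unique hΦ hα hαs hα0 hα0' hR hR'⟩
  · obtain ⟨α, hα, hα0, hR⟩ := B.exists_reconstruction hΦ hΦ0 hJs hJ0
    have hphi : B.phi α = Φ := by
      funext ⟨p, s⟩
      exact congrFun (eq_of_rotLap_eq ((B.smooth_phi hα).slice p) (hΦ.slice p)
        ((B.monopoleFree_phi hα hα0).avg p) (hΦ0.avg p)
        ((B.evenMaster_iff hΦ hα hJs hR).1 hE p)) s
    have hdiv : B.EvenDivergence α j :=
      B.evenDivergence_of_rotLap_eq hα hα0 hJ.smooth_even hJ.monopoleFree_even fun p s => by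
        linear_combination hR.div_eq hΦ hα hJs p s - (B.conserved_iff hJs hJ).1 hC p s
    refine ⟨α, ⟨hα, hα0, hR⟩,
      fun α' hα' hα0' hR' => B.reconstruction_unique hΦ hα hα' hα0 hα0' hR hR', hphi, hdiv,
      exists_hasInvariants hα hν hν0, ?_, ?_⟩
    · rintro A ⟨hA, μ, h, rfl⟩
      refine (B.maxwell_iff hA h J).2 ⟨by rwa [hphi], fun p i s => ?_⟩
      rw [hJ.angFam_eq, show (fun s => divergence b2 B.g (alphaInv A μ s) p) = fun s => j (p, s) from
        funext (hdiv p), show B.masterOp ν p = fun s => k (p, s) from funext (hO p)]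
    · rintro A A' h h' ⟨p, s⟩ i l
      rw [extChartAt_prod_self]
      exact B.faraday_eq_of_hasInvariants h h' p s i l (mem_extChartAt_target p) 0
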